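/- **Proposition 1.8.** Let $\mathbb T=\mathbb R/2\pi\mathbb Z$, $\widehat f(n)=\frac1{2\pi}\int_0^{2\pi} f(x)e^{-inx}\,dx$, $\langle x\rangle=(1+x^2)^{1/2}$, and $$P(f)=\frac{1}{2\pi}\int_0^{2\pi} \operatorname{Im}(\overline f\,\partial_x f)\,dx,\qquad \mathbf P_{\le N}f=\sum_{|n|\le N}\widehat f(n)e^{inx},\qquad \mathbf P_{>N}=\mathrm{Id}-\mathbf P_{\le N},\qquad \|f\|_{\mathcal FL^{s,p}}=\|\langle n\rangle^s\widehat f(n)\|_{\ell^p_n}.$$ Let $X^{s,1/2}_{p,2}$ be the completion of the Schwartz functions on $\mathbb R\times\mathbb T$ under $\|v\|_{X^{s,1/2}_{p,2}}=\|\langle n\rangle^s\langle\tau-n^3\rangle^{1/2}\widehat v(\tau,n)\|_{\ell^p_nL^2_\tau}$, where $\widehat v(\tau,n)$ is the space-time Fourier transform of $v$, and for an interval $I$ let $\|u\|_{X^{s,1/2}_{p,2}(I)}=\inf\{\|v\|_{X^{s,1/2}_{p,2}}: v\in X^{s,1/2}_{p,2},\ v|_{t\in I}=u\}$. Let $(s,p)$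 satisfy one of the following conditions: (i) $\frac12\le s<\frac56$ and $2\le p<\frac{6}{5-6s}$; (ii) $s\ge\frac56$ and $1\le p<\infty$. Then there exist $\varepsilon_0>0$ and $C>0$, depending only on $s$ and $p$, such that the following holds for every $0<\varepsilon\le\varepsilon_0$ and either choice of the sign $\pm$. Let $u_0\in H^\infty(\mathbb T)$ and let $u:\mathbb R\times\mathbb T\to\mathbb C$ be a smooth solution of the second renormalized mKdV equation (mKdV2) $$\partial_t u+\partial_x^3u=\pm\Big(|u|^2\partial_xu-\Big(\frac{1}{2\pi}\int_0^{2\pi}|u|^2dx\Big)\partial_xu-i\Big(\frac{1}{2\pi}\int_0^{2\pi}\operatorname{Im}(\overline u\,\partial_xu)\,dx\Big)u\Big),\qquad u|_{t=0}=u_0.$$ Then for all $t\in\mathbb R$ and all integers $N\ge1$, $$\big|P(\mathbf P_{>N}u(t))-P(\mathbf P_{>N}u(0))\big|\le\frac{C}{N^\varepsilon}\Big(\sup_{t'\in I_t}\|u(t')\|_{\mathcal FL^{s,p}}^4+\|u\|_{X^{s,1/2}_{p,2}(I_t)}^4+\|u\|_{X^{s,1/2}_{p,2}(I_t)}^6\Big),$$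 where $I_t$ is the closed interval with endpoints $0$ and $t$. -/

import Mathlib

open scoped ENNReal ContDiff FourierTransform
open MeasureTheory

/-! Functions on the circle `𝕋 = ℝ / 2πℤ` are written as `2π`-periodic functions on `ℝ`. -/

namespace MKdV

/-- The Japanese bracket `⟨x⟩ = (1 + x²)^{1/2}`. -/
noncomputable def bracket (x : ℝ) : ℝ := Real.sqrt (1 + x ^ 2)

/-- The mean value of a real function over one period. -/
noncomputable def mean (g : ℝ → ℝ) : ℝ :=
  (1 / (2 * Real.pi)) * ∫ x in (0 : ℝ)..(2 * Real.pi), g x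

/-- The `n`-th Fourier coefficient on the circle,
`(1 / 2π) ∫₀^{2π} f(x) e^{-inx} dx`. -/
noncomputable def coeff (f : ℝ → ℂ) (n : ℤ) : ℂ :=
  (1 / (2 * Real.pi) : ℂ) *
    ∫ x in (0 : ℝ)..(2 * Real.pi), f x * Complex.exp (-(Complex.I * n * x))

/-- The Dirichlet projection onto the frequencies `|n| ≤ N`. -/
noncomputable def projLe (N : ℕ) (f : ℝ → ℂ) : ℝ → ℂ := fun x =>
  ∑ n ∈ Finset.Icc (-(N : ℤ)) (N : ℤ), coeff f n * Complex.exp (Complex.I * n * x)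

/-- The projection onto the frequencies `|n| > N`, i.e. identity minus Dirichlet projection. -/
noncomputable def projGt (N : ℕ) (f : ℝ → ℂ) : ℝ → ℂ := fun x => f x - projLe N f x

/-- The mass density mean `⨍ |f|² dx`. -/
noncomputable def mass (f : ℝ → ℂ) : ℝ := mean fun x => ‖f x‖ ^ 2

/-- The momentum `P(f) = ⨍ Im (conj f · ∂ₓ f) dx`. -/
noncomputable def momentum (f : ℝ → ℂ) : ℝ :=
  mean fun x => ((starRingEnd ℂ) (f x) * deriv f x).im

/-- Smooth functions on the circle (equivalently `H^∞(𝕋)`). -/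
def SmoothPeriodic (f : ℝ → ℂ) : Prop :=
  ContDiff ℝ ∞ f ∧ ∀ x, f (x + 2 * Real.pi) = f x

/-- `u`, with `u t x` the value at time `t` and position `x`, is a smooth solution on `ℝ × 𝕋`
of the second renormalized mKdV equation with sign `κ` and initial data `u₀`. -/
structure IsSmoothSolution (κ : ℝ) (u₀ : ℝ → ℂ) (u : ℝ → ℝ → ℂ) : Prop where
  smooth : ContDiff ℝ ∞ (fun z : ℝ × ℝ => u z.1 z.2)
  periodic : ∀ t x, u t (x + 2 * Real.pi) = u t x
  init : u 0 = u₀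
  eqn : ∀ t x,
    deriv (fun t' => u t' x) t + iteratedDeriv 3 (u t) x =
      (κ : ℂ) * ((‖u t x‖ ^ 2 : ℝ) * deriv (u t) x - (mass (u t) : ℂ) * deriv (u t) x
        - Complex.I * (momentum (u t) : ℂ) * u t x)

/-- The `ℓ^p(ℤ)` norm, `1 ≤ p < ∞`, of a sequence with values in `[0, ∞]`. -/
noncomputable def seqNorm (p : ℝ) (a : ℤ → ℝ≥0∞) : ℝ≥0∞ := (∑' n, a n ^ p) ^ (1 / p)

/-- The Fourier-Lebesgue norm `‖⟨n⟩^s f̂(n)‖_{ℓ^p_n}`. -/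
noncomputable def flNorm (s p : ℝ) (f : ℝ → ℂ) : ℝ≥0∞ :=
  seqNorm p fun n => ENNReal.ofReal (bracket n ^ s * ‖coeff f n‖)

/-- The space-time Fourier transform
`v̂(τ, n) = (1 / 2π) ∫ v̂(t, n) e^{-itτ} dt` of a function `v` on `ℝ × 𝕋`, given by its spatial
Fourier coefficients `v n = v̂(·, n) ∈ L²(ℝ)`. Here `𝓕` is the `L²` Fourier transform with kernel
`e^{-2πitξ}`, so that `ξ = τ / 2π`. -/
noncomputable def spaceTimeFT (v : ℤ → Lp ℂ 2 (volume : Measure ℝ)) (n : ℤ) (τ : ℝ) : ℂ :=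
  (1 / (2 * Real.pi) : ℂ) * (𝓕 (v n) : Lp ℂ 2 (volume : Measure ℝ)) (τ / (2 * Real.pi))

/-- The norm of `X^{s,b}_{p,2}(ℝ × 𝕋)` for `b ≥ 0` and `1 ≤ p < ∞`,
`‖⟨n⟩^s ⟨τ - n³⟩^b v̂(τ, n)‖_{ℓ^p_n L²_τ}`. For these exponents the completion of the
Schwartz functions on `ℝ × 𝕋` is the set of all `v` of finite norm, and every Fourier
coefficient `v̂(·, n)` of such a `v` is in `L²(ℝ)`, whence the type of `v`. -/
noncomputable def xNorm (s b p : ℝ) (v : ℤ → Lp ℂ 2 (volume : Measure ℝ)) : ℝ≥0∞ :=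
  seqNorm p fun n => ENNReal.ofReal (bracket n ^ s) *
    eLpNorm (fun τ : ℝ => (bracket (τ - (n : ℝ) ^ 3) ^ b : ℝ) * ‖spaceTimeFT v n τ‖) 2 volume

/-- The norm of the restriction space `X^{s,b}_{p,2}(I)`: the infimum of the norms of all
extensions `v` with `v = u` on `I × 𝕋`. -/
noncomputable def xNormOn (s b p : ℝ) (I : Set ℝ) (u : ℝ → ℝ → ℂ) : ℝ≥0∞ :=
  ⨅ v : ℤ → Lp ℂ 2 (volume : Measure ℝ),
    ⨅ _ : ∀ n : ℤ, ∀ᵐ t ∂(volume.restrict I), v n t = coeff (u t) n, xNorm s b p v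

end MKdV

namespace MKdV

/-- The summable weight `(1 + |n|)^{-(1 + η)}`. -/
noncomputable def decay (η : ℝ) (n : ℤ) : ℝ := (1 + |(n : ℝ)|) ^ (-(1 + η))

lemma decay_pos (η : ℝ) (n : ℤ) : 0 < decay η n := by
  unfold decay; positivity

lemma decay_nonneg (η : ℝ) (n : ℤ) : 0 ≤ decay η n := (decay_pos η n).le

lemma decay_neg (η : ℝ) (n : ℤ) : decay η (-n) = decay η n := by
  simp [decay]

lemma summable_decay {η : ℝ} (hη : 0 < η) : Summable (decay η) := by
  have h0 : Summable fun n : ℕ => (1 + (n : ℝ)) ^ (-(1 + η)) := by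
    have h := (summable_nat_add_iff 1).mpr (Real.summable_nat_rpow.mpr (by linarith : -(1 + η) < -1))
    refine h.congr fun n => ?_
    push_cast
    rw [add_comm]
  refine Summable.of_nat_of_neg ?_ ?_
  · refine h0.congr fun n => ?_
    simp [decay]
  · refine h0.congr fun n => ?_
    simp [decay]

/-- The total mass of the weight `decay η`. -/
noncomputable def decaySum (η : ℝ) : ℝ≥0∞ := ∑' n, ENNReal.ofReal (decay η n)

lemma decaySum_ne_top {η : ℝ} (hη : 0 < η) : decaySum η ≠ ⊤ := by
  unfold decaySum
  rw [← ENNReal.ofReal_tsum_of_nonneg (decay_nonneg η) (summable_decay hη)]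
  exact ENNReal.ofReal_ne_top

/-- A Schur test: along an injective parametrization the sum of a product is at most the product
of the sums. -/
lemma tsum_fiber_le {Γ α : Type*} (X : Γ → α) (u w : Γ → ℤ)
    (hinj : Function.Injective fun i => (X i, u i, w i)) (F : α → ℝ≥0∞) (g : α → ℤ → ℤ → ℝ≥0∞)
    (C : ℝ≥0∞) (hg : ∀ x, ∑' v, ∑' w, g x v w ≤ C) :
    ∑' i, F (X i) * g (X i) (u i) (w i) ≤ (∑' a, F a) * C := by
  calc ∑' i, F (X i) * g (X i) (u i) (w i)
      ≤ ∑' y : α × ℤ × ℤ, F y.1 * g y.1 y.2.1 y.2.2 :=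
        ENNReal.tsum_comp_le_tsum_of_injective hinj
          (fun y : α × ℤ × ℤ => F y.1 * g y.1 y.2.1 y.2.2)
    _ = ∑' a, F a * ∑' v, ∑' w, g a v w := by
        rw [ENNReal.tsum_prod']
        refine tsum_congr fun a => ?_
        rw [ENNReal.tsum_prod', ← ENNReal.tsum_mul_left]
        refine tsum_congr fun v => ?_
        rw [← ENNReal.tsum_mul_left]
    _ ≤ ∑' a, F a * C := ENNReal.tsum_le_tsum fun a => by gcongr; exact hg a
    _ = (∑' a, F a) * C := ENNReal.tsum_mul_right

/-- The sum over triples of a product of squares. -/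
lemma tsum_triple_le (f g h : ℤ → ℝ) (B : ℝ≥0∞)
    (hf : ∑' n, ENNReal.ofReal (f n ^ 2) ≤ B) (hg : ∑' n, ENNReal.ofReal (g n ^ 2) ≤ B)
    (hh : ∑' n, ENNReal.ofReal (h n ^ 2) ≤ B) :
    ∑' a : ℤ × ℤ × ℤ, ENNReal.ofReal (f a.1 ^ 2 * g a.2.1 ^ 2 * h a.2.2 ^ 2) ≤ B ^ 3 := by
  have : ∀ a : ℤ × ℤ × ℤ, ENNReal.ofReal (f a.1 ^ 2 * g a.2.1 ^ 2 * h a.2.2 ^ 2) =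
      ENNReal.ofReal (f a.1 ^ 2) * (ENNReal.ofReal (g a.2.1 ^ 2) * ENNReal.ofReal (h a.2.2 ^ 2)) := by
    intro a
    rw [ENNReal.ofReal_mul (by positivity), ENNReal.ofReal_mul (by positivity), mul_assoc]
  simp_rw [this]
  rw [ENNReal.tsum_prod']
  simp_rw [ENNReal.tsum_mul_left, ENNReal.tsum_prod', ENNReal.tsum_mul_left, ENNReal.tsum_mul_right]
  calc _ ≤ B * (B * B) := by gcongr
    _ = B ^ 3 := by ring

lemma tsum_square_kernel {Γ : Type*} (x y z u w : Γ → ℤ)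
    (hinj : ∀ i i', x i = x i' → y i = y i' → z i = z i' → u i = u i' → w i = w i' → i = i')
    (f g h : ℤ → ℝ) (B : ℝ≥0∞)
    (hf : ∑' n, ENNReal.ofReal (f n ^ 2) ≤ B) (hg : ∑' n, ENNReal.ofReal (g n ^ 2) ≤ B)
    (hh : ∑' n, ENNReal.ofReal (h n ^ 2) ≤ B) (η : ℝ) :
    ∑' i, ENNReal.ofReal
      (f (x i) ^ 2 * g (y i) ^ 2 * h (z i) ^ 2 * (decay η (u i) * decay η (w i))) ≤
      B ^ 3 * decaySum η ^ 2 := by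
  have h1 := tsum_fiber_le (fun i => (x i, y i, z i)) u w
    (by
      intro i i' hii
      simp only [Prod.mk.injEq] at hii
      exact hinj i i' hii.1.1 hii.1.2.1 hii.1.2.2 hii.2.1 hii.2.2)
    (fun a : ℤ × ℤ × ℤ => ENNReal.ofReal (f a.1 ^ 2 * g a.2.1 ^ 2 * h a.2.2 ^ 2))
    (fun _ v w => ENNReal.ofReal (decay η v) * ENNReal.ofReal (decay η w))
    (decaySum η ^ 2) (by
      intro _
      simp_rw [ENNReal.tsum_mul_left, ENNReal.tsum_mul_right]
      rw [sq]; rfl)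
  refine le_trans (le_of_eq ?_) (h1.trans (by gcongr; exact tsum_triple_le f g h B hf hg hh))
  refine tsum_congr fun i => ?_
  rw [ENNReal.ofReal_mul (by positivity), ENNReal.ofReal_mul (decay_nonneg _ _)]

/-- Summation of a kernel which is a geometric mean. -/
lemma tsum_le_of_geom {Γ : Type*} {F G H : Γ → ℝ} {C : ℝ≥0∞}
    (hG : ∑' i, ENNReal.ofReal (G i) ≤ C) (hH : ∑' i, ENNReal.ofReal (H i) ≤ C)
    (hG0 : ∀ i, 0 ≤ G i) (hH0 : ∀ i, 0 ≤ H i) (h : ∀ i, F i ^ 2 ≤ G i * H i) :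
    ∑' i, ENNReal.ofReal (F i) ≤ 2 * C := by
  calc ∑' i, ENNReal.ofReal (F i) ≤ ∑' i, (ENNReal.ofReal (G i) + ENNReal.ofReal (H i)) := by
        refine ENNReal.tsum_le_tsum fun i => ?_
        rw [← ENNReal.ofReal_add (hG0 i) (hH0 i)]
        apply ENNReal.ofReal_le_ofReal
        refine abs_le_of_sq_le_sq' ?_ (add_nonneg (hG0 i) (hH0 i)) |>.2
        nlinarith [h i, hG0 i, hH0 i, mul_nonneg (hG0 i) (hH0 i), sq_nonneg (G i), sq_nonneg (H i)]
    _ = _ := ENNReal.tsum_add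
    _ ≤ C + C := by gcongr
    _ = 2 * C := (two_mul C).symm

/-- Six frequencies with zero sum that determine the index. -/
structure ZeroSum {Γ : Type*} (z₁ z₂ z₃ z₄ z₅ z₆ : Γ → ℤ) : Prop where
  sum : ∀ i, z₁ i + z₂ i + z₃ i + z₄ i + z₅ i + z₆ i = 0
  inj : ∀ i i', z₁ i = z₁ i' → z₂ i = z₂ i' → z₃ i = z₃ i' → z₄ i = z₄ i' → z₅ i = z₅ i' →
    z₆ i = z₆ i' → i = i'

/-- The kernel attached to the pair `x, y` and to two further frequencies `p, q`. -/
noncomputable def pairKernel (η : ℝ) (x y p q : ℤ) : ℝ :=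
  decay η (x + y) * √(decay η p * decay η q)

/-- The kernel attached to a resonant pair `x + y = 0`. -/
noncomputable def diagKernel (η : ℝ) (x y p q : ℤ) : ℝ :=
  if x + y = 0 then decay η (p + q) else 0

/-- The kernel for six comparable frequencies. -/
noncomputable def tripleKernel (η : ℝ) (x y z x' y' z' : ℤ) : ℝ :=
  √(decay η (x + y) * decay η (z + y)) * √(decay η (x' + y') * decay η (z' + y'))

/-- The kernel of the product estimate. -/
noncomputable def productKernel (η : ℝ) (x y z x' y' z' : ℤ) : ℝ :=
  (decay η x * decay η y * decay η z) ^ (1 / 3 : ℝ) *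
    (decay η x' * decay η y' * decay η z') ^ (1 / 3 : ℝ)

/-- The kernel which uses the resonance function; the pairs `x₁, x₂` and `x₃, x₄` have nonzero
sum. -/
noncomputable def phaseKernel (η : ℝ) (x₁ x₂ x₃ x₄ p q : ℤ) : ℝ :=
  if x₁ + x₂ ≠ 0 ∧ x₃ + x₄ ≠ 0 then
    (1 + |((x₁ ^ 3 + x₂ ^ 3 + x₃ ^ 3 + x₄ ^ 3 + p ^ 3 + q ^ 3 : ℤ) : ℝ)|) ^ (-(1 / 2 + η / 2)) *
      √(decay η p * decay η q)
  else 0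

section Kernels

variable {Γ : Type*} {z₁ z₂ z₃ z₄ z₅ z₆ : Γ → ℤ} {f₁ f₂ f₃ f₄ f₅ f₆ : ℤ → ℝ} {B : ℝ≥0∞} {η : ℝ}

lemma tsum_pairKernel (hz : ZeroSum z₁ z₂ z₃ z₄ z₅ z₆)
    (h₁ : ∑' n, ENNReal.ofReal (f₁ n ^ 2) ≤ B) (h₂ : ∑' n, ENNReal.ofReal (f₂ n ^ 2) ≤ B)
    (h₃ : ∑' n, ENNReal.ofReal (f₃ n ^ 2) ≤ B) (h₄ : ∑' n, ENNReal.ofReal (f₄ n ^ 2) ≤ B)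
    (h₅ : ∑' n, ENNReal.ofReal (f₅ n ^ 2) ≤ B) (h₆ : ∑' n, ENNReal.ofReal (f₆ n ^ 2) ≤ B) :
    ∑' i, ENNReal.ofReal (pairKernel η (z₁ i) (z₂ i) (z₃ i) (z₄ i) *
      (f₁ (z₁ i) * f₂ (z₂ i) * f₃ (z₃ i) * f₄ (z₄ i) * f₅ (z₅ i) * f₆ (z₆ i))) ≤
      2 * (B ^ 3 * decaySum η ^ 2) := by
  refine tsum_le_of_geom
    (tsum_square_kernel z₁ z₃ z₅ (fun i => z₁ i + z₂ i) z₄ ?_ f₁ f₃ f₅ B h₁ h₃ h₅ η)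
    (tsum_square_kernel z₂ z₄ z₆ (fun i => z₁ i + z₂ i) z₃ ?_ f₂ f₄ f₆ B h₂ h₄ h₆ η) ?_ ?_ ?_
  · intro i i' a b c d e
    have := hz.sum i; have := hz.sum i'
    apply hz.inj i i' <;> omega
  · intro i i' a b c d e
    have := hz.sum i; have := hz.sum i'
    apply hz.inj i i' <;> omega
  · intro i; have := decay_nonneg η (z₁ i + z₂ i); have := decay_nonneg η (z₄ i); positivity
  · intro i; have := decay_nonneg η (z₁ i + z₂ i); have := decay_nonneg η (z₃ i); positivity
  · intro i
    unfold pairKernel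
    rw [mul_pow, mul_pow, Real.sq_sqrt (mul_nonneg (decay_nonneg _ _) (decay_nonneg _ _))]
    apply le_of_eq; ring

lemma tsum_diagKernel (hz : ZeroSum z₁ z₂ z₃ z₄ z₅ z₆)
    (h₁ : ∑' n, ENNReal.ofReal (f₁ n ^ 2) ≤ B) (h₂ : ∑' n, ENNReal.ofReal (f₂ n ^ 2) ≤ B)
    (h₃ : ∑' n, ENNReal.ofReal (f₃ n ^ 2) ≤ B) (h₄ : ∑' n, ENNReal.ofReal (f₄ n ^ 2) ≤ B)
    (h₅ : ∑' n, ENNReal.ofReal (f₅ n ^ 2) ≤ B) (h₆ : ∑' n, ENNReal.ofReal (f₆ n ^ 2) ≤ B) :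
    ∑' i, ENNReal.ofReal (diagKernel η (z₁ i) (z₂ i) (z₃ i) (z₄ i) *
      (f₁ (z₁ i) * f₂ (z₂ i) * f₃ (z₃ i) * f₄ (z₄ i) * f₅ (z₅ i) * f₆ (z₆ i))) ≤
      2 * (B ^ 3 * decaySum η ^ 2) := by
  refine tsum_le_of_geom
    (tsum_square_kernel z₁ z₃ z₅ (fun i => z₁ i + z₂ i) (fun i => z₃ i + z₄ i) ?_
      f₁ f₃ f₅ B h₁ h₃ h₅ η)
    (tsum_square_kernel z₂ z₄ z₆ (fun i => z₁ i + z₂ i) (fun i => z₃ i + z₄ i) ?_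
      f₂ f₄ f₆ B h₂ h₄ h₆ η) ?_ ?_ ?_
  · intro i i' a b c d e
    have := hz.sum i; have := hz.sum i'
    apply hz.inj i i' <;> omega
  · intro i i' a b c d e
    have := hz.sum i; have := hz.sum i'
    apply hz.inj i i' <;> omega
  · intro i; have := decay_nonneg η (z₁ i + z₂ i); have := decay_nonneg η (z₃ i + z₄ i); positivity
  · intro i; have := decay_nonneg η (z₁ i + z₂ i); have := decay_nonneg η (z₃ i + z₄ i); positivity
  · intro i
    have ha := decay_nonneg η (z₁ i + z₂ i)
    have hb := decay_nonneg η (z₃ i + z₄ i)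
    unfold diagKernel
    split_ifs with h
    · rw [h]
      have : decay η 0 = 1 := by simp [decay]
      rw [this]
      apply le_of_eq; ring
    · rw [zero_mul, zero_pow two_ne_zero]; positivity

lemma tsum_tripleKernel (hz : ZeroSum z₁ z₂ z₃ z₄ z₅ z₆)
    (h₁ : ∑' n, ENNReal.ofReal (f₁ n ^ 2) ≤ B) (h₂ : ∑' n, ENNReal.ofReal (f₂ n ^ 2) ≤ B)
    (h₃ : ∑' n, ENNReal.ofReal (f₃ n ^ 2) ≤ B) (h₄ : ∑' n, ENNReal.ofReal (f₄ n ^ 2) ≤ B)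
    (h₅ : ∑' n, ENNReal.ofReal (f₅ n ^ 2) ≤ B) (h₆ : ∑' n, ENNReal.ofReal (f₆ n ^ 2) ≤ B) :
    ∑' i, ENNReal.ofReal (tripleKernel η (z₁ i) (z₂ i) (z₃ i) (z₄ i) (z₅ i) (z₆ i) *
      (f₁ (z₁ i) * f₂ (z₂ i) * f₃ (z₃ i) * f₄ (z₄ i) * f₅ (z₅ i) * f₆ (z₆ i))) ≤
      2 * (B ^ 3 * decaySum η ^ 2) := by
  refine tsum_le_of_geom
    (tsum_square_kernel z₁ z₂ z₃ (fun i => z₄ i + z₅ i) (fun i => z₆ i + z₅ i) ?_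
      f₁ f₂ f₃ B h₁ h₂ h₃ η)
    (tsum_square_kernel z₄ z₅ z₆ (fun i => z₁ i + z₂ i) (fun i => z₃ i + z₂ i) ?_
      f₄ f₅ f₆ B h₄ h₅ h₆ η) ?_ ?_ ?_
  · intro i i' a b c d e
    have := hz.sum i; have := hz.sum i'
    apply hz.inj i i' <;> omega
  · intro i i' a b c d e
    have := hz.sum i; have := hz.sum i'
    apply hz.inj i i' <;> omega
  · intro i; have := decay_nonneg η (z₄ i + z₅ i); have := decay_nonneg η (z₆ i + z₅ i); positivity
  · intro i; have := decay_nonneg η (z₁ i + z₂ i); have := decay_nonneg η (z₃ i + z₂ i); positivity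
  · intro i
    unfold tripleKernel
    rw [mul_pow, mul_pow, Real.sq_sqrt (mul_nonneg (decay_nonneg _ _) (decay_nonneg _ _)),
      Real.sq_sqrt (mul_nonneg (decay_nonneg _ _) (decay_nonneg _ _))]
    apply le_of_eq; ring

lemma rpow_two_thirds_le {x y z : ℝ} (hx : 0 ≤ x) (hy : 0 ≤ y) (hz : 0 ≤ z) :
    ((x * y * z) ^ (1 / 3 : ℝ)) ^ 2 ≤ x * y + y * z + z * x := by
  have h := Real.geom_mean_le_arith_mean3_weighted (w₁ := 1 / 3) (w₂ := 1 / 3) (w₃ := 1 / 3)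
    (by norm_num) (by norm_num) (by norm_num) (mul_nonneg hx hy) (mul_nonneg hy hz)
    (mul_nonneg hz hx) (by norm_num)
  rw [← Real.mul_rpow (by positivity) (by positivity),
    ← Real.mul_rpow (by positivity) (by positivity)] at h
  have e : x * y * (y * z) * (z * x) = (x * y * z) ^ 2 := by ring
  rw [e] at h
  have e2 : ((x * y * z) ^ 2) ^ (1 / 3 : ℝ) = ((x * y * z) ^ (1 / 3 : ℝ)) ^ 2 := by
    rw [← Real.rpow_natCast, ← Real.rpow_natCast, ← Real.rpow_mul (by positivity),
      ← Real.rpow_mul (by positivity)]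
    norm_num
  rw [e2] at h
  nlinarith [mul_nonneg hx hy, mul_nonneg hy hz, mul_nonneg hz hx]

lemma tsum_add_three_le {Γ : Type*} {G G₁ G₂ G₃ : Γ → ℝ} {C : ℝ≥0∞}
    (h₁ : ∑' i, ENNReal.ofReal (G₁ i) ≤ C) (h₂ : ∑' i, ENNReal.ofReal (G₂ i) ≤ C)
    (h₃ : ∑' i, ENNReal.ofReal (G₃ i) ≤ C) (h : ∀ i, G i ≤ G₁ i + G₂ i + G₃ i) :
    ∑' i, ENNReal.ofReal (G i) ≤ 3 * C := by
  calc ∑' i, ENNReal.ofReal (G i)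
      ≤ ∑' i, (ENNReal.ofReal (G₁ i) + ENNReal.ofReal (G₂ i) + ENNReal.ofReal (G₃ i)) := by
        refine ENNReal.tsum_le_tsum fun i => ?_
        refine (ENNReal.ofReal_le_ofReal (h i)).trans ?_
        exact ENNReal.ofReal_add_le.trans (by gcongr; exact ENNReal.ofReal_add_le)
    _ = _ := by rw [ENNReal.tsum_add, ENNReal.tsum_add]
    _ ≤ C + C + C := by gcongr
    _ = 3 * C := by ring

lemma tsum_productKernel (hz : ZeroSum z₁ z₂ z₃ z₄ z₅ z₆)
    (h₁ : ∑' n, ENNReal.ofReal (f₁ n ^ 2) ≤ B) (h₂ : ∑' n, ENNReal.ofReal (f₂ n ^ 2) ≤ B)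
    (h₃ : ∑' n, ENNReal.ofReal (f₃ n ^ 2) ≤ B) (h₄ : ∑' n, ENNReal.ofReal (f₄ n ^ 2) ≤ B)
    (h₅ : ∑' n, ENNReal.ofReal (f₅ n ^ 2) ≤ B) (h₆ : ∑' n, ENNReal.ofReal (f₆ n ^ 2) ≤ B) :
    ∑' i, ENNReal.ofReal (productKernel η (z₁ i) (z₂ i) (z₃ i) (z₄ i) (z₅ i) (z₆ i) *
      (f₁ (z₁ i) * f₂ (z₂ i) * f₃ (z₃ i) * f₄ (z₄ i) * f₅ (z₅ i) * f₆ (z₆ i))) ≤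
      2 * (3 * (B ^ 3 * decaySum η ^ 2)) := by
  have inj : ∀ i i', z₁ i = z₁ i' → z₂ i = z₂ i' → z₃ i = z₃ i' → z₄ i = z₄ i' → z₅ i = z₅ i' →
      i = i' := by
    intro i i' a b c d e
    have := hz.sum i; have := hz.sum i'
    apply hz.inj i i' <;> omega
  have inj2 : ∀ i i', z₁ i = z₁ i' → z₂ i = z₂ i' → z₃ i = z₃ i' → z₅ i = z₅ i' → z₆ i = z₆ i' →
      i = i' := by
    intro i i' a b c d e
    have := hz.sum i; have := hz.sum i'
    apply hz.inj i i' <;> omega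
  have inj3 : ∀ i i', z₁ i = z₁ i' → z₂ i = z₂ i' → z₃ i = z₃ i' → z₆ i = z₆ i' → z₄ i = z₄ i' →
      i = i' := by
    intro i i' a b c d e
    have := hz.sum i; have := hz.sum i'
    apply hz.inj i i' <;> omega
  have inj' : ∀ i i', z₄ i = z₄ i' → z₅ i = z₅ i' → z₆ i = z₆ i' → z₁ i = z₁ i' → z₂ i = z₂ i' →
      i = i' := by
    intro i i' a b c d e
    have := hz.sum i; have := hz.sum i'
    apply hz.inj i i' <;> omega
  have inj2' : ∀ i i', z₄ i = z₄ i' → z₅ i = z₅ i' → z₆ i = z₆ i' → z₂ i = z₂ i' → z₃ i = z₃ i' →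
      i = i' := by
    intro i i' a b c d e
    have := hz.sum i; have := hz.sum i'
    apply hz.inj i i' <;> omega
  have inj3' : ∀ i i', z₄ i = z₄ i' → z₅ i = z₅ i' → z₆ i = z₆ i' → z₃ i = z₃ i' → z₁ i = z₁ i' →
      i = i' := by
    intro i i' a b c d e
    have := hz.sum i; have := hz.sum i'
    apply hz.inj i i' <;> omega
  refine tsum_le_of_geom
    (G := fun i => f₁ (z₁ i) ^ 2 * f₂ (z₂ i) ^ 2 * f₃ (z₃ i) ^ 2 *
      ((decay η (z₄ i) * decay η (z₅ i) * decay η (z₆ i)) ^ (1 / 3 : ℝ)) ^ 2)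
    (H := fun i => f₄ (z₄ i) ^ 2 * f₅ (z₅ i) ^ 2 * f₆ (z₆ i) ^ 2 *
      ((decay η (z₁ i) * decay η (z₂ i) * decay η (z₃ i)) ^ (1 / 3 : ℝ)) ^ 2)
    (tsum_add_three_le
      (tsum_square_kernel z₁ z₂ z₃ z₄ z₅ inj f₁ f₂ f₃ B h₁ h₂ h₃ η)
      (tsum_square_kernel z₁ z₂ z₃ z₅ z₆ inj2 f₁ f₂ f₃ B h₁ h₂ h₃ η)
      (tsum_square_kernel z₁ z₂ z₃ z₆ z₄ inj3 f₁ f₂ f₃ B h₁ h₂ h₃ η) ?_)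
    (tsum_add_three_le
      (tsum_square_kernel z₄ z₅ z₆ z₁ z₂ inj' f₄ f₅ f₆ B h₄ h₅ h₆ η)
      (tsum_square_kernel z₄ z₅ z₆ z₂ z₃ inj2' f₄ f₅ f₆ B h₄ h₅ h₆ η)
      (tsum_square_kernel z₄ z₅ z₆ z₃ z₁ inj3' f₄ f₅ f₆ B h₄ h₅ h₆ η) ?_) ?_ ?_ ?_
  · intro i
    have := rpow_two_thirds_le (decay_nonneg η (z₄ i)) (decay_nonneg η (z₅ i))
      (decay_nonneg η (z₆ i))
    rw [← mul_add, ← mul_add]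
    gcongr
  · intro i
    have := rpow_two_thirds_le (decay_nonneg η (z₁ i)) (decay_nonneg η (z₂ i))
      (decay_nonneg η (z₃ i))
    rw [← mul_add, ← mul_add]
    gcongr
  · intro i; positivity
  · intro i; positivity
  · intro i
    unfold productKernel
    apply le_of_eq; ring

lemma rpow_neg_half_le {η x y : ℝ} (hη : 0 < η) (hη1 : η ≤ 1) (hx : 0 ≤ x) (hy : x ^ 2 ≤ y) :
    (1 + y) ^ (-(1 / 2 + η / 2)) ≤ 2 * (1 + x) ^ (-(1 + η)) := by
  have h1 : (1 + x) ^ 2 / 2 ≤ 1 + y := by nlinarith [sq_nonneg (1 - x)]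
  calc (1 + y) ^ (-(1 / 2 + η / 2)) ≤ ((1 + x) ^ 2 / 2) ^ (-(1 / 2 + η / 2)) :=
        Real.rpow_le_rpow_of_nonpos (by positivity) h1 (by linarith)
    _ = (1 + x) ^ (-(1 + η)) * 2 ^ (1 / 2 + η / 2) := by
        rw [Real.div_rpow (by positivity) (by norm_num), ← Real.rpow_natCast,
          ← Real.rpow_mul (by positivity), Real.rpow_neg (by norm_num : (0 : ℝ) ≤ 2), div_inv_eq_mul]
        congr 2
        push_cast; ring
    _ ≤ (1 + x) ^ (-(1 + η)) * 2 ^ (1 : ℝ) := by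
        gcongr
        · norm_num
        · linarith
    _ = _ := by rw [Real.rpow_one, mul_comm]

lemma tsum_shift_decay_le {η : ℝ} (hη : 0 < η) (hη1 : η ≤ 1) (r : ℝ) :
    ∑' v : ℤ, ENNReal.ofReal ((1 + |(v : ℝ) - r|) ^ (-(1 + η))) ≤ 4 * decaySum η := by
  have h : ∀ v : ℤ, ENNReal.ofReal ((1 + |(v : ℝ) - r|) ^ (-(1 + η))) ≤
      4 * ENNReal.ofReal (decay η (v - ⌊r⌋)) := by
    intro v
    rw [show (4 : ℝ≥0∞) = ENNReal.ofReal 4 by norm_num, ← ENNReal.ofReal_mul (by norm_num)]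
    apply ENNReal.ofReal_le_ofReal
    have h1 : (1 + |((v - ⌊r⌋ : ℤ) : ℝ)|) / 2 ≤ 1 + |(v : ℝ) - r| := by
      have h2 := abs_sub_abs_le_abs_sub (((v - ⌊r⌋ : ℤ) : ℝ)) ((v : ℝ) - r)
      have h3 : |((v - ⌊r⌋ : ℤ) : ℝ) - ((v : ℝ) - r)| ≤ 1 := by
        push_cast
        rw [show (v : ℝ) - ⌊r⌋ - (v - r) = r - ⌊r⌋ by ring, abs_le]
        constructor <;> linarith [Int.floor_le r, Int.lt_floor_add_one r]
      linarith [abs_nonneg ((v : ℝ) - r)]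
    calc (1 + |(v : ℝ) - r|) ^ (-(1 + η))
        ≤ ((1 + |((v - ⌊r⌋ : ℤ) : ℝ)|) / 2) ^ (-(1 + η)) :=
          Real.rpow_le_rpow_of_nonpos (by positivity) h1 (by linarith)
      _ = 2 ^ (1 + η) * decay η (v - ⌊r⌋) := by
          rw [Real.div_rpow (by positivity) (by norm_num), Real.rpow_neg (by norm_num : (0 : ℝ) ≤ 2),
            div_inv_eq_mul, mul_comm, decay]
      _ ≤ 2 ^ (2 : ℝ) * decay η (v - ⌊r⌋) := by
          gcongr
          · exact decay_nonneg _ _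
          · norm_num
          · linarith
      _ = _ := by norm_num
  calc _ ≤ ∑' v : ℤ, 4 * ENNReal.ofReal (decay η (v - ⌊r⌋)) := ENNReal.tsum_le_tsum h
    _ = 4 * ∑' v : ℤ, ENNReal.ofReal (decay η (v - ⌊r⌋)) := ENNReal.tsum_mul_left
    _ = 4 * decaySum η := by
        congr 1
        exact (Equiv.subRight ⌊r⌋).tsum_eq (fun v => ENNReal.ofReal (decay η v))

lemma exists_roots (h Δ : ℝ) : ∃ r₁ r₂ : ℝ, ∀ v : ℝ, |v - r₁| * |v - r₂| ≤ |(v - h) ^ 2 - Δ| := by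
  rcases le_total 0 Δ with hΔ | hΔ
  · refine ⟨h + √Δ, h - √Δ, fun v => ?_⟩
    rw [← abs_mul]
    apply le_of_eq
    congr 1
    nlinarith [Real.sq_sqrt hΔ]
  · refine ⟨h, h, fun v => ?_⟩
    rw [← sq, sq_abs]
    exact (by linarith : (v - h) ^ 2 ≤ (v - h) ^ 2 - Δ).trans (le_abs_self _)

lemma tsum_cubes_le {η : ℝ} (hη : 0 < η) (hη1 : η ≤ 1) (s c : ℤ) (hs : s ≠ 0) :
    ∑' v : ℤ, ENNReal.ofReal
      ((1 + |((v ^ 3 + (s - v) ^ 3 + c : ℤ) : ℝ)|) ^ (-(1 / 2 + η / 2))) ≤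
      16 * decaySum η := by
  have hs' : (s : ℝ) ≠ 0 := by exact_mod_cast hs
  have hs1 : (1 : ℝ) ≤ |(s : ℝ)| := by exact_mod_cast Int.one_le_abs hs
  obtain ⟨r₁, r₂, hr⟩ := exists_roots ((s : ℝ) / 2) (-((s : ℝ) ^ 3 / 4 + c) / (3 * s))
  have key : ∀ v : ℤ, |(v : ℝ) - r₁| * |(v : ℝ) - r₂| ≤ |((v ^ 3 + (s - v) ^ 3 + c : ℤ) : ℝ)| := by
    intro v
    have e : ((v ^ 3 + (s - v) ^ 3 + c : ℤ) : ℝ) =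
        (3 * s) * (((v : ℝ) - s / 2) ^ 2 - -((s : ℝ) ^ 3 / 4 + c) / (3 * s)) := by
      push_cast; field_simp; ring
    rw [e, abs_mul]
    refine (hr v).trans ?_
    have : 1 ≤ |3 * (s : ℝ)| := by rw [abs_mul, abs_of_pos (by norm_num : (0 : ℝ) < 3)]; linarith
    exact le_mul_of_one_le_left (abs_nonneg _) this
  have h : ∀ v : ℤ, ENNReal.ofReal
      ((1 + |((v ^ 3 + (s - v) ^ 3 + c : ℤ) : ℝ)|) ^ (-(1 / 2 + η / 2))) ≤
      2 * ENNReal.ofReal ((1 + |(v : ℝ) - r₁|) ^ (-(1 + η))) +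
      2 * ENNReal.ofReal ((1 + |(v : ℝ) - r₂|) ^ (-(1 + η))) := by
    intro v
    have hk := key v
    rw [show (2 : ℝ≥0∞) = ENNReal.ofReal 2 by norm_num, ← ENNReal.ofReal_mul (by norm_num),
      ← ENNReal.ofReal_mul (by norm_num), ← ENNReal.ofReal_add (by positivity) (by positivity)]
    apply ENNReal.ofReal_le_ofReal
    rcases le_total |(v : ℝ) - r₁| |(v : ℝ) - r₂| with hle | hle
    · refine (rpow_neg_half_le hη hη1 (abs_nonneg _) ?_).trans (le_add_of_nonneg_right (by positivity))
      exact le_trans (by rw [sq]; gcongr) hk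
    · refine (rpow_neg_half_le hη hη1 (abs_nonneg _) ?_).trans (le_add_of_nonneg_left (by positivity))
      exact le_trans (by rw [sq]; gcongr) hk
  calc _ ≤ _ := ENNReal.tsum_le_tsum h
    _ = _ := by rw [ENNReal.tsum_add, ENNReal.tsum_mul_left, ENNReal.tsum_mul_left]
    _ ≤ 2 * (4 * decaySum η) + 2 * (4 * decaySum η) := by
        gcongr <;> exact tsum_shift_decay_le hη hη1 _
    _ = 16 * decaySum η := by ring

lemma tsum_phase_half (hη : 0 < η) (hη1 : η ≤ 1) (hz : ZeroSum z₁ z₂ z₃ z₄ z₅ z₆)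
    (h₁ : ∑' n, ENNReal.ofReal (f₁ n ^ 2) ≤ B) (h₂ : ∑' n, ENNReal.ofReal (f₂ n ^ 2) ≤ B)
    (h₅ : ∑' n, ENNReal.ofReal (f₅ n ^ 2) ≤ B) :
    ∑' i, ENNReal.ofReal (f₁ (z₁ i) ^ 2 * f₂ (z₂ i) ^ 2 * f₅ (z₅ i) ^ 2 *
      ((if z₃ i + z₄ i ≠ 0 then (1 + |((z₁ i ^ 3 + z₂ i ^ 3 + z₃ i ^ 3 + z₄ i ^ 3 + z₅ i ^ 3
        + z₆ i ^ 3 : ℤ) : ℝ)|) ^ (-(1 / 2 + η / 2)) else 0) * decay η (z₆ i))) ≤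
      B ^ 3 * (16 * decaySum η ^ 2) := by
  have h := tsum_fiber_le (fun i => (z₁ i, z₂ i, z₅ i)) z₆ z₃ (by
      intro i i' hii
      simp only [Prod.mk.injEq] at hii
      have := hz.sum i; have := hz.sum i'
      apply hz.inj i i' <;> omega)
    (fun a : ℤ × ℤ × ℤ => ENNReal.ofReal (f₁ a.1 ^ 2 * f₂ a.2.1 ^ 2 * f₅ a.2.2 ^ 2))
    (fun a w v => ENNReal.ofReal (decay η w) *
      (if -(a.1 + a.2.1 + a.2.2 + w) ≠ 0 then ENNReal.ofReal ((1 + |((v ^ 3 +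
        (-(a.1 + a.2.1 + a.2.2 + w) - v) ^ 3 + (a.1 ^ 3 + a.2.1 ^ 3 + a.2.2 ^ 3 + w ^ 3) : ℤ) : ℝ)|)
        ^ (-(1 / 2 + η / 2))) else 0))
    (16 * decaySum η ^ 2) (by
      intro a
      calc _ ≤ ∑' w : ℤ, ENNReal.ofReal (decay η w) * (16 * decaySum η) := by
            refine ENNReal.tsum_le_tsum fun w => ?_
            rw [ENNReal.tsum_mul_left]
            gcongr
            by_cases hs : -(a.1 + a.2.1 + a.2.2 + w) ≠ 0
            · simp only [hs, ne_eq, not_false_eq_true, if_true]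
              exact tsum_cubes_le hη hη1 _ _ hs
            · simp only [hs, if_false, tsum_zero, zero_le]
        _ = decaySum η * (16 * decaySum η) := by rw [ENNReal.tsum_mul_right]; rfl
        _ = _ := by ring)
  refine le_trans (le_of_eq ?_) (h.trans (by gcongr; exact tsum_triple_le f₁ f₂ f₅ B h₁ h₂ h₅))
  refine tsum_congr fun i => ?_
  have e : z₃ i + z₄ i = -(z₁ i + z₂ i + z₅ i + z₆ i) := by have := hz.sum i; omega
  have e' : z₄ i = -(z₁ i + z₂ i + z₅ i + z₆ i) - z₃ i := by omega
  rw [ENNReal.ofReal_mul (by positivity)]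
  congr 1
  simp only [e]
  by_cases hs : -(z₁ i + z₂ i + z₅ i + z₆ i) ≠ 0
  · simp only [hs, ne_eq, not_false_eq_true, if_true]
    have E : z₁ i ^ 3 + z₂ i ^ 3 + z₃ i ^ 3 + z₄ i ^ 3 + z₅ i ^ 3 + z₆ i ^ 3 =
        z₃ i ^ 3 + (-(z₁ i + z₂ i + z₅ i + z₆ i) - z₃ i) ^ 3 +
          (z₁ i ^ 3 + z₂ i ^ 3 + z₅ i ^ 3 + z₆ i ^ 3) := by
      rw [← e']; ring
    rw [ENNReal.ofReal_mul (by positivity), mul_comm, E]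
  · simp only [hs, if_false, zero_mul, mul_zero, ENNReal.ofReal_zero]

lemma tsum_phaseKernel (hη : 0 < η) (hη1 : η ≤ 1) (hz : ZeroSum z₁ z₂ z₃ z₄ z₅ z₆)
    (h₁ : ∑' n, ENNReal.ofReal (f₁ n ^ 2) ≤ B) (h₂ : ∑' n, ENNReal.ofReal (f₂ n ^ 2) ≤ B)
    (h₃ : ∑' n, ENNReal.ofReal (f₃ n ^ 2) ≤ B) (h₄ : ∑' n, ENNReal.ofReal (f₄ n ^ 2) ≤ B)
    (h₅ : ∑' n, ENNReal.ofReal (f₅ n ^ 2) ≤ B) (h₆ : ∑' n, ENNReal.ofReal (f₆ n ^ 2) ≤ B) :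
    ∑' i, ENNReal.ofReal (phaseKernel η (z₁ i) (z₂ i) (z₃ i) (z₄ i) (z₅ i) (z₆ i) *
      (f₁ (z₁ i) * f₂ (z₂ i) * f₃ (z₃ i) * f₄ (z₄ i) * f₅ (z₅ i) * f₆ (z₆ i))) ≤
      2 * (B ^ 3 * (16 * decaySum η ^ 2)) := by
  have hz' : ZeroSum z₃ z₄ z₁ z₂ z₆ z₅ :=
    ⟨fun i => by have := hz.sum i; omega, fun i i' a b c d e f => hz.inj i i' c d a b f e⟩
  refine tsum_le_of_geom (tsum_phase_half hη hη1 hz h₁ h₂ h₅) (tsum_phase_half hη hη1 hz' h₃ h₄ h₆)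
    ?_ ?_ ?_
  · intro i
    have := decay_nonneg η (z₆ i)
    split_ifs <;> positivity
  · intro i
    have := decay_nonneg η (z₅ i)
    split_ifs <;> positivity
  · intro i
    have ha := decay_nonneg η (z₅ i)
    have hb := decay_nonneg η (z₆ i)
    have e : z₃ i ^ 3 + z₄ i ^ 3 + z₁ i ^ 3 + z₂ i ^ 3 + z₆ i ^ 3 + z₅ i ^ 3 =
      z₁ i ^ 3 + z₂ i ^ 3 + z₃ i ^ 3 + z₄ i ^ 3 + z₅ i ^ 3 + z₆ i ^ 3 := by ring
    simp only [e]
    unfold phaseKernel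
    generalize (1 + |((z₁ i ^ 3 + z₂ i ^ 3 + z₃ i ^ 3 + z₄ i ^ 3 + z₅ i ^ 3 + z₆ i ^ 3 : ℤ) : ℝ)|)
      ^ (-(1 / 2 + η / 2)) = y
    by_cases h12 : z₁ i + z₂ i ≠ 0
    · by_cases h34 : z₃ i + z₄ i ≠ 0
      · simp only [h12, h34, ne_eq, not_false_eq_true, and_self, if_true]
        rw [mul_pow, mul_pow, Real.sq_sqrt (by positivity)]
        apply le_of_eq; ring
      · simp [h34]
    · simp [h12]

end Kernels

/-- The size condition that allows an estimate by `pairKernel`. -/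
def PairBound (C q Θ x y l : ℝ) : Prop :=
  q ^ 6 * (x + y) ^ 6 ≤ C * ((1 + |x|) * (1 + |y|) * (1 + |l|)) ^ 2 * Θ ^ 3

/-- The size condition that allows an estimate by `phaseKernel`. -/
def PhaseBound (C q x₁ x₂ x₃ x₄ p r : ℝ) : Prop :=
  q ^ 6 * ((1 + |p|) * (1 + |r|)) ≤
    C * ((1 + |x₁|) * (1 + |x₂|) * (1 + |x₃|) * (1 + |x₄|)) ^ 2 ∧ x₁ + x₂ ≠ 0 ∧ x₃ + x₄ ≠ 0

lemma pairBound_of_sq {K C q Θ x y l t : ℝ} (hΘ : 0 ≤ Θ) (ht : 0 ≤ t) (hK : 0 ≤ K) (hC : 0 ≤ C)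
    (h : q ^ 2 * (x + y) ^ 2 ≤ K * t ^ 2 * Θ) (hx : t ≤ C * |x|) (hy : t ≤ C * |y|)
    (hl : t ≤ C * |l|) : PairBound (K ^ 3 * C ^ 6) q Θ x y l := by
  unfold PairBound
  have h1 : t ≤ C * (1 + |x|) := by nlinarith
  have h2 : t ≤ C * (1 + |y|) := by nlinarith
  have h3 : t ≤ C * (1 + |l|) := by nlinarith
  calc q ^ 6 * (x + y) ^ 6 = (q ^ 2 * (x + y) ^ 2) ^ 3 := by ring
    _ ≤ (K * t ^ 2 * Θ) ^ 3 := by gcongr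
    _ = K ^ 3 * (t * t * t) ^ 2 * Θ ^ 3 := by ring
    _ ≤ K ^ 3 * ((C * (1 + |x|)) * (C * (1 + |y|)) * (C * (1 + |l|))) ^ 2 * Θ ^ 3 := by gcongr
    _ = _ := by ring

/-- Two triples of frequencies with the same alternating sum: `M` and `R` are the sizes of the
two quadruples, `q` bounds the multiplier and `Θ` the resonance function. -/
structure Config (n₁ n₂ n₃ m₁ m₂ m₃ M R q Θ : ℝ) : Prop where
  one_le : 1 ≤ M
  n₁_le : |n₁| ≤ M
  n₂_le : |n₂| ≤ M
  n₃_le : |n₃| ≤ M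
  n_le : |n₁ - n₂ + n₃| ≤ M
  M_eq : M = |n₁| ∨ M = |n₂| ∨ M = |n₃| ∨ M = |n₁ - n₂ + n₃|
  m₁_le : |m₁| ≤ R
  m₂_le : |m₂| ≤ R
  m₃_le : |m₃| ≤ R
  m_le : |n₁ - n₂ + n₃| ≤ R
  R_eq : R = |m₁| ∨ R = |m₂| ∨ R = |m₃| ∨ R = |n₁ - n₂ + n₃|
  sum : n₁ - n₂ + n₃ = m₁ - m₂ + m₃
  one_le_k : 1 ≤ |n₃ - n₂|
  k_le : |n₃ - n₂| ≤ |n₁ - n₂|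
  one_le_k' : 1 ≤ |m₃ - m₂|
  k_le' : |m₃ - m₂| ≤ |m₁ - m₂|
  q_nonneg : 0 ≤ q
  q_le : q * (|n₁ - n₂| * |n₃ - n₂|) ≤ 4 * M * |m₁ + m₃|
  one_le_Θ : 1 ≤ Θ
  le_Θ : |(m₁ + m₃) * (m₁ - m₂) * (m₃ - m₂) - (n₁ + n₃) * (n₁ - n₂) * (n₃ - n₂)| ≤ Θ

lemma sizes_of_close {a b c M : ℝ} (h1 : |a| ≤ M) (hM : M = |a| ∨ M = |b| ∨ M = |c| ∨ M = |a - b + c|)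
    (hj : |a - b| ≤ M / 8) (hk : |c - b| ≤ M / 8) :
    3 * M / 4 ≤ |a| ∧ 3 * M / 4 ≤ |b| ∧ 3 * M / 4 ≤ |c| ∧ 3 * M / 4 ≤ |a - b + c| ∧
      M ≤ |a + c| ∧ M ≤ |a + b| := by
  obtain ⟨j1, j2⟩ := abs_le.mp hj
  obtain ⟨k1, k2⟩ := abs_le.mp hk
  have M0 : 0 ≤ M := (abs_nonneg _).trans h1
  rcases hM with h | h | h | h
  · rcases abs_cases a with ⟨e, _⟩ | ⟨e, _⟩ <;>
      refine ⟨le_abs.mpr ?_, le_abs.mpr ?_, le_abs.mpr ?_, le_abs.mpr ?_, le_abs.mpr ?_,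
        le_abs.mpr ?_⟩ <;> first | (left; linarith) | (right; linarith)
  · rcases abs_cases b with ⟨e, _⟩ | ⟨e, _⟩ <;>
      refine ⟨le_abs.mpr ?_, le_abs.mpr ?_, le_abs.mpr ?_, le_abs.mpr ?_, le_abs.mpr ?_,
        le_abs.mpr ?_⟩ <;> first | (left; linarith) | (right; linarith)
  · rcases abs_cases c with ⟨e, _⟩ | ⟨e, _⟩ <;>
      refine ⟨le_abs.mpr ?_, le_abs.mpr ?_, le_abs.mpr ?_, le_abs.mpr ?_, le_abs.mpr ?_,
        le_abs.mpr ?_⟩ <;> first | (left; linarith) | (right; linarith)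
  · rcases abs_cases (a - b + c) with ⟨e, _⟩ | ⟨e, _⟩ <;>
      refine ⟨le_abs.mpr ?_, le_abs.mpr ?_, le_abs.mpr ?_, le_abs.mpr ?_, le_abs.mpr ?_,
        le_abs.mpr ?_⟩ <;> first | (left; linarith) | (right; linarith)

namespace Config

variable {n₁ n₂ n₃ m₁ m₂ m₃ M R q Θ : ℝ}

/-- The resonance function controls the second triple if that dominates the first. -/
lemma le_Θ_of_dominates (h : Config n₁ n₂ n₃ m₁ m₂ m₃ M R q Θ)
    (hd : 2 * (|n₁ + n₃| * (|n₁ - n₂| * |n₃ - n₂|)) ≤ |m₁ + m₃| * (|m₁ - m₂| * |m₃ - m₂|)) :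
    |m₁ + m₃| * (|m₁ - m₂| * |m₃ - m₂|) ≤ 2 * Θ := by
  have h1 := h.le_Θ
  have h2 := abs_sub_abs_le_abs_sub ((m₁ + m₃) * (m₁ - m₂) * (m₃ - m₂))
    ((n₁ + n₃) * (n₁ - n₂) * (n₃ - n₂))
  simp only [abs_mul, mul_assoc] at h1 h2 hd ⊢
  linarith

/-- All six frequencies are comparable and both triples are close. -/
lemma comparable (h : Config n₁ n₂ n₃ m₁ m₂ m₃ M R q Θ) (hj : |n₁ - n₂| ≤ M / 8)
    (hj' : |m₁ - m₂| ≤ R / 8) :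
    q ^ 6 * ((|n₁ - n₂| * |n₃ - n₂|) * (|m₁ - m₂| * |m₃ - m₂|)) ^ 3 ≤
      10 ^ 15 * ((1 + |n₁|) * (1 + |n₂|) * (1 + |n₃|) * (1 + |m₁|) * (1 + |m₂|) * (1 + |m₃|)) ^ 2
        * Θ ^ 3 := by
  obtain ⟨a1, a2, a3, a4, a5, -⟩ := sizes_of_close h.n₁_le h.M_eq hj
    (h.k_le.trans hj)
  obtain ⟨b1, b2, b3, b4, b5, -⟩ := sizes_of_close h.m₁_le (h.sum ▸ h.R_eq) hj' (h.k_le'.trans hj')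
  have hM := h.one_le
  have hRM : 3 * M / 4 ≤ R := a4.trans h.m_le
  have hMR : R ≤ 4 * M / 3 := by rw [← h.sum] at b4; linarith [h.n_le]
  have hS : |m₁ + m₃| ≤ 2 * R := (abs_add_le _ _).trans (by linarith [h.m₁_le, h.m₃_le])
  have hSn : |n₁ + n₃| ≤ 2 * M := (abs_add_le _ _).trans (by linarith [h.n₁_le, h.n₃_le])
  have hq := h.q_le
  have hq0 := h.q_nonneg
  have hΘ := h.one_le_Θ
  have hu : 1 ≤ |n₁ - n₂| * |n₃ - n₂| :=
    one_le_mul_of_one_le_of_one_le (h.one_le_k.trans h.k_le) h.one_le_k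
  have hd := h.le_Θ_of_dominates
  have hv : 1 ≤ |m₁ - m₂| * |m₃ - m₂| :=
    one_le_mul_of_one_le_of_one_le (h.one_le_k'.trans h.k_le') h.one_le_k'
  generalize |n₁ - n₂| * |n₃ - n₂| = u at *
  generalize |m₁ - m₂| * |m₃ - m₂| = v at *
  have hqu : q * u ≤ 32 * M ^ 2 / 3 := by
    have : 4 * M * |m₁ + m₃| ≤ 4 * M * (2 * (4 * M / 3)) := by gcongr; linarith
    linarith
  have hqu2 : (q * u) ^ 2 ≤ (32 * M ^ 2 / 3) ^ 2 := by gcongr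
  have main : q ^ 2 * (u * v) ≤ 1000 * M ^ 4 * Θ := by
    rcases le_total v (8 * u) with hvu | hvu
    · have h1 : q ^ 2 * (u * v) ≤ q ^ 2 * (u * (8 * u)) := by gcongr
      have h2 : 1000 * M ^ 4 * 1 ≤ 1000 * M ^ 4 * Θ := by gcongr
      have h3 : 0 ≤ M ^ 4 := by positivity
      linarith
    · have h5 : 2 * (|n₁ + n₃| * u) ≤ |m₁ + m₃| * v := by
        have h6 : |n₁ + n₃| * u ≤ 2 * M * (v / 8) := by gcongr; linarith
        have h7 : R * v ≤ |m₁ + m₃| * v := by gcongr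
        have h8 : 3 * M / 4 * v ≤ R * v := by gcongr
        nlinarith
      have h7 : v ≤ 4 * Θ := by
        have h6 := hd h5
        have h8 : 1 / 2 * v ≤ |m₁ + m₃| * v := by gcongr; linarith
        linarith
      have : q ^ 2 * (u * v) ≤ (q * u) ^ 2 * v := by
        have : q ^ 2 * u * v * 1 ≤ q ^ 2 * u * v * u := by gcongr
        linarith
      have h8 : (q * u) ^ 2 * v ≤ (32 * M ^ 2 / 3) ^ 2 * (4 * Θ) := by gcongr
      have h4 : 0 ≤ M ^ 4 * Θ := by positivity
      linarith
  have hP : (M / 2) ^ 6 ≤ (1 + |n₁|) * (1 + |n₂|) * (1 + |n₃|) * (1 + |m₁|) * (1 + |m₂|) * (1 + |m₃|) := by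
    rw [show (M / 2) ^ 6 = (M / 2) * (M / 2) * (M / 2) * (M / 2) * (M / 2) * (M / 2) by ring]
    gcongr <;> linarith
  calc q ^ 6 * (u * v) ^ 3 = (q ^ 2 * (u * v)) ^ 3 := by ring
    _ ≤ (1000 * M ^ 4 * Θ) ^ 3 := by gcongr
    _ = 10 ^ 9 * 2 ^ 12 * ((M / 2) ^ 6) ^ 2 * Θ ^ 3 := by ring
    _ ≤ 10 ^ 15 * ((1 + |n₁|) * (1 + |n₂|) * (1 + |n₃|) * (1 + |m₁|) * (1 + |m₂|) * (1 + |m₃|)) ^ 2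
        * Θ ^ 3 := by gcongr; norm_num

lemma second_spread (h : Config n₁ n₂ n₃ m₁ m₂ m₃ M R q Θ) (hj' : R / 8 ≤ |m₁ - m₂|) :
    R / 8 * |m₃ - m₂| ≤ |m₁ - m₂| * |m₃ - m₂| ∧ R / 8 ≤ |m₁ - m₂| * |m₃ - m₂| := by
  have := h.one_le_k'
  have h0 := abs_nonneg (m₁ - m₂)
  constructor
  · gcongr
  · nlinarith

/-- The first triple is close, the second is spread. -/
lemma close_spread (h : Config n₁ n₂ n₃ m₁ m₂ m₃ M R q Θ) (hj : |n₁ - n₂| ≤ M / 8)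
    (hj' : R / 8 ≤ |m₁ - m₂|) :
    PairBound (10 ^ 12) q Θ n₁ (-n₂) n₃ ∨
    ((n₁ + n₃ ≠ 0 ∧ n₃ + -n₂ ≠ 0 ∧ n₁ + n₂ ≠ 0) ∧
      q ^ 6 ≤ 10 ^ 15 * ((1 + |n₁|) * (1 + |n₂|) * (1 + |n₃|)) ^ 2) := by
  obtain ⟨a1, a2, a3, a4, a5, a6⟩ := sizes_of_close h.n₁_le h.M_eq hj
    (h.k_le.trans hj)
  have hM := h.one_le
  have hRM : 3 * M / 4 ≤ R := a4.trans h.m_le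
  have hS : |m₁ + m₃| ≤ 2 * R := (abs_add_le _ _).trans (by linarith [h.m₁_le, h.m₃_le])
  have hSn : |n₁ + n₃| ≤ 2 * M := (abs_add_le _ _).trans (by linarith [h.n₁_le, h.n₃_le])
  have hq := h.q_le
  have hq0 := h.q_nonneg
  have hΘ := h.one_le_Θ
  have hu : 1 ≤ |n₁ - n₂| * |n₃ - n₂| :=
    one_le_mul_of_one_le_of_one_le (h.one_le_k.trans h.k_le) h.one_le_k
  have hju : |n₁ - n₂| ≤ |n₁ - n₂| * |n₃ - n₂| := le_mul_of_one_le_right (abs_nonneg _) h.one_le_k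
  have hd := h.le_Θ_of_dominates
  have hv := (h.second_spread hj').2
  have hs0 := abs_nonneg (m₁ + m₃)
  have hsn0 := abs_nonneg (n₁ + n₃)
  have hR0 : 0 ≤ R := by linarith
  generalize |n₁ - n₂| * |n₃ - n₂| = u at *
  generalize |m₁ - m₂| * |m₃ - m₂| = v at *
  rcases le_total (2 * (|n₁ + n₃| * u)) (|m₁ + m₃| * v) with hc | hc
  · left
    have h1 := hd hc
    have h2 : |m₁ + m₃| * R ≤ 16 * Θ := by
      have : |m₁ + m₃| * (R / 8) ≤ |m₁ + m₃| * v := by gcongr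
      linarith
    have h3 : |m₁ + m₃| ^ 2 ≤ 32 * Θ := by
      have : |m₁ + m₃| * |m₁ + m₃| ≤ |m₁ + m₃| * (2 * R) := by gcongr
      linarith [sq |m₁ + m₃|]
    have h4 : q ^ 2 * (n₁ + -n₂) ^ 2 ≤ 512 * M ^ 2 * Θ := by
      have : q * |n₁ - n₂| ≤ 4 * M * |m₁ + m₃| := (by gcongr : _ ≤ q * u).trans hq
      have h5 : (q * |n₁ - n₂|) ^ 2 ≤ (4 * M * |m₁ + m₃|) ^ 2 := by gcongr
      rw [mul_pow, sq_abs] at h5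
      have h6 : (4 * M) ^ 2 * |m₁ + m₃| ^ 2 ≤ (4 * M) ^ 2 * (32 * Θ) := by gcongr
      rw [mul_pow _ |m₁ + m₃|] at h5
      rw [← sub_eq_add_neg]
      linarith
    have := pairBound_of_sq (C := 4 / 3) (by linarith) (by linarith : (0 : ℝ) ≤ M) (by norm_num) (by norm_num) h4
      (by linarith : M ≤ 4 / 3 * |n₁|) (by rw [abs_neg]; linarith : M ≤ 4 / 3 * |-n₂|)
      (by linarith : M ≤ 4 / 3 * |n₃|)
    unfold PairBound at this ⊢
    refine this.trans ?_
    gcongr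
    norm_num
  · right
    refine ⟨⟨?_, ?_, ?_⟩, ?_⟩
    · intro h0; rw [h0, abs_zero] at a5; linarith
    · intro h0
      have := h.one_le_k
      rw [sub_eq_add_neg, h0, abs_zero] at this; linarith
    · intro h0; rw [h0, abs_zero] at a6; linarith
    · have h1 : |m₁ + m₃| * R ≤ 32 * M * u := by
        have : |m₁ + m₃| * (R / 8) ≤ |m₁ + m₃| * v := by gcongr
        have : |n₁ + n₃| * u ≤ 2 * M * u := by gcongr
        linarith
      have h2 : q * R ≤ 128 * M ^ 2 := by
        have h3 : q * u * R ≤ 4 * M * (32 * M * u) := by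
          calc q * u * R ≤ 4 * M * |m₁ + m₃| * R := by gcongr
            _ = 4 * M * (|m₁ + m₃| * R) := by ring
            _ ≤ _ := by gcongr
        have : (q * R) * u ≤ (128 * M ^ 2) * u := by linarith
        exact le_of_mul_le_mul_right this (by linarith)
      have h3 : q ≤ 171 * M := by
        have : q * (3 * M / 4) ≤ 128 * M ^ 2 := le_trans (by gcongr) h2
        nlinarith
      have hP : (3 * M / 4) ^ 3 ≤ (1 + |n₁|) * (1 + |n₂|) * (1 + |n₃|) := by
        rw [show (3 * M / 4) ^ 3 = (3 * M / 4) * (3 * M / 4) * (3 * M / 4) by ring]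
        gcongr <;> linarith
      calc q ^ 6 ≤ (171 * M) ^ 6 := by gcongr
        _ = (228 : ℝ) ^ 6 * ((3 * M / 4) ^ 3) ^ 2 := by ring
        _ ≤ 10 ^ 15 * ((1 + |n₁|) * (1 + |n₂|) * (1 + |n₃|)) ^ 2 := by gcongr; norm_num

lemma q_mul_k_le (h : Config n₁ n₂ n₃ m₁ m₂ m₃ M R q Θ) {c : ℝ} (hc : 0 < c)
    (hj : M / c ≤ |n₁ - n₂|) : q * |n₃ - n₂| ≤ 4 * c * |m₁ + m₃| := by
  have hM := h.one_le
  have hq := h.q_le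
  have hq0 := h.q_nonneg
  have h1 : M / c * (q * |n₃ - n₂|) ≤ |n₁ - n₂| * (q * |n₃ - n₂|) := by gcongr
  have h2 : M * (q * |n₃ - n₂|) ≤ M * (4 * c * |m₁ + m₃|) := by
    have : M * (q * |n₃ - n₂|) = c * (M / c * (q * |n₃ - n₂|)) := by field_simp
    rw [this]
    calc c * (M / c * (q * |n₃ - n₂|)) ≤ c * (4 * M * |m₁ + m₃|) :=
          mul_le_mul_of_nonneg_left (by linarith) hc.le
      _ = _ := by ring
  exact le_of_mul_le_mul_left h2 (by linarith)

/-- The second triple has much larger frequencies. -/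
lemma second_dominant (h : Config n₁ n₂ n₃ m₁ m₂ m₃ M R q Θ) (hj : M / 8 ≤ |n₁ - n₂|)
    (hR : 16 * M ≤ R) :
    q ^ 2 ≤ 10 ^ 6 * Θ ∨ PairBound (10 ^ 24) q Θ m₂ (-m₃) n₁ ∨ PairBound (10 ^ 24) q Θ m₂ (-m₃) n₂ ∨
      PairBound (10 ^ 24) q Θ m₂ (-m₃) n₃ := by
  have hM := h.one_le
  have hqk := h.q_mul_k_le (by norm_num) hj
  have hq0 := h.q_nonneg
  have hΘ := h.one_le_Θ
  have hk := h.one_le_k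
  have hk' := h.one_le_k'
  have hn := h.n_le
  have hj' : R / 8 ≤ |m₁ - m₂| := by
    by_contra hcon
    have := (sizes_of_close h.m₁_le (h.sum ▸ h.R_eq) (le_of_not_ge hcon)
      (h.k_le'.trans (le_of_not_ge hcon))).2.2.2.1
    rw [← h.sum] at this
    linarith
  obtain ⟨hv, hv'⟩ := h.second_spread hj'
  have hd := h.le_Θ_of_dominates
  have hs : |m₁ + m₃| ≤ 2 * R := (abs_add_le _ _).trans (by linarith [h.m₁_le, h.m₃_le])
  have hs0 := abs_nonneg (m₁ + m₃)
  have hqq : q ≤ q * |n₃ - n₂| := le_mul_of_one_le_right hq0 hk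
  rcases le_total (2 * (|n₁ + n₃| * (|n₁ - n₂| * |n₃ - n₂|)))
    (|m₁ + m₃| * (|m₁ - m₂| * |m₃ - m₂|)) with hc | hc
  · left
    have h1 := hd hc
    have h2 : |m₁ + m₃| * (R / 8) ≤ |m₁ + m₃| * (|m₁ - m₂| * |m₃ - m₂|) := by gcongr
    have h3 : |m₁ + m₃| * |m₁ + m₃| ≤ |m₁ + m₃| * (2 * R) := by gcongr
    have h4 : q ^ 2 ≤ (4 * 8 * |m₁ + m₃|) ^ 2 := by gcongr; linarith
    have h5 : (4 * 8 * |m₁ + m₃|) ^ 2 = 1024 * (|m₁ + m₃| * |m₁ + m₃|) := by ring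
    linarith
  · have hsn : |n₁ + n₃| ≤ 2 * M := (abs_add_le _ _).trans (by linarith [h.n₁_le, h.n₃_le])
    have hjn : |n₁ - n₂| ≤ 2 * M := (abs_sub _ _).trans (by linarith [h.n₁_le, h.n₂_le])
    have h1 : |m₁ + m₃| * (R / 8 * |m₃ - m₂|) ≤ 2 * (2 * M * (2 * M * |n₃ - n₂|)) := by
      refine le_trans (le_trans (by gcongr) hc) ?_
      gcongr
    have h2 : q * (R * |m₃ - m₂|) ≤ 2048 * M ^ 2 := by
      have h3 : (q * |n₃ - n₂|) * (R * |m₃ - m₂|) ≤ 4 * 8 * |m₁ + m₃| * (R * |m₃ - m₂|) := by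
        have : 0 ≤ R := by linarith
        gcongr
      have h4 : q * (R * |m₃ - m₂|) * |n₃ - n₂| ≤ 2048 * M ^ 2 * |n₃ - n₂| := by linarith
      exact le_of_mul_le_mul_right h4 (by linarith)
    rcases le_total |m₃ - m₂| (R / 4) with hkR | hkR
    · right
      have hm : R / 2 ≤ |m₂| ∧ R / 2 ≤ |m₃| := by
        have e1 : |m₁| ≤ |n₁ - n₂ + n₃| + |m₃ - m₂| := by
          have := abs_sub (n₁ - n₂ + n₃) (m₃ - m₂)
          have e : n₁ - n₂ + n₃ - (m₃ - m₂) = m₁ := by linarith [h.sum]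
          rwa [e] at this
        have e2 := abs_sub_abs_le_abs_sub m₃ m₂
        have e3 := abs_sub_abs_le_abs_sub m₂ m₃
        rw [abs_sub_comm m₂ m₃] at e3
        rcases h.R_eq with e | e | e | e <;> constructor <;> linarith
      have hR0 : 0 < R := by linarith
      have ht : M ^ 2 / R ≤ M / 16 := by
        rw [div_le_iff₀ hR0]; nlinarith
      have hsq : q ^ 2 * (m₂ + -m₃) ^ 2 ≤ 2048 ^ 2 * (M ^ 2 / R) ^ 2 * Θ := by
        have h5 : q * |m₃ - m₂| ≤ 2048 * (M ^ 2 / R) := by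
          rw [← mul_div_assoc, le_div_iff₀ hR0]; linarith
        have h6 : (q * |m₃ - m₂|) ^ 2 ≤ (2048 * (M ^ 2 / R)) ^ 2 := by gcongr
        rw [mul_pow, sq_abs, mul_pow] at h6
        calc q ^ 2 * (m₂ + -m₃) ^ 2 = q ^ 2 * (m₃ - m₂) ^ 2 := by ring
          _ ≤ 2048 ^ 2 * (M ^ 2 / R) ^ 2 * 1 := by linarith
          _ ≤ _ := by gcongr
      have key : ∀ l, M / 3 ≤ |l| → PairBound (10 ^ 24) q Θ m₂ (-m₃) l := by
        intro l hl
        have := pairBound_of_sq (C := 1) (by linarith) (by positivity) (by norm_num) (by norm_num) hsq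
          (by linarith [hm.1] : M ^ 2 / R ≤ 1 * |m₂|)
          (by rw [abs_neg]; linarith [hm.2] : M ^ 2 / R ≤ 1 * |-m₃|)
          (by linarith : M ^ 2 / R ≤ 1 * |l|)
        unfold PairBound at this ⊢
        refine this.trans ?_
        gcongr
        norm_num
      by_contra hcon
      push Not at hcon
      have c1 : |n₁| < M / 3 := lt_of_not_ge fun h => hcon.1 (key _ h)
      have c2 : |n₂| < M / 3 := lt_of_not_ge fun h => hcon.2.1 (key _ h)
      have c3 : |n₃| < M / 3 := lt_of_not_ge fun h => hcon.2.2 (key _ h)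
      have c4 : |n₁ - n₂ + n₃| ≤ |n₁| + |n₂| + |n₃| :=
        (abs_add_le _ _).trans (by linarith [abs_sub n₁ n₂])
      rcases h.M_eq with e | e | e | e <;> linarith
    · left
      have hR0 : 0 < R := by linarith
      have h5 : q * (R * (R / 4)) ≤ 2048 * (R / 16) ^ 2 := by
        calc q * (R * (R / 4)) ≤ q * (R * |m₃ - m₂|) := by gcongr
          _ ≤ 2048 * M ^ 2 := h2
          _ ≤ _ := by gcongr; linarith
      have h6 : q ≤ 32 := by
        have : q * R ^ 2 ≤ 32 * R ^ 2 := by linarith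
        exact le_of_mul_le_mul_right this (by positivity)
      nlinarith

/-- The first triple is spread and `n₁` does not dominate. -/
lemma first_spread (h : Config n₁ n₂ n₃ m₁ m₂ m₃ M R q Θ) (hj : M / 8 ≤ |n₁ - n₂|)
    (hR : R ≤ 16 * M) (hc : M / 64 ≤ |n₃ - n₂| ∨ M / 32 ≤ |n₂|) :
    q ^ 2 ≤ 10 ^ 12 * Θ ∨ PairBound (10 ^ 40) q Θ (-n₂) n₃ m₁ ∨
      PairBound (10 ^ 40) q Θ (-n₂) n₃ m₃ := by
  have hM := h.one_le
  have hqk := h.q_mul_k_le (by norm_num) hj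
  have hq0 := h.q_nonneg
  have hΘ := h.one_le_Θ
  have hs : |m₁ + m₃| ≤ 2 * R := (abs_add_le _ _).trans (by linarith [h.m₁_le, h.m₃_le])
  have hs0 := abs_nonneg (m₁ + m₃)
  rcases le_or_gt (M / 64) |n₃ - n₂| with hk | hk
  · left
    have h1 : q * (M / 64) ≤ q * |n₃ - n₂| := by gcongr
    have h2 : q ≤ 65536 := by
      have : q * M ≤ 65536 * M := by linarith
      exact le_of_mul_le_mul_right this (by linarith)
    nlinarith
  · right
    have h2 : M / 32 ≤ |n₂| := hc.resolve_left (not_le.mpr hk)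
    have h3 : M / 64 ≤ |n₃| := by
      have := abs_sub_abs_le_abs_sub n₂ n₃
      rw [abs_sub_comm n₂ n₃] at this
      linarith
    have hsq : q ^ 2 * (-n₂ + n₃) ^ 2 ≤ 1024 * |m₁ + m₃| ^ 2 * Θ := by
      have h6 : (q * |n₃ - n₂|) ^ 2 ≤ (4 * 8 * |m₁ + m₃|) ^ 2 := by gcongr
      rw [mul_pow, sq_abs, mul_pow] at h6
      calc q ^ 2 * (-n₂ + n₃) ^ 2 = q ^ 2 * (n₃ - n₂) ^ 2 := by ring
        _ ≤ 1024 * |m₁ + m₃| ^ 2 * 1 := by linarith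
        _ ≤ _ := by gcongr
    have key : ∀ l, |m₁ + m₃| ≤ 2 * |l| → PairBound (10 ^ 40) q Θ (-n₂) n₃ l := by
      intro l hl
      have := pairBound_of_sq (C := 2048) (by linarith) hs0 (by norm_num) (by norm_num) hsq
        (by rw [abs_neg]; linarith : |m₁ + m₃| ≤ 2048 * |-n₂|)
        (by linarith : |m₁ + m₃| ≤ 2048 * |n₃|)
        (by linarith [abs_nonneg l] : |m₁ + m₃| ≤ 2048 * |l|)
      unfold PairBound at this ⊢
      refine this.trans ?_
      gcongr
      norm_num
    have := abs_add_le m₁ m₃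
    rcases le_total |m₁| |m₃| with h5 | h5
    · right; exact key _ (by linarith)
    · left; exact key _ (by linarith)

/-- Both `n₁` and the alternating sum are large, `n₂` and `n₃` are small. -/
structure HighLow (n₁ n₂ n₃ M : ℝ) : Prop where
  n₁_ge : 63 / 64 * M ≤ |n₁|
  n_ge : 63 / 64 * M ≤ |n₁ - n₂ + n₃|
  n₂_le : |n₂| ≤ M / 32
  n₃_le : |n₃| ≤ 3 / 64 * M
  k_le : |n₃ - n₂| ≤ M / 64

lemma highLow (h : Config n₁ n₂ n₃ m₁ m₂ m₃ M R q Θ) (hk : |n₃ - n₂| < M / 64)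
    (h2 : |n₂| < M / 32) : HighLow n₁ n₂ n₃ M := by
  have hM := h.one_le
  have h3 : |n₃| ≤ 3 / 64 * M := by
    have := abs_sub_abs_le_abs_sub n₃ n₂
    linarith
  have e1 := abs_add_le n₁ (n₃ - n₂)
  have e2 := abs_sub (n₁ - n₂ + n₃) (n₃ - n₂)
  rw [show n₁ + (n₃ - n₂) = n₁ - n₂ + n₃ by ring] at e1
  rw [show n₁ - n₂ + n₃ - (n₃ - n₂) = n₁ by ring] at e2
  refine ⟨?_, ?_, h2.le, h3, hk.le⟩ <;> rcases h.M_eq with e | e | e | e <;> linarith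

namespace HighLow

variable (hl : HighLow n₁ n₂ n₃ M)
include hl

lemma bounds (h : Config n₁ n₂ n₃ m₁ m₂ m₃ M R q Θ) :
    M / (5 / 4) ≤ |n₁ - n₂| ∧ |n₁ + n₃| * (|n₁ - n₂| * |n₃ - n₂|) ≤ 1.1 * M ^ 2 * |n₃ - n₂| := by
  have hM := h.one_le
  have := hl.n₁_ge; have := hl.n₂_le; have := hl.n₃_le
  have e1 := abs_sub_abs_le_abs_sub n₁ n₂
  have e2 := abs_sub n₁ n₂
  have e3 := abs_add_le n₁ n₃
  have := h.n₁_le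
  constructor
  · rw [div_le_iff₀ (by norm_num)]; linarith
  · calc |n₁ + n₃| * (|n₁ - n₂| * |n₃ - n₂|) ≤ (1.05 * M) * ((1.04 * M) * |n₃ - n₂|) := by
          gcongr <;> linarith
      _ = 1.092 * (M ^ 2 * |n₃ - n₂|) := by ring
      _ ≤ 1.1 * (M ^ 2 * |n₃ - n₂|) := by gcongr; norm_num
      _ = _ := by ring

/-- The second triple is spread in both directions. -/
lemma large_k' (h : Config n₁ n₂ n₃ m₁ m₂ m₃ M R q Θ) (hR : R ≤ 16 * M)
    (hk' : M / 64 ≤ |m₃ - m₂|) : q ^ 2 ≤ 10 ^ 12 * Θ := by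
  have hM := h.one_le
  obtain ⟨hj, hP⟩ := hl.bounds h
  have hqk := h.q_mul_k_le (by norm_num) hj
  have hq0 := h.q_nonneg
  have hΘ := h.one_le_Θ
  have hk := h.one_le_k
  have hs : |m₁ + m₃| ≤ 2 * R := (abs_add_le _ _).trans (by linarith [h.m₁_le, h.m₃_le])
  have hs0 := abs_nonneg (m₁ + m₃)
  have hv : M / 64 * (M / 64) ≤ |m₁ - m₂| * |m₃ - m₂| := by
    have := h.k_le'
    gcongr
    linarith
  have hsv : |m₁ + m₃| * (M / 64 * (M / 64)) ≤ |m₁ + m₃| * (|m₁ - m₂| * |m₃ - m₂|) := by gcongr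
  rcases le_total |m₁ + m₃| (10 ^ 4 * |n₃ - n₂|) with hc | hc
  · have : q * |n₃ - n₂| ≤ 50000 * |n₃ - n₂| := by linarith
    have : q ≤ 50000 := le_of_mul_le_mul_right this (by linarith)
    nlinarith
  · have h1 : 2 * (|n₁ + n₃| * (|n₁ - n₂| * |n₃ - n₂|)) ≤
        |m₁ + m₃| * (|m₁ - m₂| * |m₃ - m₂|) := by
      have : M ^ 2 * (10 ^ 4 * |n₃ - n₂|) ≤ M ^ 2 * |m₁ + m₃| := by gcongr
      have : 0 ≤ M ^ 2 * |m₁ + m₃| := by positivity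
      linarith
    have h2 := h.le_Θ_of_dominates h1
    have h3 : |m₁ + m₃| * M ≤ 8192 * Θ := by
      have : |m₁ + m₃| * (1 * M) ≤ |m₁ + m₃| * (M * M) := by gcongr
      linarith
    have h4 : q ^ 2 ≤ (4 * (5 / 4) * |m₁ + m₃|) ^ 2 := by
      gcongr
      exact (le_mul_of_one_le_right hq0 hk).trans hqk
    have h5 : |m₁ + m₃| * |m₁ + m₃| ≤ |m₁ + m₃| * (32 * M) := by gcongr; linarith
    have h6 : (4 * (5 / 4) * |m₁ + m₃|) ^ 2 = 25 * (|m₁ + m₃| * |m₁ + m₃|) := by ring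
    linarith

lemma m₁_ge (h : Config n₁ n₂ n₃ m₁ m₂ m₃ M R q Θ) (hk' : |m₃ - m₂| ≤ M / 64) :
    62 / 64 * M ≤ |m₁| := by
  have e := abs_add_le m₁ (m₃ - m₂)
  rw [show m₁ + (m₃ - m₂) = n₁ - n₂ + n₃ by rw [h.sum]; ring] at e
  linarith [hl.n_ge]

/-- Four large frequencies. -/
lemma four_large (h : Config n₁ n₂ n₃ m₁ m₂ m₃ M R q Θ) (hR : R ≤ 16 * M)
    (hk' : |m₃ - m₂| < M / 64) (hm₂ : M / 16 ≤ |m₂|) :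
    q ^ 2 ≤ 10 ^ 12 * Θ ∨ PhaseBound (10 ^ 25) q n₁ m₂ (-m₁) (-m₃) (-n₂) n₃ ∨
      PhaseBound (10 ^ 25) q n₁ (-m₃) (-m₁) m₂ (-n₂) n₃ := by
  have hM := h.one_le
  obtain ⟨hj, -⟩ := hl.bounds h
  have hqk := h.q_mul_k_le (by norm_num) hj
  have hq0 := h.q_nonneg
  have hΘ := h.one_le_Θ
  have hk := h.one_le_k
  have hs : |m₁ + m₃| ≤ 2 * R := (abs_add_le _ _).trans (by linarith [h.m₁_le, h.m₃_le])
  have hm₁ := hl.m₁_ge h hk'.le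
  have hm₃ : 3 / 64 * M ≤ |m₃| := by
    have := abs_sub_abs_le_abs_sub m₂ m₃
    rw [abs_sub_comm m₂ m₃] at this
    linarith
  have hqM : q ≤ 160 * M := by
    have := le_mul_of_one_le_right hq0 hk
    linarith
  have hn₁ := hl.n₁_ge
  have hn₂ := hl.n₂_le
  have hn₃ := hl.n₃_le
  have hpr : (1 + |n₂|) * (1 + |n₃|) ≤ (2 * M) * (2 * M) := by gcongr <;> linarith
  have hP : (3 / 64 * M) ^ 4 ≤ (1 + |n₁|) * (1 + |m₂|) * (1 + |m₁|) * (1 + |m₃|) := by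
    rw [show (3 / 64 * M) ^ 4 = (3 / 64 * M) * (3 / 64 * M) * (3 / 64 * M) * (3 / 64 * M) by ring]
    gcongr <;> linarith
  have main : q ^ 6 * ((1 + |n₂|) * (1 + |n₃|)) ≤
      10 ^ 25 * ((1 + |n₁|) * (1 + |m₂|) * (1 + |m₁|) * (1 + |m₃|)) ^ 2 := by
    calc q ^ 6 * ((1 + |n₂|) * (1 + |n₃|)) ≤ (160 * M) ^ 6 * ((2 * M) * (2 * M)) := by gcongr
      _ = (160 ^ 6 * 4 * (64 / 3) ^ 8) * ((3 / 64 * M) ^ 4) ^ 2 := by ring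
      _ ≤ 10 ^ 25 * ((1 + |n₁|) * (1 + |m₂|) * (1 + |m₁|) * (1 + |m₃|)) ^ 2 := by
        gcongr; norm_num
  by_cases hS : m₁ + m₃ = 0
  · left
    have : q * |n₃ - n₂| ≤ 0 := by rw [hS, abs_zero, mul_zero] at hqk; exact hqk
    have : q ≤ 0 := (le_mul_of_one_le_right hq0 hk).trans this
    have : q = 0 := le_antisymm this hq0
    rw [this]; linarith
  right
  by_cases hp : n₁ + m₂ = 0
  · right
    unfold PhaseBound
    simp only [abs_neg]
    refine ⟨?_, ?_, ?_⟩
    · calc _ ≤ _ := main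
        _ = _ := by ring
    · intro h0
      have e : m₃ - m₂ = 2 * n₁ := by linarith
      rw [e, abs_mul, abs_two] at hk'
      linarith
    · intro h0
      have : m₁ - m₂ = 0 := by linarith
      have h1 := h.one_le_k'.trans h.k_le'
      rw [this, abs_zero] at h1
      linarith
  · left
    unfold PhaseBound
    simp only [abs_neg]
    refine ⟨main, hp, ?_⟩
    intro h0
    exact hS (by linarith)

/-- Two large frequencies, `n₁` and `m₁`, which are different. -/
lemma two_large (h : Config n₁ n₂ n₃ m₁ m₂ m₃ M R q Θ)
    (hk' : |m₃ - m₂| < M / 64) (hm₂ : |m₂| < M / 16) (hd : 1 ≤ |n₁ - m₁|) :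
    q ^ 2 ≤ 10 ^ 12 * Θ ∨ ∃ l, (l = n₂ ∨ l = n₃ ∨ l = m₂ ∨ l = m₃) ∧
      PairBound (10 ^ 12) q Θ n₁ (-m₁) l := by
  have hM := h.one_le
  obtain ⟨hj, -⟩ := hl.bounds h
  have hqk := h.q_mul_k_le (by norm_num) hj
  have hq0 := h.q_nonneg
  have hΘ := h.one_le_Θ
  have hk := h.one_le_k
  have hm₁ := hl.m₁_ge h hk'.le
  have hm₃ : |m₃| ≤ 5 / 64 * M := by
    have := abs_sub_abs_le_abs_sub m₃ m₂
    linarith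
  have hn₁ := hl.n₁_ge
  have hn₂ := hl.n₂_le
  have hn₃ := hl.n₃_le
  have hkk := hl.k_le
  obtain ⟨l, hl1, hl2, hl3, hl4, hl5, hl6⟩ : ∃ l, (l = n₂ ∨ l = n₃ ∨ l = m₂ ∨ l = m₃) ∧
      |n₂| ≤ |l| ∧ |n₃| ≤ |l| ∧ |m₂| ≤ |l| ∧ |m₃| ≤ |l| ∧ |l| ≤ 5 / 64 * M := by
    rcases le_total |n₂| |n₃| with h1 | h1 <;> rcases le_total |m₂| |m₃| with h2 | h2
    · rcases le_total |n₃| |m₃| with h3 | h3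
      · exact ⟨m₃, by simp, h1.trans h3, h3, h2, le_rfl, by linarith⟩
      · exact ⟨n₃, by simp, h1, le_rfl, h2.trans h3, h3, by linarith⟩
    · rcases le_total |n₃| |m₂| with h3 | h3
      · exact ⟨m₂, by simp, h1.trans h3, h3, le_rfl, h2, by linarith⟩
      · exact ⟨n₃, by simp, h1, le_rfl, h3, h2.trans h3, by linarith⟩
    · rcases le_total |n₂| |m₃| with h3 | h3
      · exact ⟨m₃, by simp, h3, h1.trans h3, h2, le_rfl, by linarith⟩
      · exact ⟨n₂, by simp, le_rfl, h1, h2.trans h3, h3, by linarith⟩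
    · rcases le_total |n₂| |m₂| with h3 | h3
      · exact ⟨m₂, by simp, h3, h1.trans h3, le_rfl, h2, by linarith⟩
      · exact ⟨n₂, by simp, le_rfl, h1, h3, h2.trans h3, by linarith⟩
  have hs : |m₁ + m₃| ≤ 1.2 * M := by
    have e := abs_sub (n₁ - n₂ + n₃) (m₃ - m₂)
    rw [show n₁ - n₂ + n₃ - (m₃ - m₂) = m₁ by rw [h.sum]; ring] at e
    have := abs_add_le m₁ m₃
    linarith [h.n_le]
  have hqM : q * |n₃ - n₂| ≤ 6 * M := by linarith
  obtain ⟨n, hn⟩ : ∃ n, n = n₁ - n₂ + n₃ := ⟨_, rfl⟩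
  obtain ⟨k, hkdef⟩ : ∃ k, k = n₃ - n₂ := ⟨_, rfl⟩
  obtain ⟨k', hkdef'⟩ : ∃ k', k' = m₃ - m₂ := ⟨_, rfl⟩
  have hn63 := hl.n_ge
  have hnM := h.n_le
  have hΘ' := h.le_Θ
  have hsum := h.sum
  have e : (m₁ + m₃) * (m₁ - m₂) * (m₃ - m₂) - (n₁ + n₃) * (n₁ - n₂) * (n₃ - n₂) =
      (k' - k) * (n ^ 2 - n * (k + k')) - (k' * (m₂ * m₃) - k * (n₂ * n₃)) := by
    have hm : n = m₁ - m₂ + m₃ := hn.trans hsum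
    have e1 : (n₁ + n₃) * (n₁ - n₂) = n ^ 2 - n * k - n₂ * n₃ := by rw [hn, hkdef]; ring
    have e2 : (m₁ + m₃) * (m₁ - m₂) = n ^ 2 - n * k' - m₂ * m₃ := by rw [hm, hkdef']; ring
    rw [e1, e2, ← hkdef, ← hkdef']; ring
  have ed : n₁ - m₁ = k' - k := by rw [hkdef, hkdef']; linarith
  rw [e] at hΘ'
  rw [← hn] at hn63 hnM
  rw [← hkdef] at hqM hkk hk
  rw [← hkdef'] at hk'
  rw [ed] at hd
  have hl0 := abs_nonneg l
  have hmain : 0.9 * M ^ 2 ≤ |n ^ 2 - n * (k + k')| := by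
    have h1 : n ^ 2 = |n| * |n| := by rw [← sq, sq_abs]
    have h2 : n * (k + k') ≤ |n| * (M / 32) := by
      refine (le_abs_self _).trans ?_
      rw [abs_mul]
      gcongr
      exact (abs_add_le _ _).trans (by linarith)
    refine le_trans ?_ (le_abs_self _)
    have h3 : |n| * (|n| - M / 32) ≥ (63 / 64 * M) * (61 / 64 * M) := by
      apply mul_le_mul hn63 _ (by positivity) (abs_nonneg _)
      linarith
    have : 0 ≤ M * M := by positivity
    rw [h1]
    linarith
  have hlow : |k' * (m₂ * m₃) - k * (n₂ * n₃)| ≤ (2 * |k| + |k' - k|) * |l| ^ 2 := by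
    have h1 : |k'| ≤ |k| + |k' - k| := by
      have := abs_add_le k (k' - k); rwa [add_sub_cancel] at this
    have h2 : |m₂ * m₃| ≤ |l| ^ 2 := by rw [abs_mul, sq]; gcongr
    have h3 : |n₂ * n₃| ≤ |l| ^ 2 := by rw [abs_mul, sq]; gcongr
    calc _ ≤ |k' * (m₂ * m₃)| + |k * (n₂ * n₃)| := abs_sub _ _
      _ = |k'| * |m₂ * m₃| + |k| * |n₂ * n₃| := by rw [abs_mul k', abs_mul k]
      _ ≤ (|k| + |k' - k|) * |l| ^ 2 + |k| * |l| ^ 2 := by gcongr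
      _ = _ := by ring
  have hM2 : M ≤ M ^ 2 := by nlinarith
  rcases le_or_gt (M ^ 2 * |k' - k| / 4) Θ with hc | hc
  · left
    have h1 : M ^ 2 * 1 ≤ M ^ 2 * |k' - k| := by gcongr
    have h2 : q ≤ 6 * M := (le_mul_of_one_le_right hq0 hk).trans hqM
    have h3 : q ^ 2 ≤ (6 * M) ^ 2 := by gcongr
    linarith
  · right
    refine ⟨l, hl1, ?_⟩
    have h1 : |k' - k| * (0.9 * M ^ 2) ≤ M ^ 2 * |k' - k| / 4 + (2 * |k| + |k' - k|) * |l| ^ 2 := by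
      have h2 := abs_sub_abs_le_abs_sub ((k' - k) * (n ^ 2 - n * (k + k')))
        (k' * (m₂ * m₃) - k * (n₂ * n₃))
      rw [abs_mul (k' - k)] at h2
      have h3 : |k' - k| * (0.9 * M ^ 2) ≤ |k' - k| * |n ^ 2 - n * (k + k')| := by gcongr
      linarith
    have hl2' : |l| ^ 2 ≤ (5 / 64 * M) ^ 2 := by gcongr
    have h4 : 0.6 * (M ^ 2 * |k' - k|) ≤ 2 * |k| * |l| ^ 2 := by
      have : |k' - k| * |l| ^ 2 ≤ |k' - k| * (5 / 64 * M) ^ 2 := by gcongr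
      have : 0 ≤ M ^ 2 * |k' - k| := by positivity
      linarith
    have h5 : q * |k' - k| ≤ 2 * |l| := by
      have h6 : q * (0.6 * (M ^ 2 * |k' - k|)) ≤ q * (2 * |k| * |l| ^ 2) := by gcongr
      have h7 : (q * |k|) * |l| ^ 2 ≤ (6 * M) * ((5 / 64 * M) * |l|) := by
        gcongr
        rw [sq]; gcongr
      have h8 : 0 ≤ M ^ 2 * |l| := by positivity
      have h9 : M ^ 2 * (q * |k' - k|) ≤ M ^ 2 * (2 * |l|) := by linarith
      exact le_of_mul_le_mul_left h9 (by positivity)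
    have hsq : q ^ 2 * (n₁ + -m₁) ^ 2 ≤ 4 * |l| ^ 2 * Θ := by
      have h6 : (q * |k' - k|) ^ 2 ≤ (2 * |l|) ^ 2 := by gcongr
      rw [mul_pow, sq_abs, mul_pow] at h6
      rw [← sub_eq_add_neg, ed]
      calc q ^ 2 * (k' - k) ^ 2 ≤ 4 * |l| ^ 2 * 1 := by linarith
        _ ≤ _ := by gcongr
    have := pairBound_of_sq (C := 1) (by linarith) hl0 (by norm_num) (by norm_num) hsq
      (by linarith : |l| ≤ 1 * |n₁|) (by rw [abs_neg]; linarith : |l| ≤ 1 * |-m₁|)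
      (by linarith : |l| ≤ 1 * |l|)
    unfold PairBound at this ⊢
    refine this.trans ?_
    gcongr
    norm_num

end HighLow

end Config

/-- The sum of the cubes of six frequencies, i.e. the resonance function. -/
def cubes (z : Fin 6 → ℤ) : ℤ := ∑ k, z k ^ 3

/-- The modulation `1 + |Ψ|` of six frequencies. -/
noncomputable def modulation (z : Fin 6 → ℤ) : ℝ := 1 + |(cubes z : ℝ)|

/-- The product of the sizes of six frequencies. -/
noncomputable def sizeProd (z : Fin 6 → ℤ) : ℝ := ∏ k, (1 + |(z k : ℝ)|)

/-- The gain from the modulation and from the weights. -/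
noncomputable def gain (η : ℝ) (z : Fin 6 → ℤ) : ℝ :=
  modulation z ^ (-(1 / 2 : ℝ)) * sizeProd z ^ (-(1 / 3 + 2 * η))

/-- The sum of the kernels for one ordering of the frequencies. -/
noncomputable def baseKernel (η : ℝ) (z : Fin 6 → ℤ) : ℝ :=
  pairKernel η (z 0) (z 1) (z 2) (z 3) + diagKernel η (z 0) (z 1) (z 2) (z 3) +
    tripleKernel η (z 0) (z 1) (z 2) (z 3) (z 4) (z 5) +
    productKernel η (z 0) (z 1) (z 2) (z 3) (z 4) (z 5) +
    phaseKernel η (z 0) (z 1) (z 2) (z 3) (z 4) (z 5)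

/-- The symmetrization of `baseKernel`. -/
noncomputable def totalKernel (η : ℝ) (z : Fin 6 → ℤ) : ℝ :=
  ∑ σ : Equiv.Perm (Fin 6), baseKernel η (z ∘ σ)

section SixTuples

variable {η : ℝ} {z : Fin 6 → ℤ}

lemma pairKernel_nonneg (η : ℝ) (x y p q : ℤ) : 0 ≤ pairKernel η x y p q :=
  mul_nonneg (decay_nonneg _ _) (Real.sqrt_nonneg _)

lemma diagKernel_nonneg (η : ℝ) (x y p q : ℤ) : 0 ≤ diagKernel η x y p q := by
  unfold diagKernel
  split_ifs
  · exact decay_nonneg _ _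
  · exact le_rfl

lemma tripleKernel_nonneg (η : ℝ) (x y z x' y' z' : ℤ) : 0 ≤ tripleKernel η x y z x' y' z' :=
  mul_nonneg (Real.sqrt_nonneg _) (Real.sqrt_nonneg _)

lemma productKernel_nonneg (η : ℝ) (x y z x' y' z' : ℤ) : 0 ≤ productKernel η x y z x' y' z' := by
  have := decay_nonneg η
  unfold productKernel
  exact mul_nonneg (Real.rpow_nonneg (mul_nonneg (mul_nonneg (this _) (this _)) (this _)) _)
    (Real.rpow_nonneg (mul_nonneg (mul_nonneg (this _) (this _)) (this _)) _)

lemma phaseKernel_nonneg (η : ℝ) (x y z w p q : ℤ) : 0 ≤ phaseKernel η x y z w p q := by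
  unfold phaseKernel
  split_ifs
  · positivity
  · exact le_rfl

lemma baseKernel_nonneg (η : ℝ) (z : Fin 6 → ℤ) : 0 ≤ baseKernel η z :=
  add_nonneg (add_nonneg (add_nonneg (add_nonneg (pairKernel_nonneg ..) (diagKernel_nonneg ..))
    (tripleKernel_nonneg ..)) (productKernel_nonneg ..)) (phaseKernel_nonneg ..)

lemma totalKernel_nonneg (η : ℝ) (z : Fin 6 → ℤ) : 0 ≤ totalKernel η z :=
  Finset.sum_nonneg fun _ _ => baseKernel_nonneg η _

lemma totalKernel_comp (η : ℝ) (z : Fin 6 → ℤ) (σ : Equiv.Perm (Fin 6)) :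
    totalKernel η (z ∘ σ) = totalKernel η z := by
  unfold totalKernel
  exact Equiv.sum_comp (Equiv.mulLeft σ) (fun τ : Equiv.Perm (Fin 6) => baseKernel η (z ∘ τ))

lemma gain_comp (η : ℝ) (z : Fin 6 → ℤ) (σ : Equiv.Perm (Fin 6)) :
    gain η (z ∘ σ) = gain η z := by
  unfold gain modulation sizeProd cubes
  simp only [Function.comp]
  rw [Equiv.sum_comp σ (fun k => z k ^ 3), Equiv.prod_comp σ (fun k => (1 + |(z k : ℝ)|))]

lemma modulation_comp (z : Fin 6 → ℤ) (σ : Equiv.Perm (Fin 6)) :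
    modulation (z ∘ σ) = modulation z := by
  unfold modulation cubes
  simp only [Function.comp]
  rw [Equiv.sum_comp σ (fun k => z k ^ 3)]

lemma baseKernel_le (η : ℝ) (z : Fin 6 → ℤ) : baseKernel η z ≤ totalKernel η z := by
  have h := Finset.single_le_sum (f := fun σ : Equiv.Perm (Fin 6) => baseKernel η (z ∘ σ))
    (fun _ _ => baseKernel_nonneg η _) (Finset.mem_univ 1)
  simp only [Equiv.Perm.coe_one, Function.comp_id] at h
  exact h

lemma pairKernel_le (η : ℝ) (z : Fin 6 → ℤ) :
    pairKernel η (z 0) (z 1) (z 2) (z 3) ≤ totalKernel η z := by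
  refine le_trans ?_ (baseKernel_le η z)
  have := diagKernel_nonneg η (z 0) (z 1) (z 2) (z 3)
  have := tripleKernel_nonneg η (z 0) (z 1) (z 2) (z 3) (z 4) (z 5)
  have := productKernel_nonneg η (z 0) (z 1) (z 2) (z 3) (z 4) (z 5)
  have := phaseKernel_nonneg η (z 0) (z 1) (z 2) (z 3) (z 4) (z 5)
  unfold baseKernel
  linarith

lemma diagKernel_le (η : ℝ) (z : Fin 6 → ℤ) :
    diagKernel η (z 0) (z 1) (z 2) (z 3) ≤ totalKernel η z := by
  refine le_trans ?_ (baseKernel_le η z)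
  have := pairKernel_nonneg η (z 0) (z 1) (z 2) (z 3)
  have := tripleKernel_nonneg η (z 0) (z 1) (z 2) (z 3) (z 4) (z 5)
  have := productKernel_nonneg η (z 0) (z 1) (z 2) (z 3) (z 4) (z 5)
  have := phaseKernel_nonneg η (z 0) (z 1) (z 2) (z 3) (z 4) (z 5)
  unfold baseKernel
  linarith

lemma tripleKernel_le (η : ℝ) (z : Fin 6 → ℤ) :
    tripleKernel η (z 0) (z 1) (z 2) (z 3) (z 4) (z 5) ≤ totalKernel η z := by
  refine le_trans ?_ (baseKernel_le η z)
  have := pairKernel_nonneg η (z 0) (z 1) (z 2) (z 3)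
  have := diagKernel_nonneg η (z 0) (z 1) (z 2) (z 3)
  have := productKernel_nonneg η (z 0) (z 1) (z 2) (z 3) (z 4) (z 5)
  have := phaseKernel_nonneg η (z 0) (z 1) (z 2) (z 3) (z 4) (z 5)
  unfold baseKernel
  linarith

lemma productKernel_le (η : ℝ) (z : Fin 6 → ℤ) :
    productKernel η (z 0) (z 1) (z 2) (z 3) (z 4) (z 5) ≤ totalKernel η z := by
  refine le_trans ?_ (baseKernel_le η z)
  have := pairKernel_nonneg η (z 0) (z 1) (z 2) (z 3)
  have := diagKernel_nonneg η (z 0) (z 1) (z 2) (z 3)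
  have := tripleKernel_nonneg η (z 0) (z 1) (z 2) (z 3) (z 4) (z 5)
  have := phaseKernel_nonneg η (z 0) (z 1) (z 2) (z 3) (z 4) (z 5)
  unfold baseKernel
  linarith

lemma phaseKernel_le (η : ℝ) (z : Fin 6 → ℤ) :
    phaseKernel η (z 0) (z 1) (z 2) (z 3) (z 4) (z 5) ≤ totalKernel η z := by
  refine le_trans ?_ (baseKernel_le η z)
  have := pairKernel_nonneg η (z 0) (z 1) (z 2) (z 3)
  have := diagKernel_nonneg η (z 0) (z 1) (z 2) (z 3)
  have := tripleKernel_nonneg η (z 0) (z 1) (z 2) (z 3) (z 4) (z 5)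
  have := productKernel_nonneg η (z 0) (z 1) (z 2) (z 3) (z 4) (z 5)
  unfold baseKernel
  linarith

lemma totalKernel_neg (η : ℝ) (z : Fin 6 → ℤ) : totalKernel η (-z) = totalKernel η z := by
  have hs : ∀ a b : ℤ, decay η (-a + -b) = decay η (a + b) := fun a b => by
    rw [← neg_add, decay_neg]
  have hz : ∀ a b : ℤ, (-a + -b = 0) ↔ (a + b = 0) := fun a b => by omega
  unfold totalKernel
  refine Finset.sum_congr rfl fun σ _ => ?_
  have hc : ∀ a b c d e f : ℤ, |((((-a) ^ 3 + (-b) ^ 3 + (-c) ^ 3 + (-d) ^ 3 + (-e) ^ 3 + (-f) ^ 3 : ℤ)) : ℝ)|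
      = |((a ^ 3 + b ^ 3 + c ^ 3 + d ^ 3 + e ^ 3 + f ^ 3 : ℤ) : ℝ)| := by
    intro a b c d e f
    rw [← abs_neg]
    congr 1
    push_cast
    ring
  simp only [baseKernel, pairKernel, diagKernel, tripleKernel, productKernel, phaseKernel,
    Function.comp, Pi.neg_apply, decay_neg, hs, hc, ne_eq, hz]

lemma tsum_totalKernel {Γ : Type*} {Z : Γ → Fin 6 → ℤ} (hsum : ∀ i, ∑ k, Z i k = 0)
    (hinj : Function.Injective Z) {f : Fin 6 → ℤ → ℝ} (hf0 : ∀ k n, 0 ≤ f k n) {B : ℝ≥0∞}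
    (hf : ∀ k, ∑' n, ENNReal.ofReal (f k n ^ 2) ≤ B) (hη : 0 < η) (hη1 : η ≤ 1) :
    ∑' i, ENNReal.ofReal (totalKernel η (Z i) * ∏ k, f k (Z i k)) ≤
      31680 * (B ^ 3 * decaySum η ^ 2) := by
  have hF : ∀ i, 0 ≤ ∏ k, f k (Z i k) := fun i => Finset.prod_nonneg fun k _ => hf0 k _
  have key : ∀ σ : Equiv.Perm (Fin 6),
      ∑' i, ENNReal.ofReal (baseKernel η (Z i ∘ σ) * ∏ k, f k (Z i k)) ≤
        44 * (B ^ 3 * decaySum η ^ 2) := by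
    intro σ
    have hz : ZeroSum (fun i => Z i (σ 0)) (fun i => Z i (σ 1)) (fun i => Z i (σ 2))
        (fun i => Z i (σ 3)) (fun i => Z i (σ 4)) (fun i => Z i (σ 5)) := by
      constructor
      · intro i
        have := hsum i
        rw [← Equiv.sum_comp σ, Fin.sum_univ_six] at this
        exact this
      · intro i i' h0 h1 h2 h3 h4 h5
        apply hinj
        funext k
        obtain ⟨l, rfl⟩ := σ.surjective k
        fin_cases l <;> assumption
    have h := fun (k : Fin 6) => hf (σ k)
    have e1 := tsum_pairKernel (η := η) hz (h 0) (h 1) (h 2) (h 3) (h 4) (h 5)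
    have e2 := tsum_diagKernel (η := η) hz (h 0) (h 1) (h 2) (h 3) (h 4) (h 5)
    have e3 := tsum_tripleKernel (η := η) hz (h 0) (h 1) (h 2) (h 3) (h 4) (h 5)
    have e4 := tsum_productKernel (η := η) hz (h 0) (h 1) (h 2) (h 3) (h 4) (h 5)
    have e5 := tsum_phaseKernel hη hη1 hz (h 0) (h 1) (h 2) (h 3) (h 4) (h 5)
    have hp : ∀ i, f (σ 0) (Z i (σ 0)) * f (σ 1) (Z i (σ 1)) * f (σ 2) (Z i (σ 2)) *
        f (σ 3) (Z i (σ 3)) * f (σ 4) (Z i (σ 4)) * f (σ 5) (Z i (σ 5)) = ∏ k, f k (Z i k) := by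
      intro i
      rw [← Equiv.prod_comp σ, Fin.prod_univ_six]
    simp only [hp] at e1 e2 e3 e4 e5
    have hadd : ∀ a b c d e F : ℝ, ENNReal.ofReal ((a + b + c + d + e) * F) ≤ ENNReal.ofReal (a * F) +
        ENNReal.ofReal (b * F) + ENNReal.ofReal (c * F) + ENNReal.ofReal (d * F) +
        ENNReal.ofReal (e * F) := by
      intro a b c d e F
      rw [add_mul, add_mul, add_mul, add_mul]
      exact ENNReal.ofReal_add_le.trans (add_le_add (ENNReal.ofReal_add_le.trans
            (add_le_add (ENNReal.ofReal_add_le.trans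
            (add_le_add ENNReal.ofReal_add_le le_rfl)) le_rfl)) le_rfl)
    refine (ENNReal.tsum_le_tsum fun i => hadd _ _ _ _ _ _).trans ?_
    rw [ENNReal.tsum_add, ENNReal.tsum_add, ENNReal.tsum_add, ENNReal.tsum_add]
    refine (add_le_add (add_le_add (add_le_add (add_le_add e1 e2) e3) e4) e5).trans (le_of_eq ?_)
    ring
  calc ∑' i, ENNReal.ofReal (totalKernel η (Z i) * ∏ k, f k (Z i k))
      = ∑' i, ∑ σ : Equiv.Perm (Fin 6),
          ENNReal.ofReal (baseKernel η (Z i ∘ σ) * ∏ k, f k (Z i k)) := by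
        refine tsum_congr fun i => ?_
        rw [totalKernel, Finset.sum_mul, ENNReal.ofReal_sum_of_nonneg]
        exact fun σ _ => mul_nonneg (baseKernel_nonneg _ _) (hF i)
    _ = ∑ σ : Equiv.Perm (Fin 6), ∑' i,
          ENNReal.ofReal (baseKernel η (Z i ∘ σ) * ∏ k, f k (Z i k)) :=
        Summable.tsum_finsetSum fun _ _ => ENNReal.summable
    _ ≤ ∑ σ : Equiv.Perm (Fin 6), 44 * (B ^ 3 * decaySum η ^ 2) :=
        Finset.sum_le_sum fun σ _ => key σ
    _ = 31680 * (B ^ 3 * decaySum η ^ 2) := by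
        rw [Finset.sum_const, Finset.card_univ, Fintype.card_perm, Fintype.card_fin, nsmul_eq_mul,
          ← mul_assoc]
        norm_num [Nat.factorial]

lemma one_le_size (n : ℤ) : 1 ≤ 1 + |(n : ℝ)| := by linarith [abs_nonneg (n : ℝ)]

lemma sizeProd_eq (z : Fin 6 → ℤ) : sizeProd z = (1 + |(z 0 : ℝ)|) * (1 + |(z 1 : ℝ)|) *
    (1 + |(z 2 : ℝ)|) * (1 + |(z 3 : ℝ)|) * (1 + |(z 4 : ℝ)|) * (1 + |(z 5 : ℝ)|) := by
  rw [sizeProd, Fin.prod_univ_six]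

lemma one_le_sizeProd (z : Fin 6 → ℤ) : 1 ≤ sizeProd z :=
  Finset.one_le_prod fun _ _ => one_le_size _

lemma one_le_modulation (z : Fin 6 → ℤ) : 1 ≤ modulation z := one_le_size _

lemma size_le_sizeProd (z : Fin 6 → ℤ) (k : Fin 6) : 1 + |(z k : ℝ)| ≤ sizeProd z := by
  unfold sizeProd
  rw [← Finset.mul_prod_erase _ _ (Finset.mem_univ k)]
  exact le_mul_of_one_le_right (by positivity)
    (Finset.one_le_prod fun _ _ => one_le_size _)

lemma size_add_le_sizeProd (z : Fin 6 → ℤ) {k l : Fin 6} (hkl : k ≠ l) :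
    1 + |((z k + z l : ℤ) : ℝ)| ≤ sizeProd z := by
  unfold sizeProd
  rw [← Finset.mul_prod_erase _ _ (Finset.mem_univ k),
    ← Finset.mul_prod_erase _ _ (Finset.mem_erase.mpr ⟨hkl.symm, Finset.mem_univ l⟩), ← mul_assoc]
  refine le_trans ?_ (le_mul_of_one_le_right (by positivity)
    (Finset.one_le_prod fun _ _ => one_le_size _))
  push_cast
  nlinarith [abs_add_le (z k : ℝ) (z l), mul_nonneg (abs_nonneg (z k : ℝ)) (abs_nonneg (z l : ℝ))]

lemma one_add_sum_le_prod {ι : Type*} (t : Finset ι) (f : ι → ℝ) (hf : ∀ i, 0 ≤ f i) :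
    1 + ∑ i ∈ t, f i ≤ ∏ i ∈ t, (1 + f i) := by
  classical
  induction t using Finset.induction_on with
  | empty => simp
  | insert a t ha ih =>
    rw [Finset.sum_insert ha, Finset.prod_insert ha]
    have h1 : 0 ≤ ∑ i ∈ t, f i := Finset.sum_nonneg fun i _ => hf i
    nlinarith [hf a, mul_nonneg (hf a) h1, mul_le_mul_of_nonneg_left ih (hf a)]

lemma modulation_le_sizeProd (z : Fin 6 → ℤ) : modulation z ≤ sizeProd z ^ 3 := by
  have h1 : modulation z ≤ 1 + ∑ k, |(z k : ℝ)| ^ 3 := by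
    unfold modulation cubes
    push_cast
    gcongr
    refine (Finset.abs_sum_le_sum_abs _ _).trans ?_
    simp only [abs_pow, le_refl]
  refine (h1.trans (one_add_sum_le_prod _ _ fun k => by positivity)).trans ?_
  unfold sizeProd
  rw [← Finset.prod_pow]
  refine Finset.prod_le_prod (fun k _ => by positivity) fun k _ => ?_
  have := abs_nonneg (z k : ℝ)
  nlinarith [sq_nonneg |(z k : ℝ)|]

section Permuted

variable (η) (z) (s : Fin 6 → Fin 6) (hs : Function.Bijective s)
include hs

lemma pairKernel_perm_le :
    pairKernel η (z (s 0)) (z (s 1)) (z (s 2)) (z (s 3)) ≤ totalKernel η z := by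
  rw [← totalKernel_comp η z (Equiv.ofBijective s hs)]
  exact pairKernel_le η (z ∘ Equiv.ofBijective s hs)

lemma gain_perm : gain η (z ∘ s) = gain η z := gain_comp η z (Equiv.ofBijective s hs)

lemma totalKernel_perm : totalKernel η (z ∘ s) = totalKernel η z :=
  totalKernel_comp η z (Equiv.ofBijective s hs)

omit η in
lemma modulation_perm : modulation (z ∘ s) = modulation z :=
  modulation_comp z (Equiv.ofBijective s hs)

end Permuted

lemma root_six_le {q D K Y Θ : ℝ} (hq : 0 ≤ q) (hD : 0 ≤ D) (hK : 0 ≤ K) (hY : 0 ≤ Y) (hΘ : 0 ≤ Θ)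
    (h : q ^ 6 * D ^ 6 ≤ K ^ 6 * Y ^ 2 * Θ ^ 3) :
    q * D ≤ K * Y ^ (1 / 3 : ℝ) * Θ ^ (1 / 2 : ℝ) := by
  rw [← pow_le_pow_iff_left₀ (n := 6) (by positivity) (by positivity) (by norm_num)]
  have e1 : (Y ^ (1 / 3 : ℝ)) ^ 6 = Y ^ 2 := by
    rw [← Real.rpow_natCast, ← Real.rpow_mul hY, ← Real.rpow_natCast]; norm_num
  have e2 : (Θ ^ (1 / 2 : ℝ)) ^ 6 = Θ ^ 3 := by
    rw [← Real.rpow_natCast, ← Real.rpow_mul hΘ, ← Real.rpow_natCast]; norm_num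
  rw [mul_pow, mul_pow, mul_pow, e1, e2]
  exact h

lemma mul_gain_le {q D K Y W T : ℝ} (hD : 0 < D) (hY : 0 < Y) (hW : 0 < W)
    (hP : sizeProd z = Y * W) (h : q * D ≤ K * Y ^ (1 / 3 : ℝ) * T) :
    q * gain η z ≤ K * (D⁻¹ * (T * modulation z ^ (-(1 / 2 : ℝ))) * W ^ (-(1 / 3 : ℝ)) *
      sizeProd z ^ (-(2 * η))) := by
  have hPpos : 0 < sizeProd z := by linarith [one_le_sizeProd z]
  have h1 : q ≤ K * Y ^ (1 / 3 : ℝ) * T * D⁻¹ := by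
    rw [← div_eq_mul_inv, le_div_iff₀ hD]; exact h
  have hg0 : 0 ≤ gain η z := by
    unfold gain
    have := one_le_modulation z
    positivity
  calc q * gain η z ≤ K * Y ^ (1 / 3 : ℝ) * T * D⁻¹ * gain η z := by gcongr
    _ = K * Y ^ (1 / 3 : ℝ) * T * D⁻¹ * (modulation z ^ (-(1 / 2 : ℝ)) *
        ((Y ^ (1 / 3 : ℝ))⁻¹ * W ^ (-(1 / 3 : ℝ)) * sizeProd z ^ (-(2 * η)))) := by
        unfold gain
        rw [show -(1 / 3 + 2 * η) = -(1 / 3) + -(2 * η) by ring, Real.rpow_add hPpos]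
        congr 3
        rw [hP, Real.mul_rpow hY.le hW.le, Real.rpow_neg hY.le]
    _ = _ := by
        have : Y ^ (1 / 3 : ℝ) ≠ 0 := by positivity
        field_simp

lemma rpow_absorb {A P α η : ℝ} (hA : 0 < A) (hAP : A ≤ P) (hη : 0 ≤ η) :
    A ^ (-α) * P ^ (-η) ≤ A ^ (-(α + η)) := by
  rw [neg_add, Real.rpow_add hA]
  exact mul_le_mul_of_nonneg_left (Real.rpow_le_rpow_of_nonpos hA hAP (by linarith))
    (by positivity)

lemma inv_abs_le {d : ℤ} (hd : d ≠ 0) : |(d : ℝ)|⁻¹ ≤ 2 * (1 + |(d : ℝ)|) ^ (-(1 : ℝ)) := by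
  have : (1 : ℝ) ≤ |(d : ℝ)| := by exact_mod_cast Int.one_le_abs hd
  rw [Real.rpow_neg (by positivity), Real.rpow_one, ← div_eq_mul_inv, inv_eq_one_div,
    div_le_div_iff₀ (by positivity) (by positivity)]
  linarith

lemma decay_mul_three (η : ℝ) (a b c : ℤ) : (decay η a * decay η b * decay η c) ^ (1 / 3 : ℝ) =
    ((1 + |(a : ℝ)|) * (1 + |(b : ℝ)|) * (1 + |(c : ℝ)|)) ^ (-((1 + η) / 3)) := by
  unfold decay
  rw [← Real.mul_rpow (by positivity) (by positivity), ← Real.mul_rpow (by positivity)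
    (by positivity), ← Real.rpow_mul (by positivity)]
  congr 1
  ring

lemma sqrt_decay_mul (η : ℝ) (a b : ℤ) : √(decay η a * decay η b) =
    ((1 + |(a : ℝ)|) * (1 + |(b : ℝ)|)) ^ (-((1 + η) / 2)) := by
  unfold decay
  rw [Real.sqrt_eq_rpow, ← Real.mul_rpow (by positivity) (by positivity),
    ← Real.rpow_mul (by positivity)]
  congr 1
  ring

lemma modulation_rpow_cancel (z : Fin 6 → ℤ) :
    modulation z ^ (1 / 2 : ℝ) * modulation z ^ (-(1 / 2 : ℝ)) = 1 := by
  rw [← Real.rpow_add (by linarith [one_le_modulation z])]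
  norm_num

lemma modulation_rpow_le_one (z : Fin 6 → ℤ) : modulation z ^ (-(1 / 2 : ℝ)) ≤ 1 :=
  Real.rpow_le_one_of_one_le_of_nonpos (one_le_modulation z) (by norm_num)

lemma split_sizeProd_rpow (z : Fin 6 → ℤ) (a b : ℝ) :
    sizeProd z ^ (-(a + b)) = sizeProd z ^ (-a) * sizeProd z ^ (-b) := by
  rw [neg_add, Real.rpow_add (by linarith [one_le_sizeProd z])]

lemma prod_three_le_sizeProd (z : Fin 6 → ℤ) :
    (1 + |(z 3 : ℝ)|) * (1 + |(z 4 : ℝ)|) * (1 + |(z 5 : ℝ)|) ≤ sizeProd z := by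
  rw [sizeProd_eq]
  have h0 := one_le_size (z 0)
  have h1 := one_le_size (z 1)
  have h2 := one_le_size (z 2)
  calc _ = 1 * 1 * 1 * ((1 + |(z 3 : ℝ)|) * (1 + |(z 4 : ℝ)|) * (1 + |(z 5 : ℝ)|)) := by ring
    _ ≤ (1 + |(z 0 : ℝ)|) * (1 + |(z 1 : ℝ)|) * (1 + |(z 2 : ℝ)|) *
      ((1 + |(z 3 : ℝ)|) * (1 + |(z 4 : ℝ)|) * (1 + |(z 5 : ℝ)|)) := by gcongr
    _ = _ := by ring

lemma pair_gain_aux (hη : 0 < η) {q K : ℝ} (hq : 0 ≤ q) (hK : 0 ≤ K)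
    (h : PairBound (K ^ 6) q (modulation z) (z 0) (z 1) (z 2)) (hne : z 0 + z 1 ≠ 0) :
    q * gain η z ≤ 6 * K * totalKernel η z := by
  have hΘ := one_le_modulation z
  have hW1 : 1 ≤ (1 + |(z 3 : ℝ)|) * (1 + |(z 4 : ℝ)|) * (1 + |(z 5 : ℝ)|) :=
    one_le_mul_of_one_le_of_one_le (one_le_mul_of_one_le_of_one_le (one_le_size _) (one_le_size _))
      (one_le_size _)
  have h1 : q * |((z 0 + z 1 : ℤ) : ℝ)| ≤ K *
      ((1 + |(z 0 : ℝ)|) * (1 + |(z 1 : ℝ)|) * (1 + |(z 2 : ℝ)|)) ^ (1 / 3 : ℝ) *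
        modulation z ^ (1 / 2 : ℝ) := by
    refine root_six_le hq (abs_nonneg _) hK (by positivity) (by linarith) ?_
    unfold PairBound at h
    rw [Even.pow_abs (by decide)]
    push_cast
    exact h
  have hWP := prod_three_le_sizeProd z
  have h2 := mul_gain_le (η := η) (abs_pos.mpr (by exact_mod_cast hne)) (by positivity)
    (by positivity) (W := (1 + |(z 3 : ℝ)|) * (1 + |(z 4 : ℝ)|) * (1 + |(z 5 : ℝ)|))
    (by rw [sizeProd_eq]; ring) h1
  rw [modulation_rpow_cancel, mul_one] at h2
  refine h2.trans ?_
  have hd1 := one_le_size (z 0 + z 1)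
  have hdP := size_add_le_sizeProd z (show (0 : Fin 6) ≠ 1 by decide)
  generalize hWe : (1 + |(z 3 : ℝ)|) * (1 + |(z 4 : ℝ)|) * (1 + |(z 5 : ℝ)|) = W at *
  have h3 : |((z 0 + z 1 : ℤ) : ℝ)|⁻¹ * W ^ (-(1 / 3 : ℝ)) * sizeProd z ^ (-(2 * η)) ≤
      2 * (decay η (z 0 + z 1) * (decay η (z 3) * decay η (z 4) * decay η (z 5)) ^ (1 / 3 : ℝ)) := by
    rw [show 2 * η = η + η by ring, split_sizeProd_rpow, decay_mul_three, hWe]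
    have e1 := rpow_absorb (α := 1) (by linarith) hdP hη.le
    have e2 : W ^ (-(1 / 3 : ℝ)) * sizeProd z ^ (-η) ≤ W ^ (-((1 + η) / 3)) := by
      refine (rpow_absorb (by linarith) hWP hη.le).trans ?_
      exact Real.rpow_le_rpow_of_exponent_le hW1 (by linarith)
    have hP0 : 0 ≤ sizeProd z ^ (-η) := by have := one_le_sizeProd z; positivity
    calc _ ≤ 2 * (1 + |((z 0 + z 1 : ℤ) : ℝ)|) ^ (-(1 : ℝ)) * W ^ (-(1 / 3 : ℝ)) *
          (sizeProd z ^ (-η) * sizeProd z ^ (-η)) := by gcongr; exact inv_abs_le hne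
      _ = 2 * (((1 + |((z 0 + z 1 : ℤ) : ℝ)|) ^ (-(1 : ℝ)) * sizeProd z ^ (-η)) *
          (W ^ (-(1 / 3 : ℝ)) * sizeProd z ^ (-η))) := by ring
      _ ≤ 2 * ((1 + |((z 0 + z 1 : ℤ) : ℝ)|) ^ (-(1 + η)) * W ^ (-((1 + η) / 3))) := by gcongr
  have h4 : (decay η (z 3) * decay η (z 4) * decay η (z 5)) ^ (1 / 3 : ℝ) ≤
      √(decay η (z 3) * decay η (z 4)) + √(decay η (z 4) * decay η (z 5)) +
        √(decay η (z 5) * decay η (z 3)) := by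
    have a := decay_nonneg η (z 3)
    have b := decay_nonneg η (z 4)
    have c := decay_nonneg η (z 5)
    refine (le_abs_self _).trans (abs_le_of_sq_le_sq ((rpow_two_thirds_le a b c).trans ?_) (by positivity))
    have e1 := Real.sq_sqrt (mul_nonneg a b)
    have e2 := Real.sq_sqrt (mul_nonneg b c)
    have e3 := Real.sq_sqrt (mul_nonneg c a)
    have f1 := Real.sqrt_nonneg (decay η (z 3) * decay η (z 4))
    have f2 := Real.sqrt_nonneg (decay η (z 4) * decay η (z 5))
    have f3 := Real.sqrt_nonneg (decay η (z 5) * decay η (z 3))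
    nlinarith [mul_nonneg f1 f2, mul_nonneg f2 f3, mul_nonneg f3 f1]
  have k1 : decay η (z 0 + z 1) * √(decay η (z 3) * decay η (z 4)) ≤ totalKernel η z :=
    pairKernel_perm_le η z ![0, 1, 3, 4, 5, 2] (by decide)
  have k2 : decay η (z 0 + z 1) * √(decay η (z 4) * decay η (z 5)) ≤ totalKernel η z :=
    pairKernel_perm_le η z ![0, 1, 4, 5, 3, 2] (by decide)
  have k3 : decay η (z 0 + z 1) * √(decay η (z 5) * decay η (z 3)) ≤ totalKernel η z :=
    pairKernel_perm_le η z ![0, 1, 5, 3, 4, 2] (by decide)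
  have h5 := mul_le_mul_of_nonneg_left h4 (decay_nonneg η (z 0 + z 1))
  calc _ ≤ K * (6 * totalKernel η z) := mul_le_mul_of_nonneg_left (by linarith) hK
    _ = _ := by ring

/-- The estimate by `pairKernel`. -/
lemma pair_gain (hη : 0 < η) (s : Fin 6 → Fin 6) (hs : Function.Bijective s) {q K : ℝ} (hq : 0 ≤ q)
    (hK : 0 ≤ K) (h : PairBound (K ^ 6) q (modulation z) (z (s 0)) (z (s 1)) (z (s 2)))
    (hne : z (s 0) + z (s 1) ≠ 0) : q * gain η z ≤ 6 * K * totalKernel η z := by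
  have := pair_gain_aux (z := z ∘ s) hη hq hK (by rw [modulation_perm z s hs]; exact h) hne
  rwa [gain_perm η z s hs, totalKernel_perm η z s hs] at this

/-- The estimate by `productKernel`. -/
lemma product_gain (hη : 0 < η) {q K : ℝ} (hq : 0 ≤ q) (hK : 0 ≤ K)
    (h : q ^ 2 ≤ K ^ 2 * modulation z) : q * gain η z ≤ 6 * K * totalKernel η z := by
  have hΘ := one_le_modulation z
  have hP1 := one_le_sizeProd z
  have h1 : q * 1 ≤ K * 1 ^ (1 / 3 : ℝ) * modulation z ^ (1 / 2 : ℝ) := by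
    refine root_six_le hq zero_le_one hK zero_le_one (by linarith) ?_
    calc q ^ 6 * 1 ^ 6 = (q ^ 2) ^ 3 := by ring
      _ ≤ (K ^ 2 * modulation z) ^ 3 := by gcongr
      _ = _ := by ring
  have h2 := mul_gain_le (η := η) zero_lt_one zero_lt_one (by linarith) (one_mul (sizeProd z)).symm h1
  rw [modulation_rpow_cancel, inv_one, mul_one, one_mul] at h2
  refine h2.trans ?_
  have h3 : sizeProd z ^ (-(1 / 3 : ℝ)) * sizeProd z ^ (-(2 * η)) ≤ totalKernel η z := by
    refine le_trans ?_ (productKernel_le η z)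
    unfold productKernel
    rw [decay_mul_three, decay_mul_three, ← Real.mul_rpow (by positivity) (by positivity),
      ← Real.rpow_add (by linarith)]
    rw [show (1 + |(z 0 : ℝ)|) * (1 + |(z 1 : ℝ)|) * (1 + |(z 2 : ℝ)|) * ((1 + |(z 3 : ℝ)|) *
      (1 + |(z 4 : ℝ)|) * (1 + |(z 5 : ℝ)|)) = sizeProd z by rw [sizeProd_eq]; ring]
    exact Real.rpow_le_rpow_of_exponent_le hP1 (by linarith)
  calc _ ≤ K * totalKernel η z := by gcongr
    _ ≤ _ := by nlinarith [mul_nonneg hK (totalKernel_nonneg η z)]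

/-- The estimate by `tripleKernel`. -/
lemma triple_gain (hη : 0 < η) {q K : ℝ} (hq : 0 ≤ q) (hK : 0 ≤ K)
    (h1 : z 0 + z 1 ≠ 0) (h2 : z 2 + z 1 ≠ 0) (h3 : z 3 + z 4 ≠ 0) (h4 : z 5 + z 4 ≠ 0)
    (h : q ^ 6 * ((|((z 0 + z 1 : ℤ) : ℝ)| * |((z 2 + z 1 : ℤ) : ℝ)|) *
      (|((z 3 + z 4 : ℤ) : ℝ)| * |((z 5 + z 4 : ℤ) : ℝ)|)) ^ 3 ≤
      K ^ 6 * sizeProd z ^ 2 * modulation z ^ 3) :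
    q * gain η z ≤ 6 * K * totalKernel η z := by
  have hΘ := one_le_modulation z
  have hP1 := one_le_sizeProd z
  have g1 : (1 : ℝ) ≤ |((z 0 + z 1 : ℤ) : ℝ)| := by exact_mod_cast Int.one_le_abs h1
  have g2 : (1 : ℝ) ≤ |((z 2 + z 1 : ℤ) : ℝ)| := by exact_mod_cast Int.one_le_abs h2
  have g3 : (1 : ℝ) ≤ |((z 3 + z 4 : ℤ) : ℝ)| := by exact_mod_cast Int.one_le_abs h3
  have g4 : (1 : ℝ) ≤ |((z 5 + z 4 : ℤ) : ℝ)| := by exact_mod_cast Int.one_le_abs h4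
  have p1 := size_add_le_sizeProd z (show (0 : Fin 6) ≠ 1 by decide)
  have p2 := size_add_le_sizeProd z (show (2 : Fin 6) ≠ 1 by decide)
  have p3 := size_add_le_sizeProd z (show (3 : Fin 6) ≠ 4 by decide)
  have p4 := size_add_le_sizeProd z (show (5 : Fin 6) ≠ 4 by decide)
  have hk := tripleKernel_le η z
  unfold tripleKernel at hk
  rw [sqrt_decay_mul, sqrt_decay_mul, ← Real.mul_rpow (by positivity) (by positivity)] at hk
  generalize |((z 0 + z 1 : ℤ) : ℝ)| = a at *
  generalize |((z 2 + z 1 : ℤ) : ℝ)| = b at *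
  generalize |((z 3 + z 4 : ℤ) : ℝ)| = c at *
  generalize |((z 5 + z 4 : ℤ) : ℝ)| = d at *
  have hD : ((a * b * (c * d)) ^ (1 / 2 : ℝ)) ^ 6 = (a * b * (c * d)) ^ 3 := by
    rw [← Real.rpow_natCast, ← Real.rpow_mul (by positivity), ← Real.rpow_natCast]; norm_num
  have e1 : q * (a * b * (c * d)) ^ (1 / 2 : ℝ) ≤ K * sizeProd z ^ (1 / 3 : ℝ) *
      modulation z ^ (1 / 2 : ℝ) :=
    root_six_le hq (by positivity) hK (by positivity) (by linarith) (by rw [hD]; exact h)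
  have e2 := mul_gain_le (η := η) (by positivity) (by linarith) zero_lt_one
    (mul_one (sizeProd z)).symm e1
  rw [modulation_rpow_cancel, mul_one, Real.one_rpow, mul_one] at e2
  refine e2.trans ?_
  have hQ : (1 + a) * (1 + b) * ((1 + c) * (1 + d)) ≤ 16 * (a * b * (c * d)) := by
    calc (1 + a) * (1 + b) * ((1 + c) * (1 + d)) ≤ (2 * a) * (2 * b) * ((2 * c) * (2 * d)) := by
          gcongr <;> linarith
      _ = _ := by ring
  have hQP : (1 + a) * (1 + b) * ((1 + c) * (1 + d)) ≤ sizeProd z ^ 4 := by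
    calc (1 + a) * (1 + b) * ((1 + c) * (1 + d)) ≤ sizeProd z * sizeProd z * (sizeProd z * sizeProd z) := by
          gcongr
      _ = _ := by ring
  have hQ0 : 0 < (1 + a) * (1 + b) * ((1 + c) * (1 + d)) := by positivity
  have hP4 : sizeProd z ^ (-(2 * η)) = (sizeProd z ^ 4) ^ (-(η / 2)) := by
    rw [← Real.rpow_natCast, ← Real.rpow_mul (by linarith)]; congr 1; push_cast; ring
  have e3 : ((a * b * (c * d)) ^ (1 / 2 : ℝ))⁻¹ ≤
      4 * ((1 + a) * (1 + b) * ((1 + c) * (1 + d))) ^ (-(1 / 2 : ℝ)) := by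
    rw [← Real.rpow_neg (by positivity)]
    calc (a * b * (c * d)) ^ (-(1 / 2 : ℝ))
        ≤ ((1 + a) * (1 + b) * ((1 + c) * (1 + d)) / 16) ^ (-(1 / 2 : ℝ)) :=
          Real.rpow_le_rpow_of_nonpos (by positivity) (by linarith) (by norm_num)
      _ = _ := by
          rw [Real.div_rpow (by positivity) (by norm_num), Real.rpow_neg (by norm_num : (0 : ℝ) ≤ 16),
            div_inv_eq_mul, ← Real.sqrt_eq_rpow, show (16 : ℝ) = 4 ^ 2 by norm_num,
            Real.sqrt_sq (by norm_num), mul_comm]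
  generalize (1 + a) * (1 + b) * ((1 + c) * (1 + d)) = Q at *
  rw [hP4]
  have e4 : Q ^ (-(1 / 2 : ℝ)) * (sizeProd z ^ 4) ^ (-(η / 2)) ≤ totalKernel η z := by
    refine (rpow_absorb hQ0 hQP (by linarith)).trans (le_trans (le_of_eq ?_) hk)
    congr 1; ring
  have e5 : 0 ≤ (sizeProd z ^ 4) ^ (-(η / 2)) := by positivity
  calc K * (((a * b * (c * d)) ^ (1 / 2 : ℝ))⁻¹ * (sizeProd z ^ 4) ^ (-(η / 2)))
      ≤ K * (4 * Q ^ (-(1 / 2 : ℝ)) * (sizeProd z ^ 4) ^ (-(η / 2))) := by gcongr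
    _ = 4 * K * (Q ^ (-(1 / 2 : ℝ)) * (sizeProd z ^ 4) ^ (-(η / 2))) := by ring
    _ ≤ 4 * K * totalKernel η z := by gcongr
    _ ≤ _ := by nlinarith [mul_nonneg hK (totalKernel_nonneg η z)]

lemma phase_gain_aux (hη : 0 < η) {q K : ℝ} (hq : 0 ≤ q) (hK : 0 ≤ K)
    (h : PhaseBound (K ^ 6) q (z 0) (z 1) (z 2) (z 3) (z 4) (z 5)) :
    q * gain η z ≤ 6 * K * totalKernel η z := by
  have hΘ := one_le_modulation z
  have hP1 := one_le_sizeProd z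
  obtain ⟨h0, h01, h23⟩ := h
  have hW1 : 1 ≤ (1 + |(z 4 : ℝ)|) * (1 + |(z 5 : ℝ)|) :=
    one_le_mul_of_one_le_of_one_le (one_le_size _) (one_le_size _)
  have hWP : (1 + |(z 4 : ℝ)|) * (1 + |(z 5 : ℝ)|) ≤ sizeProd z := by
    refine le_trans ?_ (prod_three_le_sizeProd z)
    rw [mul_assoc]
    exact le_mul_of_one_le_left (by positivity) (one_le_size _)
  have hk := phaseKernel_le η z
  unfold phaseKernel at hk
  rw [if_pos ⟨by exact_mod_cast h01, by exact_mod_cast h23⟩, sqrt_decay_mul] at hk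
  have hc : (z 0 ^ 3 + z 1 ^ 3 + z 2 ^ 3 + z 3 ^ 3 + z 4 ^ 3 + z 5 ^ 3) = cubes z := by
    rw [cubes, Fin.sum_univ_six]
  rw [hc] at hk
  change modulation z ^ (-(1 / 2 + η / 2)) * _ ≤ _ at hk
  have hP : sizeProd z = (1 + |(z 0 : ℝ)|) * (1 + |(z 1 : ℝ)|) * (1 + |(z 2 : ℝ)|) *
    (1 + |(z 3 : ℝ)|) * ((1 + |(z 4 : ℝ)|) * (1 + |(z 5 : ℝ)|)) := by rw [sizeProd_eq]; ring
  have hY : 0 < (1 + |(z 0 : ℝ)|) * (1 + |(z 1 : ℝ)|) * (1 + |(z 2 : ℝ)|) *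
    (1 + |(z 3 : ℝ)|) := by positivity
  generalize (1 + |(z 4 : ℝ)|) * (1 + |(z 5 : ℝ)|) = W at *
  generalize (1 + |(z 0 : ℝ)|) * (1 + |(z 1 : ℝ)|) * (1 + |(z 2 : ℝ)|) *
    (1 + |(z 3 : ℝ)|) = Y at *
  have hD : (W ^ (1 / 6 : ℝ)) ^ 6 = W := by
    rw [← Real.rpow_natCast, ← Real.rpow_mul (by linarith)]; norm_num
  have e1 : q * W ^ (1 / 6 : ℝ) ≤ K * Y ^ (1 / 3 : ℝ) * 1 ^ (1 / 2 : ℝ) :=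
    root_six_le hq (by positivity) hK hY.le (by norm_num) (by rw [hD]; linarith)
  rw [Real.one_rpow] at e1
  have hW0 : 0 < W := by linarith
  have e2 := mul_gain_le (η := η) (by positivity) hY hW0 hP e1
  refine e2.trans ?_
  have e3 : (W ^ (1 / 6 : ℝ))⁻¹ * W ^ (-(1 / 3 : ℝ)) = W ^ (-(1 / 2 : ℝ)) := by
    rw [← Real.rpow_neg hW0.le, ← Real.rpow_add hW0]; norm_num
  have e4 : W ^ (-(1 / 2 : ℝ)) * sizeProd z ^ (-(η / 2)) ≤ W ^ (-((1 + η) / 2)) := by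
    refine (rpow_absorb hW0 hWP (by linarith)).trans (le_of_eq ?_)
    congr 1; ring
  have e5 : modulation z ^ (-(1 / 2 : ℝ)) * sizeProd z ^ (-(3 * η / 2)) ≤
      modulation z ^ (-(1 / 2 + η / 2)) := by
    have : sizeProd z ^ (-(3 * η / 2)) = (sizeProd z ^ 3) ^ (-(η / 2)) := by
      rw [← Real.rpow_natCast, ← Real.rpow_mul (by linarith)]; congr 1; push_cast; ring
    rw [this]
    exact rpow_absorb (by linarith) (modulation_le_sizeProd z) (by linarith)
  rw [show 2 * η = η / 2 + 3 * η / 2 by ring, split_sizeProd_rpow]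
  have e6 : 0 ≤ sizeProd z ^ (-(η / 2)) := by positivity
  have e7 : 0 ≤ sizeProd z ^ (-(3 * η / 2)) := by positivity
  calc _ = K * ((modulation z ^ (-(1 / 2 : ℝ)) * sizeProd z ^ (-(3 * η / 2))) *
        ((W ^ (1 / 6 : ℝ))⁻¹ * W ^ (-(1 / 3 : ℝ)) * sizeProd z ^ (-(η / 2)))) := by ring
    _ ≤ K * (modulation z ^ (-(1 / 2 + η / 2)) * W ^ (-((1 + η) / 2))) := by
        rw [e3]; gcongr
    _ ≤ K * totalKernel η z := by gcongr
    _ ≤ _ := by nlinarith [mul_nonneg hK (totalKernel_nonneg η z)]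

/-- The estimate by `phaseKernel`. -/
lemma phase_gain (hη : 0 < η) (s : Fin 6 → Fin 6) (hs : Function.Bijective s) {q K : ℝ} (hq : 0 ≤ q)
    (hK : 0 ≤ K) (h : PhaseBound (K ^ 6) q (z (s 0)) (z (s 1)) (z (s 2)) (z (s 3)) (z (s 4)) (z (s 5))) :
    q * gain η z ≤ 6 * K * totalKernel η z := by
  have := phase_gain_aux (z := z ∘ s) hη hq hK h
  rwa [gain_perm η z s hs, totalKernel_perm η z s hs] at this

lemma diag_gain_aux (hη : 0 < η) {q K L : ℝ} (hK : 0 ≤ K) (hL : 0 ≤ L)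
    (hLP : L ^ 3 ≤ sizeProd z) (h01 : z 0 + z 1 = 0) (h23 : z 2 + z 3 ≠ 0)
    (h : q * |((z 2 + z 3 : ℤ) : ℝ)| ≤ K * L) :
    q * gain η z ≤ 6 * K * totalKernel η z := by
  have hP1 := one_le_sizeProd z
  have hL' : L ≤ sizeProd z ^ (1 / 3 : ℝ) := by
    calc L = (L ^ 3) ^ (1 / 3 : ℝ) := by
          rw [← Real.rpow_natCast, ← Real.rpow_mul hL]; norm_num
      _ ≤ _ := by gcongr
  have e1 : q * |((z 2 + z 3 : ℤ) : ℝ)| ≤ K * sizeProd z ^ (1 / 3 : ℝ) * 1 := by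
    rw [mul_one]; exact h.trans (by gcongr)
  have e2 := mul_gain_le (η := η) (abs_pos.mpr (by exact_mod_cast h23)) (by linarith) zero_lt_one
    (mul_one (sizeProd z)).symm e1
  refine e2.trans ?_
  have hk := diagKernel_le η z
  unfold diagKernel decay at hk
  rw [if_pos h01] at hk
  have hm := modulation_rpow_le_one z
  have hm0 : 0 ≤ modulation z ^ (-(1 / 2 : ℝ)) := by have := one_le_modulation z; positivity
  have hd1 := one_le_size (z 2 + z 3)
  have hdP := size_add_le_sizeProd z (show (2 : Fin 6) ≠ 3 by decide)
  have e3 := inv_abs_le h23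
  have e4 : (1 + |((z 2 + z 3 : ℤ) : ℝ)|) ^ (-(1 : ℝ)) * sizeProd z ^ (-(2 * η)) ≤
      (1 + |((z 2 + z 3 : ℤ) : ℝ)|) ^ (-(1 + η)) := by
    refine (rpow_absorb (by linarith) hdP (by linarith)).trans ?_
    exact Real.rpow_le_rpow_of_exponent_le hd1 (by linarith)
  have e6 : 0 ≤ sizeProd z ^ (-(2 * η)) := by positivity
  rw [Real.one_rpow, mul_one, one_mul]
  calc _ ≤ K * (2 * (1 + |((z 2 + z 3 : ℤ) : ℝ)|) ^ (-(1 : ℝ)) * 1 * sizeProd z ^ (-(2 * η))) := by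
        gcongr
    _ = 2 * K * ((1 + |((z 2 + z 3 : ℤ) : ℝ)|) ^ (-(1 : ℝ)) * sizeProd z ^ (-(2 * η))) := by ring
    _ ≤ 2 * K * totalKernel η z := by gcongr; exact e4.trans hk
    _ ≤ _ := by nlinarith [mul_nonneg hK (totalKernel_nonneg η z)]

/-- The estimate by `diagKernel`. -/
lemma diag_gain (hη : 0 < η) (s : Fin 6 → Fin 6) (hs : Function.Bijective s) {q K L : ℝ}
    (hK : 0 ≤ K) (hL : 0 ≤ L) (hLP : L ^ 3 ≤ sizeProd z) (h01 : z (s 0) + z (s 1) = 0)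
    (h23 : z (s 2) + z (s 3) ≠ 0) (h : q * |((z (s 2) + z (s 3) : ℤ) : ℝ)| ≤ K * L) :
    q * gain η z ≤ 6 * K * totalKernel η z := by
  have hp : sizeProd (z ∘ s) = sizeProd z :=
    Equiv.prod_comp (Equiv.ofBijective s hs) (fun k => (1 + |(z k : ℝ)|))
  have := diag_gain_aux (z := z ∘ s) hη hK hL (by rw [hp]; exact hLP) h01 h23 h
  rwa [gain_perm η z s hs, totalKernel_perm η z s hs] at this

end SixTuples

/-- The symbol of the high frequency part of the momentum. -/
noncomputable def psi (N : ℕ) (n : ℤ) : ℝ := if (N : ℤ) < |n| then (n : ℝ) else 0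

/-- The alternating sum of `psi` over a quadruple of frequencies. -/
noncomputable def psi4 (N : ℕ) (n₁ n₂ n₃ : ℤ) : ℝ :=
  psi N n₂ + psi N (n₁ - n₂ + n₃) - psi N n₁ - psi N n₃

/-- The quadrilinear multiplier. -/
noncomputable def beta (N : ℕ) (n₁ n₂ n₃ : ℤ) : ℝ :=
  psi4 N n₁ n₂ n₃ / ((n₁ - n₂) * (n₃ - n₂))

/-- The six-linear multiplier. -/
noncomputable def six (N : ℕ) (n₁ n₂ n₃ m₁ m₂ m₃ : ℤ) : ℝ :=
  beta N n₁ n₂ n₃ * (m₁ + m₃) - beta N m₁ m₂ m₃ * (n₁ + n₃)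

/-- The signed frequencies of two triples. -/
def signed (n₁ n₂ n₃ m₁ m₂ m₃ : ℤ) : Fin 6 → ℤ := ![n₁, -n₂, n₃, -m₁, m₂, -m₃]

lemma abs_psi_le (N : ℕ) (n : ℤ) : |psi N n| ≤ |(n : ℝ)| := by
  unfold psi
  split_ifs
  · exact le_rfl
  · rw [abs_zero]; exact abs_nonneg _

lemma psi_of_le {N : ℕ} {n : ℤ} (h : |(n : ℝ)| ≤ N) : psi N n = 0 := by
  unfold psi
  rw [if_neg]
  exact not_lt.mpr (by exact_mod_cast h)

lemma abs_psi_sub_le (N : ℕ) (a b : ℤ) : |psi N a - psi N b| ≤ |(a : ℝ) - b| + N := by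
  have hN : (0 : ℝ) ≤ N := Nat.cast_nonneg N
  unfold psi
  split_ifs with h1 h2 h2
  · linarith
  · have : |(b : ℝ)| ≤ N := by exact_mod_cast not_lt.mp h2
    rw [sub_zero]
    linarith [abs_sub_abs_le_abs_sub (a : ℝ) b]
  · have : |(a : ℝ)| ≤ N := by exact_mod_cast not_lt.mp h1
    rw [zero_sub, abs_neg]
    have := abs_sub_abs_le_abs_sub (b : ℝ) a
    rw [abs_sub_comm] at this
    linarith
  · rw [sub_zero, abs_zero]; positivity

lemma abs_psi4_le {N : ℕ} {n₁ n₂ n₃ : ℤ} {M : ℝ} (h₁ : |(n₁ : ℝ)| ≤ M) (h₂ : |(n₂ : ℝ)| ≤ M)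
    (h₃ : |(n₃ : ℝ)| ≤ M) (h₄ : |(n₁ : ℝ) - n₂ + n₃| ≤ M) : |psi4 N n₁ n₂ n₃| ≤ 4 * M := by
  unfold psi4
  have e1 := (abs_psi_le N n₁).trans h₁
  have e2 := (abs_psi_le N n₂).trans h₂
  have e3 := (abs_psi_le N n₃).trans h₃
  have e4 := (abs_psi_le N (n₁ - n₂ + n₃)).trans (by push_cast; exact h₄)
  rw [abs_le] at *
  constructor <;> linarith [e1.1, e1.2, e2.1, e2.2, e3.1, e3.2, e4.1, e4.2]

lemma psi4_swap (N : ℕ) (n₁ n₂ n₃ : ℤ) : psi4 N n₃ n₂ n₁ = psi4 N n₁ n₂ n₃ := by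
  unfold psi4
  rw [show n₃ - n₂ + n₁ = n₁ - n₂ + n₃ by ring]
  ring

lemma beta_swap (N : ℕ) (n₁ n₂ n₃ : ℤ) : beta N n₃ n₂ n₁ = beta N n₁ n₂ n₃ := by
  unfold beta
  rw [psi4_swap, mul_comm]

lemma psi4_eq_zero {N : ℕ} {n₁ n₂ n₃ : ℤ} (h₁ : |(n₁ : ℝ)| ≤ N / 3) (h₂ : |(n₂ : ℝ)| ≤ N / 3)
    (h₃ : |(n₃ : ℝ)| ≤ N / 3) : psi4 N n₁ n₂ n₃ = 0 := by
  have hN : (0 : ℝ) ≤ N := Nat.cast_nonneg N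
  unfold psi4
  rw [psi_of_le (by linarith : |(n₁ : ℝ)| ≤ N), psi_of_le (by linarith : |(n₂ : ℝ)| ≤ N),
    psi_of_le (by linarith : |(n₃ : ℝ)| ≤ N), psi_of_le]
  · norm_num
  · push_cast
    rw [abs_le] at *
    constructor <;> linarith [h₁.1, h₁.2, h₂.1, h₂.2, h₃.1, h₃.2]

lemma PairBound.mono {C C' q Θ x y l : ℝ} (h : PairBound C q Θ x y l) (hC : C ≤ C') (hΘ : 0 ≤ Θ) :
    PairBound C' q Θ x y l := by
  unfold PairBound at *
  exact h.trans (by gcongr)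

lemma PhaseBound.mono {C C' q x₁ x₂ x₃ x₄ p r : ℝ} (h : PhaseBound C q x₁ x₂ x₃ x₄ p r)
    (hC : C ≤ C') : PhaseBound C' q x₁ x₂ x₃ x₄ p r :=
  ⟨h.1.trans (by gcongr), h.2⟩

lemma PairBound.neg_last {C q Θ x y l : ℝ} (h : PairBound C q Θ x y l) :
    PairBound C q Θ x y (-l) := by
  unfold PairBound at *
  rwa [abs_neg]

/-- The region where the first frequencies agree and all others are smaller. -/
def Paired (n₁ n₂ n₃ m₁ m₂ m₃ : ℤ) : Prop :=
  n₁ = m₁ ∧ 8 * |(n₂ : ℝ)| ≤ |(n₁ : ℝ)| ∧ 8 * |(n₃ : ℝ)| ≤ |(n₁ : ℝ)| ∧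
    8 * |(m₂ : ℝ)| ≤ |(n₁ : ℝ)| ∧ 8 * |(m₃ : ℝ)| ≤ |(n₁ : ℝ)|

lemma exists_config {n₁ n₂ n₃ m₁ m₂ m₃ : ℤ} (hsum : n₁ - n₂ + n₃ = m₁ - m₂ + m₃)
    (hk : n₃ ≠ n₂) (hjk : |n₃ - n₂| ≤ |n₁ - n₂|) (hk' : m₃ ≠ m₂) (hjk' : |m₃ - m₂| ≤ |m₁ - m₂|)
    (N : ℕ) {Θ : ℝ} (hΘ : 1 ≤ Θ) (hΘ' : |((m₁ : ℝ) + m₃) * (m₁ - m₂) * (m₃ - m₂) -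
      (n₁ + n₃) * (n₁ - n₂) * (n₃ - n₂)| ≤ Θ) :
    ∃ M R : ℝ, Config (n₁ : ℝ) n₂ n₃ m₁ m₂ m₃ M R |beta N n₁ n₂ n₃ * (m₁ + m₃)| Θ := by
  have hk1 : (1 : ℝ) ≤ |(n₃ : ℝ) - n₂| := by exact_mod_cast Int.one_le_abs (sub_ne_zero.mpr hk)
  have hk1' : (1 : ℝ) ≤ |(m₃ : ℝ) - m₂| := by exact_mod_cast Int.one_le_abs (sub_ne_zero.mpr hk')
  have hj : |(n₃ : ℝ) - n₂| ≤ |(n₁ : ℝ) - n₂| := by exact_mod_cast hjk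
  have hj' : |(m₃ : ℝ) - m₂| ≤ |(m₁ : ℝ) - m₂| := by exact_mod_cast hjk'
  have hs : (n₁ : ℝ) - n₂ + n₃ = m₁ - m₂ + m₃ := by exact_mod_cast hsum
  have max4 : ∀ a b c d : ℝ, ∃ M, |a| ≤ M ∧ |b| ≤ M ∧ |c| ≤ M ∧ |d| ≤ M ∧
      (M = |a| ∨ M = |b| ∨ M = |c| ∨ M = |d|) := by
    intro a b c d
    refine ⟨max (max |a| |b|) (max |c| |d|), by simp, by simp, by simp, by simp, ?_⟩
    rcases max_choice (max |a| |b|) (max |c| |d|) with h | h <;> rw [h]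
    · rcases max_choice |a| |b| with h | h <;> simp [h]
    · rcases max_choice |c| |d| with h | h <;> simp [h]
  obtain ⟨M, hM1, hM2, hM3, hM4, hM⟩ := max4 n₁ n₂ n₃ (n₁ - n₂ + n₃)
  obtain ⟨R, hR1, hR2, hR3, hR4, hR⟩ := max4 m₁ m₂ m₃ (n₁ - n₂ + n₃)
  refine ⟨M, R, ?_, hM1, hM2, hM3, hM4, hM, hR1, hR2, hR3, hR4, hR, hs, hk1, hj, hk1', hj',
    abs_nonneg _, ?_, hΘ, hΘ'⟩
  · have h1 : (n₃ ≠ 0 ∨ n₂ ≠ 0) := by omega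
    rcases h1 with h | h
    · exact le_trans (by exact_mod_cast Int.one_le_abs h) hM3
    · exact le_trans (by exact_mod_cast Int.one_le_abs h) hM2
  · have hp := abs_psi4_le (N := N) hM1 hM2 hM3 hM4
    have h1 : |(n₁ : ℝ) - n₂| ≠ 0 := by linarith
    have h2 : |(n₃ : ℝ) - n₂| ≠ 0 := by linarith
    calc |beta N n₁ n₂ n₃ * (m₁ + m₃)| * (|(n₁ : ℝ) - n₂| * |(n₃ : ℝ) - n₂|)
        = |psi4 N n₁ n₂ n₃| * |(m₁ : ℝ) + m₃| := by
          unfold beta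
          rw [abs_mul, abs_div, abs_mul]
          field_simp
      _ ≤ 4 * M * |(m₁ : ℝ) + m₃| := by gcongr

lemma cubes_signed {n₁ n₂ n₃ m₁ m₂ m₃ : ℤ} (hsum : n₁ - n₂ + n₃ = m₁ - m₂ + m₃) :
    cubes (signed n₁ n₂ n₃ m₁ m₂ m₃) =
      3 * ((m₁ + m₃) * (m₁ - m₂) * (m₃ - m₂) - (n₁ + n₃) * (n₁ - n₂) * (n₃ - n₂)) := by
  have : m₃ = n₁ - n₂ + n₃ - m₁ + m₂ := by linarith
  subst this
  simp only [cubes, signed, Fin.sum_univ_six]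
  change n₁ ^ 3 + (-n₂) ^ 3 + n₃ ^ 3 + (-m₁) ^ 3 + m₂ ^ 3 + (-(n₁ - n₂ + n₃ - m₁ + m₂)) ^ 3 = _
  ring

lemma resonance_le_modulation {n₁ n₂ n₃ m₁ m₂ m₃ : ℤ} (hsum : n₁ - n₂ + n₃ = m₁ - m₂ + m₃) :
    |((m₁ : ℝ) + m₃) * (m₁ - m₂) * (m₃ - m₂) - (n₁ + n₃) * (n₁ - n₂) * (n₃ - n₂)| ≤
      modulation (signed n₁ n₂ n₃ m₁ m₂ m₃) := by
  unfold modulation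
  rw [cubes_signed hsum]
  push_cast
  rw [abs_mul, abs_of_pos (by norm_num : (0 : ℝ) < 3)]
  linarith [abs_nonneg (((m₁ : ℝ) + m₃) * (m₁ - m₂) * (m₃ - m₂) - (n₁ + n₃) * (n₁ - n₂) * (n₃ - n₂))]

/-- The estimate for one of the two terms of the six-linear multiplier. -/
lemma one_sided {η : ℝ} (hη : 0 < η) {n₁ n₂ n₃ m₁ m₂ m₃ : ℤ}
    (hsum : n₁ - n₂ + n₃ = m₁ - m₂ + m₃)
    (hk : n₃ ≠ n₂) (hjk : |n₃ - n₂| ≤ |n₁ - n₂|) (hk' : m₃ ≠ m₂) (hjk' : |m₃ - m₂| ≤ |m₁ - m₂|)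
    (N : ℕ) (hP : ¬ Paired n₁ n₂ n₃ m₁ m₂ m₃) :
    |beta N n₁ n₂ n₃ * (m₁ + m₃)| * gain η (signed n₁ n₂ n₃ m₁ m₂ m₃) ≤
      6 * 10 ^ 7 * totalKernel η (signed n₁ n₂ n₃ m₁ m₂ m₃) := by
  obtain ⟨M, R, h⟩ := exists_config hsum hk hjk hk' hjk' N (one_le_modulation _)
    (resonance_le_modulation hsum)
  obtain ⟨z, hz⟩ : ∃ z, z = signed n₁ n₂ n₃ m₁ m₂ m₃ := ⟨_, rfl⟩
  rw [← hz] at h ⊢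
  have z0 : z 0 = n₁ := by rw [hz]; rfl
  have z1 : z 1 = -n₂ := by rw [hz]; rfl
  have z2 : z 2 = n₃ := by rw [hz]; rfl
  have z3 : z 3 = -m₁ := by rw [hz]; rfl
  have z4 : z 4 = m₂ := by rw [hz]; rfl
  have z5 : z 5 = -m₃ := by rw [hz]; rfl
  have hj : n₁ ≠ n₂ := by
    rintro rfl
    rw [sub_self, abs_zero] at hjk
    exact hk (by have := abs_nonpos_iff.mp hjk; omega)
  have hj' : m₁ ≠ m₂ := by
    rintro rfl
    rw [sub_self, abs_zero] at hjk'
    exact hk' (by have := abs_nonpos_iff.mp hjk'; omega)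
  have hq := h.q_nonneg
  have hΘ := h.one_le_Θ
  generalize |beta N n₁ n₂ n₃ * (m₁ + m₃)| = q at *
  have hK : (0 : ℝ) ≤ 10 ^ 7 := by norm_num
  have pair : ∀ s : Fin 6 → Fin 6, Function.Bijective s → z (s 0) + z (s 1) ≠ 0 →
      PairBound (10 ^ 40) q (modulation z) (z (s 0)) (z (s 1)) (z (s 2)) →
      q * gain η z ≤ 6 * 10 ^ 7 * totalKernel η z := fun s hs hne hb =>
    pair_gain hη s hs hq hK (hb.mono (by norm_num) (by linarith)) hne
  have phase : ∀ s : Fin 6 → Fin 6, Function.Bijective s →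
      PhaseBound (10 ^ 25) q (z (s 0)) (z (s 1)) (z (s 2)) (z (s 3)) (z (s 4)) (z (s 5)) →
      q * gain η z ≤ 6 * 10 ^ 7 * totalKernel η z := fun s hs hb =>
    phase_gain hη s hs hq hK (hb.mono (by norm_num))
  have product : q ^ 2 ≤ 10 ^ 12 * modulation z → q * gain η z ≤ 6 * 10 ^ 7 * totalKernel η z :=
    fun hb => product_gain hη hq hK (hb.trans (by gcongr; norm_num))
  rcases le_or_gt |(n₁ : ℝ) - n₂| (M / 8) with hjM | hjM
  · rcases le_or_gt |(m₁ : ℝ) - m₂| (R / 8) with hjR | hjR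
    · have h1 := h.comparable hjM hjR
      refine triple_gain hη hq hK ?_ ?_ ?_ ?_ ?_
      · rw [z0, z1]; omega
      · rw [z2, z1]; omega
      · rw [z3, z4]; omega
      · rw [z5, z4]; omega
      · have a1 : |((-m₁ + m₂ : ℤ) : ℝ)| = |(m₁ : ℝ) - m₂| := by
          push_cast; rw [← abs_neg]; congr 1; ring
        have a2 : |((-m₃ + m₂ : ℤ) : ℝ)| = |(m₃ : ℝ) - m₂| := by
          push_cast; rw [← abs_neg]; congr 1; ring
        rw [sizeProd_eq, z0, z1, z2, z3, z4, z5, a1, a2]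
        push_cast
        simp only [abs_neg, ← sub_eq_add_neg]
        exact h1.trans (by gcongr; norm_num)
    · rcases h.close_spread hjM hjR.le with h1 | ⟨⟨c1, c2, c3⟩, h1⟩
      · refine pair ![0, 1, 2, 3, 4, 5] (by decide) ?_ ?_
        · change z 0 + z 1 ≠ 0
          rw [z0, z1]; omega
        · change PairBound _ _ _ (z 0) (z 1) (z 2)
          rw [z0, z1, z2]
          push_cast
          exact h1.mono (by norm_num) (by linarith)
      · have main : ∀ a p r : ℝ, |p| ≤ |a| → |r| ≤ |a| →
            PhaseBound (10 ^ 25) q n₁ n₃ (-n₂) a p r ∨ PhaseBound (10 ^ 25) q (-n₂) n₃ n₁ a p r := by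
          intro a p r hp hr
          have b1 : q ^ 6 * ((1 + |p|) * (1 + |r|)) ≤ 10 ^ 25 *
              ((1 + |(n₁ : ℝ)|) * (1 + |(n₂ : ℝ)|) * (1 + |(n₃ : ℝ)|) * (1 + |a|)) ^ 2 := by
            calc q ^ 6 * ((1 + |p|) * (1 + |r|)) ≤ 10 ^ 15 * ((1 + |(n₁ : ℝ)|) * (1 + |(n₂ : ℝ)|)
                  * (1 + |(n₃ : ℝ)|)) ^ 2 * ((1 + |a|) * (1 + |a|)) := by gcongr
              _ = 10 ^ 15 * ((1 + |(n₁ : ℝ)|) * (1 + |(n₂ : ℝ)|) * (1 + |(n₃ : ℝ)|) * (1 + |a|)) ^ 2 := by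
                  ring
              _ ≤ _ := by gcongr <;> norm_num
          unfold PhaseBound
          simp only [abs_neg]
          by_cases ha : -(n₂ : ℝ) + a = 0
          · right
            refine ⟨b1.trans (le_of_eq (by ring)), by rwa [add_comm], ?_⟩
            rwa [show a = n₂ by linarith]
          · left
            exact ⟨b1.trans (le_of_eq (by ring)), c1, ha⟩
        have hmax : (|(m₂ : ℝ)| ≤ |(m₁ : ℝ)| ∧ |(m₃ : ℝ)| ≤ |(m₁ : ℝ)|) ∨
            (|(m₁ : ℝ)| ≤ |(m₂ : ℝ)| ∧ |(m₃ : ℝ)| ≤ |(m₂ : ℝ)|) ∨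
            (|(m₁ : ℝ)| ≤ |(m₃ : ℝ)| ∧ |(m₂ : ℝ)| ≤ |(m₃ : ℝ)|) := by
          rcases le_total |(m₁ : ℝ)| |(m₂ : ℝ)| with e1 | e1
          · rcases le_total |(m₂ : ℝ)| |(m₃ : ℝ)| with e2 | e2
            · exact .inr (.inr ⟨e1.trans e2, e2⟩)
            · exact .inr (.inl ⟨e1, e2⟩)
          · rcases le_total |(m₁ : ℝ)| |(m₃ : ℝ)| with e2 | e2
            · exact .inr (.inr ⟨e2, e1.trans e2⟩)
            · exact .inl ⟨e1, e2⟩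
        rcases hmax with ⟨u, v⟩ | ⟨u, v⟩ | ⟨u, v⟩
        · rcases main (-m₁) m₂ (-m₃) (by rwa [abs_neg]) (by rwa [abs_neg, abs_neg]) with b | b
          · refine phase ![0, 2, 1, 3, 4, 5] (by decide) ?_
            change PhaseBound _ _ (z 0) (z 2) (z 1) (z 3) (z 4) (z 5)
            rw [z0, z1, z2, z3, z4, z5]; push_cast; exact b
          · refine phase ![1, 2, 0, 3, 4, 5] (by decide) ?_
            change PhaseBound _ _ (z 1) (z 2) (z 0) (z 3) (z 4) (z 5)
            rw [z0, z1, z2, z3, z4, z5]; push_cast; exact b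
        · rcases main m₂ (-m₁) (-m₃) (by rwa [abs_neg]) (by rwa [abs_neg]) with b | b
          · refine phase ![0, 2, 1, 4, 3, 5] (by decide) ?_
            change PhaseBound _ _ (z 0) (z 2) (z 1) (z 4) (z 3) (z 5)
            rw [z0, z1, z2, z3, z4, z5]; push_cast; exact b
          · refine phase ![1, 2, 0, 4, 3, 5] (by decide) ?_
            change PhaseBound _ _ (z 1) (z 2) (z 0) (z 4) (z 3) (z 5)
            rw [z0, z1, z2, z3, z4, z5]; push_cast; exact b
        · rcases main (-m₃) (-m₁) m₂ (by rwa [abs_neg, abs_neg]) (by rwa [abs_neg]) with b | b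
          · refine phase ![0, 2, 1, 5, 3, 4] (by decide) ?_
            change PhaseBound _ _ (z 0) (z 2) (z 1) (z 5) (z 3) (z 4)
            rw [z0, z1, z2, z3, z4, z5]; push_cast; exact b
          · refine phase ![1, 2, 0, 5, 3, 4] (by decide) ?_
            change PhaseBound _ _ (z 1) (z 2) (z 0) (z 5) (z 3) (z 4)
            rw [z0, z1, z2, z3, z4, z5]; push_cast; exact b
  rcases le_or_gt (16 * M) R with hRM | hRM
  · have hne : z 4 + z 5 ≠ 0 := by rw [z4, z5]; omega
    rcases h.second_dominant hjM.le hRM with b | b | b | b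
    · exact product (b.trans (by gcongr <;> norm_num))
    · refine pair ![4, 5, 0, 1, 2, 3] (by decide) hne ?_
      change PairBound _ _ _ (z 4) (z 5) (z 0)
      rw [z4, z5, z0]; push_cast; exact b.mono (by norm_num) (by linarith)
    · refine pair ![4, 5, 1, 0, 2, 3] (by decide) hne ?_
      change PairBound _ _ _ (z 4) (z 5) (z 1)
      rw [z4, z5, z1]; push_cast; exact (b.mono (by norm_num) (by linarith)).neg_last
    · refine pair ![4, 5, 2, 0, 1, 3] (by decide) hne ?_
      change PairBound _ _ _ (z 4) (z 5) (z 2)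
      rw [z4, z5, z2]; push_cast; exact b.mono (by norm_num) (by linarith)
  by_cases hc : M / 64 ≤ |(n₃ : ℝ) - n₂| ∨ M / 32 ≤ |(n₂ : ℝ)|
  · have hne : z 1 + z 2 ≠ 0 := by rw [z1, z2]; omega
    rcases h.first_spread hjM.le hRM.le hc with b | b | b
    · exact product b
    · refine pair ![1, 2, 3, 0, 4, 5] (by decide) hne ?_
      change PairBound _ _ _ (z 1) (z 2) (z 3)
      rw [z1, z2, z3]; push_cast; exact b.neg_last
    · refine pair ![1, 2, 5, 0, 4, 3] (by decide) hne ?_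
      change PairBound _ _ _ (z 1) (z 2) (z 5)
      rw [z1, z2, z5]; push_cast; exact b.neg_last
  push Not at hc
  have hl := h.highLow hc.1 hc.2
  rcases le_or_gt (M / 64) |(m₃ : ℝ) - m₂| with hkM | hkM
  · exact product (hl.large_k' h hRM.le hkM)
  rcases le_or_gt (M / 16) |(m₂ : ℝ)| with hm₂ | hm₂
  · rcases hl.four_large h hRM.le hkM hm₂ with b | b | b
    · exact product b
    · refine phase ![0, 4, 3, 5, 1, 2] (by decide) ?_
      change PhaseBound _ _ (z 0) (z 4) (z 3) (z 5) (z 1) (z 2)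
      rw [z0, z1, z2, z3, z4, z5]; push_cast; exact b
    · refine phase ![0, 5, 3, 4, 1, 2] (by decide) ?_
      change PhaseBound _ _ (z 0) (z 5) (z 3) (z 4) (z 1) (z 2)
      rw [z0, z1, z2, z3, z4, z5]; push_cast; exact b
  by_cases hd : n₁ = m₁
  · exfalso
    apply hP
    have e1 := hl.n₁_ge
    have e2 := hl.n₂_le
    have e3 := hl.n₃_le
    have e4 := abs_sub_abs_le_abs_sub (m₃ : ℝ) m₂
    have := h.one_le
    exact ⟨hd, by linarith, by linarith, by linarith, by linarith⟩
  · have hd1 : (1 : ℝ) ≤ |(n₁ : ℝ) - m₁| := by exact_mod_cast Int.one_le_abs (sub_ne_zero.mpr hd)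
    have hne : z 0 + z 3 ≠ 0 := by rw [z0, z3]; omega
    rcases hl.two_large h hkM hm₂ hd1 with b | ⟨l, hl, b⟩
    · exact product b
    have b := b.mono (C' := 10 ^ 40) (by norm_num) (by linarith)
    rcases hl with rfl | rfl | rfl | rfl
    · refine pair ![0, 3, 1, 2, 4, 5] (by decide) hne ?_
      change PairBound _ _ _ (z 0) (z 3) (z 1)
      rw [z0, z3, z1]; push_cast; exact b.neg_last
    · refine pair ![0, 3, 2, 1, 4, 5] (by decide) hne ?_
      change PairBound _ _ _ (z 0) (z 3) (z 2)
      rw [z0, z3, z2]; push_cast; exact b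
    · refine pair ![0, 3, 4, 2, 1, 5] (by decide) hne ?_
      change PairBound _ _ _ (z 0) (z 3) (z 4)
      rw [z0, z3, z4]; push_cast; exact b
    · refine pair ![0, 3, 5, 2, 4, 1] (by decide) hne ?_
      change PairBound _ _ _ (z 0) (z 3) (z 5)
      rw [z0, z3, z5]; push_cast; exact b.neg_last

/-- The estimate of the six-linear multiplier in the paired region. -/
lemma paired_bound {n₁ n₂ n₃ m₁ m₂ m₃ : ℤ} (hsum : n₁ - n₂ + n₃ = m₁ - m₂ + m₃)
    (hk : n₃ ≠ n₂) (hj : n₁ ≠ n₂) (hj' : m₁ ≠ m₂) (N : ℕ) (hP : Paired n₁ n₂ n₃ m₁ m₂ m₃)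
    {l : ℝ} (h2 : |(n₂ : ℝ)| ≤ l) (h3 : |(n₃ : ℝ)| ≤ l) (h2' : |(m₂ : ℝ)| ≤ l)
    (h3' : |(m₃ : ℝ)| ≤ l) (hl : 8 * l ≤ |(n₁ : ℝ)|) (hne : n₁ ≠ 0) :
    |six N n₁ n₂ n₃ m₁ m₂ m₃| * |(n₃ : ℝ) - n₂| ≤ 14 * l := by
  obtain ⟨rfl, -⟩ := hP
  have hl0 : 0 ≤ l := (abs_nonneg _).trans h2
  have hn : 0 < |(n₁ : ℝ)| := abs_pos.mpr (by exact_mod_cast hne)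
  have hk0 : (n₃ : ℝ) - n₂ ≠ 0 := sub_ne_zero.mpr (by exact_mod_cast hk)
  have hj0 : (n₁ : ℝ) - n₂ ≠ 0 := sub_ne_zero.mpr (by exact_mod_cast hj)
  have hj0' : (n₁ : ℝ) - m₂ ≠ 0 := sub_ne_zero.mpr (by exact_mod_cast hj')
  have hkk : (m₃ : ℝ) - m₂ = n₃ - n₂ := by
    have : m₃ - m₂ = n₃ - n₂ := by omega
    exact_mod_cast this
  have hjl : 7 / 8 * |(n₁ : ℝ)| ≤ |(n₁ : ℝ) - n₂| := by
    linarith [abs_sub_abs_le_abs_sub (n₁ : ℝ) n₂]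
  have hjl' : 7 / 8 * |(n₁ : ℝ)| ≤ |(n₁ : ℝ) - m₂| := by
    linarith [abs_sub_abs_le_abs_sub (n₁ : ℝ) m₂]
  have hS : |(n₁ : ℝ) + n₃| ≤ 9 / 8 * |(n₁ : ℝ)| := by linarith [abs_add_le (n₁ : ℝ) n₃]
  have hS' : |(n₁ : ℝ) + m₃| ≤ 9 / 8 * |(n₁ : ℝ)| := by linarith [abs_add_le (n₁ : ℝ) m₃]
  have hkl : |(n₃ : ℝ) - n₂| ≤ 2 * l := (abs_sub _ _).trans (by linarith)
  have hn4 : ((n₁ - n₂ + n₃ : ℤ) : ℝ) - n₁ = n₃ - n₂ := by push_cast; ring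
  rcases le_or_gt l N with hlN | hlN
  · have ep : psi4 N n₁ m₂ m₃ = psi4 N n₁ n₂ n₃ := by
      unfold psi4
      rw [psi_of_le (h2.trans hlN), psi_of_le (h3.trans hlN), psi_of_le (h2'.trans hlN),
        psi_of_le (h3'.trans hlN), hsum]
    have hp : |psi4 N n₁ n₂ n₃| ≤ 3 * |(n₁ : ℝ)| := by
      unfold psi4
      rw [psi_of_le (h2.trans hlN), psi_of_le (h3.trans hlN), zero_add, sub_zero]
      have e1 := abs_psi_le N (n₁ - n₂ + n₃)
      have e2 := abs_psi_le N n₁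
      have e3 := abs_sub (psi N (n₁ - n₂ + n₃)) (psi N n₁)
      have e4 := abs_add_le (n₁ : ℝ) (((n₁ - n₂ + n₃ : ℤ) : ℝ) - n₁)
      rw [add_sub_cancel, hn4] at e4
      linarith
    have e : six N n₁ n₂ n₃ n₁ m₂ m₃ * ((n₃ : ℝ) - n₂) = psi4 N n₁ n₂ n₃ *
        (n₂ * n₃ - m₂ * m₃) / ((n₁ - n₂) * (n₁ - m₂)) := by
      unfold six beta
      rw [ep, hkk]
      have : (m₃ : ℝ) = n₃ - n₂ + m₂ := by linarith
      rw [this]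
      field_simp
      ring
    rw [← abs_mul, e, abs_div, abs_mul, abs_mul, div_le_iff₀ (by positivity)]
    have h5 : |(n₂ : ℝ) * n₃ - m₂ * m₃| ≤ 2 * (l * l) := by
      refine (abs_sub _ _).trans ?_
      rw [abs_mul, abs_mul]
      have : |(n₂ : ℝ)| * |(n₃ : ℝ)| ≤ l * l := by gcongr
      have : |(m₂ : ℝ)| * |(m₃ : ℝ)| ≤ l * l := by gcongr
      linarith
    calc |psi4 N n₁ n₂ n₃| * |(n₂ : ℝ) * n₃ - m₂ * m₃| ≤ 3 * |(n₁ : ℝ)| * (2 * (l * (|(n₁ : ℝ)| / 8))) := by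
          refine mul_le_mul hp (h5.trans ?_) (abs_nonneg _) (by positivity)
          gcongr
          linarith
      _ = 3 / 4 * (l * (|(n₁ : ℝ)| * |(n₁ : ℝ)|)) := by ring
      _ ≤ 14 * (49 / 64) * (l * (|(n₁ : ℝ)| * |(n₁ : ℝ)|)) := by gcongr; norm_num
      _ = 14 * l * (7 / 8 * |(n₁ : ℝ)| * (7 / 8 * |(n₁ : ℝ)|)) := by ring
      _ ≤ _ := by gcongr
  · have hdiff := abs_psi_sub_le N (n₁ - n₂ + n₃) n₁
    rw [hn4] at hdiff
    have hp : |psi4 N n₁ n₂ n₃| ≤ 5 * l := by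
      have e1 := (abs_psi_le N n₂).trans h2
      have e2 := (abs_psi_le N n₃).trans h3
      have e3 : |psi N (n₁ - n₂ + n₃) - psi N n₁| ≤ 3 * l := by linarith
      unfold psi4
      rw [abs_le] at *
      constructor <;> linarith [e1.1, e1.2, e2.1, e2.2, e3.1, e3.2]
    have hp' : |psi4 N n₁ m₂ m₃| ≤ 5 * l := by
      have e1 := (abs_psi_le N m₂).trans h2'
      have e2 := (abs_psi_le N m₃).trans h3'
      have e3 : |psi N (n₁ - n₂ + n₃) - psi N n₁| ≤ 3 * l := by linarith
      unfold psi4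
      rw [← hsum]
      rw [abs_le] at *
      constructor <;> linarith [e1.1, e1.2, e2.1, e2.2, e3.1, e3.2]
    have bound : ∀ p S j : ℝ, |p| ≤ 5 * l → |S| ≤ 9 / 8 * |(n₁ : ℝ)| → 7 / 8 * |(n₁ : ℝ)| ≤ |j| →
        |p / (j * ((n₃ : ℝ) - n₂)) * S| * |(n₃ : ℝ) - n₂| ≤ 7 * l := by
      intro p S j h1 h2 h3
      have hj1 : 0 < |j| := by linarith
      have hk1 : 0 < |(n₃ : ℝ) - n₂| := abs_pos.mpr hk0
      rw [abs_mul, abs_div, abs_mul]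
      have : |p| / (|j| * |(n₃ : ℝ) - n₂|) * |S| * |(n₃ : ℝ) - n₂| = |p| * |S| / |j| := by
        field_simp
      rw [this, div_le_iff₀ hj1]
      calc |p| * |S| ≤ 5 * l * (9 / 8 * |(n₁ : ℝ)|) := by gcongr
        _ = 45 / 8 * (l * |(n₁ : ℝ)|) := by ring
        _ ≤ 49 / 8 * (l * |(n₁ : ℝ)|) := by gcongr; norm_num
        _ = 7 * l * (7 / 8 * |(n₁ : ℝ)|) := by ring
        _ ≤ _ := by gcongr
    have b1 := bound _ _ _ hp hS' hjl
    have b2 := bound _ _ _ hp' hS hjl'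
    unfold six beta
    rw [hkk]
    calc _ ≤ (|psi4 N n₁ n₂ n₃ / ((n₁ - n₂) * ((n₃ : ℝ) - n₂)) * (n₁ + m₃)| +
          |psi4 N n₁ m₂ m₃ / ((n₁ - m₂) * ((n₃ : ℝ) - n₂)) * (n₁ + n₃)|) * |(n₃ : ℝ) - n₂| := by
          gcongr; exact abs_sub _ _
      _ ≤ 14 * l := by rw [add_mul]; linarith

lemma gain_neg (η : ℝ) (z : Fin 6 → ℤ) : gain η (-z) = gain η z := by
  have : cubes (-z) = -cubes z := by
    unfold cubes
    rw [← Finset.sum_neg_distrib]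
    exact Finset.sum_congr rfl fun k _ => by simp only [Pi.neg_apply]; ring
  unfold gain modulation sizeProd
  rw [this]
  simp

lemma signed_exchange (n₁ n₂ n₃ m₁ m₂ m₃ : ℤ) : signed m₁ m₂ m₃ n₁ n₂ n₃ =
    -(signed n₁ n₂ n₃ m₁ m₂ m₃ ∘ ![3, 4, 5, 0, 1, 2]) := by
  funext k
  fin_cases k <;> simp [signed]

lemma gain_exchange (η : ℝ) (n₁ n₂ n₃ m₁ m₂ m₃ : ℤ) : gain η (signed m₁ m₂ m₃ n₁ n₂ n₃) =
    gain η (signed n₁ n₂ n₃ m₁ m₂ m₃) := by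
  rw [signed_exchange, gain_neg, gain_perm _ _ _ (by decide)]

lemma totalKernel_exchange (η : ℝ) (n₁ n₂ n₃ m₁ m₂ m₃ : ℤ) :
    totalKernel η (signed m₁ m₂ m₃ n₁ n₂ n₃) = totalKernel η (signed n₁ n₂ n₃ m₁ m₂ m₃) := by
  rw [signed_exchange, totalKernel_neg, totalKernel_perm _ _ _ (by decide)]

lemma Paired.exchange {n₁ n₂ n₃ m₁ m₂ m₃ : ℤ} (h : Paired m₁ m₂ m₃ n₁ n₂ n₃) :
    Paired n₁ n₂ n₃ m₁ m₂ m₃ := by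
  obtain ⟨rfl, h1, h2, h3, h4⟩ := h
  exact ⟨rfl, h3, h4, h1, h2⟩

lemma gain_nonneg (η : ℝ) (z : Fin 6 → ℤ) : 0 ≤ gain η z := by
  unfold gain
  have := one_le_modulation z
  have := one_le_sizeProd z
  positivity

lemma six_bound_ordered {η : ℝ} (hη : 0 < η) {n₁ n₂ n₃ m₁ m₂ m₃ : ℤ}
    (hsum : n₁ - n₂ + n₃ = m₁ - m₂ + m₃)
    (hk : n₃ ≠ n₂) (hjk : |n₃ - n₂| ≤ |n₁ - n₂|) (hk' : m₃ ≠ m₂) (hjk' : |m₃ - m₂| ≤ |m₁ - m₂|)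
    (N : ℕ) : |six N n₁ n₂ n₃ m₁ m₂ m₃| * gain η (signed n₁ n₂ n₃ m₁ m₂ m₃) ≤
      12 * 10 ^ 7 * totalKernel η (signed n₁ n₂ n₃ m₁ m₂ m₃) := by
  have hT := totalKernel_nonneg η (signed n₁ n₂ n₃ m₁ m₂ m₃)
  by_cases hP : Paired n₁ n₂ n₃ m₁ m₂ m₃
  · have hj : n₁ ≠ n₂ := by
      rintro rfl
      rw [sub_self, abs_zero] at hjk
      exact hk (by have := abs_nonpos_iff.mp hjk; omega)
    have hj' : m₁ ≠ m₂ := by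
      rintro rfl
      rw [sub_self, abs_zero] at hjk'
      exact hk' (by have := abs_nonpos_iff.mp hjk'; omega)
    obtain ⟨l, hl, h2, h3, h2', h3'⟩ : ∃ l : ℝ, 8 * l = |(n₁ : ℝ)| ∧ |(n₂ : ℝ)| ≤ l ∧
        |(n₃ : ℝ)| ≤ l ∧ |(m₂ : ℝ)| ≤ l ∧ |(m₃ : ℝ)| ≤ l := by
      obtain ⟨-, a, b, c, d⟩ := hP
      exact ⟨|(n₁ : ℝ)| / 8, by ring, by linarith, by linarith, by linarith, by linarith⟩
    obtain ⟨l, hl, h2, h3, h2', h3', hmax⟩ : ∃ l : ℝ, 8 * l ≤ |(n₁ : ℝ)| ∧ |(n₂ : ℝ)| ≤ l ∧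
        |(n₃ : ℝ)| ≤ l ∧ |(m₂ : ℝ)| ≤ l ∧ |(m₃ : ℝ)| ≤ l ∧
        1 + l ≤ (1 + |(n₂ : ℝ)|) * (1 + |(n₃ : ℝ)|) * (1 + |(m₂ : ℝ)|) * (1 + |(m₃ : ℝ)|) := by
      refine ⟨max (max |(n₂ : ℝ)| |(n₃ : ℝ)|) (max |(m₂ : ℝ)| |(m₃ : ℝ)|), ?_, by simp, by simp,
        by simp, by simp, ?_⟩
      · have : max (max |(n₂ : ℝ)| |(n₃ : ℝ)|) (max |(m₂ : ℝ)| |(m₃ : ℝ)|) ≤ l := by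
          simp [h2, h3, h2', h3']
        linarith
      · have g2 := one_le_size n₂
        have g3 := one_le_size n₃
        have g2' := one_le_size m₂
        have g3' := one_le_size m₃
        generalize |(n₂ : ℝ)| = a at *
        generalize |(n₃ : ℝ)| = b at *
        generalize |(m₂ : ℝ)| = c at *
        generalize |(m₃ : ℝ)| = d at *
        have key : ∀ x y : ℝ, 1 ≤ x → 1 ≤ y → x ≤ x * y ∧ y ≤ x * y := fun x y hx hy =>
          ⟨le_mul_of_one_le_right (by linarith) hy, le_mul_of_one_le_left (by linarith) hx⟩
        have k1 := key _ _ g2 g3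
        have k2 := key _ _ (g2.trans k1.1) g2'
        have k3 := key _ _ ((g2.trans k1.1).trans k2.1) g3'
        rw [← sub_nonneg, show ∀ P m : ℝ, P - (1 + m) = (P - 1) - m from fun _ _ => by ring, sub_nonneg]
        refine max_le (max_le ?_ ?_) (max_le ?_ ?_) <;> linarith [k1.1, k1.2, k2.1, k2.2, k3.1, k3.2]
    have hne : n₁ ≠ 0 := by
      rintro rfl
      rw [Int.cast_zero, abs_zero] at hl
      have a2 : |(n₂ : ℝ)| = 0 := le_antisymm (by linarith) (abs_nonneg _)
      have a3 : n₂ = 0 := by exact_mod_cast abs_eq_zero.mp a2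
      exact hj a3.symm
    have hb := paired_bound hsum hk hj hj' N hP h2 h3 h2' h3' hl hne
    have hl0 : 0 ≤ l := (abs_nonneg _).trans h2
    have hs := hP.1
    refine (diag_gain (K := 14) (L := 1 + l) hη ![0, 3, 2, 1, 4, 5] (by decide) (by norm_num)
      (by linarith) ?_ ?_ ?_ ?_).trans (by linarith)
    · rw [sizeProd_eq]
      change _ ≤ (1 + |(n₁ : ℝ)|) * (1 + |((-n₂ : ℤ) : ℝ)|) * (1 + |(n₃ : ℝ)|) * (1 + |((-m₁ : ℤ) : ℝ)|) *
        (1 + |(m₂ : ℝ)|) * (1 + |((-m₃ : ℤ) : ℝ)|)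
      push_cast
      simp only [abs_neg]
      rw [← hs]
      calc (1 + l) ^ 3 = (1 + l) * (1 + l) * (1 + l) := by ring
        _ ≤ (1 + |(n₁ : ℝ)|) * (1 + |(n₁ : ℝ)|) * ((1 + |(n₂ : ℝ)|) * (1 + |(n₃ : ℝ)|) *
          (1 + |(m₂ : ℝ)|) * (1 + |(m₃ : ℝ)|)) := by gcongr <;> linarith
        _ = _ := by ring
    · change n₁ + -m₁ = 0
      omega
    · change n₃ + -n₂ ≠ 0
      omega
    · change _ * |((n₃ + -n₂ : ℤ) : ℝ)| ≤ _
      push_cast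
      rw [← sub_eq_add_neg]
      linarith
  · have h1 := one_sided hη hsum hk hjk hk' hjk' N hP
    have h2 := one_sided hη hsum.symm hk' hjk' hk hjk N (fun h => hP h.exchange)
    rw [gain_exchange, totalKernel_exchange] at h2
    have h3 : |six N n₁ n₂ n₃ m₁ m₂ m₃| ≤ |beta N n₁ n₂ n₃ * (m₁ + m₃)| +
        |beta N m₁ m₂ m₃ * (n₁ + n₃)| := abs_sub _ _
    have h4 := mul_le_mul_of_nonneg_right h3 (gain_nonneg η (signed n₁ n₂ n₃ m₁ m₂ m₃))
    linarith

lemma six_swap_left (N : ℕ) (n₁ n₂ n₃ m₁ m₂ m₃ : ℤ) :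
    six N n₃ n₂ n₁ m₁ m₂ m₃ = six N n₁ n₂ n₃ m₁ m₂ m₃ := by
  unfold six
  rw [beta_swap, add_comm (n₃ : ℝ)]

lemma six_swap_right (N : ℕ) (n₁ n₂ n₃ m₁ m₂ m₃ : ℤ) :
    six N n₁ n₂ n₃ m₃ m₂ m₁ = six N n₁ n₂ n₃ m₁ m₂ m₃ := by
  unfold six
  rw [beta_swap N m₁, add_comm (m₃ : ℝ)]

lemma signed_swap_left (n₁ n₂ n₃ m₁ m₂ m₃ : ℤ) : signed n₃ n₂ n₁ m₁ m₂ m₃ =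
    signed n₁ n₂ n₃ m₁ m₂ m₃ ∘ ![2, 1, 0, 3, 4, 5] := by
  funext k
  fin_cases k <;> simp [signed]

lemma signed_swap_right (n₁ n₂ n₃ m₁ m₂ m₃ : ℤ) : signed n₁ n₂ n₃ m₃ m₂ m₁ =
    signed n₁ n₂ n₃ m₁ m₂ m₃ ∘ ![0, 1, 2, 5, 4, 3] := by
  funext k
  fin_cases k <;> simp [signed]

/-- The pointwise estimate of the six-linear multiplier. -/
lemma six_bound {η : ℝ} (hη : 0 < η) {n₁ n₂ n₃ m₁ m₂ m₃ : ℤ}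
    (hsum : n₁ - n₂ + n₃ = m₁ - m₂ + m₃) (hj : n₁ ≠ n₂) (hk : n₃ ≠ n₂) (hj' : m₁ ≠ m₂)
    (hk' : m₃ ≠ m₂) (N : ℕ) :
    |six N n₁ n₂ n₃ m₁ m₂ m₃| * gain η (signed n₁ n₂ n₃ m₁ m₂ m₃) ≤
      12 * 10 ^ 7 * totalKernel η (signed n₁ n₂ n₃ m₁ m₂ m₃) := by
  have left : ∀ {n₁ n₃ m₁ m₃ : ℤ}, n₁ - n₂ + n₃ = m₁ - m₂ + m₃ → n₁ ≠ n₂ → n₃ ≠ n₂ →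
      |m₃ - m₂| ≤ |m₁ - m₂| → m₃ ≠ m₂ →
      |six N n₁ n₂ n₃ m₁ m₂ m₃| * gain η (signed n₁ n₂ n₃ m₁ m₂ m₃) ≤
      12 * 10 ^ 7 * totalKernel η (signed n₁ n₂ n₃ m₁ m₂ m₃) := by
    intro n₁ n₃ m₁ m₃ hsum hj hk hjk' hk'
    rcases le_total |n₃ - n₂| |n₁ - n₂| with h | h
    · exact six_bound_ordered hη hsum hk h hk' hjk' N
    · have := six_bound_ordered hη (by linarith : n₃ - n₂ + n₁ = m₁ - m₂ + m₃) hj h hk' hjk' N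
      rwa [six_swap_left, signed_swap_left, gain_perm _ _ _ (by decide),
        totalKernel_perm _ _ _ (by decide)] at this
  rcases le_total |m₃ - m₂| |m₁ - m₂| with h | h
  · exact left hsum hj hk h hk'
  · have := left (by linarith : n₁ - n₂ + n₃ = m₃ - m₂ + m₁) hj hk h hj'
    rwa [six_swap_right, signed_swap_right, gain_perm _ _ _ (by decide),
      totalKernel_perm _ _ _ (by decide)] at this

/-- If the six-linear multiplier does not vanish then some frequency is large. -/
lemma six_eq_zero {N : ℕ} {n₁ n₂ n₃ m₁ m₂ m₃ : ℤ}
    (h : 3 * sizeProd (signed n₁ n₂ n₃ m₁ m₂ m₃) < N) : six N n₁ n₂ n₃ m₁ m₂ m₃ = 0 := by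
  have hs := fun k => size_le_sizeProd (signed n₁ n₂ n₃ m₁ m₂ m₃) k
  have h0 := hs 0
  have h1 := hs 1
  have h2 := hs 2
  have h3 := hs 3
  have h4 := hs 4
  have h5 := hs 5
  change 1 + |(n₁ : ℝ)| ≤ _ at h0
  change 1 + |((-n₂ : ℤ) : ℝ)| ≤ _ at h1
  change 1 + |(n₃ : ℝ)| ≤ _ at h2
  change 1 + |((-m₁ : ℤ) : ℝ)| ≤ _ at h3
  change 1 + |(m₂ : ℝ)| ≤ _ at h4
  change 1 + |((-m₃ : ℤ) : ℝ)| ≤ _ at h5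
  push_cast at h1 h3 h5
  rw [abs_neg] at h1 h3 h5
  unfold six beta
  rw [psi4_eq_zero (N := N) (n₁ := n₁) (by linarith) (by linarith) (by linarith),
    psi4_eq_zero (N := N) (n₁ := m₁) (by linarith) (by linarith) (by linarith)]
  simp

/-- The sum of the outer frequencies of a nonresonant triple. -/
noncomputable def freqSum (n₁ n₂ n₃ : ℤ) : ℝ := if n₁ ≠ n₂ ∧ n₃ ≠ n₂ then (n₁ : ℝ) + n₃ else 0

/-- The six-linear multiplier, restricted to nonresonant triples. -/
noncomputable def sixNR (N : ℕ) (n₁ n₂ n₃ m₁ m₂ m₃ : ℤ) : ℝ :=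
  beta N n₁ n₂ n₃ * freqSum m₁ m₂ m₃ - beta N m₁ m₂ m₃ * freqSum n₁ n₂ n₃

lemma beta_eq_zero {N : ℕ} {n₁ n₂ n₃ : ℤ} (h : ¬ (n₁ ≠ n₂ ∧ n₃ ≠ n₂)) : beta N n₁ n₂ n₃ = 0 := by
  have : ((n₁ : ℝ) - n₂) * (n₃ - n₂) = 0 := by
    rw [not_and_or, not_not, not_not] at h
    rcases h with rfl | rfl <;> simp
  rw [beta, this, div_zero]

lemma sixNR_eq (N : ℕ) (n₁ n₂ n₃ m₁ m₂ m₃ : ℤ) : sixNR N n₁ n₂ n₃ m₁ m₂ m₃ =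
    if (n₁ ≠ n₂ ∧ n₃ ≠ n₂) ∧ (m₁ ≠ m₂ ∧ m₃ ≠ m₂) then six N n₁ n₂ n₃ m₁ m₂ m₃ else 0 := by
  unfold sixNR freqSum six
  by_cases h1 : n₁ ≠ n₂ ∧ n₃ ≠ n₂
  · by_cases h2 : m₁ ≠ m₂ ∧ m₃ ≠ m₂
    · rw [if_pos h1, if_pos h2, if_pos ⟨h1, h2⟩]
    · rw [if_neg h2, if_neg (fun h : (n₁ ≠ n₂ ∧ n₃ ≠ n₂) ∧ (m₁ ≠ m₂ ∧ m₃ ≠ m₂) => h2 h.2),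
        beta_eq_zero h2]
      ring
  · rw [if_neg h1, if_neg (fun h : (n₁ ≠ n₂ ∧ n₃ ≠ n₂) ∧ (m₁ ≠ m₂ ∧ m₃ ≠ m₂) => h1 h.1),
      beta_eq_zero h1]
    ring

/-- The weight in the sequence spaces of the multilinear estimates. -/
noncomputable def weight (η : ℝ) (n : ℤ) : ℝ := (1 + |(n : ℝ)|) ^ (1 / 3 + 4 * η)

lemma weight_pos (η : ℝ) (n : ℤ) : 0 < weight η n := by unfold weight; positivity

lemma sixNR_gain_le {η : ℝ} (hη : 0 < η) (hη1 : η ≤ 1) {N : ℕ} (hN : 1 ≤ N) {n₁ n₂ n₃ m₁ m₂ m₃ : ℤ}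
    (hsum : n₁ - n₂ + n₃ = m₁ - m₂ + m₃) :
    |sixNR N n₁ n₂ n₃ m₁ m₂ m₃| * modulation (signed n₁ n₂ n₃ m₁ m₂ m₃) ^ (-(1 / 2 : ℝ)) ≤
      (12 * 10 ^ 7 * 9) * (N : ℝ) ^ (-(2 * η)) * (totalKernel η (signed n₁ n₂ n₃ m₁ m₂ m₃) *
        ∏ k, weight η (signed n₁ n₂ n₃ m₁ m₂ m₃ k)) := by
  have hT := totalKernel_nonneg η (signed n₁ n₂ n₃ m₁ m₂ m₃)
  have hw : 0 ≤ ∏ k, weight η (signed n₁ n₂ n₃ m₁ m₂ m₃ k) :=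
    Finset.prod_nonneg fun k _ => (weight_pos η _).le
  have hN0 : (0 : ℝ) < N := by exact_mod_cast hN
  rw [sixNR_eq]
  by_cases h : (n₁ ≠ n₂ ∧ n₃ ≠ n₂) ∧ (m₁ ≠ m₂ ∧ m₃ ≠ m₂)
  swap
  · rw [if_neg h, abs_zero, zero_mul]; positivity
  rw [if_pos h]
  by_cases hs : 3 * sizeProd (signed n₁ n₂ n₃ m₁ m₂ m₃) < N
  · rw [six_eq_zero hs, abs_zero, zero_mul]; positivity
  have h6 := six_bound hη hsum h.1.1 h.1.2 h.2.1 h.2.2 N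
  have hwe : ∏ k, weight η (signed n₁ n₂ n₃ m₁ m₂ m₃ k) =
      sizeProd (signed n₁ n₂ n₃ m₁ m₂ m₃) ^ (1 / 3 + 4 * η) := by
    unfold weight sizeProd
    rw [Real.finsetProd_rpow _ _ (fun k _ => by positivity)]
  rw [hwe]
  have hP1 := one_le_sizeProd (signed n₁ n₂ n₃ m₁ m₂ m₃)
  have hM1 := one_le_modulation (signed n₁ n₂ n₃ m₁ m₂ m₃)
  unfold gain at h6
  generalize signed n₁ n₂ n₃ m₁ m₂ m₃ = z at *
  generalize |six N n₁ n₂ n₃ m₁ m₂ m₃| = q at *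
  have hP0 : 0 < sizeProd z := by linarith
  have e1 : sizeProd z ^ (-(2 * η)) ≤ 9 * (N : ℝ) ^ (-(2 * η)) := by
    calc sizeProd z ^ (-(2 * η)) ≤ ((N : ℝ) / 3) ^ (-(2 * η)) :=
          Real.rpow_le_rpow_of_nonpos (by positivity) (by linarith) (by linarith)
      _ = 3 ^ (2 * η) * (N : ℝ) ^ (-(2 * η)) := by
          rw [Real.div_rpow hN0.le (by norm_num), Real.rpow_neg (by norm_num : (0 : ℝ) ≤ 3),
            div_inv_eq_mul, mul_comm]
      _ ≤ 3 ^ (2 : ℝ) * (N : ℝ) ^ (-(2 * η)) := by gcongr <;> linarith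
      _ = _ := by norm_num
  have e2 : sizeProd z ^ (-(1 / 3 + 2 * η)) * sizeProd z ^ (-(2 * η)) *
      sizeProd z ^ (1 / 3 + 4 * η) = 1 := by
    rw [← Real.rpow_add hP0, ← Real.rpow_add hP0,
      show -(1 / 3 + 2 * η) + -(2 * η) + (1 / 3 + 4 * η) = 0 by ring, Real.rpow_zero]
  calc q * modulation z ^ (-(1 / 2 : ℝ))
      = (q * (modulation z ^ (-(1 / 2 : ℝ)) * sizeProd z ^ (-(1 / 3 + 2 * η)))) *
        (sizeProd z ^ (-(2 * η)) * sizeProd z ^ (1 / 3 + 4 * η)) := by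
        rw [show (q * (modulation z ^ (-(1 / 2 : ℝ)) * sizeProd z ^ (-(1 / 3 + 2 * η)))) *
          (sizeProd z ^ (-(2 * η)) * sizeProd z ^ (1 / 3 + 4 * η)) =
          q * modulation z ^ (-(1 / 2 : ℝ)) * (sizeProd z ^ (-(1 / 3 + 2 * η)) *
          sizeProd z ^ (-(2 * η)) * sizeProd z ^ (1 / 3 + 4 * η)) by ring, e2, mul_one]
    _ ≤ (12 * 10 ^ 7 * totalKernel η z) *
        (9 * (N : ℝ) ^ (-(2 * η)) * sizeProd z ^ (1 / 3 + 4 * η)) := by gcongr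
    _ = _ := by ring

/-- The constant of the six-linear estimate. -/
noncomputable def sixConst (η : ℝ) : ℝ≥0∞ := (12 * 10 ^ 7 * 9) * (31680 * decaySum η ^ 2)

lemma sixConst_ne_top {η : ℝ} (hη : 0 < η) : sixConst η ≠ ⊤ := by
  have := decaySum_ne_top hη
  unfold sixConst
  finiteness

/-- The product of the six amplitudes of two triples. -/
def prodSix (a : ℤ → ℝ) (n₁ n₂ n₃ m₁ m₂ m₃ : ℤ) : ℝ :=
  (a n₁ * a n₂ * a n₃) * (a m₁ * a m₂ * a m₃)

/-- The six-linear estimate. -/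
lemma tsum_six {η : ℝ} (hη : 0 < η) (hη1 : η ≤ 1) {N : ℕ} (hN : 1 ≤ N) {a : ℤ → ℝ}
    (ha : ∀ n, 0 ≤ a n) {B : ℝ≥0∞}
    (hB : ∑' n, ENNReal.ofReal ((weight η n * a n) ^ 2) ≤ B) :
    ∑' x : ℤ × (ℤ × ℤ) × (ℤ × ℤ), ENNReal.ofReal
      (|sixNR N x.2.1.1 x.2.1.2 (x.1 - x.2.1.1 + x.2.1.2) x.2.2.1 x.2.2.2 (x.1 - x.2.2.1 + x.2.2.2)| *
      modulation (signed x.2.1.1 x.2.1.2 (x.1 - x.2.1.1 + x.2.1.2) x.2.2.1 x.2.2.2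
        (x.1 - x.2.2.1 + x.2.2.2)) ^ (-(1 / 2 : ℝ)) *
      prodSix a x.2.1.1 x.2.1.2 (x.1 - x.2.1.1 + x.2.1.2) x.2.2.1 x.2.2.2
        (x.1 - x.2.2.1 + x.2.2.2)) ≤
      ENNReal.ofReal ((N : ℝ) ^ (-(2 * η))) * (sixConst η * B ^ 3) := by
  let Z : ℤ × (ℤ × ℤ) × (ℤ × ℤ) → Fin 6 → ℤ := fun x => signed x.2.1.1 x.2.1.2
    (x.1 - x.2.1.1 + x.2.1.2) x.2.2.1 x.2.2.2 (x.1 - x.2.2.1 + x.2.2.2)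
  let f : Fin 6 → ℤ → ℝ := ![fun n => weight η n * a n, fun n => weight η n * a (-n),
    fun n => weight η n * a n, fun n => weight η n * a (-n), fun n => weight η n * a n,
    fun n => weight η n * a (-n)]
  have hBneg : ∑' n, ENNReal.ofReal ((weight η n * a (-n)) ^ 2) ≤ B := by
    refine le_trans (le_of_eq ?_) hB
    rw [← (Equiv.neg ℤ).tsum_eq]
    simp [weight]
  have h := tsum_totalKernel (Z := Z) (f := f) (η := η) (B := B) ?_ ?_ ?_ ?_ hη hη1
  · have hpt : ∀ x : ℤ × (ℤ × ℤ) × (ℤ × ℤ), ENNReal.ofReal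
        (|sixNR N x.2.1.1 x.2.1.2 (x.1 - x.2.1.1 + x.2.1.2) x.2.2.1 x.2.2.2
          (x.1 - x.2.2.1 + x.2.2.2)| * modulation (Z x) ^ (-(1 / 2 : ℝ)) *
        prodSix a x.2.1.1 x.2.1.2 (x.1 - x.2.1.1 + x.2.1.2) x.2.2.1 x.2.2.2
          (x.1 - x.2.2.1 + x.2.2.2)) ≤
        ENNReal.ofReal ((12 * 10 ^ 7 * 9) * (N : ℝ) ^ (-(2 * η))) *
          ENNReal.ofReal (totalKernel η (Z x) * ∏ k, f k (Z x k)) := by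
      intro x
      rw [← ENNReal.ofReal_mul (by positivity)]
      apply ENNReal.ofReal_le_ofReal
      have h1 := sixNR_gain_le hη hη1 hN (n₁ := x.2.1.1) (n₂ := x.2.1.2)
        (n₃ := x.1 - x.2.1.1 + x.2.1.2) (m₁ := x.2.2.1) (m₂ := x.2.2.2)
        (m₃ := x.1 - x.2.2.1 + x.2.2.2) (by ring)
      have hp : ∏ k, f k (Z x k) = (∏ k, weight η (Z x k)) *
          prodSix a x.2.1.1 x.2.1.2 (x.1 - x.2.1.1 + x.2.1.2) x.2.2.1 x.2.2.2
          (x.1 - x.2.2.1 + x.2.2.2) := by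
        rw [Fin.prod_univ_six, Fin.prod_univ_six]
        simp only [f, Z, signed, prodSix]
        simp [-neg_add_rev, -neg_sub]
        ring
      rw [hp]
      have hp0 : 0 ≤ prodSix a x.2.1.1 x.2.1.2 (x.1 - x.2.1.1 + x.2.1.2) x.2.2.1 x.2.2.2
          (x.1 - x.2.2.1 + x.2.2.2) := by
        unfold prodSix
        exact mul_nonneg (mul_nonneg (mul_nonneg (ha _) (ha _)) (ha _))
          (mul_nonneg (mul_nonneg (ha _) (ha _)) (ha _))
      calc _ ≤ _ := mul_le_mul_of_nonneg_right h1 hp0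
        _ = _ := by ring
    refine (ENNReal.tsum_le_tsum hpt).trans ?_
    rw [ENNReal.tsum_mul_left, ENNReal.ofReal_mul (by norm_num)]
    refine (mul_le_mul_right h _).trans (le_of_eq ?_)
    unfold sixConst
    rw [show ENNReal.ofReal (12 * 10 ^ 7 * 9) = 12 * 10 ^ 7 * 9 by
      rw [show (12 * 10 ^ 7 * 9 : ℝ) = ((12 * 10 ^ 7 * 9 : ℕ) : ℝ) by norm_num,
        ENNReal.ofReal_natCast]; norm_num]
    ring
  · intro x
    rw [Fin.sum_univ_six]
    change x.2.1.1 + -x.2.1.2 + (x.1 - x.2.1.1 + x.2.1.2) + -x.2.2.1 + x.2.2.2 +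
      -(x.1 - x.2.2.1 + x.2.2.2) = 0
    ring
  · intro x y hxy
    have e := fun k => congrFun hxy k
    have e0 : x.2.1.1 = y.2.1.1 := e 0
    have e1 : -x.2.1.2 = -y.2.1.2 := e 1
    have e2 : x.1 - x.2.1.1 + x.2.1.2 = y.1 - y.2.1.1 + y.2.1.2 := e 2
    have e3 : -x.2.2.1 = -y.2.2.1 := e 3
    have e4 : x.2.2.2 = y.2.2.2 := e 4
    ext <;> omega
  · intro k n
    have := (weight_pos η n).le
    have := ha n
    have := ha (-n)
    fin_cases k <;> simp [f] <;> positivity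
  · intro k
    fin_cases k <;> simpa [f] using by assumption

lemma tsum_decay_square {Γ : Type*} (u v w : Γ → ℤ)
    (hinj : ∀ i i', u i = u i' → v i = v i' → w i = w i' → i = i') (η : ℝ) {f : ℤ → ℝ} {B : ℝ≥0∞}
    (hf : ∑' n, ENNReal.ofReal (f n ^ 2) ≤ B) :
    ∑' i, ENNReal.ofReal (decay η (u i) * (f (v i) ^ 2 * f (w i) ^ 2)) ≤ decaySum η * B ^ 2 := by
  calc ∑' i, ENNReal.ofReal (decay η (u i) * (f (v i) ^ 2 * f (w i) ^ 2))
      ≤ ∑' y : ℤ × ℤ × ℤ, ENNReal.ofReal (decay η y.1 * (f y.2.1 ^ 2 * f y.2.2 ^ 2)) :=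
        ENNReal.tsum_comp_le_tsum_of_injective (f := fun i => (u i, v i, w i))
          (fun i i' h => by
            simp only [Prod.mk.injEq] at h
            exact hinj i i' h.1 h.2.1 h.2.2)
          (fun y : ℤ × ℤ × ℤ => ENNReal.ofReal (decay η y.1 * (f y.2.1 ^ 2 * f y.2.2 ^ 2)))
    _ = decaySum η * ((∑' n, ENNReal.ofReal (f n ^ 2)) * ∑' n, ENNReal.ofReal (f n ^ 2)) := by
        have : ∀ y : ℤ × ℤ × ℤ, ENNReal.ofReal (decay η y.1 * (f y.2.1 ^ 2 * f y.2.2 ^ 2)) =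
            ENNReal.ofReal (decay η y.1) *
              (ENNReal.ofReal (f y.2.1 ^ 2) * ENNReal.ofReal (f y.2.2 ^ 2)) := fun y => by
          rw [ENNReal.ofReal_mul (decay_nonneg _ _), ENNReal.ofReal_mul (by positivity)]
        simp_rw [this, ENNReal.tsum_prod', ENNReal.tsum_mul_left, ENNReal.tsum_mul_right]
        rfl
    _ ≤ decaySum η * (B * B) := by gcongr
    _ = _ := by rw [sq]

lemma beta_le_of_large {p j k M : ℝ} (hj : 1 ≤ |j|) (hk : 1 ≤ |k|) (hp : |p| ≤ 4 * M)
    (h : M / 8 ≤ |j|) : |p / (j * k)| ≤ 64 * (1 + |k|)⁻¹ := by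
  rw [abs_div, abs_mul, ← div_eq_mul_inv, div_le_div_iff₀ (by positivity) (by positivity)]
  calc |p| * (1 + |k|) ≤ (4 * (8 * |j|)) * (2 * |k|) := by gcongr <;> linarith
    _ = _ := by ring

/-- The pointwise estimate of the quadrilinear multiplier. -/
lemma beta_le {N : ℕ} {n₁ n₂ n₃ : ℤ} (hj : n₁ ≠ n₂) (hk : n₃ ≠ n₂) :
    |beta N n₁ n₂ n₃| ≤ 64 * ((1 + |((n₁ - n₂ : ℤ) : ℝ)|)⁻¹ + (1 + |((n₃ - n₂ : ℤ) : ℝ)|)⁻¹) *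
      ((1 + |(n₁ : ℝ)|) * (1 + |(n₂ : ℝ)|) * (1 + |(n₃ : ℝ)|) *
        (1 + |((n₁ - n₂ + n₃ : ℤ) : ℝ)|)) ^ (1 / 3 : ℝ) := by
  have hj1 : (1 : ℝ) ≤ |((n₁ - n₂ : ℤ) : ℝ)| := by exact_mod_cast Int.one_le_abs (sub_ne_zero.mpr hj)
  have hk1 : (1 : ℝ) ≤ |((n₃ - n₂ : ℤ) : ℝ)| := by exact_mod_cast Int.one_le_abs (sub_ne_zero.mpr hk)
  obtain ⟨M, hM1, hM2, hM3, hM4, hM⟩ : ∃ M, |(n₁ : ℝ)| ≤ M ∧ |(n₂ : ℝ)| ≤ M ∧ |(n₃ : ℝ)| ≤ M ∧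
      |(n₁ : ℝ) - n₂ + n₃| ≤ M ∧
      (M = |(n₁ : ℝ)| ∨ M = |(n₂ : ℝ)| ∨ M = |(n₃ : ℝ)| ∨ M = |(n₁ : ℝ) - n₂ + n₃|) := by
    refine ⟨max (max |(n₁ : ℝ)| |(n₂ : ℝ)|) (max |(n₃ : ℝ)| |(n₁ : ℝ) - n₂ + n₃|), by simp, by simp,
      by simp, by simp, ?_⟩
    rcases max_choice (max |(n₁ : ℝ)| |(n₂ : ℝ)|) (max |(n₃ : ℝ)| |(n₁ : ℝ) - n₂ + n₃|) with h | h <;>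
      rw [h]
    · rcases max_choice |(n₁ : ℝ)| |(n₂ : ℝ)| with h | h <;> simp [h]
    · rcases max_choice |(n₃ : ℝ)| |(n₁ : ℝ) - n₂ + n₃| with h | h <;> simp [h]
  have hM0 : 1 ≤ M := by
    have h1 : (n₃ ≠ 0 ∨ n₂ ≠ 0) := by omega
    rcases h1 with h | h
    · exact le_trans (by exact_mod_cast Int.one_le_abs h) hM3
    · exact le_trans (by exact_mod_cast Int.one_le_abs h) hM2
  have hp := abs_psi4_le (N := N) hM1 hM2 hM3 hM4
  have hP1 : 1 ≤ (1 + |(n₁ : ℝ)|) * (1 + |(n₂ : ℝ)|) * (1 + |(n₃ : ℝ)|) *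
        (1 + |((n₁ - n₂ + n₃ : ℤ) : ℝ)|) :=
    one_le_mul_of_one_le_of_one_le (one_le_mul_of_one_le_of_one_le (one_le_mul_of_one_le_of_one_le
      (one_le_size _) (one_le_size _)) (one_le_size _)) (one_le_size _)
  have hPr : 1 ≤ ((1 + |(n₁ : ℝ)|) * (1 + |(n₂ : ℝ)|) * (1 + |(n₃ : ℝ)|) *
        (1 + |((n₁ - n₂ + n₃ : ℤ) : ℝ)|)) ^ (1 / 3 : ℝ) := Real.one_le_rpow hP1 (by norm_num)
  have hbeta : beta N n₁ n₂ n₃ = psi4 N n₁ n₂ n₃ / (((n₁ - n₂ : ℤ) : ℝ) * ((n₃ - n₂ : ℤ) : ℝ)) := by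
    unfold beta; push_cast; rfl
  rw [hbeta]
  have hj0 : 0 ≤ (1 + |((n₁ - n₂ : ℤ) : ℝ)|)⁻¹ := by positivity
  have hk0 : 0 ≤ (1 + |((n₃ - n₂ : ℤ) : ℝ)|)⁻¹ := by positivity
  rcases le_or_gt (M / 8) |((n₁ - n₂ : ℤ) : ℝ)| with h | h
  · have := beta_le_of_large hj1 hk1 hp h
    refine this.trans (le_trans ?_ (le_mul_of_one_le_right (by positivity) hPr))
    linarith
  rcases le_or_gt (M / 8) |((n₃ - n₂ : ℤ) : ℝ)| with h' | h'
  · have := beta_le_of_large hk1 hj1 hp h'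
    rw [mul_comm ((n₃ - n₂ : ℤ) : ℝ)] at this
    refine this.trans (le_trans ?_ (le_mul_of_one_le_right (by positivity) hPr))
    linarith
  · obtain ⟨a1, a2, a3, a4, -⟩ := sizes_of_close hM1 hM (by push_cast at h; exact h.le)
      (by push_cast at h'; exact h'.le)
    have hPM : M / 2 ≤ ((1 + |(n₁ : ℝ)|) * (1 + |(n₂ : ℝ)|) * (1 + |(n₃ : ℝ)|) *
        (1 + |((n₁ - n₂ + n₃ : ℤ) : ℝ)|)) ^ (1 / 3 : ℝ) := by
      have e : M / 2 = ((M / 2) ^ 3) ^ (1 / 3 : ℝ) := by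
        rw [← Real.rpow_natCast, ← Real.rpow_mul (by positivity)]; norm_num
      rw [e]
      refine Real.rpow_le_rpow (by positivity) ?_ (by norm_num)
      calc (M / 2) ^ 3 = (M / 2) * (M / 2) * (M / 2) * 1 := by ring
        _ ≤ _ := by
          gcongr
          · linarith
          · linarith
          · linarith
          · exact one_le_size _
    have h1 : |psi4 N n₁ n₂ n₃ / (((n₁ - n₂ : ℤ) : ℝ) * ((n₃ - n₂ : ℤ) : ℝ))| ≤
        8 * (1 + |((n₃ - n₂ : ℤ) : ℝ)|)⁻¹ * M := by
      rw [abs_div, abs_mul, div_le_iff₀ (by positivity)]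
      have h3 : 1 ≤ (1 + |((n₃ - n₂ : ℤ) : ℝ)|)⁻¹ * (2 * |((n₃ - n₂ : ℤ) : ℝ)|) := by
        rw [inv_mul_eq_div, le_div_iff₀ (by positivity)]; linarith
      calc |psi4 N n₁ n₂ n₃| ≤ 4 * M * (1 * 1) := by linarith
        _ ≤ 4 * M * ((1 + |((n₃ - n₂ : ℤ) : ℝ)|)⁻¹ * (2 * |((n₃ - n₂ : ℤ) : ℝ)|) *
            |((n₁ - n₂ : ℤ) : ℝ)|) := by gcongr
        _ = _ := by ring
    refine h1.trans ?_
    calc 8 * (1 + |((n₃ - n₂ : ℤ) : ℝ)|)⁻¹ * M = 16 * (1 + |((n₃ - n₂ : ℤ) : ℝ)|)⁻¹ * (M / 2) := by ring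
      _ ≤ _ := by
        refine mul_le_mul ?_ hPM (by positivity) (by positivity)
        linarith

/-- The product of the four amplitudes of a quadruple. -/
def prodFour (a : ℤ → ℝ) (n₁ n₂ n₃ : ℤ) : ℝ := a n₁ * a n₂ * a n₃ * a (n₁ - n₂ + n₃)

lemma beta_prodFour_le {η : ℝ} (hη : 0 < η) (hη1 : η ≤ 1) {N : ℕ} (hN : 1 ≤ N) {a : ℤ → ℝ}
    (ha : ∀ n, 0 ≤ a n) (n₁ n₂ n₃ : ℤ) :
    |beta N n₁ n₂ n₃| * prodFour a n₁ n₂ n₃ ≤ (64 * 9) * (N : ℝ) ^ (-(2 * η)) *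
      ((decay η (n₁ - n₂) + decay η (n₃ - n₂)) * prodFour (fun n => weight η n * a n) n₁ n₂ n₃) := by
  have hb0 : ∀ n, 0 ≤ weight η n * a n := fun n => mul_nonneg (weight_pos η n).le (ha n)
  have hpf : ∀ b : ℤ → ℝ, (∀ n, 0 ≤ b n) → 0 ≤ prodFour b n₁ n₂ n₃ := fun b hb =>
    mul_nonneg (mul_nonneg (mul_nonneg (hb _) (hb _)) (hb _)) (hb _)
  have hw := hpf _ hb0
  have hp0 := hpf _ ha
  have hd := decay_nonneg η (n₁ - n₂)
  have hd' := decay_nonneg η (n₃ - n₂)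
  have hN0 : (0 : ℝ) < N := by exact_mod_cast hN
  by_cases hnr : n₁ ≠ n₂ ∧ n₃ ≠ n₂
  swap
  · rw [beta_eq_zero hnr, abs_zero, zero_mul]; positivity
  have hbl := beta_le (N := N) hnr.1 hnr.2
  have hPe : prodFour (fun n => weight η n * a n) n₁ n₂ n₃ =
      ((1 + |(n₁ : ℝ)|) * (1 + |(n₂ : ℝ)|) * (1 + |(n₃ : ℝ)|) *
        (1 + |((n₁ - n₂ + n₃ : ℤ) : ℝ)|)) ^ (1 / 3 + 4 * η) * prodFour a n₁ n₂ n₃ := by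
    unfold prodFour weight
    rw [Real.mul_rpow (by positivity) (by positivity), Real.mul_rpow (by positivity) (by positivity),
      Real.mul_rpow (by positivity) (by positivity)]
    ring
  have hP1 : (1 + |(n₁ : ℝ)|) ≤ (1 + |(n₁ : ℝ)|) * (1 + |(n₂ : ℝ)|) * (1 + |(n₃ : ℝ)|) *
        (1 + |((n₁ - n₂ + n₃ : ℤ) : ℝ)|) ∧ (1 + |(n₂ : ℝ)|) ≤ (1 + |(n₁ : ℝ)|) * (1 + |(n₂ : ℝ)|) *
        (1 + |(n₃ : ℝ)|) * (1 + |((n₁ - n₂ + n₃ : ℤ) : ℝ)|) ∧ (1 + |(n₃ : ℝ)|) ≤ (1 + |(n₁ : ℝ)|) *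
        (1 + |(n₂ : ℝ)|) * (1 + |(n₃ : ℝ)|) * (1 + |((n₁ - n₂ + n₃ : ℤ) : ℝ)|) ∧
      1 + |((n₁ - n₂ : ℤ) : ℝ)| ≤ (1 + |(n₁ : ℝ)|) *
        (1 + |(n₂ : ℝ)|) * (1 + |(n₃ : ℝ)|) * (1 + |((n₁ - n₂ + n₃ : ℤ) : ℝ)|) ∧
      1 + |((n₃ - n₂ : ℤ) : ℝ)| ≤ (1 + |(n₁ : ℝ)|) *
        (1 + |(n₂ : ℝ)|) * (1 + |(n₃ : ℝ)|) * (1 + |((n₁ - n₂ + n₃ : ℤ) : ℝ)|) := by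
    have key : ∀ x y z : ℝ, 1 ≤ x → 1 ≤ y → x ≤ x * y ∧ y ≤ x * y := fun x y z hx hy =>
      ⟨le_mul_of_one_le_right (by linarith) hy, le_mul_of_one_le_left (by linarith) hx⟩
    have g1 := one_le_size n₁
    have g2 := one_le_size n₂
    have g3 := one_le_size n₃
    have g4 := one_le_size (n₁ - n₂ + n₃)
    have k1 := key _ _ 0 g1 g2
    have k2 := key _ _ 0 (g1.trans k1.1) g3
    have k3 := key _ _ 0 ((g1.trans k1.1).trans k2.1) g4
    have t1 : 1 + |((n₁ - n₂ : ℤ) : ℝ)| ≤ (1 + |(n₁ : ℝ)|) * (1 + |(n₂ : ℝ)|) := by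
      have := abs_sub (n₁ : ℝ) n₂
      push_cast
      nlinarith [mul_nonneg (abs_nonneg (n₁ : ℝ)) (abs_nonneg (n₂ : ℝ))]
    have t2 : 1 + |((n₃ - n₂ : ℤ) : ℝ)| ≤ (1 + |(n₂ : ℝ)|) * (1 + |(n₃ : ℝ)|) := by
      have := abs_sub (n₃ : ℝ) n₂
      push_cast
      nlinarith [mul_nonneg (abs_nonneg (n₂ : ℝ)) (abs_nonneg (n₃ : ℝ))]
    have t3 : (1 + |(n₂ : ℝ)|) * (1 + |(n₃ : ℝ)|) ≤
        (1 + |(n₁ : ℝ)|) * (1 + |(n₂ : ℝ)|) * (1 + |(n₃ : ℝ)|) := by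
      rw [mul_assoc]
      exact le_mul_of_one_le_left (by positivity) g1
    refine ⟨?_, ?_, ?_, ?_, ?_⟩ <;> linarith [k1.1, k1.2, k2.1, k2.2, k3.1, k3.2]
  rw [hPe]
  generalize (1 + |(n₁ : ℝ)|) * (1 + |(n₂ : ℝ)|) * (1 + |(n₃ : ℝ)|) *
        (1 + |((n₁ - n₂ + n₃ : ℤ) : ℝ)|) = P at *
  obtain ⟨p1, p2, p3, p4, p5⟩ := hP1
  have hPge : 1 ≤ P := (one_le_size _).trans p1
  by_cases hs : 3 * P < N
  · have : psi4 N n₁ n₂ n₃ = 0 := psi4_eq_zero (by linarith) (by linarith) (by linarith)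
    rw [show beta N n₁ n₂ n₃ = 0 by rw [beta, this, zero_div], abs_zero, zero_mul]
    positivity
  have hP0 : 0 < P := by linarith
  have e1 : P ^ (-(2 * η)) ≤ 9 * (N : ℝ) ^ (-(2 * η)) := by
    calc P ^ (-(2 * η)) ≤ ((N : ℝ) / 3) ^ (-(2 * η)) :=
          Real.rpow_le_rpow_of_nonpos (by positivity) (by linarith) (by linarith)
      _ = 3 ^ (2 * η) * (N : ℝ) ^ (-(2 * η)) := by
          rw [Real.div_rpow hN0.le (by norm_num), Real.rpow_neg (by norm_num : (0 : ℝ) ≤ 3),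
            div_inv_eq_mul, mul_comm]
      _ ≤ 3 ^ (2 : ℝ) * (N : ℝ) ^ (-(2 * η)) := by gcongr <;> linarith
      _ = _ := by norm_num
  have e2 : ∀ x : ℝ, 1 ≤ x → x ≤ P → x⁻¹ ≤ x ^ (-(1 + η)) * P ^ η := by
    intro x hx hxP
    rw [neg_add, Real.rpow_add (by linarith), Real.rpow_neg_one, mul_assoc,
      Real.rpow_neg (by linarith)]
    have hx0 : 0 < x := by linarith
    refine le_mul_of_one_le_right (inv_nonneg.mpr hx0.le) ?_
    rw [inv_mul_eq_div, le_div_iff₀ (by positivity), one_mul]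
    gcongr
  have e3 : |beta N n₁ n₂ n₃| ≤ 64 * ((decay η (n₁ - n₂) + decay η (n₃ - n₂)) * P ^ η) *
      P ^ (1 / 3 : ℝ) := by
    refine hbl.trans ?_
    have a1 := e2 _ (one_le_size (n₁ - n₂)) p4
    have a2 := e2 _ (one_le_size (n₃ - n₂)) p5
    gcongr
    rw [add_mul]
    exact add_le_add a1 a2
  have e4 : P ^ η * P ^ (1 / 3 : ℝ) ≤ P ^ (-(2 * η)) * P ^ (1 / 3 + 4 * η) := by
    rw [← Real.rpow_add hP0, ← Real.rpow_add hP0]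
    exact Real.rpow_le_rpow_of_exponent_le hPge (by linarith)
  calc |beta N n₁ n₂ n₃| * prodFour a n₁ n₂ n₃
      ≤ 64 * ((decay η (n₁ - n₂) + decay η (n₃ - n₂)) * P ^ η) * P ^ (1 / 3 : ℝ) *
        prodFour a n₁ n₂ n₃ := by gcongr
    _ = 64 * (decay η (n₁ - n₂) + decay η (n₃ - n₂)) * (P ^ η * P ^ (1 / 3 : ℝ)) *
        prodFour a n₁ n₂ n₃ := by ring
    _ ≤ 64 * (decay η (n₁ - n₂) + decay η (n₃ - n₂)) * (9 * (N : ℝ) ^ (-(2 * η)) *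
        P ^ (1 / 3 + 4 * η)) * prodFour a n₁ n₂ n₃ := by
        have e5 := e4.trans (mul_le_mul_of_nonneg_right e1 (by positivity))
        gcongr 64 * (decay η (n₁ - n₂) + decay η (n₃ - n₂)) * ?_ * _
    _ = _ := by ring

/-- The constant of the quadrilinear estimate. -/
noncomputable def fourConst (η : ℝ) : ℝ≥0∞ := (64 * 9) * (4 * decaySum η)

lemma fourConst_ne_top {η : ℝ} (hη : 0 < η) : fourConst η ≠ ⊤ := by
  have := decaySum_ne_top hη
  unfold fourConst
  finiteness

/-- The quadrilinear estimate. -/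
lemma tsum_four {η : ℝ} (hη : 0 < η) (hη1 : η ≤ 1) {N : ℕ} (hN : 1 ≤ N) {a : ℤ → ℝ}
    (ha : ∀ n, 0 ≤ a n) {B : ℝ≥0∞}
    (hB : ∑' n, ENNReal.ofReal ((weight η n * a n) ^ 2) ≤ B) :
    ∑' x : ℤ × (ℤ × ℤ), ENNReal.ofReal (|beta N x.2.1 x.2.2 (x.1 - x.2.1 + x.2.2)| *
      prodFour a x.2.1 x.2.2 (x.1 - x.2.1 + x.2.2)) ≤
      ENNReal.ofReal ((N : ℝ) ^ (-(2 * η))) * (fourConst η * B ^ 2) := by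
  obtain ⟨b, hb⟩ : ∃ b : ℤ → ℝ, b = fun n => weight η n * a n := ⟨_, rfl⟩
  have hB' : ∑' n, ENNReal.ofReal (b n ^ 2) ≤ B := by rw [hb]; exact hB
  have h1 : ∑' x : ℤ × (ℤ × ℤ), ENNReal.ofReal (decay η (x.2.1 - x.2.2) *
      prodFour b x.2.1 x.2.2 (x.1 - x.2.1 + x.2.2)) ≤ 2 * (decaySum η * B ^ 2) := by
    refine tsum_le_of_geom
      (tsum_decay_square (fun x : ℤ × (ℤ × ℤ) => x.2.1 - x.2.2) (fun x => x.2.1) (fun x => x.1)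
        ?_ η hB')
      (tsum_decay_square (fun x : ℤ × (ℤ × ℤ) => x.2.1 - x.2.2) (fun x => x.2.2)
        (fun x => x.1 - x.2.1 + x.2.2) ?_ η hB') ?_ ?_ ?_
    · intro x y h1 h2 h3; ext <;> omega
    · intro x y h1 h2 h3; ext <;> omega
    · intro x; have := decay_nonneg η (x.2.1 - x.2.2); positivity
    · intro x; have := decay_nonneg η (x.2.1 - x.2.2); positivity
    · intro x
      unfold prodFour
      rw [show x.2.1 - x.2.2 + (x.1 - x.2.1 + x.2.2) = x.1 by ring]
      exact le_of_eq (by ring)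
  have h2 : ∑' x : ℤ × (ℤ × ℤ), ENNReal.ofReal (decay η (x.1 - x.2.1 + x.2.2 - x.2.2) *
      prodFour b x.2.1 x.2.2 (x.1 - x.2.1 + x.2.2)) ≤ 2 * (decaySum η * B ^ 2) := by
    refine tsum_le_of_geom
      (tsum_decay_square (fun x : ℤ × (ℤ × ℤ) => x.1 - x.2.1 + x.2.2 - x.2.2) (fun x => x.2.1)
        (fun x => x.2.2) ?_ η hB')
      (tsum_decay_square (fun x : ℤ × (ℤ × ℤ) => x.1 - x.2.1 + x.2.2 - x.2.2)
        (fun x => x.1 - x.2.1 + x.2.2) (fun x => x.1) ?_ η hB') ?_ ?_ ?_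
    · intro x y h1 h2 h3; ext <;> omega
    · intro x y h1 h2 h3; ext <;> omega
    · intro x; have := decay_nonneg η (x.1 - x.2.1 + x.2.2 - x.2.2); positivity
    · intro x; have := decay_nonneg η (x.1 - x.2.1 + x.2.2 - x.2.2); positivity
    · intro x
      unfold prodFour
      rw [show x.2.1 - x.2.2 + (x.1 - x.2.1 + x.2.2) = x.1 by ring]
      exact le_of_eq (by ring)
  have hpt : ∀ x : ℤ × (ℤ × ℤ), ENNReal.ofReal (|beta N x.2.1 x.2.2 (x.1 - x.2.1 + x.2.2)| *
      prodFour a x.2.1 x.2.2 (x.1 - x.2.1 + x.2.2)) ≤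
      ENNReal.ofReal ((64 * 9) * (N : ℝ) ^ (-(2 * η))) * (ENNReal.ofReal (decay η (x.2.1 - x.2.2) *
      prodFour b x.2.1 x.2.2 (x.1 - x.2.1 + x.2.2)) +
      ENNReal.ofReal (decay η (x.1 - x.2.1 + x.2.2 - x.2.2) *
      prodFour b x.2.1 x.2.2 (x.1 - x.2.1 + x.2.2))) := by
    intro x
    refine (ENNReal.ofReal_le_ofReal (beta_prodFour_le hη hη1 hN ha _ _ _)).trans ?_
    rw [← hb, ENNReal.ofReal_mul (by positivity), add_mul]
    gcongr
    exact ENNReal.ofReal_add_le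
  refine (ENNReal.tsum_le_tsum hpt).trans ?_
  rw [ENNReal.tsum_mul_left, ENNReal.tsum_add, ENNReal.ofReal_mul (by norm_num)]
  refine (mul_le_mul_right (add_le_add h1 h2) _).trans (le_of_eq ?_)
  unfold fourConst
  rw [show ENNReal.ofReal (64 * 9) = 64 * 9 by
      rw [show (64 * 9 : ℝ) = ((64 * 9 : ℕ) : ℝ) by norm_num,
        ENNReal.ofReal_natCast]; norm_num]
  ring

lemma lintegral_enorm_sq {E : Type*} [NormedAddCommGroup E] (f : ℝ → E) :
    ∫⁻ t, ‖f t‖ₑ ^ 2 = eLpNorm f 2 volume ^ 2 := by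
  rw [eLpNorm_eq_lintegral_rpow_enorm_toReal two_ne_zero ENNReal.ofNat_ne_top]
  simp only [ENNReal.toReal_ofNat, ENNReal.rpow_ofNat]
  rw [← ENNReal.rpow_natCast, ← ENNReal.rpow_mul]
  norm_num

lemma eLpNorm_fourier (f : Lp ℂ 2 (volume : Measure ℝ)) :
    eLpNorm (𝓕 f : Lp ℂ 2 (volume : Measure ℝ)) 2 volume = eLpNorm f 2 volume := by
  rw [← Lp.enorm_def, ← Lp.enorm_def, ← ofReal_norm, ← ofReal_norm,
    Lp.norm_fourier_eq]

lemma eLpNorm_comp_add (f : Lp ℂ 2 (volume : Measure ℝ)) (h : ℝ) :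
    eLpNorm (fun t => f (t + h)) 2 volume = eLpNorm f 2 volume :=
  eLpNorm_comp_measurePreserving (Lp.aestronglyMeasurable f) (measurePreserving_add_right volume h)

lemma ae_comp_add {p : ℝ → Prop} (h : ∀ᵐ t, p t) (r : ℝ) : ∀ᵐ t, p (t + r) :=
  (measurePreserving_add_right volume r).quasiMeasurePreserving.ae h

/-- The Fourier multiplier of the operator `c v(· + h) - v`. -/
noncomputable def shiftSymbol (c : ℂ) (h : ℝ) (ξ : ℝ) : ℂ :=
  c * Complex.exp (2 * Real.pi * Complex.I * (ξ * h)) - 1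

lemma measurable_shiftSymbol (c : ℂ) (h : ℝ) : Measurable (shiftSymbol c h) := by
  unfold shiftSymbol
  fun_prop

lemma norm_exp_shift (h ξ : ℝ) : ‖Complex.exp (2 * Real.pi * Complex.I * (ξ * h))‖ = 1 := by
  rw [show (2 * Real.pi * Complex.I * (ξ * h) : ℂ) = ((2 * Real.pi * (ξ * h) : ℝ) : ℂ) * Complex.I by
    push_cast; ring]
  exact Complex.norm_exp_ofReal_mul_I _

lemma norm_shiftSymbol_le {c : ℂ} (hc : ‖c‖ = 1) (h ξ : ℝ) : ‖shiftSymbol c h ξ‖ ≤ 2 := by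
  unfold shiftSymbol
  refine (norm_sub_le _ _).trans ?_
  rw [norm_mul, hc, norm_exp_shift, norm_one]
  norm_num

lemma fourier_shift_schwartz (φ : SchwartzMap ℝ ℂ) (c : ℂ) (h : ℝ) :
    eLpNorm (fun t => c * φ (t + h) - φ t) 2 volume =
      eLpNorm (fun ξ => shiftSymbol c h ξ * 𝓕 (φ : ℝ → ℂ) ξ) 2 volume := by
  obtain ⟨g, hg⟩ : ∃ g : SchwartzMap ℝ ℂ,
      g = c • SchwartzMap.compSubConstCLM ℂ (-h) φ - φ := ⟨_, rfl⟩
  have h1 : (fun t => c * φ (t + h) - φ t) = g := by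
    funext t
    rw [hg]
    simp
  have h2 : (fun ξ => shiftSymbol c h ξ * 𝓕 (φ : ℝ → ℂ) ξ) = 𝓕 g := by
    have e : 𝓕 g = c • 𝓕 (SchwartzMap.compSubConstCLM ℂ (-h) φ) - 𝓕 φ := by
      rw [hg]
      exact (map_sub (FourierTransform.fourierCLM ℂ (SchwartzMap ℝ ℂ)) _ _).trans
        (congrArg (· - 𝓕 φ) (map_smul (FourierTransform.fourierCLM ℂ (SchwartzMap ℝ ℂ)) c _))
    funext ξ
    rw [e]
    have e2 : 𝓕 (SchwartzMap.compSubConstCLM ℂ (-h) φ) ξ =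
        Complex.exp (2 * Real.pi * Complex.I * (ξ * h)) * 𝓕 (φ : ℝ → ℂ) ξ := by
      rw [SchwartzMap.fourier_coe]
      have e3 : ((SchwartzMap.compSubConstCLM ℂ (-h) φ : SchwartzMap ℝ ℂ) : ℝ → ℂ) =
          (φ : ℝ → ℂ) ∘ fun t => t + h := by
        funext t; simp
      rw [e3]
      rw [Real.fourier_real_eq_integral_exp_smul, Real.fourier_real_eq_integral_exp_smul,
        ← integral_const_mul,
        ← integral_add_right_eq_self (fun t => Complex.exp (2 * Real.pi * Complex.I * (ξ * h)) *
          Complex.exp (((-2 * Real.pi * t * ξ : ℝ) : ℂ) * Complex.I) • φ t) h]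
      refine integral_congr_ae (Filter.Eventually.of_forall fun t => ?_)
      simp only [Function.comp, smul_eq_mul]
      rw [← mul_assoc, ← Complex.exp_add]
      congr 2
      push_cast
      ring
    rw [_root_.sub_apply, _root_.smul_apply, e2, SchwartzMap.fourier_coe, shiftSymbol,
      smul_eq_mul]
    ring
  rw [h1, h2]
  have e1 := eLpNorm_congr_ae (p := 2) (SchwartzMap.coeFn_toLp g 2 (volume : Measure ℝ))
  have e2 := eLpNorm_congr_ae (p := 2) (SchwartzMap.coeFn_toLp (𝓕 g) 2 (volume : Measure ℝ))
  rw [← e1, ← e2, ← SchwartzMap.toLp_fourier_eq, eLpNorm_fourier]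

lemma shift_le (v : Lp ℂ 2 (volume : Measure ℝ)) {c : ℂ} (hc : ‖c‖ = 1) (h : ℝ) :
    eLpNorm (fun t => c * v (t + h) - v t) 2 volume ≤
      eLpNorm (fun ξ => shiftSymbol c h ξ * (𝓕 v : Lp ℂ 2 (volume : Measure ℝ)) ξ) 2 volume := by
  have hmS := (measurable_shiftSymbol c h).aestronglyMeasurable (μ := volume)
  have mult_le : ∀ f : Lp ℂ 2 (volume : Measure ℝ),
      eLpNorm (fun ξ => shiftSymbol c h ξ * f ξ) 2 volume ≤ 2 * eLpNorm f 2 volume := by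
    intro f
    have := eLpNorm_le_mul_eLpNorm_of_ae_le_mul (p := 2) (c := 2) (μ := volume)
      (f := fun ξ => shiftSymbol c h ξ * f ξ) (g := f) (Filter.Eventually.of_forall fun ξ => by
        rw [norm_mul]
        gcongr
        exact norm_shiftSymbol_le hc h ξ)
    simpa using this
  have approx : ∀ φ : SchwartzMap ℝ ℂ, eLpNorm (fun t => c * v (t + h) - v t) 2 volume ≤
      eLpNorm (fun ξ => shiftSymbol c h ξ * (𝓕 v : Lp ℂ 2 (volume : Measure ℝ)) ξ) 2 volume +
        4 * ‖v - φ.toLp 2 volume‖ₑ := by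
    intro φ
    obtain ⟨d, hd⟩ : ∃ d, d = v - φ.toLp 2 volume := ⟨_, rfl⟩
    rw [← hd, Lp.enorm_def]
    have hv : ∀ᵐ t, v t = φ t + d t := by
      filter_upwards [Lp.coeFn_sub v (φ.toLp 2 volume), SchwartzMap.coeFn_toLp φ 2 (volume : Measure ℝ)]
        with t h1 h2
      rw [hd, h1, Pi.sub_apply, h2]
      ring
    have hFv : ∀ᵐ ξ, 𝓕 (φ : ℝ → ℂ) ξ = (𝓕 v : Lp ℂ 2 (volume : Measure ℝ)) ξ -
        (𝓕 d : Lp ℂ 2 (volume : Measure ℝ)) ξ := by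
      have e : (𝓕 φ).toLp 2 volume = 𝓕 v - 𝓕 d := by
        have : 𝓕 (v - φ.toLp 2 volume) = 𝓕 v - 𝓕 (φ.toLp 2 volume) :=
          map_sub (Lp.fourierTransformₗᵢ ℝ ℂ) _ _
        rw [hd, this, SchwartzMap.toLp_fourier_eq]
        abel
      filter_upwards [Lp.coeFn_sub (𝓕 v) (𝓕 d), SchwartzMap.coeFn_toLp (𝓕 φ) 2 (volume : Measure ℝ)]
        with ξ h1 h2
      rw [← SchwartzMap.fourier_coe, ← h2, e, h1, Pi.sub_apply]
    have hmd := Lp.aestronglyMeasurable d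
    have hmd' : AEStronglyMeasurable (fun t => d (t + h)) volume :=
      hmd.comp_measurePreserving (measurePreserving_add_right volume h)
    have e1 : eLpNorm (fun t => c * v (t + h) - v t) 2 volume ≤
        eLpNorm (fun t => c * φ (t + h) - φ t) 2 volume + (eLpNorm d 2 volume + eLpNorm d 2 volume) := by
      have e : (fun t => c * v (t + h) - v t) =ᵐ[volume]
          (fun t => c * φ (t + h) - φ t) + ((fun t => c * d (t + h)) - d) := by
        filter_upwards [hv, ae_comp_add hv h] with t h1 h2
        simp only [Pi.add_apply, Pi.sub_apply]
        rw [h1, h2]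
        ring
      rw [eLpNorm_congr_ae e]
      refine (eLpNorm_add_le ?_ ((hmd'.const_mul c).sub hmd) (by norm_num)).trans ?_
      · have := φ.continuous
        exact Continuous.aestronglyMeasurable (by fun_prop)
      gcongr
      refine (eLpNorm_sub_le (hmd'.const_mul c) hmd (by norm_num)).trans ?_
      gcongr
      rw [← eLpNorm_comp_add d h]
      refine le_of_eq (eLpNorm_congr_norm_ae (Filter.Eventually.of_forall fun t => ?_))
      rw [norm_mul, hc, one_mul]
    have e2 : eLpNorm (fun ξ => shiftSymbol c h ξ * 𝓕 (φ : ℝ → ℂ) ξ) 2 volume ≤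
        eLpNorm (fun ξ => shiftSymbol c h ξ * (𝓕 v : Lp ℂ 2 (volume : Measure ℝ)) ξ) 2 volume +
          2 * eLpNorm d 2 volume := by
      have e : (fun ξ => shiftSymbol c h ξ * 𝓕 (φ : ℝ → ℂ) ξ) =ᵐ[volume]
          (fun ξ => shiftSymbol c h ξ * (𝓕 v : Lp ℂ 2 (volume : Measure ℝ)) ξ) -
          (fun ξ => shiftSymbol c h ξ * (𝓕 d : Lp ℂ 2 (volume : Measure ℝ)) ξ) := by
        filter_upwards [hFv] with ξ h1
        simp only [Pi.sub_apply]
        rw [h1]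
        ring
      rw [eLpNorm_congr_ae e]
      refine (eLpNorm_sub_le (hmS.mul (Lp.aestronglyMeasurable _))
        (hmS.mul (Lp.aestronglyMeasurable _)) (by norm_num)).trans ?_
      refine add_le_add le_rfl ?_
      rw [← eLpNorm_fourier d]
      exact mult_le _
    rw [fourier_shift_schwartz] at e1
    calc _ ≤ _ := e1
      _ ≤ _ := add_le_add e2 le_rfl
      _ = _ := by ring
  refine ENNReal.le_of_forall_pos_le_add fun ε hε _ => ?_
  obtain ⟨φ, hφ⟩ : ∃ φ : SchwartzMap ℝ ℂ, ‖v - φ.toLp 2 volume‖ < ε / 4 := by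
    have := (SchwartzMap.denseRange_toLpCLM (E := ℝ) (F := ℂ) (μ := (volume : Measure ℝ)) (p := 2)
      ENNReal.ofNat_ne_top).exists_dist_lt v (ε := ε / 4) (by positivity)
    obtain ⟨φ, hφ⟩ := this
    exact ⟨φ, by rwa [dist_eq_norm] at hφ⟩
  refine (approx φ).trans ?_
  gcongr
  rw [← ofReal_norm, show (4 : ℝ≥0∞) = ENNReal.ofReal 4 by norm_num,
    ← ENNReal.ofReal_mul (by norm_num), ← ENNReal.ofReal_coe_nnreal]
  exact ENNReal.ofReal_le_ofReal (by linarith)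

/-- Functions with half a derivative in `L²`, in the sense of differences. -/
structure HalfReg (w : ℝ → ℂ) (a : ℝ≥0∞) : Prop where
  meas : Measurable w
  sq_le : ∫⁻ t, ‖w t‖ₑ ^ 2 ≤ a ^ 2
  shift_le : ∀ h : ℝ, ∫⁻ t, ‖w (t + h) - w t‖ₑ ^ 2 ≤ ‖h‖ₑ * a ^ 2

lemma HalfReg.conj {w : ℝ → ℂ} {a : ℝ≥0∞} (h : HalfReg w a) :
    HalfReg (fun t => starRingEnd ℂ (w t)) a := by
  refine ⟨Complex.continuous_conj.measurable.comp h.meas, ?_, fun r => ?_⟩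
  · simpa using h.sq_le
  · refine le_trans (le_of_eq ?_) (h.shift_le r)
    refine lintegral_congr fun t => ?_
    rw [← map_sub, RCLike.enorm_conj]

/-- The contribution of one frequency to the norm of `X^{s,1/2}`. -/
noncomputable def halfNorm (n : ℤ) (f : ℝ → ℂ) : ℝ≥0∞ :=
  eLpNorm (fun τ : ℝ => (bracket (τ - (n : ℝ) ^ 3) ^ (1 / 2 : ℝ) : ℝ) * ‖f τ‖) 2 volume

lemma one_le_bracket (x : ℝ) : 1 ≤ bracket x := by
  unfold bracket
  rw [Real.one_le_sqrt]
  nlinarith [sq_nonneg x]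

lemma abs_le_bracket (x : ℝ) : |x| ≤ bracket x := by
  unfold bracket
  apply Real.abs_le_sqrt
  linarith

lemma measurable_bracket : Measurable bracket := by
  unfold bracket
  fun_prop

lemma lintegral_comp_div {f : ℝ → ℝ≥0∞} (hf : Measurable f) {a : ℝ} (ha : 0 < a) :
    ∫⁻ x, f (x / a) = ENNReal.ofReal a * ∫⁻ x, f x := by
  have h := Real.map_volume_mul_left (inv_ne_zero ha.ne')
  have e : ∫⁻ x, f (x / a) = ∫⁻ y, f y ∂(Measure.map (a⁻¹ * ·) volume) := by
    rw [lintegral_map hf (measurable_const_mul _)]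
    simp only [div_eq_inv_mul]
  rw [e, h, lintegral_smul_measure, inv_inv, abs_of_pos ha, smul_eq_mul]

lemma lintegral_bracket_fourier (v : ℤ → Lp ℂ 2 (volume : Measure ℝ)) (n : ℤ) :
    ∫⁻ ξ : ℝ, ENNReal.ofReal (bracket (2 * Real.pi * ξ - (n : ℝ) ^ 3)) *
      ‖(𝓕 (v n) : Lp ℂ 2 (volume : Measure ℝ)) ξ‖ₑ ^ 2 =
      ENNReal.ofReal (2 * Real.pi) * halfNorm n (spaceTimeFT v n) ^ 2 := by
  have hpi := Real.pi_pos
  have hm : Measurable fun ξ : ℝ => ENNReal.ofReal (bracket (2 * Real.pi * ξ - (n : ℝ) ^ 3)) *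
      ‖(𝓕 (v n) : Lp ℂ 2 (volume : Measure ℝ)) ξ‖ₑ ^ 2 := by
    have h1 := (Lp.stronglyMeasurable (𝓕 (v n) : Lp ℂ 2 (volume : Measure ℝ))).measurable
    have h2 := measurable_bracket
    fun_prop
  have h := lintegral_comp_div hm (a := 2 * Real.pi) (by positivity)
  have e : halfNorm n (spaceTimeFT v n) ^ 2 = ENNReal.ofReal ((2 * Real.pi)⁻¹ ^ 2) *
      ∫⁻ τ : ℝ, ENNReal.ofReal (bracket (2 * Real.pi * (τ / (2 * Real.pi)) - (n : ℝ) ^ 3)) *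
      ‖(𝓕 (v n) : Lp ℂ 2 (volume : Measure ℝ)) (τ / (2 * Real.pi))‖ₑ ^ 2 := by
    unfold halfNorm
    rw [← lintegral_enorm_sq, ← lintegral_const_mul' _ _ ENNReal.ofReal_ne_top]
    refine lintegral_congr fun τ => ?_
    have hb := one_le_bracket (τ - (n : ℝ) ^ 3)
    rw [mul_div_cancel₀ _ (by positivity)]
    unfold spaceTimeFT
    generalize (𝓕 (v n) : Lp ℂ 2 (volume : Measure ℝ)) (τ / (2 * Real.pi)) = y
    rw [← ofReal_norm, ← ofReal_norm, ← ENNReal.ofReal_pow (norm_nonneg _),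
      ← ENNReal.ofReal_pow (norm_nonneg _), ← ENNReal.ofReal_mul (by positivity),
      ← ENNReal.ofReal_mul (by positivity)]
    congr 1
    have e1 : ‖(1 / (2 * Real.pi) : ℂ)‖ = (2 * Real.pi)⁻¹ := by
      rw [show (1 / (2 * Real.pi) : ℂ) = (((2 * Real.pi)⁻¹ : ℝ) : ℂ) by push_cast; ring,
        Complex.norm_real, Real.norm_of_nonneg (by positivity)]
    rw [norm_mul, norm_norm, norm_mul, e1, mul_pow, mul_pow,
      Real.norm_of_nonneg (by positivity), ← Real.sqrt_eq_rpow, Real.sq_sqrt (by linarith)]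
    ring
  rw [e, h, ← mul_assoc, ← mul_assoc, ← ENNReal.ofReal_mul (by positivity),
    ← ENNReal.ofReal_mul (by positivity)]
  rw [show 2 * Real.pi * (2 * Real.pi)⁻¹ ^ 2 * (2 * Real.pi) = 1 by field_simp, ENNReal.ofReal_one,
    one_mul]

lemma norm_exp_sub_one_sq_le (x : ℝ) : ‖Complex.exp (Complex.I * x) - 1‖ ^ 2 ≤ 2 * |x| := by
  have h1 : ‖Complex.exp (Complex.I * x) - 1‖ ≤ |x| := Real.norm_exp_I_mul_ofReal_sub_one_le
  have h2 : ‖Complex.exp (Complex.I * x) - 1‖ ≤ 2 := by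
    refine (norm_sub_le _ _).trans ?_
    rw [mul_comm, Complex.norm_exp_ofReal_mul_I, norm_one]
    norm_num
  rw [sq]
  exact mul_le_mul h2 h1 (norm_nonneg _) (by norm_num)

/-- Conjugating by the free evolution yields a function with half a derivative. -/
lemma halfReg_of_halfNorm (v : ℤ → Lp ℂ 2 (volume : Measure ℝ)) (n : ℤ) :
    HalfReg (fun t : ℝ => Complex.exp (-(Complex.I * ((n : ℝ) ^ 3 * t : ℝ))) * v n t)
      (4 * halfNorm n (spaceTimeFT v n)) := by
  have hpi := Real.pi_pos
  have hpi4 := Real.pi_le_four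
  have hid := lintegral_bracket_fourier v n
  have hexp : ∀ x : ℝ, ‖Complex.exp (-(Complex.I * x))‖ = 1 := fun x => by
    rw [show -(Complex.I * x) = ((-x : ℝ) : ℂ) * Complex.I by push_cast; ring]
    exact Complex.norm_exp_ofReal_mul_I _
  refine ⟨?_, ?_, ?_⟩
  · have := (Lp.stronglyMeasurable (v n)).measurable
    fun_prop
  · have e : ∫⁻ t : ℝ, ‖Complex.exp (-(Complex.I * ((n : ℝ) ^ 3 * t : ℝ))) * v n t‖ₑ ^ 2 =
        ∫⁻ ξ : ℝ, ‖(𝓕 (v n) : Lp ℂ 2 (volume : Measure ℝ)) ξ‖ₑ ^ 2 := by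
      rw [lintegral_enorm_sq (𝓕 (v n) : Lp ℂ 2 (volume : Measure ℝ)), eLpNorm_fourier,
        ← lintegral_enorm_sq]
      refine lintegral_congr fun t => ?_
      rw [← ofReal_norm, ← ofReal_norm, norm_mul, hexp, one_mul]
    rw [e]
    calc _ ≤ ∫⁻ ξ : ℝ, ENNReal.ofReal (bracket (2 * Real.pi * ξ - (n : ℝ) ^ 3)) *
          ‖(𝓕 (v n) : Lp ℂ 2 (volume : Measure ℝ)) ξ‖ₑ ^ 2 := by
          refine lintegral_mono fun ξ => ?_
          refine le_mul_of_one_le_left zero_le ?_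
          rw [ENNReal.one_le_ofReal]
          exact one_le_bracket _
      _ = _ := hid
      _ ≤ ENNReal.ofReal 16 * halfNorm n (spaceTimeFT v n) ^ 2 := by
          gcongr; linarith
      _ = _ := by
          rw [mul_pow]; congr 1; norm_num
  · intro h
    obtain ⟨c, hc⟩ : ∃ c, c = Complex.exp (-(Complex.I * ((n : ℝ) ^ 3 * h : ℝ))) := ⟨_, rfl⟩
    have hcn : ‖c‖ = 1 := by rw [hc]; exact hexp _
    have e : ∫⁻ t : ℝ, ‖Complex.exp (-(Complex.I * ((n : ℝ) ^ 3 * (t + h) : ℝ))) * v n (t + h) -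
        Complex.exp (-(Complex.I * ((n : ℝ) ^ 3 * t : ℝ))) * v n t‖ₑ ^ 2 =
        ∫⁻ t : ℝ, ‖c * v n (t + h) - v n t‖ₑ ^ 2 := by
      refine lintegral_congr fun t => ?_
      have : Complex.exp (-(Complex.I * ((n : ℝ) ^ 3 * (t + h) : ℝ))) =
          Complex.exp (-(Complex.I * ((n : ℝ) ^ 3 * t : ℝ))) * c := by
        rw [hc, ← Complex.exp_add]; congr 1; push_cast; ring
      rw [this, mul_assoc, ← mul_sub, ← ofReal_norm, ← ofReal_norm, norm_mul, hexp, one_mul]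
    rw [e, lintegral_enorm_sq]
    calc _ ≤ eLpNorm (fun ξ => shiftSymbol c h ξ * (𝓕 (v n) : Lp ℂ 2 (volume : Measure ℝ)) ξ) 2
          volume ^ 2 := by gcongr; exact shift_le (v n) hcn h
      _ = ∫⁻ ξ : ℝ, ‖shiftSymbol c h ξ * (𝓕 (v n) : Lp ℂ 2 (volume : Measure ℝ)) ξ‖ₑ ^ 2 :=
          (lintegral_enorm_sq _).symm
      _ ≤ ∫⁻ ξ : ℝ, ENNReal.ofReal (2 * |h|) * (ENNReal.ofReal (bracket (2 * Real.pi * ξ - (n : ℝ) ^ 3)) *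
          ‖(𝓕 (v n) : Lp ℂ 2 (volume : Measure ℝ)) ξ‖ₑ ^ 2) := by
          refine lintegral_mono fun ξ => ?_
          rw [enorm_mul, mul_pow, ← mul_assoc]
          gcongr
          rw [← ofReal_norm, ← ENNReal.ofReal_pow (norm_nonneg _), ← ENNReal.ofReal_mul (by positivity)]
          apply ENNReal.ofReal_le_ofReal
          have : shiftSymbol c h ξ =
              Complex.exp (Complex.I * (((2 * Real.pi * ξ - (n : ℝ) ^ 3) * h : ℝ) : ℂ)) - 1 := by
            unfold shiftSymbol
            rw [hc, ← Complex.exp_add]; congr 2; push_cast; ring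
          rw [this]
          refine (norm_exp_sub_one_sq_le _).trans ?_
          rw [abs_mul]
          have h1 := abs_le_bracket (2 * Real.pi * ξ - (n : ℝ) ^ 3)
          calc _ ≤ 2 * (bracket (2 * Real.pi * ξ - (n : ℝ) ^ 3) * |h|) := by gcongr
            _ = _ := by ring
      _ = ENNReal.ofReal (2 * |h|) * (ENNReal.ofReal (2 * Real.pi) * halfNorm n (spaceTimeFT v n) ^ 2) := by
          rw [lintegral_const_mul' _ _ ENNReal.ofReal_ne_top, hid]
      _ = ENNReal.ofReal (4 * Real.pi) * (‖h‖ₑ * halfNorm n (spaceTimeFT v n) ^ 2) := by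
          rw [← ofReal_norm, Real.norm_eq_abs, ← mul_assoc, ← mul_assoc,
            ← ENNReal.ofReal_mul (by positivity), ← ENNReal.ofReal_mul (by positivity)]
          congr 2; ring
      _ ≤ ENNReal.ofReal 16 * (‖h‖ₑ * halfNorm n (spaceTimeFT v n) ^ 2) := by
          gcongr; linarith
      _ = _ := by
          rw [mul_pow]
          rw [show ENNReal.ofReal 16 = 4 ^ 2 by norm_num]
          ring

/-- Cauchy-Schwarz on a set of finite measure. -/
lemma sq_setLIntegral_le {f : ℝ → ℝ≥0∞} (hf : Measurable f) (s : Set ℝ) :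
    (∫⁻ x in s, f x) ^ 2 ≤ volume s * ∫⁻ x in s, f x ^ 2 := by
  have h := ENNReal.lintegral_mul_le_Lp_mul_Lq (volume.restrict s) Real.HolderConjugate.two_two
    hf.aemeasurable (aemeasurable_const (b := (1 : ℝ≥0∞)))
  simp only [Pi.mul_apply, mul_one, ENNReal.one_rpow, lintegral_const, Measure.restrict_apply_univ,
    one_mul] at h
  calc _ ≤ _ := pow_le_pow_left' h 2
    _ = _ := by
      rw [mul_pow, ← ENNReal.rpow_natCast, ← ENNReal.rpow_natCast, ← ENNReal.rpow_mul,
        ← ENNReal.rpow_mul]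
      norm_num
      rw [mul_comm]

lemma le_of_sq_le_sq {x y : ℝ≥0∞} (h : x ^ 2 ≤ y ^ 2) : x ≤ y :=
  (ENNReal.pow_le_pow_left_iff two_ne_zero).1 h

/-- The mean of `‖w‖` over `(t, t + h)`. -/
noncomputable def fwdMean (w : ℝ → ℂ) (h t : ℝ) : ℝ≥0∞ :=
  (ENNReal.ofReal h)⁻¹ * ∫⁻ s in Set.Ioo 0 h, ‖w (t + s)‖ₑ

/-- The mean of `‖w - w t‖` over `(t, t + h)`. -/
noncomputable def fwdDiff (w : ℝ → ℂ) (h t : ℝ) : ℝ≥0∞ :=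
  (ENNReal.ofReal h)⁻¹ * ∫⁻ s in Set.Ioo 0 h, ‖w (t + s) - w t‖ₑ

section
variable {w : ℝ → ℂ} {a : ℝ≥0∞}

lemma enorm_le_fwd (hw : Measurable w) {h : ℝ} (hh : 0 < h) (t : ℝ) :
    ‖w t‖ₑ ≤ fwdMean w h t + fwdDiff w h t := by
  have h0 : ENNReal.ofReal h ≠ 0 := by simpa using hh
  unfold fwdMean fwdDiff
  rw [← mul_add, ← lintegral_add_left (by fun_prop)]
  calc ‖w t‖ₑ = (ENNReal.ofReal h)⁻¹ * ∫⁻ s in Set.Ioo 0 h, ‖w t‖ₑ := by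
        rw [setLIntegral_const, Real.volume_Ioo, sub_zero, mul_comm ‖w t‖ₑ, ← mul_assoc,
          ENNReal.inv_mul_cancel h0 ENNReal.ofReal_ne_top, one_mul]
    _ ≤ _ := by
        gcongr with s
        calc ‖w t‖ₑ = ‖w (t + s) - (w (t + s) - w t)‖ₑ := by congr 1; ring
          _ ≤ _ := enorm_sub_le

lemma sq_mean_le {f : ℝ → ℝ≥0∞} (hf : Measurable f) {h : ℝ} (hh : 0 < h) :
    ((ENNReal.ofReal h)⁻¹ * ∫⁻ s in Set.Ioo 0 h, f s) ^ 2 ≤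
      (ENNReal.ofReal h)⁻¹ * ∫⁻ s in Set.Ioo 0 h, f s ^ 2 := by
  have h0 : ENNReal.ofReal h ≠ 0 := by simpa using hh
  have h1 := sq_setLIntegral_le hf (Set.Ioo 0 h)
  rw [Real.volume_Ioo, sub_zero] at h1
  rw [mul_pow]
  calc _ ≤ (ENNReal.ofReal h)⁻¹ ^ 2 * (ENNReal.ofReal h * ∫⁻ s in Set.Ioo 0 h, f s ^ 2) := by
        gcongr
    _ = (ENNReal.ofReal h)⁻¹ * ((ENNReal.ofReal h)⁻¹ * ENNReal.ofReal h) *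
        ∫⁻ s in Set.Ioo 0 h, f s ^ 2 := by ring
    _ = _ := by rw [ENNReal.inv_mul_cancel h0 ENNReal.ofReal_ne_top, mul_one]

lemma HalfReg.lintegral_fwdDiff_sq (hw : HalfReg w a) {h : ℝ} (hh : 0 < h) :
    ∫⁻ t, fwdDiff w h t ^ 2 ≤ ENNReal.ofReal h * a ^ 2 := by
  have h0 : ENNReal.ofReal h ≠ 0 := by simpa using hh
  have hm := hw.meas
  calc _ ≤ ∫⁻ t, (ENNReal.ofReal h)⁻¹ * ∫⁻ s in Set.Ioo 0 h, ‖w (t + s) - w t‖ₑ ^ 2 := by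
        refine lintegral_mono fun t => ?_
        exact sq_mean_le (f := fun s => ‖w (t + s) - w t‖ₑ) (by fun_prop) hh
    _ = (ENNReal.ofReal h)⁻¹ * ∫⁻ s in Set.Ioo 0 h, ∫⁻ t, ‖w (t + s) - w t‖ₑ ^ 2 := by
        rw [lintegral_const_mul' _ _ (ENNReal.inv_ne_top.2 h0), lintegral_lintegral_swap]
        fun_prop
    _ ≤ (ENNReal.ofReal h)⁻¹ * ∫⁻ s in Set.Ioo 0 h, ENNReal.ofReal h * a ^ 2 := by
        gcongr 1
        refine setLIntegral_mono' measurableSet_Ioo fun s hs => ?_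
        refine (hw.shift_le s).trans ?_
        gcongr
        rw [← ofReal_norm, Real.norm_of_nonneg hs.1.le]
        exact ENNReal.ofReal_le_ofReal hs.2.le
    _ = _ := by
        rw [setLIntegral_const, Real.volume_Ioo, sub_zero, mul_comm _ (ENNReal.ofReal h),
          ← mul_assoc, ENNReal.inv_mul_cancel h0 ENNReal.ofReal_ne_top, one_mul]

lemma lintegral_comp_add_left (f : ℝ → ℝ≥0∞) (t : ℝ) : ∫⁻ s, f (t + s) = ∫⁻ s, f s :=
  lintegral_add_left_eq_self f t

lemma HalfReg.fwdMean_one_le (hw : HalfReg w a) (t : ℝ) : fwdMean w 1 t ≤ a := by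
  have hm := hw.meas
  have h := sq_mean_le (f := fun s => ‖w (t + s)‖ₑ) (by fun_prop) one_pos
  have h2 : fwdMean w 1 t ^ 2 ≤ a ^ 2 := by
    refine h.trans ?_
    rw [ENNReal.ofReal_one, inv_one, one_mul]
    refine (setLIntegral_le_lintegral _ _).trans ?_
    rw [lintegral_comp_add_left fun s => ‖w s‖ₑ ^ 2]
    exact hw.sq_le
  exact le_of_sq_le_sq h2

lemma HalfReg.fwdMean_half_le (hw : HalfReg w a) {h : ℝ} (hh : 0 < h) (t : ℝ) :
    fwdMean w h t ≤ fwdMean w (2 * h) t + a := by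
  have h0 : ENNReal.ofReal h ≠ 0 := by simpa using hh
  have hm := hw.meas
  obtain ⟨M', hM'⟩ : ∃ M', M' = (ENNReal.ofReal h)⁻¹ * ∫⁻ s in Set.Ioo 0 h, ‖w (t + (s + h))‖ₑ :=
    ⟨_, rfl⟩
  have e1 : 2 * fwdMean w (2 * h) t = fwdMean w h t + M' := by
    have e : ∫⁻ s in Set.Ioo 0 (2 * h), ‖w (t + s)‖ₑ =
        (∫⁻ s in Set.Ioo 0 h, ‖w (t + s)‖ₑ) + ∫⁻ s in Set.Ioo 0 h, ‖w (t + (s + h))‖ₑ := by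
      have es : Set.Ioo 0 (2 * h) = Set.Ioo 0 h ∪ Set.Ico h (2 * h) :=
        (Set.Ioo_union_Ico_eq_Ioo hh (by linarith)).symm
      rw [es, lintegral_union measurableSet_Ico
        (Set.disjoint_left.2 fun x hx hy => absurd hx.2 (not_lt.2 hy.1))]
      congr 1
      rw [setLIntegral_congr Ioo_ae_eq_Ico.symm]
      have := (measurePreserving_add_right volume h).setLIntegral_comp_preimage
        (s := Set.Ioo h (2 * h)) (f := fun s => ‖w (t + s)‖ₑ) measurableSet_Ioo (by fun_prop)
      rw [← this]
      congr 2
      ext x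
      simp only [Set.mem_preimage, Set.mem_Ioo]
      constructor <;> rintro ⟨h1, h2⟩ <;> constructor <;> linarith
    rw [hM']
    unfold fwdMean
    rw [e, ← mul_add, ← mul_assoc, ENNReal.ofReal_mul (by norm_num),
      ENNReal.mul_inv (Or.inl (by simp)) (Or.inl (by simp)), ← mul_assoc]
    rw [ENNReal.ofReal_ofNat, ENNReal.mul_inv_cancel (by simp) (by simp), one_mul]
  have e2 : fwdMean w h t ≤ M' + a := by
    have hd : (ENNReal.ofReal h)⁻¹ * ∫⁻ s in Set.Ioo 0 h, ‖w (t + s + h) - w (t + s)‖ₑ ≤ a := by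
      have h1 := sq_mean_le (f := fun s => ‖w (t + s + h) - w (t + s)‖ₑ) (by fun_prop) hh
      refine le_of_sq_le_sq (h1.trans ?_)
      calc _ ≤ (ENNReal.ofReal h)⁻¹ * (ENNReal.ofReal h * a ^ 2) := by
            gcongr
            refine (setLIntegral_le_lintegral _ _).trans ?_
            rw [lintegral_comp_add_left fun s => ‖w (s + h) - w s‖ₑ ^ 2]
            refine (hw.shift_le h).trans ?_
            rw [← ofReal_norm, Real.norm_of_nonneg hh.le]
        _ = _ := by rw [← mul_assoc, ENNReal.inv_mul_cancel h0 ENNReal.ofReal_ne_top, one_mul]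
    calc _ ≤ M' + (ENNReal.ofReal h)⁻¹ * ∫⁻ s in Set.Ioo 0 h, ‖w (t + s + h) - w (t + s)‖ₑ := by
          rw [hM', ← mul_add, ← lintegral_add_left (by fun_prop)]
          unfold fwdMean
          gcongr with s
          calc ‖w (t + s)‖ₑ = ‖w (t + (s + h)) - (w (t + s + h) - w (t + s))‖ₑ := by
                rw [← add_assoc]; congr 1; ring
            _ ≤ _ := enorm_sub_le
      _ ≤ _ := by gcongr
  have e3 : 2 * fwdMean w h t ≤ 2 * (fwdMean w (2 * h) t + a) := by
    calc 2 * fwdMean w h t = fwdMean w h t + fwdMean w h t := two_mul _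
      _ ≤ fwdMean w h t + (M' + a) := by gcongr
      _ = 2 * fwdMean w (2 * h) t + a := by rw [e1, add_assoc]
      _ ≤ 2 * fwdMean w (2 * h) t + 2 * a := by
          gcongr
          exact le_mul_of_one_le_left bot_le (by norm_num)
      _ = _ := by rw [mul_add]
  exact (ENNReal.mul_le_mul_iff_right (by simp) (by simp)).1 e3

lemma HalfReg.fwdMean_le (hw : HalfReg w a) (k : ℕ) (t : ℝ) :
    fwdMean w ((1 / 2) ^ k) t ≤ (k + 1 : ℕ) * a := by
  induction k with
  | zero => simpa using hw.fwdMean_one_le t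
  | succ k ih =>
    have h := hw.fwdMean_half_le (h := (1 / 2) ^ (k + 1)) (by positivity) t
    rw [show (2 : ℝ) * (1 / 2) ^ (k + 1) = (1 / 2) ^ k by rw [pow_succ]; ring] at h
    calc _ ≤ _ := h
      _ ≤ (k + 1 : ℕ) * a + a := by gcongr
      _ = _ := by push_cast; ring

/-- The constant of the embedding into `L^{r+2}`. -/
noncomputable def embConst (r : ℕ) : ℝ≥0∞ :=
  2 ^ r + ∑' k : ℕ, ENNReal.ofReal ((2 * (k + 2)) ^ r * 4 * (1 / 2) ^ k)

lemma embConst_ne_top (r : ℕ) : embConst r ≠ ⊤ := by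
  unfold embConst
  refine ENNReal.add_ne_top.2 ⟨by simp, ?_⟩
  have hs : Summable fun k : ℕ => (2 * ((k : ℝ) + 2)) ^ r * 4 * (1 / 2) ^ k := by
    have h := summable_pow_mul_geometric_of_norm_lt_one (R := ℝ) r (r := 1 / 2) (by norm_num)
    have h2 := ((summable_nat_add_iff 2).2 h).mul_left (2 ^ r * 4 * 4)
    refine h2.congr fun k => ?_
    push_cast
    rw [mul_pow, pow_add]
    ring
  have := hs.tsum_ofReal_ne_top
  exact this

lemma one_le_embConst (r : ℕ) : 1 ≤ embConst r :=
  le_add_of_le_of_nonneg (one_le_pow₀ (by norm_num)) bot_le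

lemma HalfReg.pow_le (hw : HalfReg w a) (ha0 : a ≠ 0) (r : ℕ) (t : ℝ) :
    ‖w t‖ₑ ^ (r + 2) ≤ (2 * a) ^ r * ‖w t‖ₑ ^ 2 +
      ∑' k : ℕ, (2 * (k + 2 : ℕ) * a) ^ r * 4 * fwdDiff w ((1 / 2) ^ k) t ^ 2 := by
  by_cases hs : ‖w t‖ₑ ≤ 2 * a
  · refine le_trans ?_ le_self_add
    rw [pow_add]
    gcongr
  · push Not at hs
    obtain ⟨k, hk1, hk2⟩ : ∃ k : ℕ, 2 * (k + 1 : ℕ) * a ≤ ‖w t‖ₑ ∧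
        ‖w t‖ₑ ≤ 2 * (k + 2 : ℕ) * a := by
      have hex : ∃ m : ℕ, ‖w t‖ₑ < 2 * (m + 1 : ℕ) * a := by
        obtain ⟨m, hm⟩ := ENNReal.exists_nat_mul_gt ha0 (b := ‖w t‖ₑ) enorm_ne_top
        refine ⟨m, hm.trans_le ?_⟩
        gcongr
        push_cast
        calc (m : ℝ≥0∞) ≤ m + 1 := le_self_add
          _ ≤ _ := le_mul_of_one_le_left bot_le (by norm_num)
      classical
      have hspec := Nat.find_spec hex
      have hpos : Nat.find hex ≠ 0 := by
        intro h0
        rw [h0] at hspec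
        simp only [zero_add, Nat.cast_one, mul_one] at hspec
        exact absurd hspec (not_lt.2 hs.le)
      obtain ⟨k, hk⟩ := Nat.exists_eq_succ_of_ne_zero hpos
      refine ⟨k, ?_, ?_⟩
      · exact not_lt.1 (Nat.find_min hex (m := k) (by omega))
      · rw [hk] at hspec
        exact hspec.le
    have hd : ‖w t‖ₑ ≤ 2 * fwdDiff w ((1 / 2) ^ k) t := by
      have h1 := enorm_le_fwd hw.meas (h := (1 / 2) ^ k) (by positivity) t
      have h2 := hw.fwdMean_le k t
      have h3 : ‖w t‖ₑ + ‖w t‖ₑ ≤ 2 * fwdDiff w ((1 / 2) ^ k) t + ‖w t‖ₑ := by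
        calc ‖w t‖ₑ + ‖w t‖ₑ = 2 * ‖w t‖ₑ := (two_mul _).symm
          _ ≤ 2 * ((k + 1 : ℕ) * a + fwdDiff w ((1 / 2) ^ k) t) := by
              gcongr; exact h1.trans (by gcongr)
          _ = 2 * fwdDiff w ((1 / 2) ^ k) t + 2 * (k + 1 : ℕ) * a := by ring
          _ ≤ _ := by gcongr
      exact (ENNReal.add_le_add_iff_right enorm_ne_top).1 h3
    refine le_trans ?_ le_add_self
    refine le_trans ?_ (ENNReal.le_tsum k)
    rw [pow_add, mul_assoc]
    gcongr
    calc ‖w t‖ₑ ^ 2 ≤ (2 * fwdDiff w ((1 / 2) ^ k) t) ^ 2 := by gcongr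
      _ = _ := by rw [mul_pow]; norm_num

lemma measurable_fwdDiff (hw : Measurable w) (h : ℝ) : Measurable (fwdDiff w h) := by
  unfold fwdDiff
  refine Measurable.const_mul ?_ _
  exact Measurable.lintegral_prod_right' (f := fun z : ℝ × ℝ => ‖w (z.1 + z.2) - w z.1‖ₑ)
    (by fun_prop)

lemma HalfReg.lintegral_pow_le (hw : HalfReg w a) (r : ℕ) :
    ∫⁻ t, ‖w t‖ₑ ^ (r + 2) ≤ embConst r * a ^ (r + 2) := by
  have hm := hw.meas
  rcases eq_or_ne a 0 with ha0 | ha0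
  · have h : ∫⁻ t, ‖w t‖ₑ ^ 2 = 0 := by
      have := hw.sq_le
      rw [ha0] at this
      simpa using this
    rw [lintegral_eq_zero_iff (by fun_prop)] at h
    have : ∫⁻ t, ‖w t‖ₑ ^ (r + 2) = 0 := by
      rw [lintegral_eq_zero_iff (by fun_prop)]
      filter_upwards [h] with t ht
      have ht' : ‖w t‖ₑ ^ 2 = 0 := ht
      rw [pow_eq_zero_iff two_ne_zero] at ht'
      simp [ht']
    rw [this]
    exact bot_le
  rcases eq_or_ne a ⊤ with ha | ha
  · have : embConst r ≠ 0 := (zero_lt_one.trans_le (one_le_embConst r)).ne'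
    rw [ha, ENNReal.top_pow (by omega), ENNReal.mul_top this]
    exact le_top
  calc _ ≤ ∫⁻ t, ((2 * a) ^ r * ‖w t‖ₑ ^ 2 +
        ∑' k : ℕ, (2 * (k + 2 : ℕ) * a) ^ r * 4 * fwdDiff w ((1 / 2) ^ k) t ^ 2) :=
        lintegral_mono fun t => hw.pow_le ha0 r t
    _ = (2 * a) ^ r * (∫⁻ t, ‖w t‖ₑ ^ 2) + ∑' k : ℕ, (2 * (k + 2 : ℕ) * a) ^ r * 4 *
        ∫⁻ t, fwdDiff w ((1 / 2) ^ k) t ^ 2 := by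
        rw [lintegral_add_left (by fun_prop), lintegral_const_mul _ (by fun_prop), lintegral_tsum]
        · congr 2
          funext k
          rw [lintegral_const_mul _ ((measurable_fwdDiff hm _).pow_const 2)]
        · intro k
          exact (((measurable_fwdDiff hm _).pow_const 2).const_mul _).aemeasurable
    _ ≤ (2 * a) ^ r * a ^ 2 + ∑' k : ℕ, (2 * (k + 2 : ℕ) * a) ^ r * 4 *
        (ENNReal.ofReal ((1 / 2) ^ k) * a ^ 2) := by
        gcongr with k
        · exact hw.sq_le
        · exact hw.lintegral_fwdDiff_sq (by positivity)
    _ = _ := by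
        unfold embConst
        rw [add_mul, ← ENNReal.tsum_mul_right]
        congr 1
        · rw [mul_pow, pow_add]; ring
        · congr 1
          funext k
          rw [ENNReal.ofReal_mul (by positivity), ENNReal.ofReal_mul (by positivity),
            ENNReal.ofReal_pow (p := 2 * ((k : ℝ) + 2)) (by positivity),
            ENNReal.ofReal_mul (by norm_num)]
          have : ENNReal.ofReal ((k : ℝ) + 2) = ((k + 2 : ℕ) : ℝ≥0∞) := by
            rw [← ENNReal.ofReal_natCast]; push_cast; rfl
          rw [this, ENNReal.ofReal_ofNat, ENNReal.ofReal_ofNat, mul_pow, mul_pow, pow_add]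
          ring

end

lemma sq_lintegral_mul_le {f g : ℝ → ℝ≥0∞} (hf : Measurable f) (hg : Measurable g) :
    (∫⁻ x, f x * g x) ^ 2 ≤ (∫⁻ x, f x ^ 2) * ∫⁻ x, g x ^ 2 := by
  have h := ENNReal.lintegral_mul_le_Lp_mul_Lq volume Real.HolderConjugate.two_two
    hf.aemeasurable hg.aemeasurable
  simp only [Pi.mul_apply] at h
  calc _ ≤ _ := pow_le_pow_left' h 2
    _ = _ := by
      rw [mul_pow, ← ENNReal.rpow_natCast, ← ENNReal.rpow_natCast, ← ENNReal.rpow_mul,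
        ← ENNReal.rpow_mul]
      norm_num

lemma lintegral_prod_sq_le {ι : Type*} {s : Finset ι} (hs : s.Nonempty) {f : ι → ℝ → ℝ≥0∞}
    (hf : ∀ i, Measurable (f i)) {a : ι → ℝ≥0∞} {K : ℝ≥0∞}
    (h : ∀ i ∈ s, ∫⁻ t, f i t ^ (2 * s.card) ≤ K * a i ^ (2 * s.card)) :
    ∫⁻ t, ∏ i ∈ s, f i t ^ 2 ≤ K * ∏ i ∈ s, a i ^ 2 := by
  have hc : (s.card : ℝ) ≠ 0 := by exact_mod_cast hs.card_pos.ne'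
  have hroot : ∀ x : ℝ≥0∞, (x ^ (2 * s.card)) ^ (1 / (s.card : ℝ)) = x ^ 2 := fun x => by
    rw [← ENNReal.rpow_natCast, ← ENNReal.rpow_natCast, ← ENNReal.rpow_mul]
    congr 1
    push_cast
    field_simp
  have hh := ENNReal.lintegral_prod_norm_pow_le (μ := (volume : Measure ℝ)) s
    (f := fun i t => f i t ^ (2 * s.card)) (fun i _ => ((hf i).pow_const _).aemeasurable)
    (p := fun _ => 1 / (s.card : ℝ)) (by
      rw [Finset.sum_const, nsmul_eq_mul]; field_simp) (fun _ _ => by positivity)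
  simp only [hroot] at hh
  calc _ ≤ _ := hh
    _ ≤ ∏ i ∈ s, (K * a i ^ (2 * s.card)) ^ (1 / (s.card : ℝ)) := by
        refine Finset.prod_le_prod' fun i hi => ?_
        exact ENNReal.rpow_le_rpow (h i hi) (by positivity)
    _ = _ := by
        have : ∀ i, (K * a i ^ (2 * s.card)) ^ (1 / (s.card : ℝ)) =
            K ^ (1 / (s.card : ℝ)) * a i ^ 2 := fun i => by
          rw [ENNReal.mul_rpow_of_nonneg _ _ (by positivity), hroot]
        simp only [this]
        rw [Finset.prod_mul_distrib, Finset.prod_const, ← ENNReal.rpow_natCast, ← ENNReal.rpow_mul]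
        congr 1
        rw [one_div, inv_mul_cancel₀ hc, ENNReal.rpow_one]

lemma enorm_finset_prod {ι : Type*} (s : Finset ι) (x : ι → ℂ) :
    ‖∏ i ∈ s, x i‖ₑ = ∏ i ∈ s, ‖x i‖ₑ := by
  classical
  induction s using Finset.induction_on with
  | empty => simp
  | insert j s hj ih => rw [Finset.prod_insert hj, Finset.prod_insert hj, enorm_mul, ih]

lemma enorm_prod_sub_prod_le {ι : Type*} [DecidableEq ι] (s : Finset ι) (x y : ι → ℂ) :
    ‖∏ i ∈ s, x i - ∏ i ∈ s, y i‖ₑ ≤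
      ∑ k ∈ s, ‖x k - y k‖ₑ * ∏ i ∈ s.erase k, (‖x i‖ₑ + ‖y i‖ₑ) := by
  induction s using Finset.induction_on with
  | empty => simp
  | insert j s hj ih =>
    rw [Finset.prod_insert hj, Finset.prod_insert hj, Finset.sum_insert hj,
      Finset.erase_insert hj]
    have e : x j * ∏ i ∈ s, x i - y j * ∏ i ∈ s, y i =
        (x j - y j) * ∏ i ∈ s, x i + y j * (∏ i ∈ s, x i - ∏ i ∈ s, y i) := by ring
    rw [e]
    refine (enorm_add_le _ _).trans ?_
    rw [enorm_mul, enorm_mul]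
    refine add_le_add ?_ ?_
    · gcongr
      rw [enorm_finset_prod]
      exact Finset.prod_le_prod' fun i _ => le_self_add
    · calc _ ≤ (‖x j‖ₑ + ‖y j‖ₑ) *
            ∑ k ∈ s, ‖x k - y k‖ₑ * ∏ i ∈ s.erase k, (‖x i‖ₑ + ‖y i‖ₑ) := by
            gcongr
            exact le_add_self
        _ = _ := by
            rw [Finset.mul_sum]
            refine Finset.sum_congr rfl fun k hk => ?_
            have hkj : k ≠ j := fun h => hj (h ▸ hk)
            rw [Finset.erase_insert_of_ne hkj.symm, Finset.prod_insert
              (fun h => hj (Finset.mem_of_mem_erase h))]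
            ring

lemma ennreal_add_pow_le (x y : ℝ≥0∞) (n : ℕ) : (x + y) ^ n ≤ 2 ^ n * (x ^ n + y ^ n) := by
  rcases le_total x y with h | h
  · calc (x + y) ^ n ≤ (2 * y) ^ n := by rw [two_mul]; gcongr
      _ = 2 ^ n * y ^ n := mul_pow _ _ _
      _ ≤ _ := by gcongr; exact le_add_self
  · calc (x + y) ^ n ≤ (2 * x) ^ n := by rw [two_mul]; gcongr
      _ = 2 ^ n * x ^ n := mul_pow _ _ _
      _ ≤ _ := by gcongr; exact le_self_add

/-- A common constant for the `L¹⁰` and `L¹²` bounds. -/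
noncomputable def hexConst : ℝ≥0∞ := 2 ^ 10 * (embConst 8 + embConst 8) + embConst 10

lemma hexConst_ne_top : hexConst ≠ ⊤ := by
  have h1 := embConst_ne_top 8
  have h2 := embConst_ne_top 10
  unfold hexConst
  finiteness

lemma sqrt_sq (x : ℝ≥0∞) : (x ^ (1 / 2 : ℝ)) ^ 2 = x := by
  rw [← ENNReal.rpow_natCast, ← ENNReal.rpow_mul]
  norm_num

section
variable {w : Fin 6 → ℝ → ℂ} {a : Fin 6 → ℝ≥0∞}

lemma lintegral_prod_six_sq_le (hw : ∀ i, HalfReg (w i) (a i)) :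
    ∫⁻ t, (∏ i, ‖w i t‖ₑ) ^ 2 ≤ hexConst * (∏ i, a i) ^ 2 := by
  simp only [← Finset.prod_pow]
  refine lintegral_prod_sq_le Finset.univ_nonempty (fun i => (hw i).meas.enorm) fun i _ => ?_
  refine ((hw i).lintegral_pow_le 10).trans ?_
  simp only [Finset.card_univ, Fintype.card_fin]
  gcongr
  exact le_add_self

lemma lintegral_prod_five_sq_le (hw : ∀ i, HalfReg (w i) (a i)) (h : ℝ) (k : Fin 6) :
    ∫⁻ t, (∏ i ∈ Finset.univ.erase k, (‖w i (t + h)‖ₑ + ‖w i t‖ₑ)) ^ 2 ≤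
      hexConst * (∏ i ∈ Finset.univ.erase k, a i) ^ 2 := by
  simp only [← Finset.prod_pow]
  have hcard : (Finset.univ.erase k).card = 5 := by
    rw [Finset.card_erase_of_mem (Finset.mem_univ _)]; rfl
  refine lintegral_prod_sq_le (Finset.card_pos.1 (by omega))
    (f := fun i t => ‖w i (t + h)‖ₑ + ‖w i t‖ₑ) (fun i => ?_) fun i _ => ?_
  · have := (hw i).meas
    fun_prop
  · rw [hcard]
    have hm := (hw i).meas
    calc _ ≤ ∫⁻ t, 2 ^ (2 * 5) * (‖w i (t + h)‖ₑ ^ (2 * 5) + ‖w i t‖ₑ ^ (2 * 5)) :=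
          lintegral_mono fun t => ennreal_add_pow_le _ _ _
      _ = 2 ^ (2 * 5) * ((∫⁻ t, ‖w i t‖ₑ ^ (8 + 2)) + ∫⁻ t, ‖w i t‖ₑ ^ (8 + 2)) := by
          rw [lintegral_const_mul _ (by fun_prop), lintegral_add_left (by fun_prop),
            lintegral_add_right_eq_self (fun t => ‖w i t‖ₑ ^ (2 * 5))]
      _ ≤ 2 ^ (2 * 5) * (embConst 8 * a i ^ (8 + 2) + embConst 8 * a i ^ (8 + 2)) := by
          gcongr <;> exact (hw i).lintegral_pow_le 8
      _ = (2 ^ 10 * (embConst 8 + embConst 8)) * a i ^ (2 * 5) := by ring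
      _ ≤ _ := by
          gcongr
          exact le_self_add

lemma lintegral_prod_six_le (hw : ∀ i, HalfReg (w i) (a i)) :
    ∫⁻ t, ∏ i, ‖w i t‖ₑ ≤ hexConst ^ (1 / 2 : ℝ) * ∏ i, a i := by
  have hm : ∀ i, Measurable (w i) := fun i => (hw i).meas
  refine le_of_sq_le_sq ?_
  rw [mul_pow, sqrt_sq]
  have e : ∀ t, ∏ i, ‖w i t‖ₑ = ‖w 0 t‖ₑ * ∏ i ∈ Finset.univ.erase 0, ‖w i t‖ₑ := fun t =>
    (Finset.mul_prod_erase _ _ (Finset.mem_univ _)).symm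
  simp only [e]
  refine (sq_lintegral_mul_le (by fun_prop) (by fun_prop)).trans ?_
  calc _ ≤ a 0 ^ 2 * (hexConst * (∏ i ∈ Finset.univ.erase 0, a i) ^ 2) := by
        refine mul_le_mul' (hw 0).sq_le (le_trans ?_ (lintegral_prod_five_sq_le hw 0 0))
        refine lintegral_mono fun t => ?_
        gcongr
        exact le_add_self
    _ = hexConst * (a 0 * ∏ i ∈ Finset.univ.erase 0, a i) ^ 2 := by ring
    _ = _ := by rw [Finset.mul_prod_erase _ _ (Finset.mem_univ _)]

lemma lintegral_prod_shift_le (hw : ∀ i, HalfReg (w i) (a i)) (h : ℝ) :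
    ∫⁻ t, ‖∏ i, w i (t + h) - ∏ i, w i t‖ₑ ≤
      6 * ((‖h‖ₑ * hexConst) ^ (1 / 2 : ℝ) * ∏ i, a i) := by
  have hm : ∀ i, Measurable (w i) := fun i => (hw i).meas
  calc _ ≤ ∫⁻ t, ∑ k, ‖w k (t + h) - w k t‖ₑ *
        ∏ i ∈ Finset.univ.erase k, (‖w i (t + h)‖ₑ + ‖w i t‖ₑ) :=
        lintegral_mono fun t => enorm_prod_sub_prod_le _ _ _
    _ = ∑ k, ∫⁻ t, ‖w k (t + h) - w k t‖ₑ *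
        ∏ i ∈ Finset.univ.erase k, (‖w i (t + h)‖ₑ + ‖w i t‖ₑ) := by
        rw [lintegral_finsetSum]
        fun_prop
    _ ≤ ∑ _k : Fin 6, (‖h‖ₑ * hexConst) ^ (1 / 2 : ℝ) * ∏ i, a i := by
        refine Finset.sum_le_sum fun k _ => le_of_sq_le_sq ?_
        refine (sq_lintegral_mul_le (by fun_prop) (by fun_prop)).trans ?_
        rw [mul_pow, sqrt_sq]
        calc _ ≤ (‖h‖ₑ * a k ^ 2) * (hexConst * (∏ i ∈ Finset.univ.erase k, a i) ^ 2) :=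
              mul_le_mul' ((hw k).shift_le h) (lintegral_prod_five_sq_le hw h k)
          _ = ‖h‖ₑ * hexConst * (a k * ∏ i ∈ Finset.univ.erase k, a i) ^ 2 := by ring
          _ = _ := by rw [Finset.mul_prod_erase _ _ (Finset.mem_univ _)]
    _ = _ := by
        rw [Finset.sum_const, Finset.card_univ, Fintype.card_fin, nsmul_eq_mul]
        norm_num

lemma indicator_shift_le (s : Set ℝ) (G : ℝ → ℂ) (h t : ℝ) :
    ‖s.indicator G (t + h) - s.indicator G t‖ₑ ≤ ‖G (t + h) - G t‖ₑ +
      {t | ¬ (t + h ∈ s ↔ t ∈ s)}.indicator (fun t => ‖G t‖ₑ) t := by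
  by_cases h1 : t + h ∈ s <;> by_cases h2 : t ∈ s <;> simp [h1, h2, Set.indicator]
  calc ‖G (t + h)‖ₑ = ‖(G (t + h) - G t) + G t‖ₑ := by congr 1; ring
    _ ≤ _ := enorm_add_le _ _

lemma volume_shift_Ioc_le (α β h : ℝ) :
    volume {t | ¬ (t + h ∈ Set.Ioc α β ↔ t ∈ Set.Ioc α β)} ≤ 4 * ‖h‖ₑ := by
  have hsub : {t | ¬ (t + h ∈ Set.Ioc α β ↔ t ∈ Set.Ioc α β)} ⊆
      Set.Icc (α - |h|) (α + |h|) ∪ Set.Icc (β - |h|) (β + |h|) := by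
    intro t ht
    by_contra hc
    apply ht
    simp only [Set.mem_union, Set.mem_Icc, not_or, not_and_or, not_le] at hc
    have h1 := le_abs_self h
    have h2 := neg_abs_le h
    simp only [Set.mem_Ioc]
    obtain ⟨hα, hβ⟩ := hc
    constructor <;> rintro ⟨h3, h4⟩ <;> constructor <;>
      rcases hα with hα | hα <;> rcases hβ with hβ | hβ <;> linarith
  refine (measure_mono hsub).trans ((measure_union_le _ _).trans ?_)
  rw [Real.volume_Icc, Real.volume_Icc, ← ENNReal.ofReal_add (by linarith [abs_nonneg h])
    (by linarith [abs_nonneg h]), ← ofReal_norm, Real.norm_eq_abs,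
    show (4 : ℝ≥0∞) = ENNReal.ofReal 4 by norm_num, ← ENNReal.ofReal_mul (by norm_num)]
  exact ENNReal.ofReal_le_ofReal (by linarith)

lemma lintegral_indicator_prod_shift_le (hw : ∀ i, HalfReg (w i) (a i)) (α β h : ℝ) :
    ∫⁻ t, ‖(Set.Ioc α β).indicator (fun t => ∏ i, w i t) (t + h) -
      (Set.Ioc α β).indicator (fun t => ∏ i, w i t) t‖ₑ ≤
      8 * ((‖h‖ₑ * hexConst) ^ (1 / 2 : ℝ) * ∏ i, a i) := by
  have hm : ∀ i, Measurable (w i) := fun i => (hw i).meas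
  have hE : MeasurableSet {t | ¬ (t + h ∈ Set.Ioc α β ↔ t ∈ Set.Ioc α β)} := by
    have h1 : MeasurableSet {t | t + h ∈ Set.Ioc α β} :=
      measurable_add_const h measurableSet_Ioc
    have h2 : MeasurableSet {t | t ∈ Set.Ioc α β} := measurableSet_Ioc
    exact (MeasurableSet.iff h1 h2).compl
  calc _ ≤ ∫⁻ t, (‖∏ i, w i (t + h) - ∏ i, w i t‖ₑ +
        {t | ¬ (t + h ∈ Set.Ioc α β ↔ t ∈ Set.Ioc α β)}.indicator
          (fun t => ‖∏ i, w i t‖ₑ) t) :=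
        lintegral_mono fun t => indicator_shift_le _ _ _ _
    _ = (∫⁻ t, ‖∏ i, w i (t + h) - ∏ i, w i t‖ₑ) +
        ∫⁻ t in {t | ¬ (t + h ∈ Set.Ioc α β ↔ t ∈ Set.Ioc α β)}, ‖∏ i, w i t‖ₑ := by
        rw [lintegral_add_left (by fun_prop), lintegral_indicator hE]
    _ ≤ 6 * ((‖h‖ₑ * hexConst) ^ (1 / 2 : ℝ) * ∏ i, a i) +
        2 * ((‖h‖ₑ * hexConst) ^ (1 / 2 : ℝ) * ∏ i, a i) := by
        refine add_le_add (lintegral_prod_shift_le hw h) (le_of_sq_le_sq ?_)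
        refine (sq_setLIntegral_le (by fun_prop) _).trans ?_
        rw [mul_pow, mul_pow, sqrt_sq]
        calc _ ≤ (4 * ‖h‖ₑ) * (hexConst * (∏ i, a i) ^ 2) := by
              refine mul_le_mul' (volume_shift_Ioc_le α β h) ?_
              refine (setLIntegral_le_lintegral _ _).trans ?_
              simp only [enorm_finset_prod]
              exact lintegral_prod_six_sq_le hw
          _ = _ := by ring
    _ = _ := by ring

/-- The constant of the oscillatory integral bound. -/
noncomputable def oscConst : ℝ≥0∞ := 4 * (8 * hexConst) ^ (1 / 2 : ℝ)

lemma oscConst_ne_top : oscConst ≠ ⊤ := by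
  have := hexConst_ne_top
  unfold oscConst
  finiteness

lemma exp_half_turn {Ψ : ℝ} (hΨ : Ψ ≠ 0) (t : ℝ) :
    Complex.exp (Complex.I * (Ψ * (t + Real.pi / Ψ) : ℝ)) = -Complex.exp (Complex.I * (Ψ * t : ℝ)) := by
  have : Complex.I * (Ψ * (t + Real.pi / Ψ) : ℝ) = Complex.I * (Ψ * t : ℝ) + Real.pi * Complex.I := by
    have : Ψ * (t + Real.pi / Ψ) = Ψ * t + Real.pi := by field_simp
    rw [this]; push_cast; ring
  rw [this, Complex.exp_add, Complex.exp_pi_mul_I]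
  ring

lemma enorm_exp_I_mul (x : ℝ) : ‖Complex.exp (Complex.I * x)‖ₑ = 1 := by
  rw [← ofReal_norm, mul_comm, Complex.norm_exp_ofReal_mul_I, ENNReal.ofReal_one]

lemma two_mul_integral_osc_le {F : ℝ → ℂ} (hF : Integrable F) {Ψ : ℝ} (hΨ : Ψ ≠ 0) :
    2 * ‖∫ t, Complex.exp (Complex.I * (Ψ * t : ℝ)) * F t‖ₑ ≤
      ∫⁻ t, ‖F (t + Real.pi / Ψ) - F t‖ₑ := by
  have hint : ∀ G : ℝ → ℂ, Integrable G →
      Integrable fun t => Complex.exp (Complex.I * (Ψ * t : ℝ)) * G t := fun G hG => by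
    refine hG.bdd_mul (c := 1) (Continuous.aestronglyMeasurable (by fun_prop))
      (Filter.Eventually.of_forall fun t => ?_)
    rw [mul_comm, Complex.norm_exp_ofReal_mul_I]
  have h1 : ∫ t, Complex.exp (Complex.I * (Ψ * t : ℝ)) * F (t + Real.pi / Ψ) =
      -∫ t, Complex.exp (Complex.I * (Ψ * t : ℝ)) * F t := by
    rw [← integral_add_right_eq_self (fun t => Complex.exp (Complex.I * (Ψ * t : ℝ)) * F t)
      (Real.pi / Ψ), ← integral_neg]
    refine integral_congr_ae (Filter.Eventually.of_forall fun t => ?_)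
    simp only
    rw [exp_half_turn hΨ]
    ring
  have h2 : ∫ t, Complex.exp (Complex.I * (Ψ * t : ℝ)) * (F (t + Real.pi / Ψ) - F t) =
      -(2 * ∫ t, Complex.exp (Complex.I * (Ψ * t : ℝ)) * F t) := by
    simp only [mul_sub]
    rw [integral_sub (hint _ (hF.comp_add_right _)) (hint _ hF), h1]
    ring
  calc _ = ‖∫ t, Complex.exp (Complex.I * (Ψ * t : ℝ)) * (F (t + Real.pi / Ψ) - F t)‖ₑ := by
        rw [h2, enorm_neg, enorm_mul]
        congr 1
        rw [← ofReal_norm]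
        simp
    _ ≤ _ := by
        refine (enorm_integral_le_lintegral_enorm _).trans (le_of_eq ?_)
        refine lintegral_congr fun t => ?_
        rw [enorm_mul, enorm_exp_I_mul, one_mul]

/-- Products of six functions with half a derivative have oscillatory integrals with square root
decay in the modulation. -/
lemma enorm_integral_osc_le (hw : ∀ i, HalfReg (w i) (a i)) (α β Ψ : ℝ) :
    ‖∫ t in Set.Ioc α β, Complex.exp (Complex.I * (Ψ * t : ℝ)) * ∏ i, w i t‖ₑ ≤
      oscConst * (ENNReal.ofReal ((1 + |Ψ|) ^ (-(1 / 2 : ℝ))) * ∏ i, a i) := by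
  have hm : ∀ i, Measurable (w i) := fun i => (hw i).meas
  have hpos : 0 < 1 + |Ψ| := by positivity
  have key : ∀ c : ℝ≥0∞, c ≤ ENNReal.ofReal (8 * (1 + |Ψ|)⁻¹) →
      4 * ((c * hexConst) ^ (1 / 2 : ℝ) * ∏ i, a i) ≤
      oscConst * (ENNReal.ofReal ((1 + |Ψ|) ^ (-(1 / 2 : ℝ))) * ∏ i, a i) := by
    intro c hc
    unfold oscConst
    rw [show 4 * (8 * hexConst) ^ (1 / 2 : ℝ) *
        (ENNReal.ofReal ((1 + |Ψ|) ^ (-(1 / 2 : ℝ))) * ∏ i, a i) =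
      4 * ((8 * hexConst) ^ (1 / 2 : ℝ) * ENNReal.ofReal ((1 + |Ψ|) ^ (-(1 / 2 : ℝ))) * ∏ i, a i) by
        ring]
    refine mul_le_mul' le_rfl (mul_le_mul' ?_ le_rfl)
    calc _ ≤ (ENNReal.ofReal (8 * (1 + |Ψ|)⁻¹) * hexConst) ^ (1 / 2 : ℝ) := by gcongr
      _ = (8 * hexConst * ENNReal.ofReal ((1 + |Ψ|)⁻¹)) ^ (1 / 2 : ℝ) := by
          rw [ENNReal.ofReal_mul (by norm_num), ENNReal.ofReal_ofNat]
          congr 1; ring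
      _ = _ := by
          rw [ENNReal.mul_rpow_of_nonneg _ _ (by norm_num),
            ENNReal.ofReal_rpow_of_nonneg (by positivity) (by norm_num),
            Real.inv_rpow hpos.le, Real.rpow_neg hpos.le]
  by_cases hΨ : 1 ≤ |Ψ|
  · have hΨ0 : Ψ ≠ 0 := by
      rintro rfl
      norm_num at hΨ
    obtain ⟨F, hF⟩ : ∃ F, F = (Set.Ioc α β).indicator (fun t => ∏ i, w i t) := ⟨_, rfl⟩
    have e : ∫ t in Set.Ioc α β, Complex.exp (Complex.I * (Ψ * t : ℝ)) * ∏ i, w i t =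
        ∫ t, Complex.exp (Complex.I * (Ψ * t : ℝ)) * F t := by
      rw [← integral_indicator measurableSet_Ioc, hF]
      refine integral_congr_ae (Filter.Eventually.of_forall fun t => ?_)
      simp only [Set.indicator]
      split_ifs <;> simp
    rw [e]
    by_cases hint : Integrable F
    · have h1 := two_mul_integral_osc_le hint hΨ0
      have h2 := lintegral_indicator_prod_shift_le hw α β (Real.pi / Ψ)
      rw [← hF] at h2
      have h3 : 2 * ‖∫ t, Complex.exp (Complex.I * (Ψ * t : ℝ)) * F t‖ₑ ≤
          2 * (4 * ((‖Real.pi / Ψ‖ₑ * hexConst) ^ (1 / 2 : ℝ) * ∏ i, a i)) := by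
        refine h1.trans (h2.trans (le_of_eq ?_))
        ring
      refine ((ENNReal.mul_le_mul_iff_right (by simp) (by simp)).1 h3).trans (key _ ?_)
      rw [← ofReal_norm]
      apply ENNReal.ofReal_le_ofReal
      rw [norm_div, Real.norm_of_nonneg Real.pi_pos.le, Real.norm_eq_abs, ← div_eq_mul_inv,
        div_le_div_iff₀ (by linarith) hpos]
      nlinarith [Real.pi_le_four, Real.pi_pos]
    · rw [integral_undef]
      · simp
      · intro h
        apply hint
        have h' : Integrable fun t => Complex.exp (Complex.I * ((-Ψ) * t : ℝ)) *
            (Complex.exp (Complex.I * (Ψ * t : ℝ)) * F t) := by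
          refine h.bdd_mul (c := 1) (Continuous.aestronglyMeasurable (by fun_prop))
            (Filter.Eventually.of_forall fun t => ?_)
          rw [mul_comm, Complex.norm_exp_ofReal_mul_I]
        refine h'.congr (Filter.Eventually.of_forall fun t => ?_)
        simp only
        rw [← mul_assoc, ← Complex.exp_add]
        have : Complex.I * ((-Ψ) * t : ℝ) + Complex.I * (Ψ * t : ℝ) = 0 := by push_cast; ring
        rw [this, Complex.exp_zero, one_mul]
  · push Not at hΨ
    refine le_trans ?_ (key 1 ?_)
    · calc _ ≤ ∫⁻ t in Set.Ioc α β, ‖Complex.exp (Complex.I * (Ψ * t : ℝ)) * ∏ i, w i t‖ₑ :=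
            enorm_integral_le_lintegral_enorm _
        _ ≤ ∫⁻ t, ‖Complex.exp (Complex.I * (Ψ * t : ℝ)) * ∏ i, w i t‖ₑ :=
            setLIntegral_le_lintegral _ _
        _ = ∫⁻ t, ∏ i, ‖w i t‖ₑ := by
            refine lintegral_congr fun t => ?_
            rw [enorm_mul, enorm_exp_I_mul, one_mul, enorm_finset_prod]
        _ ≤ hexConst ^ (1 / 2 : ℝ) * ∏ i, a i := lintegral_prod_six_le hw
        _ ≤ _ := by
            rw [one_mul]
            exact le_mul_of_one_le_left bot_le (by norm_num)
    · rw [ENNReal.one_le_ofReal, ← div_eq_mul_inv, le_div_iff₀ hpos]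
      linarith

end

/-- The reciprocal `1 / (1 + |n|)`. -/
noncomputable def rec1 (n : ℤ) : ℝ := (1 + |(n : ℝ)|)⁻¹

lemma rec1_pos (n : ℤ) : 0 < rec1 n := by unfold rec1; positivity

lemma rec1_le_one (n : ℤ) : rec1 n ≤ 1 :=
  inv_le_one_of_one_le₀ (by linarith [abs_nonneg (n : ℝ)])

lemma abs_mul_rec1_le (n : ℤ) : |(n : ℝ)| * rec1 n ≤ 1 := by
  unfold rec1
  rw [← div_eq_mul_inv, div_le_one (by positivity)]
  linarith

lemma add_le_mul_one_add {x y : ℝ} (hx : 1 ≤ x) (hy : 0 ≤ y) : x + y ≤ x * (1 + y) := by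
  have := le_mul_of_one_le_left hy hx
  linarith

lemma rec1_mul_le (n₁ n₂ n₃ : ℤ) : rec1 n₁ * rec1 n₂ * rec1 n₃ ≤ rec1 (n₁ - n₂ + n₃) := by
  unfold rec1
  rw [← mul_inv, ← mul_inv]
  apply inv_anti₀ (by positivity)
  push_cast
  have h1 := abs_add_le ((n₁ : ℝ) - n₂) n₃
  have h2 := abs_sub (n₁ : ℝ) n₂
  have p1 := abs_nonneg (n₁ : ℝ)
  have p2 := abs_nonneg (n₂ : ℝ)
  have p3 := abs_nonneg (n₃ : ℝ)
  have q1 := add_le_mul_one_add (x := 1 + |(n₁ : ℝ)|) (by linarith) p2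
  have q2 := add_le_mul_one_add (x := (1 + |(n₁ : ℝ)|) * (1 + |(n₂ : ℝ)|)) (by linarith) p3
  linarith

lemma summable_rec1_sq : Summable fun n : ℤ => rec1 n ^ 2 := by
  have h : Summable fun n : ℕ => 1 / ((n : ℝ) + 1) ^ 2 := by
    have := (summable_nat_add_iff 1).2 (Real.summable_one_div_nat_pow.2 (by norm_num : 1 < 2))
    simpa using this
  refine Summable.of_nat_of_neg ?_ ?_ <;>
  · refine h.congr fun n => ?_
    unfold rec1
    push_cast
    rw [inv_pow, one_div]
    simp [add_comm]

/-- The fourth frequency of the quadruple `(n, (n₁, n₂))`. -/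
abbrev thd (x : ℤ × (ℤ × ℤ)) : ℤ := x.1 - x.2.1 + x.2.2

lemma thd_sub (x : ℤ × (ℤ × ℤ)) : x.2.1 - x.2.2 + thd x = x.1 := by unfold thd; ring

lemma summable_prod_mul {ι κ : Type*} {f : ι → ℝ} {g : κ → ℝ} (hf : Summable f) (hg : Summable g)
    (hf0 : ∀ i, 0 ≤ f i) (hg0 : ∀ i, 0 ≤ g i) : Summable fun x : ι × κ => f x.1 * g x.2 :=
  hf.mul_of_nonneg hg hf0 hg0

lemma summable_pair : Summable fun x : ℤ × ℤ => rec1 x.1 ^ 2 * rec1 x.2 ^ 2 :=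
  summable_prod_mul (f := fun n => rec1 n ^ 2) (g := fun n => rec1 n ^ 2) summable_rec1_sq
    summable_rec1_sq (fun _ => sq_nonneg _) fun _ => sq_nonneg _

lemma summable_quad : Summable fun x : ℤ × (ℤ × ℤ) => rec1 x.1 ^ 2 * (rec1 x.2.1 ^ 2 * rec1 x.2.2 ^ 2) :=
  summable_prod_mul (f := fun n => rec1 n ^ 2) (g := fun x : ℤ × ℤ => rec1 x.1 ^ 2 * rec1 x.2 ^ 2)
    summable_rec1_sq summable_pair (fun _ => sq_nonneg _) fun _ => by positivity

lemma summable_hex : Summable fun x : ℤ × (ℤ × ℤ) × (ℤ × ℤ) => rec1 x.1 ^ 2 *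
    ((rec1 x.2.1.1 ^ 2 * rec1 x.2.1.2 ^ 2) * (rec1 x.2.2.1 ^ 2 * rec1 x.2.2.2 ^ 2)) :=
  summable_prod_mul (f := fun n => rec1 n ^ 2) (g := fun x : (ℤ × ℤ) × (ℤ × ℤ) =>
      (rec1 x.1.1 ^ 2 * rec1 x.1.2 ^ 2) * (rec1 x.2.1 ^ 2 * rec1 x.2.2 ^ 2))
    summable_rec1_sq
    (summable_prod_mul (f := fun x : ℤ × ℤ => rec1 x.1 ^ 2 * rec1 x.2 ^ 2)
      (g := fun x : ℤ × ℤ => rec1 x.1 ^ 2 * rec1 x.2 ^ 2) summable_pair summable_pair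
      (fun _ => by positivity) fun _ => by positivity) (fun _ => sq_nonneg _) fun _ => by positivity

lemma one_le_abs_mul {n₁ n₂ n₃ : ℤ} (h : n₁ ≠ n₂ ∧ n₃ ≠ n₂) :
    1 ≤ |((n₁ : ℝ) - n₂) * (n₃ - n₂)| := by
  have h1 : 1 ≤ |(n₁ - n₂) * (n₃ - n₂)| :=
    Int.one_le_abs (mul_ne_zero (sub_ne_zero.2 h.1) (sub_ne_zero.2 h.2))
  exact_mod_cast h1

lemma abs_psi4_mul_le (N : ℕ) (n₁ n₂ n₃ : ℤ) : |psi4 N n₁ n₂ n₃| *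
    (rec1 n₁ * rec1 n₂ * rec1 n₃ * rec1 (n₁ - n₂ + n₃)) ≤ 1 := by
  have hb : |psi4 N n₁ n₂ n₃| ≤
      |(n₁ : ℝ)| + |(n₂ : ℝ)| + |(n₃ : ℝ)| + |((n₁ - n₂ + n₃ : ℤ) : ℝ)| := by
    unfold psi4
    have h1 := abs_psi_le N n₁
    have h2 := abs_psi_le N n₂
    have h3 := abs_psi_le N n₃
    have h4 := abs_psi_le N (n₁ - n₂ + n₃)
    refine (abs_sub _ _).trans ?_
    have h5 := abs_sub (psi N n₂ + psi N (n₁ - n₂ + n₃)) (psi N n₁)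
    have h6 := abs_add_le (psi N n₂) (psi N (n₁ - n₂ + n₃))
    linarith
  unfold rec1
  rw [← mul_inv, ← mul_inv, ← mul_inv, ← div_eq_mul_inv, div_le_one (by positivity)]
  refine hb.trans ?_
  obtain ⟨x1, e1⟩ : ∃ x, x = |(n₁ : ℝ)| := ⟨_, rfl⟩
  obtain ⟨x2, e2⟩ : ∃ x, x = |(n₂ : ℝ)| := ⟨_, rfl⟩
  obtain ⟨x3, e3⟩ : ∃ x, x = |(n₃ : ℝ)| := ⟨_, rfl⟩
  obtain ⟨x4, e4⟩ : ∃ x, x = |((n₁ - n₂ + n₃ : ℤ) : ℝ)| := ⟨_, rfl⟩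
  have p1 : 0 ≤ x1 := e1 ▸ abs_nonneg _
  have p2 : 0 ≤ x2 := e2 ▸ abs_nonneg _
  have p3 : 0 ≤ x3 := e3 ▸ abs_nonneg _
  have p4 : 0 ≤ x4 := e4 ▸ abs_nonneg _
  rw [← e1, ← e2, ← e3, ← e4]
  have q1 : 1 + x1 + x2 ≤ (1 + x1) * (1 + x2) := add_le_mul_one_add (by linarith) p2
  have q2 : 1 + x1 + x2 + x3 ≤ (1 + x1) * (1 + x2) * (1 + x3) :=
    (add_le_add_left q1 x3).trans (add_le_mul_one_add (by linarith) p3)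
  have q3 := add_le_mul_one_add (x := (1 + x1) * (1 + x2) * (1 + x3)) (by linarith) p4
  linarith

lemma abs_beta_mul_le (N : ℕ) (n₁ n₂ n₃ : ℤ) : |beta N n₁ n₂ n₃| *
    (rec1 n₁ * rec1 n₂ * rec1 n₃ * rec1 (n₁ - n₂ + n₃)) ≤ 1 := by
  by_cases h : n₁ ≠ n₂ ∧ n₃ ≠ n₂
  · refine le_trans (mul_le_mul_of_nonneg_right ?_ ?_) (abs_psi4_mul_le N n₁ n₂ n₃)
    · unfold beta
      rw [abs_div]
      exact div_le_self (abs_nonneg _) (one_le_abs_mul h)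
    · have := fun n => (rec1_pos n).le
      exact mul_nonneg (mul_nonneg (mul_nonneg (this _) (this _)) (this _)) (this _)
  · rw [beta_eq_zero h, abs_zero, zero_mul]
    exact zero_le_one

lemma abs_freqSum_mul_le (n₁ n₂ n₃ : ℤ) : |freqSum n₁ n₂ n₃| * (rec1 n₁ * rec1 n₃) ≤ 1 := by
  unfold freqSum rec1
  rw [← mul_inv, ← div_eq_mul_inv, div_le_one (by positivity)]
  have h := abs_add_le (n₁ : ℝ) n₃
  have h1 := abs_nonneg (n₁ : ℝ)
  have h3 := abs_nonneg (n₃ : ℝ)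
  split_ifs
  · nlinarith
  · rw [abs_zero]; positivity

/-- Exchange of `n₂` and `n`. -/
def exchTwo : Equiv.Perm (ℤ × (ℤ × ℤ)) :=
  Function.Involutive.toPerm (fun x => (x.2.2, (x.2.1, x.1))) fun _ => rfl

/-- The involution `n ↔ n₁`, `n₂ ↔ n₃`. -/
def exchOne : Equiv.Perm (ℤ × (ℤ × ℤ)) :=
  Function.Involutive.toPerm (fun x => (x.2.1, (x.1, thd x))) fun x => by
    refine Prod.ext rfl (Prod.ext rfl ?_)
    change x.2.1 - x.1 + (x.1 - x.2.1 + x.2.2) = x.2.2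
    ring

/-- Exchange of `n₁` and `n₃`. -/
def exchOdd : Equiv.Perm (ℤ × (ℤ × ℤ)) :=
  Function.Involutive.toPerm (fun x => (x.1, (thd x, x.2.2))) fun x => by
    refine Prod.ext rfl (Prod.ext ?_ rfl)
    change x.1 - (x.1 - x.2.1 + x.2.2) + x.2.2 = x.2.1
    ring

section involutions

variable {α : Type*} [AddCommMonoid α] [TopologicalSpace α]

lemma tsum_exchTwo (F : ℤ → ℤ → ℤ → ℤ → α) :
    ∑' x : ℤ × (ℤ × ℤ), F x.2.1 x.2.2 (thd x) x.1 =
      ∑' x : ℤ × (ℤ × ℤ), F x.2.1 x.1 (thd x) x.2.2 := by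
  rw [← exchTwo.tsum_eq]
  refine tsum_congr fun x => ?_
  have : thd (exchTwo x) = thd x := by
    change x.2.2 - x.2.1 + x.1 = x.1 - x.2.1 + x.2.2
    ring
  rw [this]
  rfl

lemma tsum_exchOne (F : ℤ → ℤ → ℤ → ℤ → α) :
    ∑' x : ℤ × (ℤ × ℤ), F x.2.1 x.2.2 (thd x) x.1 =
      ∑' x : ℤ × (ℤ × ℤ), F x.1 (thd x) x.2.2 x.2.1 := by
  rw [← exchOne.tsum_eq]
  refine tsum_congr fun x => ?_
  have : thd (exchOne x) = x.2.2 := by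
    change x.2.1 - x.1 + (x.1 - x.2.1 + x.2.2) = x.2.2
    ring
  rw [this]
  rfl

lemma tsum_exchOdd (F : ℤ → ℤ → ℤ → ℤ → α) :
    ∑' x : ℤ × (ℤ × ℤ), F x.2.1 x.2.2 (thd x) x.1 =
      ∑' x : ℤ × (ℤ × ℤ), F (thd x) x.2.2 x.2.1 x.1 := by
  rw [← exchOdd.tsum_eq]
  refine tsum_congr fun x => ?_
  have : thd (exchOdd x) = x.2.1 := by
    change x.1 - (x.1 - x.2.1 + x.2.2) + x.2.2 = x.2.1
    ring
  rw [this]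
  rfl

end involutions

lemma beta_exchTwo (N : ℕ) (n₁ n₂ n₃ : ℤ) :
    beta N n₁ (n₁ - n₂ + n₃) n₃ = beta N n₁ n₂ n₃ := by
  unfold beta psi4
  rw [show n₁ - (n₁ - n₂ + n₃) + n₃ = n₂ by ring]
  push_cast
  congr 1 <;> ring

lemma beta_exchOne (N : ℕ) (n₁ n₂ n₃ : ℤ) :
    beta N (n₁ - n₂ + n₃) n₃ n₂ = beta N n₁ n₂ n₃ := by
  unfold beta psi4
  rw [show n₁ - n₂ + n₃ - n₃ + n₂ = n₁ by ring]
  push_cast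
  rw [← neg_div_neg_eq]
  congr 1 <;> ring

lemma freqSum_exchTwo (n₁ n₂ n₃ : ℤ) : freqSum n₁ (n₁ - n₂ + n₃) n₃ = freqSum n₁ n₂ n₃ := by
  unfold freqSum
  refine if_congr ?_ rfl rfl
  constructor <;> rintro ⟨h1, h2⟩ <;> constructor <;> omega

lemma freqSum_exchOne (n₁ n₂ n₃ : ℤ) : freqSum (n₁ - n₂ + n₃) n₃ n₂ = freqSum n₁ n₂ n₃ := by
  unfold freqSum
  push_cast
  rw [show (n₁ : ℝ) - n₂ + n₃ + n₂ = n₁ + n₃ by ring]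
  refine if_congr ?_ rfl rfl
  constructor <;> rintro ⟨h1, h2⟩ <;> constructor <;> omega

lemma freqSum_swap (n₁ n₂ n₃ : ℤ) : freqSum n₃ n₂ n₁ = freqSum n₁ n₂ n₃ := by
  unfold freqSum
  rw [add_comm]
  exact if_congr and_comm rfl rfl

lemma beta_mul_jk (N : ℕ) (n₁ n₂ n₃ : ℤ) :
    beta N n₁ n₂ n₃ * (((n₁ : ℝ) + n₃) * (n₁ - n₂) * (n₃ - n₂)) =
      freqSum n₁ n₂ n₃ * psi4 N n₁ n₂ n₃ := by
  by_cases h : n₁ ≠ n₂ ∧ n₃ ≠ n₂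
  · have h1 : (n₁ : ℝ) - n₂ ≠ 0 := sub_ne_zero.2 (by exact_mod_cast h.1)
    have h2 : (n₃ : ℝ) - n₂ ≠ 0 := sub_ne_zero.2 (by exact_mod_cast h.2)
    unfold beta freqSum
    rw [if_pos h]
    field_simp
  · rw [beta_eq_zero h]
    unfold freqSum
    rw [if_neg h]
    ring

/-- The trilinear expression `a(n₁) conj (b(n₂)) e(n₃)`. -/
noncomputable def tri (a b e : ℤ → ℂ) (n₁ n₂ n₃ : ℤ) : ℂ := a n₁ * starRingEnd ℂ (b n₂) * e n₃

/-- The quadrilinear expression `a(n₁) conj (b(n₂)) e(n₃) conj (f(n))`. -/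
noncomputable def quad (a b e f : ℤ → ℂ) (n₁ n₂ n₃ n : ℤ) : ℂ :=
  tri a b e n₁ n₂ n₃ * starRingEnd ℂ (f n)

/-- The nonlinearity of the renormalized equation in terms of Fourier coefficients. -/
noncomputable def nonlin (c : ℤ → ℂ) (n : ℤ) : ℂ :=
  1 / 2 * ∑' y : ℤ × ℤ, (freqSum y.1 y.2 (thd (n, y)) : ℂ) * tri c c c y.1 y.2 (thd (n, y)) -
    (n * ‖c n‖ ^ 2 : ℝ) * c n

/-- Polynomial decay. -/
def Dec (k : ℕ) (C : ℝ) (a : ℤ → ℂ) : Prop := ∀ n, ‖a n‖ ≤ C * rec1 n ^ k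

lemma Dec.nonneg {k : ℕ} {C : ℝ} {a : ℤ → ℂ} (h : Dec k C a) : 0 ≤ C := by
  have := (norm_nonneg _).trans (h 0)
  exact nonneg_of_mul_nonneg_left this (pow_pos (rec1_pos 0) k)

lemma Dec.mono {k l : ℕ} {C D : ℝ} {a : ℤ → ℂ} (h : Dec k C a) (hl : l ≤ k) (hC : C ≤ D) :
    Dec l D a := fun n => (h n).trans (mul_le_mul hC
  (pow_le_pow_of_le_one (rec1_pos n).le (rec1_le_one n) hl) (pow_pos (rec1_pos n) k).le
  (h.nonneg.trans hC))

lemma norm_tri_le {k : ℕ} {C : ℝ} {a b e : ℤ → ℂ} (ha : Dec k C a) (hb : Dec k C b) (he : Dec k C e)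
    (n₁ n₂ n₃ : ℤ) : ‖tri a b e n₁ n₂ n₃‖ ≤ C ^ 3 * (rec1 n₁ * rec1 n₂ * rec1 n₃) ^ k := by
  unfold tri
  rw [norm_mul, norm_mul, RCLike.norm_conj]
  have hC := ha.nonneg
  have p1 := rec1_pos n₁
  have p2 := rec1_pos n₂
  have p3 := rec1_pos n₃
  calc _ ≤ (C * rec1 n₁ ^ k) * (C * rec1 n₂ ^ k) * (C * rec1 n₃ ^ k) := by
        gcongr
        · exact ha n₁
        · exact hb n₂
        · exact he n₃
    _ = _ := by rw [mul_pow, mul_pow]; ring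

lemma norm_quad_le {k : ℕ} {C : ℝ} {a b e f : ℤ → ℂ} (ha : Dec k C a) (hb : Dec k C b)
    (he : Dec k C e) (hf : Dec k C f) (n₁ n₂ n₃ n : ℤ) :
    ‖quad a b e f n₁ n₂ n₃ n‖ ≤ C ^ 4 * (rec1 n₁ * rec1 n₂ * rec1 n₃ * rec1 n) ^ k := by
  unfold quad
  rw [norm_mul, RCLike.norm_conj]
  have hC := ha.nonneg
  have p1 := rec1_pos n₁
  have p2 := rec1_pos n₂
  have p3 := rec1_pos n₃
  have p4 := rec1_pos n
  calc _ ≤ (C ^ 3 * (rec1 n₁ * rec1 n₂ * rec1 n₃) ^ k) * (C * rec1 n ^ k) := by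
        gcongr
        · exact norm_tri_le ha hb he _ _ _
        · exact hf n
    _ = _ := by rw [mul_pow _ (rec1 n)]; ring

lemma pow_mul_le_of_le_one {x r : ℝ} {k l m : ℕ} (hx0 : 0 ≤ x) (hr0 : 0 < r) (hr1 : r ≤ 1)
    (hx : x * r ^ k ≤ 1) (hklm : k + l ≤ m) : x * r ^ m ≤ r ^ l := by
  have : r ^ m ≤ r ^ (k + l) := pow_le_pow_of_le_one hr0.le hr1 hklm
  calc x * r ^ m ≤ x * r ^ (k + l) := by gcongr
    _ = x * r ^ k * r ^ l := by rw [pow_add]; ring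
    _ ≤ 1 * r ^ l := by gcongr
    _ = _ := one_mul _

lemma prod_four_le {r₁ r₂ r₃ r : ℝ} (h₁ : 0 < r₁) (h₂ : 0 < r₂) (h₃ : 0 < r₃) (h : 0 < r)
    (h₃' : r₃ ≤ 1) : (r₁ * r₂ * r₃ * r) ^ 2 ≤ r ^ 2 * (r₁ ^ 2 * r₂ ^ 2) := by
  have : r₃ ^ 2 ≤ 1 := pow_le_one₀ h₃.le h₃'
  calc _ = r ^ 2 * (r₁ ^ 2 * r₂ ^ 2) * r₃ ^ 2 := by ring
    _ ≤ _ := mul_le_of_le_one_right (by positivity) this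

/-- Summability over quadruples of frequencies. -/
lemma summable_quad_of_le {f : ℤ × (ℤ × ℤ) → ℝ} {D : ℝ}
    (h : ∀ x, |f x| ≤ D * (rec1 x.2.1 * rec1 x.2.2 * rec1 (thd x) * rec1 x.1) ^ 2) (hD : 0 ≤ D) :
    Summable f := by
  refine Summable.of_norm_bounded (summable_quad.mul_left D) fun x => ?_
  rw [Real.norm_eq_abs]
  refine (h x).trans ?_
  gcongr
  exact prod_four_le (rec1_pos _) (rec1_pos _) (rec1_pos _) (rec1_pos _) (rec1_le_one _)

lemma rec_four_le_one (n₁ n₂ n₃ n : ℤ) : rec1 n₁ * rec1 n₂ * rec1 n₃ * rec1 n ≤ 1 :=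
  mul_le_one₀ (mul_le_one₀ (mul_le_one₀ (rec1_le_one _) (rec1_pos _).le (rec1_le_one _))
    (rec1_pos _).le (rec1_le_one _)) (rec1_pos _).le (rec1_le_one _)

lemma rec_four_pos (n₁ n₂ n₃ n : ℤ) : 0 < rec1 n₁ * rec1 n₂ * rec1 n₃ * rec1 n :=
  mul_pos (mul_pos (mul_pos (rec1_pos _) (rec1_pos _)) (rec1_pos _)) (rec1_pos _)

/-- Summability of multiples of quadrilinear expressions by polynomially bounded coefficients. -/
lemma summable_mul_quad {k : ℕ} {C : ℝ} {a b e f : ℤ → ℂ} (ha : Dec (k + 2) C a)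
    (hb : Dec (k + 2) C b) (he : Dec (k + 2) C e) (hf : Dec (k + 2) C f) {β : ℤ × (ℤ × ℤ) → ℝ}
    (hβ : ∀ x, |β x| * (rec1 x.2.1 * rec1 x.2.2 * rec1 (thd x) * rec1 x.1) ^ k ≤ 1) :
    Summable fun x : ℤ × (ℤ × ℤ) => β x * (quad a b e f x.2.1 x.2.2 (thd x) x.1).im := by
  have hC := ha.nonneg
  refine summable_quad_of_le (D := C ^ 4) (fun x => ?_) (by positivity)
  have hq := norm_quad_le ha hb he hf x.2.1 x.2.2 (thd x) x.1
  have hr := rec_four_pos x.2.1 x.2.2 (thd x) x.1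
  have hr1 := rec_four_le_one x.2.1 x.2.2 (thd x) x.1
  rw [abs_mul]
  calc _ ≤ |β x| * (C ^ 4 * (rec1 x.2.1 * rec1 x.2.2 * rec1 (thd x) * rec1 x.1) ^ (k + 2)) := by
        gcongr
        exact (Complex.abs_im_le_norm _).trans hq
    _ = C ^ 4 * (|β x| * (rec1 x.2.1 * rec1 x.2.2 * rec1 (thd x) * rec1 x.1) ^ (k + 2)) := by ring
    _ ≤ _ := by
        gcongr
        exact pow_mul_le_of_le_one (abs_nonneg _) hr hr1 (hβ x) le_rfl

lemma abs_beta_thd_le (N : ℕ) (x : ℤ × (ℤ × ℤ)) : |beta N x.2.1 x.2.2 (thd x)| *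
    (rec1 x.2.1 * rec1 x.2.2 * rec1 (thd x) * rec1 x.1) ^ 1 ≤ 1 := by
  have := abs_beta_mul_le N x.2.1 x.2.2 (thd x)
  rwa [thd_sub, ← pow_one (_ * rec1 x.1)] at this

lemma abs_psi_mul_le (N : ℕ) (n : ℤ) : |psi N n| * rec1 n ≤ 1 :=
  (mul_le_mul_of_nonneg_right (abs_psi_le N n) (rec1_pos n).le).trans (abs_mul_rec1_le n)

lemma abs_freqSum_four_le (n₁ n₂ n₃ n : ℤ) :
    |freqSum n₁ n₂ n₃| * (rec1 n₁ * rec1 n₂ * rec1 n₃ * rec1 n) ≤ 1 := by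
  have h := abs_freqSum_mul_le n₁ n₂ n₃
  have h2 : rec1 n₂ * rec1 n ≤ 1 := mul_le_one₀ (rec1_le_one _) (rec1_pos _).le (rec1_le_one _)
  have h3 := (rec1_pos n₁).le
  have h4 := (rec1_pos n₃).le
  calc _ = |freqSum n₁ n₂ n₃| * (rec1 n₁ * rec1 n₃) * (rec1 n₂ * rec1 n) := by ring
    _ ≤ |freqSum n₁ n₂ n₃| * (rec1 n₁ * rec1 n₃) * 1 := by gcongr
    _ ≤ 1 := by rw [mul_one]; exact h

lemma abs_mul_four_le {p q r : ℝ} (hp : |p| * r ≤ 1) (hq : |q| * r ≤ 1) (hr : 0 ≤ r) :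
    |p * q| * r ^ 2 ≤ 1 := by
  calc _ = (|p| * r) * (|q| * r) := by rw [abs_mul]; ring
    _ ≤ 1 * 1 := by gcongr
    _ = 1 := one_mul 1

/-- Summability of the terms of the nonlinearity. -/
lemma norm_freqSum_tri_le {C : ℝ} {c : ℤ → ℂ} (hc : Dec 8 C c) (n : ℤ) (y : ℤ × ℤ) :
    ‖(freqSum y.1 y.2 (thd (n, y)) : ℂ) * tri c c c y.1 y.2 (thd (n, y))‖ ≤
      C ^ 3 * rec1 n ^ 5 * (rec1 y.1 ^ 2 * rec1 y.2 ^ 2) := by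
  have hC := hc.nonneg
  rw [norm_mul, Complex.norm_real, Real.norm_eq_abs]
  obtain ⟨m, hm⟩ : ∃ m, m = thd (n, y) := ⟨_, rfl⟩
  have h1 := norm_tri_le hc hc hc y.1 y.2 m
  have h2 := abs_freqSum_mul_le y.1 y.2 m
  have h3 := rec1_mul_le y.1 y.2 m
  have e : y.1 - y.2 + m = n := by rw [hm]; simp [thd]
  rw [e] at h3
  rw [← hm]
  have p1 := rec1_pos y.1
  have p2 := rec1_pos y.2
  have p3 := rec1_pos m
  have p4 := rec1_pos n
  calc _ ≤ |freqSum y.1 y.2 m| * (C ^ 3 * (rec1 y.1 * rec1 y.2 * rec1 m) ^ 8) := by gcongr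
    _ = C ^ 3 * (|freqSum y.1 y.2 m| * (rec1 y.1 * rec1 m)) * (rec1 y.1 * rec1 y.2 * rec1 m) ^ 5 *
        (rec1 y.1 ^ 2 * rec1 y.2 ^ 2) * (rec1 y.2 * rec1 m ^ 2) := by ring
    _ ≤ C ^ 3 * 1 * rec1 n ^ 5 * (rec1 y.1 ^ 2 * rec1 y.2 ^ 2) * (1 * 1 ^ 2) := by
        gcongr
        · exact rec1_le_one _
        · exact rec1_le_one _
    _ = _ := by ring

lemma summable_freqSum_tri {C : ℝ} {c : ℤ → ℂ} (hc : Dec 8 C c) (n : ℤ) :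
    Summable fun y : ℤ × ℤ => (freqSum y.1 y.2 (thd (n, y)) : ℂ) * tri c c c y.1 y.2 (thd (n, y)) :=
  Summable.of_norm_bounded (summable_pair.mul_left _) (norm_freqSum_tri_le hc n)

lemma dec_nonlin {C : ℝ} {c : ℤ → ℂ} (hc : Dec 8 C c) :
    Dec 5 (C ^ 3 * (∑' y : ℤ × ℤ, rec1 y.1 ^ 2 * rec1 y.2 ^ 2) + C ^ 3) (nonlin c) := by
  intro n
  have hC := hc.nonneg
  have p := rec1_pos n
  unfold nonlin
  refine (norm_sub_le _ _).trans ?_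
  have h1 : ‖∑' y : ℤ × ℤ, (freqSum y.1 y.2 (thd (n, y)) : ℂ) * tri c c c y.1 y.2 (thd (n, y))‖ ≤
      C ^ 3 * rec1 n ^ 5 * ∑' y : ℤ × ℤ, rec1 y.1 ^ 2 * rec1 y.2 ^ 2 := by
    rw [← tsum_mul_left]
    exact tsum_of_norm_bounded (summable_pair.mul_left _).hasSum (norm_freqSum_tri_le hc n)
  have h2 : ‖((n * ‖c n‖ ^ 2 : ℝ) : ℂ) * c n‖ ≤ C ^ 3 * rec1 n ^ 5 := by
    rw [norm_mul, Complex.norm_real, norm_mul, Real.norm_eq_abs, norm_pow, norm_norm]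
    have h3 := abs_mul_rec1_le n
    have h4 : rec1 n ^ 18 ≤ 1 := pow_le_one₀ p.le (rec1_le_one n)
    calc _ ≤ |(n : ℝ)| * (C * rec1 n ^ 8) ^ 2 * (C * rec1 n ^ 8) := by
          gcongr <;> exact hc n
      _ = C ^ 3 * rec1 n ^ 5 * ((|(n : ℝ)| * rec1 n) * rec1 n ^ 18) := by ring
      _ ≤ C ^ 3 * rec1 n ^ 5 * (1 * 1) := by gcongr
      _ = _ := by ring
  rw [norm_mul]
  have h3 : ‖(1 / 2 : ℂ)‖ ≤ 1 := by norm_num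
  have h5 : 0 ≤ ∑' y : ℤ × ℤ, rec1 y.1 ^ 2 * rec1 y.2 ^ 2 := tsum_nonneg fun y => by positivity
  calc _ ≤ 1 * (C ^ 3 * rec1 n ^ 5 * ∑' y : ℤ × ℤ, rec1 y.1 ^ 2 * rec1 y.2 ^ 2) + C ^ 3 * rec1 n ^ 5 := by
        gcongr
    _ = _ := by ring

/-- Imaginary parts against the nonlinearity, expanded. -/
lemma im_mul_conj_nonlin {C : ℝ} {c : ℤ → ℂ} (hc : Dec 8 C c) (z : ℂ) (n : ℤ) :
    (z * starRingEnd ℂ (nonlin c n)).im = 1 / 2 * (∑' y : ℤ × ℤ, freqSum y.1 y.2 (thd (n, y)) *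
      (z * starRingEnd ℂ (tri c c c y.1 y.2 (thd (n, y)))).im) -
      n * ‖c n‖ ^ 2 * (z * starRingEnd ℂ (c n)).im := by
  have h := (summable_freqSum_tri hc n).hasSum
  have h2 : HasSum (fun y : ℤ × ℤ => freqSum y.1 y.2 (thd (n, y)) *
      (z * starRingEnd ℂ (tri c c c y.1 y.2 (thd (n, y)))).im)
      (z * starRingEnd ℂ (∑' y : ℤ × ℤ, (freqSum y.1 y.2 (thd (n, y)) : ℂ) *
        tri c c c y.1 y.2 (thd (n, y)))).im := by
    have h3 := Complex.imCLM.hasSum ((Complex.hasSum_conj'.2 h).mul_left z)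
    refine HasSum.congr_fun h3 fun y => Eq.symm ?_
    change (z * starRingEnd ℂ ((freqSum y.1 y.2 (thd (n, y)) : ℂ) * tri c c c y.1 y.2 (thd (n, y)))).im = _
    rw [map_mul, Complex.conj_ofReal, mul_left_comm, Complex.im_ofReal_mul]
  rw [h2.tsum_eq]
  unfold nonlin
  rw [map_sub, map_mul, map_mul, Complex.conj_ofReal,
    show (1 / 2 : ℂ) = ((1 / 2 : ℝ) : ℂ) by norm_num, Complex.conj_ofReal, mul_sub, mul_left_comm,
    mul_left_comm z ((n * ‖c n‖ ^ 2 : ℝ) : ℂ), Complex.sub_im, Complex.im_ofReal_mul,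
    Complex.im_ofReal_mul]

section quadratic

variable {C : ℝ} {c : ℤ → ℂ} (N : ℕ)

/-- Cancellation of the momentum flux. -/
lemma tsum_psi_mul_im (hc : Dec 8 C c) :
    4 * ∑' x : ℤ × (ℤ × ℤ), psi N x.1 * freqSum x.2.1 x.2.2 (thd x) *
      (quad c c c c x.2.1 x.2.2 (thd x) x.1).im =
    ∑' x : ℤ × (ℤ × ℤ), freqSum x.2.1 x.2.2 (thd x) * psi4 N x.2.1 x.2.2 (thd x) *
      (quad c c c c x.2.1 x.2.2 (thd x) x.1).im := by
  have hc' : Dec (2 + 2) C c := hc.mono (by norm_num) le_rfl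
  have hr : ∀ x : ℤ × (ℤ × ℤ), 0 ≤ rec1 x.2.1 * rec1 x.2.2 * rec1 (thd x) * rec1 x.1 := fun x =>
    (rec_four_pos _ _ _ _).le
  have bound : ∀ (m : ℤ) (x : ℤ × (ℤ × ℤ)),
      rec1 x.2.1 * rec1 x.2.2 * rec1 (thd x) * rec1 x.1 ≤ rec1 m →
      |psi N m * freqSum x.2.1 x.2.2 (thd x)| *
        (rec1 x.2.1 * rec1 x.2.2 * rec1 (thd x) * rec1 x.1) ^ 2 ≤ 1 := by
    intro m x hm
    refine abs_mul_four_le ?_ (abs_freqSum_four_le _ _ _ _) (hr x)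
    exact (mul_le_mul_of_nonneg_left hm (abs_nonneg _)).trans (abs_psi_mul_le N m)
  have hle : ∀ x : ℤ × (ℤ × ℤ), ∀ a b d e : ℝ, 0 ≤ a → a ≤ 1 → 0 ≤ b → b ≤ 1 → 0 ≤ d → d ≤ 1 →
      0 ≤ e → a * b * d * e ≤ e := fun _ a b d e ha ha1 hb hb1 hd hd1 he =>
    mul_le_of_le_one_left he (mul_le_one₀ (mul_le_one₀ ha1 hb hb1) hd hd1)
  have p := fun m => (rec1_pos m).le
  have q := rec1_le_one
  have s0 := summable_mul_quad hc' hc' hc' hc' (β := fun x => psi N x.1 *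
    freqSum x.2.1 x.2.2 (thd x)) fun x => bound x.1 x
      (hle x _ _ _ _ (p _) (q _) (p _) (q _) (p _) (q _) (p _))
  have s1 := summable_mul_quad hc' hc' hc' hc' (β := fun x => psi N x.2.1 *
    freqSum x.2.1 x.2.2 (thd x)) fun x => bound x.2.1 x (by
      have := hle x _ _ _ _ (p x.2.2) (q _) (p (thd x)) (q _) (p x.1) (q _) (p x.2.1)
      linarith)
  have s2 := summable_mul_quad hc' hc' hc' hc' (β := fun x => psi N x.2.2 *
    freqSum x.2.1 x.2.2 (thd x)) fun x => bound x.2.2 x (by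
      have := hle x _ _ _ _ (p x.2.1) (q _) (p (thd x)) (q _) (p x.1) (q _) (p x.2.2)
      linarith)
  have s3 := summable_mul_quad hc' hc' hc' hc' (β := fun x => psi N (thd x) *
    freqSum x.2.1 x.2.2 (thd x)) fun x => bound (thd x) x (by
      have := hle x _ _ _ _ (p x.2.2) (q _) (p x.2.1) (q _) (p x.1) (q _) (p (thd x))
      linarith)
  have e2 : ∑' x : ℤ × (ℤ × ℤ), psi N x.1 * freqSum x.2.1 x.2.2 (thd x) *
      (quad c c c c x.2.1 x.2.2 (thd x) x.1).im =
      ∑' x : ℤ × (ℤ × ℤ), psi N x.2.2 * freqSum x.2.1 x.2.2 (thd x) *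
      (quad c c c c x.2.1 x.2.2 (thd x) x.1).im := by
    rw [tsum_exchTwo (fun n₁ n₂ n₃ n => psi N n * freqSum n₁ n₂ n₃ * (quad c c c c n₁ n₂ n₃ n).im)]
    refine tsum_congr fun x => ?_
    have : freqSum x.2.1 x.1 (thd x) = freqSum x.2.1 x.2.2 (thd x) := by
      rw [← freqSum_exchTwo, show x.2.1 - x.1 + thd x = x.2.2 by unfold thd; ring]
    rw [this]
    congr 2
    unfold quad tri
    ring
  have e1 : ∑' x : ℤ × (ℤ × ℤ), psi N x.1 * freqSum x.2.1 x.2.2 (thd x) *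
      (quad c c c c x.2.1 x.2.2 (thd x) x.1).im =
      -∑' x : ℤ × (ℤ × ℤ), psi N x.2.1 * freqSum x.2.1 x.2.2 (thd x) *
      (quad c c c c x.2.1 x.2.2 (thd x) x.1).im := by
    rw [tsum_exchOne (fun n₁ n₂ n₃ n => psi N n * freqSum n₁ n₂ n₃ * (quad c c c c n₁ n₂ n₃ n).im),
      ← tsum_neg]
    refine tsum_congr fun x => ?_
    have : freqSum x.1 (thd x) x.2.2 = freqSum x.2.1 x.2.2 (thd x) := by
      rw [← freqSum_exchOne x.2.1, thd_sub]
    rw [this, ← mul_neg, ← Complex.conj_im]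
    congr 2
    unfold quad tri
    simp only [map_mul, Complex.conj_conj]
    ring
  have e3 : ∑' x : ℤ × (ℤ × ℤ), psi N x.2.1 * freqSum x.2.1 x.2.2 (thd x) *
      (quad c c c c x.2.1 x.2.2 (thd x) x.1).im =
      ∑' x : ℤ × (ℤ × ℤ), psi N (thd x) * freqSum x.2.1 x.2.2 (thd x) *
      (quad c c c c x.2.1 x.2.2 (thd x) x.1).im := by
    rw [tsum_exchOdd (fun n₁ n₂ n₃ n => psi N n₁ * freqSum n₁ n₂ n₃ * (quad c c c c n₁ n₂ n₃ n).im)]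
    refine tsum_congr fun x => ?_
    rw [freqSum_swap]
    congr 2
    unfold quad tri
    ring
  have key : ∑' x : ℤ × (ℤ × ℤ), freqSum x.2.1 x.2.2 (thd x) * psi4 N x.2.1 x.2.2 (thd x) *
      (quad c c c c x.2.1 x.2.2 (thd x) x.1).im =
      ∑' x : ℤ × (ℤ × ℤ), (psi N x.2.2 * freqSum x.2.1 x.2.2 (thd x) *
        (quad c c c c x.2.1 x.2.2 (thd x) x.1).im + psi N x.1 * freqSum x.2.1 x.2.2 (thd x) *
        (quad c c c c x.2.1 x.2.2 (thd x) x.1).im - psi N x.2.1 * freqSum x.2.1 x.2.2 (thd x) *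
        (quad c c c c x.2.1 x.2.2 (thd x) x.1).im - psi N (thd x) * freqSum x.2.1 x.2.2 (thd x) *
        (quad c c c c x.2.1 x.2.2 (thd x) x.1).im) := by
    refine tsum_congr fun x => ?_
    unfold psi4
    rw [thd_sub]
    ring
  rw [key, ((s2.add s0).sub s1).tsum_sub s3, (s2.add s0).tsum_sub s1, s2.tsum_add s0]
  linarith

end quadratic

/-- The time derivative of the Fourier coefficients prescribed by the equation. -/
noncomputable def flow (κ : ℝ) (c : ℤ → ℂ) (n : ℤ) : ℂ :=
  Complex.I * ((n : ℝ) ^ 3 : ℝ) * c n + κ * Complex.I * nonlin c n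

/-- The product rule for `quad`. -/
noncomputable def dquad (c d : ℤ → ℂ) (n₁ n₂ n₃ n : ℤ) : ℂ :=
  quad d c c c n₁ n₂ n₃ n + quad c d c c n₁ n₂ n₃ n + quad c c d c n₁ n₂ n₃ n +
    quad c c c d n₁ n₂ n₃ n

lemma re_I_mul (r : ℝ) (z : ℂ) : (Complex.I * r * z).re = -(r * z.im) := by
  rw [mul_assoc, Complex.I_mul_re, Complex.im_ofReal_mul]

lemma dquad_flow_re (κ : ℝ) (c : ℤ → ℂ) (n₁ n₂ n₃ n : ℤ) :
    (dquad c (flow κ c) n₁ n₂ n₃ n).re =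
      -(((n₁ : ℝ) ^ 3 - (n₂ : ℝ) ^ 3 + (n₃ : ℝ) ^ 3 - (n : ℝ) ^ 3) * (quad c c c c n₁ n₂ n₃ n).im) +
      κ * (-(quad (nonlin c) c c c n₁ n₂ n₃ n).im + (quad c (nonlin c) c c n₁ n₂ n₃ n).im -
        (quad c c (nonlin c) c n₁ n₂ n₃ n).im + (quad c c c (nonlin c) n₁ n₂ n₃ n).im) := by
  have e : dquad c (flow κ c) n₁ n₂ n₃ n =
      Complex.I * (((n₁ : ℝ) ^ 3 - (n₂ : ℝ) ^ 3 + (n₃ : ℝ) ^ 3 - (n : ℝ) ^ 3 : ℝ) : ℂ) *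
        quad c c c c n₁ n₂ n₃ n +
      (Complex.I * (κ : ℝ) * quad (nonlin c) c c c n₁ n₂ n₃ n -
        Complex.I * (κ : ℝ) * quad c (nonlin c) c c n₁ n₂ n₃ n +
        Complex.I * (κ : ℝ) * quad c c (nonlin c) c n₁ n₂ n₃ n -
        Complex.I * (κ : ℝ) * quad c c c (nonlin c) n₁ n₂ n₃ n) := by
    unfold dquad quad tri flow
    simp only [map_add, map_mul, Complex.conj_I, Complex.conj_ofReal]
    push_cast
    ring
  rw [e]
  simp only [Complex.add_re, Complex.sub_re, re_I_mul]
  ring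

section

variable {C : ℝ} {c : ℤ → ℂ} (N : ℕ)

lemma exists_common_dec (hc : Dec 8 C c) : ∃ D, Dec 3 D c ∧ Dec 3 D (nonlin c) :=
  ⟨max C _, hc.mono (by norm_num) (le_max_left _ _),
    (dec_nonlin hc).mono (by norm_num) (le_max_right _ _)⟩

/-- Multiplying the multiplier by the resonance function. -/
lemma beta_mul_cubes (x : ℤ × (ℤ × ℤ)) : beta N x.2.1 x.2.2 (thd x) *
    ((x.2.1 : ℝ) ^ 3 - (x.2.2 : ℝ) ^ 3 + (thd x : ℝ) ^ 3 - (x.1 : ℝ) ^ 3) =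
    -3 * (freqSum x.2.1 x.2.2 (thd x) * psi4 N x.2.1 x.2.2 (thd x)) := by
  rw [← beta_mul_jk]
  have : (x.1 : ℝ) = x.2.1 - x.2.2 + (thd x : ℝ) := by
    rw [← thd_sub x]; push_cast; simp
  rw [this]
  ring

lemma tsum_beta_dquad (κ : ℝ) (hc : Dec 8 C c) :
    ∑' x : ℤ × (ℤ × ℤ), beta N x.2.1 x.2.2 (thd x) *
      (dquad c (flow κ c) x.2.1 x.2.2 (thd x) x.1).re =
    3 * ∑' x : ℤ × (ℤ × ℤ), freqSum x.2.1 x.2.2 (thd x) * psi4 N x.2.1 x.2.2 (thd x) *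
      (quad c c c c x.2.1 x.2.2 (thd x) x.1).im +
    4 * κ * ∑' x : ℤ × (ℤ × ℤ), beta N x.2.1 x.2.2 (thd x) *
      (quad c c c (nonlin c) x.2.1 x.2.2 (thd x) x.1).im := by
  obtain ⟨D, hd, hG⟩ := exists_common_dec hc
  have hβ := abs_beta_thd_le N
  have s1 := summable_mul_quad (k := 1) hG hd hd hd hβ
  have s2 := summable_mul_quad (k := 1) hd hG hd hd hβ
  have s3 := summable_mul_quad (k := 1) hd hd hG hd hβ
  have s4 := summable_mul_quad (k := 1) hd hd hd hG hβ
  have e2 : ∑' x : ℤ × (ℤ × ℤ), beta N x.2.1 x.2.2 (thd x) *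
      (quad c (nonlin c) c c x.2.1 x.2.2 (thd x) x.1).im =
      ∑' x : ℤ × (ℤ × ℤ), beta N x.2.1 x.2.2 (thd x) *
      (quad c c c (nonlin c) x.2.1 x.2.2 (thd x) x.1).im := by
    rw [tsum_exchTwo (fun n₁ n₂ n₃ n => beta N n₁ n₂ n₃ * (quad c (nonlin c) c c n₁ n₂ n₃ n).im)]
    refine tsum_congr fun x => ?_
    have : beta N x.2.1 x.1 (thd x) = beta N x.2.1 x.2.2 (thd x) := by
      rw [← beta_exchTwo, show x.2.1 - x.1 + thd x = x.2.2 by unfold thd; ring]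
    rw [this]
    congr 2
    unfold quad tri
    ring
  have e1 : ∑' x : ℤ × (ℤ × ℤ), beta N x.2.1 x.2.2 (thd x) *
      (quad (nonlin c) c c c x.2.1 x.2.2 (thd x) x.1).im =
      -∑' x : ℤ × (ℤ × ℤ), beta N x.2.1 x.2.2 (thd x) *
      (quad c c c (nonlin c) x.2.1 x.2.2 (thd x) x.1).im := by
    rw [tsum_exchOne (fun n₁ n₂ n₃ n => beta N n₁ n₂ n₃ * (quad (nonlin c) c c c n₁ n₂ n₃ n).im),
      ← tsum_neg]
    refine tsum_congr fun x => ?_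
    have : beta N x.1 (thd x) x.2.2 = beta N x.2.1 x.2.2 (thd x) := by
      rw [← beta_exchOne N x.2.1, thd_sub]
    rw [this, ← mul_neg, ← Complex.conj_im]
    congr 2
    unfold quad tri
    simp only [map_mul, Complex.conj_conj]
    ring
  have e3 : ∑' x : ℤ × (ℤ × ℤ), beta N x.2.1 x.2.2 (thd x) *
      (quad c c (nonlin c) c x.2.1 x.2.2 (thd x) x.1).im =
      ∑' x : ℤ × (ℤ × ℤ), beta N x.2.1 x.2.2 (thd x) *
      (quad (nonlin c) c c c x.2.1 x.2.2 (thd x) x.1).im := by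
    rw [tsum_exchOdd (fun n₁ n₂ n₃ n => beta N n₁ n₂ n₃ * (quad c c (nonlin c) c n₁ n₂ n₃ n).im)]
    refine tsum_congr fun x => ?_
    rw [beta_swap]
    congr 2
    unfold quad tri
    ring
  have s0 : Summable fun x : ℤ × (ℤ × ℤ) => freqSum x.2.1 x.2.2 (thd x) *
      psi4 N x.2.1 x.2.2 (thd x) * (quad c c c c x.2.1 x.2.2 (thd x) x.1).im := by
    have hc' : Dec (2 + 2) C c := hc.mono (by norm_num) le_rfl
    refine summable_mul_quad hc' hc' hc' hc' (β := fun x => freqSum x.2.1 x.2.2 (thd x) *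
      psi4 N x.2.1 x.2.2 (thd x)) fun x => ?_
    refine abs_mul_four_le (abs_freqSum_four_le _ _ _ _) ?_ (rec_four_pos _ _ _ _).le
    have := abs_psi4_mul_le N x.2.1 x.2.2 (thd x)
    rwa [thd_sub] at this
  have key : ∀ x : ℤ × (ℤ × ℤ), beta N x.2.1 x.2.2 (thd x) *
      (dquad c (flow κ c) x.2.1 x.2.2 (thd x) x.1).re =
      3 * (freqSum x.2.1 x.2.2 (thd x) * psi4 N x.2.1 x.2.2 (thd x) *
        (quad c c c c x.2.1 x.2.2 (thd x) x.1).im) +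
      κ * (-(beta N x.2.1 x.2.2 (thd x) * (quad (nonlin c) c c c x.2.1 x.2.2 (thd x) x.1).im) +
        beta N x.2.1 x.2.2 (thd x) * (quad c (nonlin c) c c x.2.1 x.2.2 (thd x) x.1).im -
        beta N x.2.1 x.2.2 (thd x) * (quad c c (nonlin c) c x.2.1 x.2.2 (thd x) x.1).im +
        beta N x.2.1 x.2.2 (thd x) * (quad c c c (nonlin c) x.2.1 x.2.2 (thd x) x.1).im) := by
    intro x
    rw [dquad_flow_re, mul_add, ← neg_mul, ← mul_assoc, mul_neg, beta_mul_cubes]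
    ring
  simp only [key]
  rw [(s0.mul_left 3).tsum_add ((((s1.neg.add s2).sub s3).add s4).mul_left κ), tsum_mul_left,
    tsum_mul_left, ((s1.neg.add s2).sub s3).tsum_add s4, (s1.neg.add s2).tsum_sub s3,
    s1.neg.tsum_add s2, tsum_neg, e3, e2, e1]
  ring

lemma tsum_psi_flow (κ : ℝ) (hc : Dec 8 C c) :
    ∑' n, psi N n * (2 * (starRingEnd ℂ (c n) * flow κ c n).re) =
    -(κ * ∑' x : ℤ × (ℤ × ℤ), psi N x.1 * freqSum x.2.1 x.2.2 (thd x) *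
      (quad c c c c x.2.1 x.2.2 (thd x) x.1).im) := by
  have hs : Summable fun x : ℤ × (ℤ × ℤ) => psi N x.1 * freqSum x.2.1 x.2.2 (thd x) *
      (quad c c c c x.2.1 x.2.2 (thd x) x.1).im := by
    have hc' : Dec (2 + 2) C c := hc.mono (by norm_num) le_rfl
    refine summable_mul_quad hc' hc' hc' hc' (β := fun x => psi N x.1 * freqSum x.2.1 x.2.2 (thd x))
      fun x => abs_mul_four_le ?_ (abs_freqSum_four_le _ _ _ _) (rec_four_pos _ _ _ _).le
    refine le_trans (mul_le_mul_of_nonneg_left ?_ (abs_nonneg _)) (abs_psi_mul_le N x.1)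
    exact mul_le_of_le_one_left (rec1_pos _).le (mul_le_one₀ (mul_le_one₀ (rec1_le_one _)
      (rec1_pos _).le (rec1_le_one _)) (rec1_pos _).le (rec1_le_one _))
  rw [hs.tsum_prod, ← tsum_mul_left, ← tsum_neg]
  refine tsum_congr fun n => ?_
  have h1 : (starRingEnd ℂ (c n) * flow κ c n).re = κ * (c n * starRingEnd ℂ (nonlin c n)).im := by
    have e : starRingEnd ℂ (c n) * flow κ c n = Complex.I * ((n : ℝ) ^ 3 * ‖c n‖ ^ 2 : ℝ) * 1 +
        Complex.I * (κ : ℝ) * starRingEnd ℂ (c n * starRingEnd ℂ (nonlin c n)) := by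
      unfold flow
      rw [map_mul, Complex.conj_conj, Complex.ofReal_mul, Complex.ofReal_pow ‖c n‖, ← Complex.conj_mul']
      ring
    rw [e, Complex.add_re, re_I_mul, re_I_mul, Complex.conj_im]
    simp
    ring
  have h2 : (c n * starRingEnd ℂ (c n)).im = 0 := by
    rw [Complex.mul_conj, Complex.ofReal_im]
  rw [h1, im_mul_conj_nonlin hc, h2, mul_zero, sub_zero]
  have h3 : ∀ y : ℤ × ℤ, psi N n * freqSum y.1 y.2 (thd (n, y)) *
      (quad c c c c y.1 y.2 (thd (n, y)) n).im = -(psi N n) * (freqSum y.1 y.2 (thd (n, y)) *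
      (c n * starRingEnd ℂ (tri c c c y.1 y.2 (thd (n, y)))).im) := by
    intro y
    have : (c n * starRingEnd ℂ (tri c c c y.1 y.2 (thd (n, y)))).im =
        -(quad c c c c y.1 y.2 (thd (n, y)) n).im := by
      rw [← Complex.conj_im]
      congr 1
      unfold quad
      rw [map_mul, Complex.conj_conj, mul_comm]
    rw [this]
    ring
  simp only [h3]
  rw [tsum_mul_left]
  ring

lemma abs_beta_tri_le (hc : Dec 8 C c) (n : ℤ) (y : ℤ × ℤ) :
    |beta N y.1 y.2 (thd (n, y))| * ‖tri c c c y.1 y.2 (thd (n, y))‖ ≤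
      C ^ 3 * (rec1 n ^ 2 * (rec1 y.1 ^ 2 * rec1 y.2 ^ 2)) := by
  obtain ⟨m, hm⟩ : ∃ m, m = thd (n, y) := ⟨_, rfl⟩
  have hC := hc.nonneg
  have h1 := norm_tri_le hc hc hc y.1 y.2 m
  have h2 := abs_beta_mul_le N y.1 y.2 m
  have h3 := rec1_mul_le y.1 y.2 m
  have e : y.1 - y.2 + m = n := by rw [hm]; simp [thd]
  rw [e] at h3 h2
  rw [← hm]
  have p1 := rec1_pos y.1
  have p2 := rec1_pos y.2
  have p3 := rec1_pos m
  have p4 := rec1_pos n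
  have q1 := rec1_le_one y.1
  have q2 := rec1_le_one y.2
  have q3 := rec1_le_one m
  have h4 : |beta N y.1 y.2 m| * (rec1 y.1 * rec1 y.2 * rec1 m) ^ 2 ≤ 1 := by
    refine le_trans ?_ h2
    rw [sq]
    gcongr
  calc _ ≤ |beta N y.1 y.2 m| * (C ^ 3 * (rec1 y.1 * rec1 y.2 * rec1 m) ^ 8) := by gcongr
    _ = C ^ 3 * (|beta N y.1 y.2 m| * (rec1 y.1 * rec1 y.2 * rec1 m) ^ 2) *
        ((rec1 y.1 * rec1 y.2 * rec1 m) ^ 2 * (rec1 y.1 ^ 2 * rec1 y.2 ^ 2)) *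
        (rec1 y.1 ^ 2 * rec1 y.2 ^ 2 * rec1 m ^ 4) := by ring
    _ ≤ C ^ 3 * 1 * (rec1 n ^ 2 * (rec1 y.1 ^ 2 * rec1 y.2 ^ 2)) * (1 ^ 2 * 1 ^ 2 * 1 ^ 4) := by
        gcongr
    _ = _ := by ring

/-- The terms of the six-linear form before symmetrization. -/
noncomputable def sixTerm (c : ℤ → ℂ) (n : ℤ) (y z : ℤ × ℤ) : ℝ :=
  beta N y.1 y.2 (thd (n, y)) * freqSum z.1 z.2 (thd (n, z)) *
    (tri c c c y.1 y.2 (thd (n, y)) * starRingEnd ℂ (tri c c c z.1 z.2 (thd (n, z)))).im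

lemma abs_sixTerm_le (hc : Dec 8 C c) (n : ℤ) (y z : ℤ × ℤ) :
    |sixTerm N c n y z| ≤ C ^ 6 * (rec1 n ^ 2 *
      ((rec1 y.1 ^ 2 * rec1 y.2 ^ 2) * (rec1 z.1 ^ 2 * rec1 z.2 ^ 2))) := by
  have hC := hc.nonneg
  have h1 := abs_beta_tri_le N hc n y
  have h2 := norm_freqSum_tri_le hc n z
  rw [norm_mul, Complex.norm_real, Real.norm_eq_abs] at h2
  have p := rec1_pos n
  have h3 : rec1 n ^ 5 ≤ 1 := pow_le_one₀ p.le (rec1_le_one n)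
  unfold sixTerm
  rw [abs_mul, abs_mul]
  calc _ ≤ |beta N y.1 y.2 (thd (n, y))| * |freqSum z.1 z.2 (thd (n, z))| *
        (‖tri c c c y.1 y.2 (thd (n, y))‖ * ‖tri c c c z.1 z.2 (thd (n, z))‖) := by
        gcongr
        refine (Complex.abs_im_le_norm _).trans ?_
        rw [norm_mul, RCLike.norm_conj]
    _ = (|beta N y.1 y.2 (thd (n, y))| * ‖tri c c c y.1 y.2 (thd (n, y))‖) *
        (|freqSum z.1 z.2 (thd (n, z))| * ‖tri c c c z.1 z.2 (thd (n, z))‖) := by ring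
    _ ≤ (C ^ 3 * (rec1 n ^ 2 * (rec1 y.1 ^ 2 * rec1 y.2 ^ 2))) *
        (C ^ 3 * rec1 n ^ 5 * (rec1 z.1 ^ 2 * rec1 z.2 ^ 2)) := by gcongr
    _ = C ^ 6 * (rec1 n ^ 2 * ((rec1 y.1 ^ 2 * rec1 y.2 ^ 2) * (rec1 z.1 ^ 2 * rec1 z.2 ^ 2))) *
        rec1 n ^ 5 := by ring
    _ ≤ _ := mul_le_of_le_one_right (by positivity) h3

lemma summable_sixTerm (hc : Dec 8 C c) :
    Summable fun x : ℤ × (ℤ × ℤ) × (ℤ × ℤ) => sixTerm N c x.1 x.2.1 x.2.2 :=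
  Summable.of_norm_bounded (summable_hex.mul_left (C ^ 6)) fun x =>
    abs_sixTerm_le N hc x.1 x.2.1 x.2.2

/-- The terms of the symmetrized six-linear form. -/
noncomputable def sixForm (c : ℤ → ℂ) (x : ℤ × (ℤ × ℤ) × (ℤ × ℤ)) : ℝ :=
  sixNR N x.2.1.1 x.2.1.2 (thd (x.1, x.2.1)) x.2.2.1 x.2.2.2 (thd (x.1, x.2.2)) *
    (tri c c c x.2.1.1 x.2.1.2 (thd (x.1, x.2.1)) *
      starRingEnd ℂ (tri c c c x.2.2.1 x.2.2.2 (thd (x.1, x.2.2)))).im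

lemma sixForm_eq (x : ℤ × (ℤ × ℤ) × (ℤ × ℤ)) :
    sixForm N c x = sixTerm N c x.1 x.2.1 x.2.2 + sixTerm N c x.1 x.2.2 x.2.1 := by
  have : ∀ u v : ℂ, (u * starRingEnd ℂ v).im = -(v * starRingEnd ℂ u).im := fun u v => by
    rw [← Complex.conj_im, map_mul, Complex.conj_conj, mul_comm]
  unfold sixForm sixTerm sixNR
  rw [this (tri c c c x.2.2.1 x.2.2.2 _)]
  ring

lemma abs_sixForm_le (hc : Dec 8 C c) (x : ℤ × (ℤ × ℤ) × (ℤ × ℤ)) :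
    |sixForm N c x| ≤ 2 * C ^ 6 * (rec1 x.1 ^ 2 *
      ((rec1 x.2.1.1 ^ 2 * rec1 x.2.1.2 ^ 2) * (rec1 x.2.2.1 ^ 2 * rec1 x.2.2.2 ^ 2))) := by
  rw [sixForm_eq]
  refine (abs_add_le _ _).trans ?_
  have h1 := abs_sixTerm_le N hc x.1 x.2.1 x.2.2
  have h2 := abs_sixTerm_le N hc x.1 x.2.2 x.2.1
  linarith

/-- The exchange of the two triples. -/
def exchTriples : Equiv.Perm (ℤ × (ℤ × ℤ) × (ℤ × ℤ)) :=
  Equiv.prodCongr (Equiv.refl ℤ) (Equiv.prodComm (ℤ × ℤ) (ℤ × ℤ))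

lemma tsum_sixForm (hc : Dec 8 C c) :
    ∑' x, sixForm N c x = 2 * ∑' x : ℤ × (ℤ × ℤ) × (ℤ × ℤ), sixTerm N c x.1 x.2.1 x.2.2 := by
  have h := summable_sixTerm N hc
  have e : ∑' x : ℤ × (ℤ × ℤ) × (ℤ × ℤ), sixTerm N c x.1 x.2.2 x.2.1 =
      ∑' x : ℤ × (ℤ × ℤ) × (ℤ × ℤ), sixTerm N c x.1 x.2.1 x.2.2 :=
    exchTriples.tsum_eq fun x : ℤ × (ℤ × ℤ) × (ℤ × ℤ) => sixTerm N c x.1 x.2.1 x.2.2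
  have h' : Summable fun x : ℤ × (ℤ × ℤ) × (ℤ × ℤ) => sixTerm N c x.1 x.2.2 x.2.1 :=
    exchTriples.summable_iff.2 h
  simp only [sixForm_eq]
  rw [h.tsum_add h', e]
  ring

/-- The terms of the resonant form. -/
noncomputable def resForm (c : ℤ → ℂ) (x : ℤ × (ℤ × ℤ)) : ℝ :=
  beta N x.2.1 x.2.2 (thd x) * (x.1 * ‖c x.1‖ ^ 2 * (quad c c c c x.2.1 x.2.2 (thd x) x.1).im)

lemma abs_resForm_le (hc : Dec 8 C c) (x : ℤ × (ℤ × ℤ)) :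
    |resForm N c x| ≤ C ^ 6 * (rec1 x.1 ^ 2 * (rec1 x.2.1 ^ 2 * rec1 x.2.2 ^ 2)) := by
  have hC := hc.nonneg
  have h1 := abs_beta_tri_le N hc x.1 x.2
  have p := rec1_pos x.1
  have h2 : |(x.1 : ℝ)| * rec1 x.1 ≤ 1 := abs_mul_rec1_le _
  have h3 : rec1 x.1 ^ 23 ≤ 1 := pow_le_one₀ p.le (rec1_le_one _)
  unfold resForm quad
  rw [abs_mul, abs_mul, abs_mul, abs_pow, abs_norm]
  calc _ ≤ |beta N x.2.1 x.2.2 (thd x)| * (|(x.1 : ℝ)| * (C * rec1 x.1 ^ 8) ^ 2 *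
        (‖tri c c c x.2.1 x.2.2 (thd x)‖ * (C * rec1 x.1 ^ 8))) := by
        gcongr
        · exact hc _
        · refine (Complex.abs_im_le_norm _).trans ?_
          rw [norm_mul, RCLike.norm_conj]
          gcongr
          exact hc _
    _ = (|beta N x.2.1 x.2.2 (thd x)| * ‖tri c c c x.2.1 x.2.2 (thd x)‖) * (|(x.1 : ℝ)| * rec1 x.1) *
        C ^ 3 * rec1 x.1 ^ 23 := by ring
    _ ≤ (C ^ 3 * (rec1 x.1 ^ 2 * (rec1 x.2.1 ^ 2 * rec1 x.2.2 ^ 2))) * 1 * C ^ 3 * 1 := by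
        gcongr
    _ = _ := by ring

lemma tsum_beta_nonlin (hc : Dec 8 C c) :
    ∑' x : ℤ × (ℤ × ℤ), beta N x.2.1 x.2.2 (thd x) *
      (quad c c c (nonlin c) x.2.1 x.2.2 (thd x) x.1).im =
    1 / 4 * (∑' x, sixForm N c x) - ∑' x, resForm N c x := by
  have h := summable_sixTerm N hc
  have h' : Summable fun x : (ℤ × (ℤ × ℤ)) × (ℤ × ℤ) => sixTerm N c x.1.1 x.1.2 x.2 :=
    (Equiv.prodAssoc ℤ (ℤ × ℤ) (ℤ × ℤ)).summable_iff.2 h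
  have e : ∑' x : ℤ × (ℤ × ℤ) × (ℤ × ℤ), sixTerm N c x.1 x.2.1 x.2.2 =
      ∑' x : ℤ × (ℤ × ℤ), ∑' z : ℤ × ℤ, sixTerm N c x.1 x.2 z := by
    rw [← h'.tsum_prod]
    exact ((Equiv.prodAssoc ℤ (ℤ × ℤ) (ℤ × ℤ)).tsum_eq
      fun x : ℤ × (ℤ × ℤ) × (ℤ × ℤ) => sixTerm N c x.1 x.2.1 x.2.2).symm
  have hr : Summable fun x => resForm N c x :=
    Summable.of_norm_bounded (summable_quad.mul_left (C ^ 6)) fun x => abs_resForm_le N hc x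
  have key : ∀ x : ℤ × (ℤ × ℤ), beta N x.2.1 x.2.2 (thd x) *
      (quad c c c (nonlin c) x.2.1 x.2.2 (thd x) x.1).im =
      1 / 2 * (∑' z : ℤ × ℤ, sixTerm N c x.1 x.2 z) - resForm N c x := by
    intro x
    unfold resForm quad
    rw [im_mul_conj_nonlin hc, mul_sub, mul_left_comm, ← tsum_mul_left]
    congr 2
    refine tsum_congr fun z => ?_
    unfold sixTerm
    rw [mul_assoc]
  simp only [key]
  rw [(h'.prod.mul_left _).tsum_sub hr, tsum_mul_left, tsum_sixForm N hc, e]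
  ring

/-- The time derivative of the modified momentum. -/
theorem modified_energy_identity {κ : ℝ} (hκ : κ ^ 2 = 1) (hc : Dec 8 C c) :
    ∑' n, psi N n * (2 * (starRingEnd ℂ (c n) * flow κ c n).re) +
      κ / 12 * ∑' x : ℤ × (ℤ × ℤ), beta N x.2.1 x.2.2 (thd x) *
        (dquad c (flow κ c) x.2.1 x.2.2 (thd x) x.1).re =
    1 / 12 * (∑' x, sixForm N c x) - 1 / 3 * ∑' x, resForm N c x := by
  have h1 := tsum_psi_mul_im N hc
  rw [tsum_psi_flow N κ hc, tsum_beta_dquad N κ hc, tsum_beta_nonlin N hc]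
  rw [← h1]
  generalize (∑' x, sixForm N c x) = a
  generalize (∑' x, resForm N c x) = b
  linear_combination (1 / 12 * a - 1 / 3 * b) * hκ

end

/-- Smooth families of periodic functions. -/
structure SmoothFamily (w : ℝ → ℝ → ℂ) : Prop where
  smooth : ContDiff ℝ ∞ (fun z : ℝ × ℝ => w z.1 z.2)
  periodic : ∀ t x, w t (x + 2 * Real.pi) = w t x

lemma SmoothPeriodic.family {f : ℝ → ℂ} (hf : SmoothPeriodic f) : SmoothFamily fun _ => f :=
  ⟨hf.1.comp contDiff_snd, fun _ => hf.2⟩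

namespace SmoothFamily

variable {w : ℝ → ℝ → ℂ} (hw : SmoothFamily w)
include hw

lemma section_x (t : ℝ) : SmoothPeriodic (w t) :=
  ⟨hw.smooth.comp (contDiff_const.prodMk contDiff_id), hw.periodic t⟩

lemma section_t (x : ℝ) : ContDiff ℝ ∞ fun t => w t x :=
  hw.smooth.comp (contDiff_id.prodMk contDiff_const)

lemma continuous : Continuous fun z : ℝ × ℝ => w z.1 z.2 := hw.smooth.continuous

lemma dx : SmoothFamily fun t => deriv (w t) := by
  refine ⟨?_, fun t x => ?_⟩
  · have h : ContDiff ℝ ∞ (Function.uncurry fun (z : ℝ × ℝ) (x : ℝ) => w z.1 x) :=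
      hw.smooth.comp ((contDiff_fst.comp contDiff_fst).prodMk contDiff_snd)
    exact h.fderiv_apply (n := ∞) contDiff_snd (contDiff_const (c := (1 : ℝ))) (by simp)
  · rw [← deriv_comp_add_const (w t) (2 * Real.pi) x]
    exact congrArg (fun f => deriv f x) (funext (hw.periodic t))

lemma dt : SmoothFamily fun t x => deriv (fun t' => w t' x) t := by
  refine ⟨?_, fun t x => ?_⟩
  · have h : ContDiff ℝ ∞ (Function.uncurry fun (z : ℝ × ℝ) (t : ℝ) => w t z.2) :=
      hw.smooth.comp (contDiff_snd.prodMk (contDiff_snd.comp contDiff_fst))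
    exact h.fderiv_apply (n := ∞) contDiff_fst (contDiff_const (c := (1 : ℝ))) (by simp)
  · simp only [hw.periodic]

end SmoothFamily

namespace SmoothPeriodic

variable {f g : ℝ → ℂ}

lemma hasDerivAt (hf : SmoothPeriodic f) (x : ℝ) : HasDerivAt f (deriv f x) x :=
  (hf.1.differentiable (by simp)).differentiableAt.hasDerivAt

lemma deriv (hf : SmoothPeriodic f) : SmoothPeriodic (deriv f) := hf.family.dx.section_x 0

lemma continuous (hf : SmoothPeriodic f) : Continuous f := hf.1.continuous

lemma mul (hf : SmoothPeriodic f) (hg : SmoothPeriodic g) : SmoothPeriodic fun x => f x * g x :=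
  ⟨hf.1.mul hg.1, fun x => by simp only [hf.2, hg.2]⟩

lemma sub (hf : SmoothPeriodic f) (hg : SmoothPeriodic g) : SmoothPeriodic fun x => f x - g x :=
  ⟨hf.1.sub hg.1, fun x => by simp only [hf.2, hg.2]⟩

lemma const_mul (hf : SmoothPeriodic f) (a : ℂ) : SmoothPeriodic fun x => a * f x :=
  ⟨contDiff_const.mul hf.1, fun x => by simp only [hf.2]⟩

lemma conj (hf : SmoothPeriodic f) : SmoothPeriodic fun x => starRingEnd ℂ (f x) :=
  ⟨Complex.conjCLE.contDiff.comp hf.1, fun x => by simp only [hf.2]⟩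

end SmoothPeriodic

lemma exp_two_pi_period (n : ℤ) (x : ℝ) :
    Complex.exp (Complex.I * n * (x + 2 * Real.pi : ℝ)) = Complex.exp (Complex.I * n * x) := by
  rw [show Complex.I * n * (x + 2 * Real.pi : ℝ) = Complex.I * n * x + n * (2 * Real.pi * Complex.I) by
    push_cast; ring, Complex.exp_add, Complex.exp_int_mul_two_pi_mul_I, mul_one]

lemma smoothPeriodic_exp (n : ℤ) : SmoothPeriodic fun x => Complex.exp (Complex.I * n * x) :=
  ⟨by
    have : ContDiff ℝ ∞ fun x : ℝ => (x : ℂ) := Complex.ofRealCLM.contDiff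
    exact (contDiff_const.mul this).cexp, exp_two_pi_period n⟩

lemma intervalIntegrable_coeff {f : ℝ → ℂ} (hf : Continuous f) (n : ℤ) (a b : ℝ) :
    IntervalIntegrable (fun x : ℝ => f x * Complex.exp (-(Complex.I * n * x))) volume a b :=
  Continuous.intervalIntegrable (by fun_prop) _ _

lemma coeff_const_mul (a : ℂ) (f : ℝ → ℂ) (n : ℤ) : coeff (fun x => a * f x) n = a * coeff f n := by
  unfold coeff
  rw [mul_left_comm, ← intervalIntegral.integral_const_mul a]
  simp only [mul_assoc]

lemma coeff_sub {f g : ℝ → ℂ} (hf : Continuous f) (hg : Continuous g) (n : ℤ) :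
    coeff (fun x => f x - g x) n = coeff f n - coeff g n := by
  unfold coeff
  rw [← mul_sub, ← intervalIntegral.integral_sub (intervalIntegrable_coeff hf n _ _)
    (intervalIntegrable_coeff hg n _ _)]
  simp only [sub_mul]

lemma coeff_deriv {f : ℝ → ℂ} (hf : SmoothPeriodic f) (n : ℤ) :
    coeff (deriv f) n = Complex.I * n * coeff f n := by
  have hd : ∀ x : ℝ, HasDerivAt (fun x : ℝ => f x * Complex.exp (-(Complex.I * n * x)))
      (deriv f x * Complex.exp (-(Complex.I * n * x)) -
        Complex.I * n * (f x * Complex.exp (-(Complex.I * n * x)))) x := by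
    intro x
    have h1 : HasDerivAt (fun x : ℝ => -(Complex.I * n * x)) (-(Complex.I * n)) x := by
      have h2 : HasDerivAt (fun x : ℝ => (x : ℂ)) 1 x := Complex.ofRealCLM.hasDerivAt
      have h3 := h2.const_mul (-(Complex.I * n))
      simp only [neg_mul, mul_one] at h3
      exact h3
    refine ((hf.hasDerivAt x).mul h1.cexp).congr_deriv ?_
    ring
  have hi := intervalIntegral.integral_eq_sub_of_hasDerivAt (a := 0) (b := 2 * Real.pi)
    (fun x _ => hd x) ((intervalIntegrable_coeff hf.deriv.continuous n _ _).sub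
      ((intervalIntegrable_coeff hf.continuous n _ _).const_mul _))
  rw [intervalIntegral.integral_sub (intervalIntegrable_coeff hf.deriv.continuous n _ _)
      ((intervalIntegrable_coeff hf.continuous n _ _).const_mul _),
    intervalIntegral.integral_const_mul] at hi
  have e0 : f (2 * Real.pi) * Complex.exp (-(Complex.I * n * (2 * Real.pi : ℝ))) =
      f 0 * Complex.exp (-(Complex.I * n * (0 : ℝ))) := by
    have h1 := hf.2 0
    have h2 := exp_two_pi_period n 0
    rw [zero_add] at h1 h2
    rw [h1, Complex.exp_neg, Complex.exp_neg, h2]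
  rw [e0, sub_self, sub_eq_zero] at hi
  unfold coeff
  rw [hi]
  ring

lemma norm_coeff_le {f : ℝ → ℂ} {M : ℝ} (hM : ∀ x ∈ Set.Icc 0 (2 * Real.pi), ‖f x‖ ≤ M) (n : ℤ) :
    ‖coeff f n‖ ≤ M := by
  have hpi := Real.pi_pos
  unfold coeff
  have h := intervalIntegral.norm_integral_le_of_norm_le_const (a := 0) (b := 2 * Real.pi)
    (f := fun x => f x * Complex.exp (-(Complex.I * n * x))) (C := M) (fun x hx => by
      rw [Set.uIoc_of_le (by positivity)] at hx
      rw [norm_mul, show -(Complex.I * n * (x : ℂ)) = ((-(n * x) : ℝ) : ℂ) * Complex.I by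
        push_cast; ring, Complex.norm_exp_ofReal_mul_I, mul_one]
      exact hM x ⟨hx.1.le, hx.2⟩)
  rw [sub_zero, abs_of_pos (by positivity)] at h
  rw [norm_mul, show (1 / (2 * Real.pi) : ℂ) = ((1 / (2 * Real.pi) : ℝ) : ℂ) by push_cast; ring,
    Complex.norm_real, Real.norm_of_nonneg (by positivity)]
  calc _ ≤ 1 / (2 * Real.pi) * (M * (2 * Real.pi)) := by gcongr
    _ = M := by field_simp

lemma SmoothFamily.exists_bound {w : ℝ → ℝ → ℂ} (hw : SmoothFamily w) (T : ℝ) :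
    ∃ M, ∀ t ∈ Set.Icc (-T) T, ∀ n, ‖coeff (w t) n‖ ≤ M := by
  obtain ⟨M, hM⟩ := (isCompact_Icc.prod isCompact_Icc).exists_bound_of_continuousOn
    (s := Set.Icc (-T) T ×ˢ Set.Icc 0 (2 * Real.pi)) hw.continuous.continuousOn
  exact ⟨M, fun t ht n => norm_coeff_le (fun x hx => hM (t, x) ⟨ht, hx⟩) n⟩

lemma SmoothFamily.exists_pow_bound {w : ℝ → ℝ → ℂ} (hw : SmoothFamily w) (T : ℝ) (k : ℕ) :
    ∃ M, ∀ t ∈ Set.Icc (-T) T, ∀ n : ℤ, |(n : ℝ)| ^ k * ‖coeff (w t) n‖ ≤ M := by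
  induction k generalizing w with
  | zero => simpa using hw.exists_bound T
  | succ k ih =>
    obtain ⟨M, hM⟩ := ih hw.dx
    refine ⟨M, fun t ht n => ?_⟩
    have := hM t ht n
    rw [coeff_deriv (hw.section_x t), norm_mul, norm_mul, Complex.norm_I, one_mul,
      Complex.norm_intCast, ← mul_assoc, ← pow_succ] at this
    exact this

/-- Rapid decay of Fourier coefficients, locally uniformly in time. -/
lemma SmoothFamily.exists_dec {w : ℝ → ℝ → ℂ} (hw : SmoothFamily w) (T : ℝ) (k : ℕ) :
    ∃ C, ∀ t ∈ Set.Icc (-T) T, Dec k C (coeff (w t)) := by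
  obtain ⟨M, hM⟩ := hw.exists_bound T
  obtain ⟨M', hM'⟩ := hw.exists_pow_bound T k
  refine ⟨2 ^ k * (M + M'), fun t ht n => ?_⟩
  have h1 := hM t ht n
  have h2 := hM' t ht n
  have hpow : (1 + |(n : ℝ)|) ^ k ≤ 2 ^ k * (1 + |(n : ℝ)| ^ k) := by
    have := add_pow_le zero_le_one (abs_nonneg (n : ℝ)) k
    refine this.trans ?_
    rw [one_pow]
    gcongr
    · norm_num
    · omega
  unfold rec1
  rw [inv_pow, ← div_eq_mul_inv, le_div_iff₀ (by positivity)]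
  calc _ ≤ ‖coeff (w t) n‖ * (2 ^ k * (1 + |(n : ℝ)| ^ k)) := by gcongr
    _ = 2 ^ k * (‖coeff (w t) n‖ + |(n : ℝ)| ^ k * ‖coeff (w t) n‖) := by ring
    _ ≤ _ := by gcongr

lemma SmoothPeriodic.exists_dec {f : ℝ → ℂ} (hf : SmoothPeriodic f) (k : ℕ) :
    ∃ C, Dec k C (coeff f) := by
  obtain ⟨C, hC⟩ := hf.family.exists_dec 0 k
  exact ⟨C, hC 0 (by simp)⟩

lemma Dec.summable {C : ℝ} {k : ℕ} {a : ℤ → ℂ} (h : Dec (k + 2) C a) : Summable fun n => ‖a n‖ :=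
  Summable.of_nonneg_of_le (fun _ => norm_nonneg _) (h.mono (l := 2) (by omega) le_rfl)
    (summable_rec1_sq.mul_left C)

lemma SmoothPeriodic.summable {f : ℝ → ℂ} (hf : SmoothPeriodic f) : Summable fun n => ‖coeff f n‖ :=
  let ⟨_, h⟩ := hf.exists_dec 2
  Dec.summable (k := 0) h

/-- Differentiation of Fourier coefficients in time. -/
lemma SmoothFamily.hasDerivAt_coeff {w : ℝ → ℝ → ℂ} (hw : SmoothFamily w) (t : ℝ) (n : ℤ) :
    HasDerivAt (fun t => coeff (w t) n) (coeff (fun x => deriv (fun t' => w t' x) t) n) t := by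
  obtain ⟨M, hM⟩ := (isCompact_Icc.prod isCompact_Icc).exists_bound_of_continuousOn
    (s := Set.Icc (t - 1) (t + 1) ×ˢ Set.Icc 0 (2 * Real.pi)) hw.dt.continuous.continuousOn
  have hpi := Real.pi_pos
  unfold coeff
  refine HasDerivAt.const_mul _ ?_
  refine (intervalIntegral.hasDerivAt_integral_of_dominated_loc_of_deriv_le
    (F' := fun t x => deriv (fun t' => w t' x) t * Complex.exp (-(Complex.I * n * x)))
    (bound := fun _ => M) (s := Set.Icc (t - 1) (t + 1)) (Icc_mem_nhds (by linarith) (by linarith))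
    (Filter.Eventually.of_forall fun t' => ?_) (intervalIntegrable_coeff
      (hw.section_x t).continuous n _ _) ?_ (Filter.Eventually.of_forall fun x hx t' ht' => ?_)
    (continuous_const.intervalIntegrable _ _)
    (Filter.Eventually.of_forall fun x _ t' _ => ?_)).2
  · exact ((intervalIntegrable_coeff (hw.section_x t').continuous n 0
      (2 * Real.pi)).def').aestronglyMeasurable
  · exact ((intervalIntegrable_coeff (hw.dt.section_x t).continuous n 0
      (2 * Real.pi)).def').aestronglyMeasurable
  · rw [Set.uIoc_of_le (by positivity)] at hx
    rw [norm_mul, show -(Complex.I * n * (x : ℂ)) = ((-(n * x) : ℝ) : ℂ) * Complex.I by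
        push_cast; ring, Complex.norm_exp_ofReal_mul_I, mul_one]
    exact hM (t', x) ⟨ht', hx.1.le, hx.2⟩
  · refine HasDerivAt.mul_const ?_ _
    exact ((hw.section_t x).differentiable (by simp)).differentiableAt.hasDerivAt

/-- Fourier inversion for smooth periodic functions. -/
lemma SmoothPeriodic.hasSum {f : ℝ → ℂ} (hf : SmoothPeriodic f) (x : ℝ) :
    HasSum (fun n : ℤ => coeff f n * Complex.exp (Complex.I * n * x)) (f x) := by
  have hpi := Real.pi_pos
  have : Fact (0 < 2 * Real.pi) := ⟨by positivity⟩
  have hp : Function.Periodic f (2 * Real.pi) := hf.2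
  obtain ⟨F, hF⟩ : ∃ F : C(AddCircle (2 * Real.pi), ℂ), ∀ x : ℝ, F x = f x :=
    ⟨⟨hp.lift, continuous_coinduced_dom.mpr hf.continuous⟩, fun x => rfl⟩
  have hexp : ∀ (n : ℤ) (x : ℝ), fourier n (x : AddCircle (2 * Real.pi)) =
      Complex.exp (Complex.I * n * x) := by
    intro n x
    rw [fourier_coe_apply]
    congr 1
    push_cast
    field_simp
  have hc : ∀ n, fourierCoeff F n = coeff f n := by
    intro n
    rw [fourierCoeff_eq_intervalIntegral _ _ 0, zero_add]
    unfold coeff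
    rw [Complex.real_smul]
    congr 1
    · push_cast; ring
    · refine intervalIntegral.integral_congr fun x _ => ?_
      rw [hexp, hF, smul_eq_mul, mul_comm]
      congr 2
      push_cast
      ring
  have h := has_pointwise_sum_fourier_series_of_summable (f := F) (by
    simp only [funext hc]
    exact hf.summable.of_norm) x
  simp only [hc, hexp, hF, smul_eq_mul] at h
  exact h

lemma hasSum_coeff_mul {f g : ℝ → ℂ} (hf : SmoothPeriodic f) (hg : SmoothPeriodic g) (n : ℤ) :
    HasSum (fun k : ℤ => coeff f k * coeff g (n - k)) (coeff (fun x => f x * g x) n) := by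
  obtain ⟨M, hM⟩ := (isCompact_Icc (a := 0) (b := 2 * Real.pi)).exists_bound_of_continuousOn
    hg.continuous.continuousOn
  have hpi := Real.pi_pos
  have h := intervalIntegral.hasSum_integral_of_dominated_convergence (μ := volume) (a := 0)
    (b := 2 * Real.pi)
    (F := fun (k : ℤ) (x : ℝ) => coeff f k * (g x * Complex.exp (-(Complex.I * (n - k : ℤ) * x))))
    (f := fun x : ℝ => f x * g x * Complex.exp (-(Complex.I * n * x)))
    (fun k _ => ‖coeff f k‖ * M)
    (fun k => (((intervalIntegrable_coeff hg.continuous (n - k) 0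
      (2 * Real.pi)).const_mul _).def').aestronglyMeasurable)
    (fun k => Filter.Eventually.of_forall fun x hx => by
      rw [Set.uIoc_of_le (by positivity)] at hx
      rw [norm_mul, norm_mul, show -(Complex.I * (n - k : ℤ) * (x : ℂ)) =
        ((-((n - k : ℤ) * x) : ℝ) : ℂ) * Complex.I by push_cast; ring,
        Complex.norm_exp_ofReal_mul_I, mul_one]
      gcongr
      exact hM x ⟨hx.1.le, hx.2⟩)
    (Filter.Eventually.of_forall fun x _ => hf.summable.mul_right M)
    (continuous_const.intervalIntegrable _ _)
    (Filter.Eventually.of_forall fun x _ => by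
      rw [mul_assoc]
      refine HasSum.congr_fun ((hf.hasSum x).mul_right (g x * Complex.exp (-(Complex.I * n * x))))
        fun k => ?_
      have : Complex.exp (-(Complex.I * (n - k : ℤ) * x)) =
          Complex.exp (Complex.I * k * x) * Complex.exp (-(Complex.I * n * x)) := by
        rw [← Complex.exp_add]; congr 1; push_cast; ring
      rw [this]
      ring)
  have h2 := h.mul_left (1 / (2 * Real.pi) : ℂ)
  refine HasSum.congr_fun h2 fun k => ?_
  rw [intervalIntegral.integral_const_mul]
  unfold coeff
  ring

lemma coeff_conj (f : ℝ → ℂ) (n : ℤ) :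
    coeff (fun x => starRingEnd ℂ (f x)) n = starRingEnd ℂ (coeff f (-n)) := by
  unfold coeff
  rw [map_mul]
  congr 1
  · rw [show (1 / (2 * Real.pi) : ℂ) = ((1 / (2 * Real.pi) : ℝ) : ℂ) by push_cast; ring,
      Complex.conj_ofReal]
  · rw [intervalIntegral.integral_of_le (by positivity), intervalIntegral.integral_of_le (by positivity),
      ← integral_conj]
    refine integral_congr_ae (Filter.Eventually.of_forall fun x => ?_)
    simp only [map_mul, ← Complex.exp_conj, map_neg, Complex.conj_I, Complex.conj_ofReal, map_intCast]
    congr 2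
    push_cast
    ring

lemma mean_im {h : ℝ → ℂ} (hh : Continuous h) : mean (fun x => (h x).im) = (coeff h 0).im := by
  unfold mean coeff
  have : ∫ x in (0 : ℝ)..(2 * Real.pi), (h x).im = (∫ x in (0 : ℝ)..(2 * Real.pi), h x).im := by
    have := Complex.imCLM.intervalIntegral_comp_comm (hh.intervalIntegrable (μ := volume) 0 (2 * Real.pi))
    simpa using this
  rw [this, show (1 / (2 * Real.pi) : ℂ) = ((1 / (2 * Real.pi) : ℝ) : ℂ) by push_cast; ring,
    Complex.im_ofReal_mul]
  simp

lemma mean_re {h : ℝ → ℂ} (hh : Continuous h) : mean (fun x => (h x).re) = (coeff h 0).re := by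
  unfold mean coeff
  have : ∫ x in (0 : ℝ)..(2 * Real.pi), (h x).re = (∫ x in (0 : ℝ)..(2 * Real.pi), h x).re := by
    have := Complex.reCLM.intervalIntegral_comp_comm (hh.intervalIntegrable (μ := volume) 0 (2 * Real.pi))
    simpa using this
  rw [this, show (1 / (2 * Real.pi) : ℂ) = ((1 / (2 * Real.pi) : ℝ) : ℂ) by push_cast; ring,
    Complex.re_ofReal_mul]
  simp

lemma hasSum_conj_mul {f g : ℝ → ℂ} (hf : SmoothPeriodic f) (hg : SmoothPeriodic g) (n : ℤ) :
    HasSum (fun l : ℤ => starRingEnd ℂ (coeff f l) * coeff g (n + l))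
      (coeff (fun x => starRingEnd ℂ (f x) * g x) n) := by
  have h := hasSum_coeff_mul hf.conj hg n
  rw [← (Equiv.neg ℤ).hasSum_iff] at h
  refine HasSum.congr_fun h fun l => ?_
  simp [coeff_conj]

/-- Parseval's identity for the mass. -/
lemma hasSum_mass {f : ℝ → ℂ} (hf : SmoothPeriodic f) :
    HasSum (fun k : ℤ => ‖coeff f k‖ ^ 2) (mass f) := by
  have h := Complex.hasSum_re (hasSum_conj_mul hf hf 0)
  rw [← mean_re (hf.conj.mul hf).continuous] at h
  convert h using 1
  · funext k
    rw [zero_add, Complex.conj_mul', ← Complex.ofReal_pow, Complex.ofReal_re]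
  · unfold mass
    congr 1
    funext x
    rw [Complex.conj_mul', ← Complex.ofReal_pow, Complex.ofReal_re]

/-- Parseval's identity for the momentum. -/
lemma hasSum_momentum {f : ℝ → ℂ} (hf : SmoothPeriodic f) :
    HasSum (fun k : ℤ => (k : ℝ) * ‖coeff f k‖ ^ 2) (momentum f) := by
  have h := Complex.hasSum_im (hasSum_conj_mul hf hf.deriv 0)
  rw [← mean_im (hf.conj.mul hf.deriv).continuous] at h
  refine HasSum.congr_fun h fun k => ?_
  rw [zero_add, coeff_deriv hf]
  have : starRingEnd ℂ (coeff f k) * (Complex.I * k * coeff f k) =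
      Complex.I * ((k * ‖coeff f k‖ ^ 2 : ℝ) : ℂ) := by
    rw [Complex.ofReal_mul, Complex.ofReal_pow, ← Complex.conj_mul']
    push_cast
    ring
  rw [this, Complex.I_mul_im, Complex.ofReal_re]

lemma coeff_exp (m n : ℤ) : coeff (fun x => Complex.exp (Complex.I * m * x)) n =
    if m = n then 1 else 0 := by
  split_ifs with h
  · subst h
    have hpi : (Real.pi : ℂ) ≠ 0 := by exact_mod_cast Real.pi_ne_zero
    unfold coeff
    have : ∀ x : ℝ, Complex.exp (Complex.I * m * x) * Complex.exp (-(Complex.I * m * x)) = 1 :=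
      fun x => by rw [← Complex.exp_add, add_neg_cancel, Complex.exp_zero]
    simp only [this]
    rw [intervalIntegral.integral_const]
    simp
    field_simp
  · have h1 := coeff_deriv (smoothPeriodic_exp m) n
    have h2 : deriv (fun x : ℝ => Complex.exp (Complex.I * m * x)) =
        fun x : ℝ => (Complex.I * m) * Complex.exp (Complex.I * m * x) := by
      funext x
      have h3 : HasDerivAt (fun x : ℝ => (x : ℂ)) 1 x := Complex.ofRealCLM.hasDerivAt
      have h4 := (h3.const_mul (Complex.I * m)).cexp.deriv
      rw [h4]
      ring
    rw [h2, coeff_const_mul, ← sub_eq_zero, ← sub_mul, ← mul_sub] at h1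
    have h5 : (m : ℂ) - n ≠ 0 := sub_ne_zero.2 (by exact_mod_cast h)
    exact (mul_eq_zero.1 h1).resolve_left (mul_ne_zero Complex.I_ne_zero h5)

lemma SmoothPeriodic.projLe {f : ℝ → ℂ} (N : ℕ) : SmoothPeriodic (projLe N f) := by
  refine ⟨?_, fun x => ?_⟩
  · unfold MKdV.projLe
    exact ContDiff.sum fun n _ => ((smoothPeriodic_exp n).const_mul _).1
  · unfold MKdV.projLe
    refine Finset.sum_congr rfl fun n _ => ?_
    rw [exp_two_pi_period]

lemma SmoothPeriodic.projGt {f : ℝ → ℂ} (hf : SmoothPeriodic f) (N : ℕ) :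
    SmoothPeriodic (projGt N f) := hf.sub (SmoothPeriodic.projLe N)

lemma coeff_finset_sum {ι : Type*} (s : Finset ι) {f : ι → ℝ → ℂ} (hf : ∀ i, Continuous (f i)) (n : ℤ) :
    coeff (fun x => ∑ i ∈ s, f i x) n = ∑ i ∈ s, coeff (f i) n := by
  unfold coeff
  simp only [Finset.sum_mul]
  rw [intervalIntegral.integral_finsetSum fun i _ => intervalIntegrable_coeff (hf i) n _ _,
    Finset.mul_sum]

lemma coeff_projGt {f : ℝ → ℂ} (hf : SmoothPeriodic f) (N : ℕ) (n : ℤ) :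
    coeff (projGt N f) n = if (N : ℤ) < |n| then coeff f n else 0 := by
  have h1 : coeff (projLe N f) n = if |n| ≤ (N : ℤ) then coeff f n else 0 := by
    unfold projLe
    rw [coeff_finset_sum (f := fun m x => coeff f m * Complex.exp (Complex.I * m * x)) _
      fun m => ((smoothPeriodic_exp m).const_mul _).continuous]
    simp only [coeff_const_mul, coeff_exp]
    simp [abs_le]
  have h2 := coeff_sub hf.continuous (SmoothPeriodic.projLe (f := f) N).continuous n
  have h3 : coeff (projGt N f) n = coeff f n - coeff (projLe N f) n := h2
  rw [h3, h1]
  by_cases h : (N : ℤ) < |n|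
  · rw [if_pos h, if_neg (not_le.2 h), sub_zero]
  · rw [if_neg h, if_pos (not_lt.1 h), sub_self]

/-- The momentum of the high frequencies. -/
lemma hasSum_momentum_projGt {f : ℝ → ℂ} (hf : SmoothPeriodic f) (N : ℕ) :
    HasSum (fun n : ℤ => psi N n * ‖coeff f n‖ ^ 2) (momentum (projGt N f)) := by
  refine HasSum.congr_fun (hasSum_momentum (hf.projGt N)) fun n => ?_
  rw [coeff_projGt hf]
  unfold psi
  split_ifs <;> simp

/-- Exchange of `n₁` and `n₃` with the output frequency fixed. -/
def exchPair (n : ℤ) : Equiv.Perm (ℤ × ℤ) :=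
  Function.Involutive.toPerm (fun y => (thd (n, y), y.2)) fun y => by
    refine Prod.ext ?_ rfl
    change n - (n - y.1 + y.2) + y.2 = y.1
    ring

lemma thd_exchPair (n : ℤ) (y : ℤ × ℤ) : thd (n, exchPair n y) = y.1 := by
  change n - (n - y.1 + y.2) + y.2 = y.1
  ring

lemma norm_tri_thd_le {C : ℝ} {c : ℤ → ℂ} (hc : Dec 8 C c) (n : ℤ) (y : ℤ × ℤ) :
    ‖((thd (n, y) : ℝ) : ℂ) * tri c c c y.1 y.2 (thd (n, y))‖ ≤
      C ^ 3 * (rec1 y.1 ^ 2 * rec1 y.2 ^ 2) := by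
  have hC := hc.nonneg
  obtain ⟨m, hm⟩ : ∃ m, m = thd (n, y) := ⟨_, rfl⟩
  rw [← hm, norm_mul, Complex.norm_real, Real.norm_eq_abs]
  have h1 := norm_tri_le hc hc hc y.1 y.2 m
  have h2 := abs_mul_rec1_le m
  have p1 := rec1_pos y.1
  have p2 := rec1_pos y.2
  have p3 := rec1_pos m
  have q1 := rec1_le_one y.1
  have q2 := rec1_le_one y.2
  have q3 := rec1_le_one m
  calc _ ≤ |(m : ℝ)| * (C ^ 3 * (rec1 y.1 * rec1 y.2 * rec1 m) ^ 8) := by gcongr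
    _ = C ^ 3 * (rec1 y.1 ^ 2 * rec1 y.2 ^ 2) * (|(m : ℝ)| * rec1 m) *
        (rec1 y.1 ^ 6 * rec1 y.2 ^ 6 * rec1 m ^ 7) := by ring
    _ ≤ C ^ 3 * (rec1 y.1 ^ 2 * rec1 y.2 ^ 2) * 1 * (1 ^ 6 * 1 ^ 6 * 1 ^ 7) := by gcongr
    _ = _ := by ring

/-- The Fourier coefficients of the cubic term. -/
lemma hasSum_cubic {f : ℝ → ℂ} (hf : SmoothPeriodic f) (n : ℤ) :
    HasSum (fun y : ℤ × ℤ => ((thd (n, y) : ℝ) : ℂ) *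
      tri (coeff f) (coeff f) (coeff f) y.1 y.2 (thd (n, y)))
      (-Complex.I * coeff (fun x => (‖f x‖ ^ 2 : ℝ) * deriv f x) n) := by
  obtain ⟨C, hc⟩ := hf.exists_dec 8
  have hs : Summable fun y : ℤ × ℤ => ((thd (n, y) : ℝ) : ℂ) *
      tri (coeff f) (coeff f) (coeff f) y.1 y.2 (thd (n, y)) :=
    Summable.of_norm_bounded (summable_pair.mul_left _) (norm_tri_thd_le hc n)
  have e : (fun x => ((‖f x‖ ^ 2 : ℝ) : ℂ) * deriv f x) =
      fun x => f x * (starRingEnd ℂ (f x) * deriv f x) := by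
    funext x
    rw [Complex.ofReal_pow, ← Complex.mul_conj']
    ring
  have h1 := (hasSum_coeff_mul hf (hf.conj.mul hf.deriv) n).tsum_eq
  rw [e, ← h1, hs.hasSum_iff, hs.tsum_prod, ← tsum_mul_left]
  refine tsum_congr fun k => ?_
  have h2 := (hasSum_conj_mul hf hf.deriv (n - k)).tsum_eq
  rw [← h2, ← tsum_mul_left, ← tsum_mul_left]
  refine tsum_congr fun l => ?_
  have e2 : n - k + l = thd (n, (k, l)) := rfl
  rw [coeff_deriv hf, e2]
  unfold tri
  generalize thd (n, (k, l)) = m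
  push_cast
  linear_combination (m * coeff f k * starRingEnd ℂ (coeff f l) * coeff f m) * Complex.I_sq

/-- The contribution of the resonant pairs. -/
lemma hasSum_resonant {f : ℝ → ℂ} (hf : SmoothPeriodic f) (n : ℤ) :
    HasSum (fun y : ℤ × ℤ => if y.1 ≠ y.2 ∧ thd (n, y) ≠ y.2 then (0 : ℂ) else
      ((y.1 : ℂ) + thd (n, y)) * tri (coeff f) (coeff f) (coeff f) y.1 y.2 (thd (n, y)))
      (2 * ((n * mass f + momentum f : ℝ) * coeff f n - (n * ‖coeff f n‖ ^ 2 : ℝ) * coeff f n)) := by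
  obtain ⟨c, hc⟩ : ∃ c, c = coeff f := ⟨_, rfl⟩
  have hM := hasSum_mass hf
  have hP := hasSum_momentum hf
  rw [← hc] at *
  have hS : HasSum (fun k : ℤ => ((k : ℂ) + n) * (‖c k‖ ^ 2 : ℝ) * c n)
      ((n * mass f + momentum f : ℝ) * c n) := by
    have h := (Complex.hasSum_ofReal.2 ((hM.mul_left (n : ℝ)).add hP)).mul_right (c n)
    refine HasSum.congr_fun h fun k => ?_
    push_cast
    ring
  have h1 : HasSum (fun y : ℤ × ℤ => if y.1 = y.2 then ((y.1 : ℂ) + n) * (‖c y.1‖ ^ 2 : ℝ) * c n else 0)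
      ((n * mass f + momentum f : ℝ) * c n) := by
    have hinj : Function.Injective fun k : ℤ => (k, k) := fun a b h => (Prod.ext_iff.1 h).1
    rw [← hinj.hasSum_iff]
    · refine HasSum.congr_fun hS fun k => ?_
      simp
    · rintro ⟨a, b⟩ hab
      refine if_neg fun h => hab ⟨a, ?_⟩
      exact Prod.ext rfl h
  have h2 : HasSum (fun y : ℤ × ℤ => if y.1 = n then ((y.2 : ℂ) + n) * (‖c y.2‖ ^ 2 : ℝ) * c n else 0)
      ((n * mass f + momentum f : ℝ) * c n) := by
    have hinj : Function.Injective fun k : ℤ => (n, k) := fun a b h => (Prod.ext_iff.1 h).2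
    rw [← hinj.hasSum_iff]
    · refine HasSum.congr_fun hS fun k => ?_
      simp
    · rintro ⟨a, b⟩ hab
      refine if_neg fun h => hab ⟨b, ?_⟩
      exact Prod.ext h.symm rfl
  have h3 : HasSum (fun y : ℤ × ℤ => if y = (n, n) then 2 * ((n * ‖c n‖ ^ 2 : ℝ) * c n) else 0)
      (2 * ((n * ‖c n‖ ^ 2 : ℝ) * c n)) := hasSum_ite_eq (n, n) _
  have h := (h1.add h2).sub h3
  rw [show 2 * ((n * mass f + momentum f : ℝ) * c n - (n * ‖c n‖ ^ 2 : ℝ) * c n) =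
    (n * mass f + momentum f : ℝ) * c n + (n * mass f + momentum f : ℝ) * c n -
      2 * ((n * ‖c n‖ ^ 2 : ℝ) * c n) by ring]
  refine HasSum.congr_fun h fun y => ?_
  obtain ⟨a, b⟩ := y
  simp only [Prod.mk.injEq, thd]
  have hcc : ∀ k, c k * starRingEnd ℂ (c k) = (‖c k‖ ^ 2 : ℝ) := fun k => by
    rw [Complex.mul_conj', Complex.ofReal_pow]
  by_cases hab : a = b
  · subst hab
    rw [if_neg (by simp), if_pos rfl]
    have e : n - a + a = n := by ring
    rw [e]
    unfold tri
    rw [hcc]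
    by_cases han : a = n
    · subst han
      simp
      ring
    · simp [han]
      ring
  · by_cases han : a = n
    · subst han
      have e : a - a + b = b := by ring
      rw [e, if_neg (by simp), if_neg hab, if_pos rfl, if_neg (fun h => hab h.2.symm)]
      unfold tri
      rw [mul_assoc (c a), mul_comm (starRingEnd ℂ (c b)), hcc]
      ring
    · have e : n - a + b ≠ b := fun h => han (by omega)
      rw [if_pos ⟨hab, e⟩, if_neg hab, if_neg han, if_neg (fun h => han h.1)]
      ring

/-- The renormalized nonlinearity on the Fourier side. -/
lemma coeff_nonlinearity {f : ℝ → ℂ} (hf : SmoothPeriodic f) (n : ℤ) :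
    coeff (fun x => (‖f x‖ ^ 2 : ℝ) * deriv f x) n - mass f * (Complex.I * n * coeff f n) -
      Complex.I * momentum f * coeff f n = Complex.I * nonlin (coeff f) n := by
  have h1 := hasSum_cubic hf n
  have h2 := h1
  rw [← (exchPair n).hasSum_iff] at h2
  have h3 := hasSum_resonant hf n
  obtain ⟨X, hX⟩ : ∃ X, X = coeff (fun x => (‖f x‖ ^ 2 : ℝ) * deriv f x) n := ⟨_, rfl⟩
  rw [← hX] at h1 h2 ⊢
  have h4 := ((h1.add h2).sub h3).tsum_eq
  have e : ∀ y : ℤ × ℤ, (freqSum y.1 y.2 (thd (n, y)) : ℂ) *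
      tri (coeff f) (coeff f) (coeff f) y.1 y.2 (thd (n, y)) =
      ((thd (n, y) : ℝ) : ℂ) * tri (coeff f) (coeff f) (coeff f) y.1 y.2 (thd (n, y)) +
      ((fun y : ℤ × ℤ => ((thd (n, y) : ℝ) : ℂ) *
        tri (coeff f) (coeff f) (coeff f) y.1 y.2 (thd (n, y))) ∘ exchPair n) y -
      (if y.1 ≠ y.2 ∧ thd (n, y) ≠ y.2 then (0 : ℂ) else
      ((y.1 : ℂ) + thd (n, y)) * tri (coeff f) (coeff f) (coeff f) y.1 y.2 (thd (n, y))) := by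
    intro y
    have e1 : tri (coeff f) (coeff f) (coeff f) (exchPair n y).1 (exchPair n y).2 y.1 =
        tri (coeff f) (coeff f) (coeff f) y.1 y.2 (thd (n, y)) := by
      change tri (coeff f) (coeff f) (coeff f) (thd (n, y)) y.2 y.1 = _
      unfold tri
      ring
    simp only [Function.comp_apply, thd_exchPair]
    rw [e1]
    unfold freqSum
    split_ifs <;> push_cast <;> ring
  unfold nonlin
  simp only [e]
  rw [h4]
  push_cast
  linear_combination X * Complex.I_sq

/-- The equation on the Fourier side. -/
lemma IsSmoothSolution.hasDerivAt_coeff {κ : ℝ} {u₀ : ℝ → ℂ} {u : ℝ → ℝ → ℂ}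
    (hu : IsSmoothSolution κ u₀ u) (t : ℝ) (n : ℤ) :
    HasDerivAt (fun t => coeff (u t) n) (flow κ (coeff (u t)) n) t := by
  have hw : SmoothFamily u := ⟨hu.smooth, hu.periodic⟩
  have hf := hw.section_x t
  refine (hw.hasDerivAt_coeff t n).congr_deriv ?_
  have e : (fun x => deriv (fun t' => u t' x) t) = fun x =>
      (κ : ℂ) * ((‖u t x‖ ^ 2 : ℝ) * deriv (u t) x - (mass (u t) : ℂ) * deriv (u t) x
        - Complex.I * (momentum (u t) : ℂ) * u t x) - deriv (deriv (deriv (u t))) x := by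
    funext x
    rw [← hu.eqn t x, iteratedDeriv_succ, iteratedDeriv_succ, iteratedDeriv_one]
    ring
  have c0 := hf.continuous
  have c1 := hf.deriv.continuous
  have c3 := hf.deriv.deriv.deriv.continuous
  rw [e, coeff_sub (by fun_prop) c3, coeff_const_mul, coeff_sub (by fun_prop) (by fun_prop),
    coeff_sub (by fun_prop) (by fun_prop), coeff_const_mul, coeff_const_mul, coeff_deriv hf.deriv.deriv,
    coeff_deriv hf.deriv, coeff_deriv hf, coeff_nonlinearity hf]
  unfold flow
  push_cast
  linear_combination (-(Complex.I * n ^ 3 * coeff (u t) n)) * Complex.I_sq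

section

variable {κ : ℝ} {u₀ : ℝ → ℂ} {u : ℝ → ℝ → ℂ}

lemma IsSmoothSolution.family (hu : IsSmoothSolution κ u₀ u) : SmoothFamily u :=
  ⟨hu.smooth, hu.periodic⟩

/-- Locally uniform decay of the coefficients and of their time derivatives. -/
lemma IsSmoothSolution.exists_dec (hu : IsSmoothSolution κ u₀ u) (T : ℝ) :
    ∃ C, ∀ t ∈ Set.Icc (-T) T, Dec 8 C (coeff (u t)) ∧ Dec 8 C (flow κ (coeff (u t))) := by
  obtain ⟨C, hC⟩ := hu.family.exists_dec T 8
  obtain ⟨D, hD⟩ := hu.family.dt.exists_dec T 8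
  refine ⟨max C D, fun t ht => ⟨(hC t ht).mono le_rfl (le_max_left _ _), ?_⟩⟩
  have h := (hD t ht).mono (l := 8) le_rfl (le_max_right C D)
  intro n
  rw [(hu.hasDerivAt_coeff t n).unique (hu.family.hasDerivAt_coeff t n)]
  exact h n

lemma norm_dquad_le {C : ℝ} {c d : ℤ → ℂ} (hc : Dec 8 C c) (hd : Dec 8 C d) (n₁ n₂ n₃ n : ℤ) :
    ‖dquad c d n₁ n₂ n₃ n‖ ≤ 4 * C ^ 4 * (rec1 n₁ * rec1 n₂ * rec1 n₃ * rec1 n) ^ 8 := by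
  unfold dquad
  have h1 := norm_quad_le hd hc hc hc n₁ n₂ n₃ n
  have h2 := norm_quad_le hc hd hc hc n₁ n₂ n₃ n
  have h3 := norm_quad_le hc hc hd hc n₁ n₂ n₃ n
  have h4 := norm_quad_le hc hc hc hd n₁ n₂ n₃ n
  have h5 := norm_add₄_le (a := quad d c c c n₁ n₂ n₃ n) (b := quad c d c c n₁ n₂ n₃ n)
    (c := quad c c d c n₁ n₂ n₃ n) (d := quad c c c d n₁ n₂ n₃ n)
  linarith

lemma abs_beta_mul_re_le {D : ℝ} (hD : 0 ≤ D) (N : ℕ) (x : ℤ × (ℤ × ℤ)) {z : ℂ}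
    (hz : ‖z‖ ≤ D * (rec1 x.2.1 * rec1 x.2.2 * rec1 (thd x) * rec1 x.1) ^ 8) :
    |beta N x.2.1 x.2.2 (thd x) * z.re| ≤ D * (rec1 x.1 ^ 2 * (rec1 x.2.1 ^ 2 * rec1 x.2.2 ^ 2)) := by
  have hr := rec_four_pos x.2.1 x.2.2 (thd x) x.1
  have hr1 := rec_four_le_one x.2.1 x.2.2 (thd x) x.1
  have h := pow_mul_le_of_le_one (l := 2) (m := 8) (abs_nonneg _) hr hr1 (abs_beta_thd_le N x)
    (by norm_num)
  rw [abs_mul]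
  calc _ ≤ |beta N x.2.1 x.2.2 (thd x)| *
        (D * (rec1 x.2.1 * rec1 x.2.2 * rec1 (thd x) * rec1 x.1) ^ 8) := by
        gcongr
        exact (Complex.abs_re_le_norm z).trans hz
    _ = D * (|beta N x.2.1 x.2.2 (thd x)| *
        (rec1 x.2.1 * rec1 x.2.2 * rec1 (thd x) * rec1 x.1) ^ 8) := by ring
    _ ≤ D * (rec1 x.2.1 * rec1 x.2.2 * rec1 (thd x) * rec1 x.1) ^ 2 := by gcongr
    _ ≤ _ := by
        gcongr
        exact prod_four_le (rec1_pos _) (rec1_pos _) (rec1_pos _) (rec1_pos _) (rec1_le_one _)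

/-- The correction term of the modified momentum. -/
noncomputable def correction (N : ℕ) (c : ℤ → ℂ) : ℝ :=
  ∑' x : ℤ × (ℤ × ℤ), beta N x.2.1 x.2.2 (thd x) * (quad c c c c x.2.1 x.2.2 (thd x) x.1).re

lemma hasDerivAt_quad {c : ℝ → ℤ → ℂ} {d : ℤ → ℂ} {t : ℝ}
    (h : ∀ n, HasDerivAt (fun t => c t n) (d n) t) (n₁ n₂ n₃ n : ℤ) :
    HasDerivAt (fun t => quad (c t) (c t) (c t) (c t) n₁ n₂ n₃ n) (dquad (c t) d n₁ n₂ n₃ n) t := by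
  have hconj : ∀ n, HasDerivAt (fun t => starRingEnd ℂ (c t n)) (starRingEnd ℂ (d n)) t := fun n =>
    (Complex.conjCLE.toContinuousLinearMap.hasFDerivAt.comp_hasDerivAt t (h n))
  refine ((((h n₁).mul (hconj n₂)).mul (h n₃)).mul (hconj n)).congr_deriv ?_
  unfold dquad quad tri
  simp only [Pi.mul_apply]
  ring

lemma IsSmoothSolution.hasDerivAt_modified (hu : IsSmoothSolution κ u₀ u) (hκ : κ ^ 2 = 1) (N : ℕ)
    (t : ℝ) :
    HasDerivAt (fun t => momentum (projGt N (u t)) + κ / 12 * correction N (coeff (u t)))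
      (1 / 12 * (∑' x, sixForm N (coeff (u t)) x) - 1 / 3 * ∑' x, resForm N (coeff (u t)) x) t := by
  obtain ⟨C, hC⟩ := hu.exists_dec (|t| + 1)
  have hC' : ∀ s ∈ Set.Ioo (-(|t| + 1)) (|t| + 1),
      Dec 8 C (coeff (u s)) ∧ Dec 8 C (flow κ (coeff (u s))) :=
    fun s hs => hC s (Set.Ioo_subset_Icc_self hs)
  have ht : t ∈ Set.Ioo (-(|t| + 1)) (|t| + 1) :=
    ⟨by linarith [neg_abs_le t], by linarith [le_abs_self t]⟩
  have hC0 := (hC' t ht).1.nonneg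
  rw [← modified_energy_identity N hκ (hC' t ht).1]
  have e1 : (fun t => momentum (projGt N (u t))) =
      fun t => ∑' n, psi N n * ‖coeff (u t) n‖ ^ 2 := by
    funext s
    exact (hasSum_momentum_projGt (hu.family.section_x s) N).tsum_eq.symm
  have d1 : HasDerivAt (fun t => momentum (projGt N (u t)))
      (∑' n, psi N n * (2 * (starRingEnd ℂ (coeff (u t) n) * flow κ (coeff (u t)) n).re)) t := by
    rw [e1]
    refine hasDerivAt_tsum_of_isPreconnected (summable_rec1_sq.mul_left (2 * C ^ 2)) isOpen_Ioo
      isPreconnected_Ioo (g := fun n s => psi N n * ‖coeff (u s) n‖ ^ 2)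
      (g' := fun n s => psi N n * (2 * (starRingEnd ℂ (coeff (u s) n) * flow κ (coeff (u s)) n).re))
      (fun n s _ => ?_) (fun n s hs => ?_) ht
      (hasSum_momentum_projGt (hu.family.section_x t) N).summable ht
    · refine HasDerivAt.const_mul _ ?_
      refine (hu.hasDerivAt_coeff s n).norm_sq.congr_deriv ?_
      rw [Complex.inner, mul_comm (starRingEnd ℂ _)]
    · obtain ⟨h1, h2⟩ := hC' s hs
      have p := rec1_pos n
      have h3 := pow_mul_le_of_le_one (k := 1) (l := 2) (m := 16) (abs_nonneg (psi N n)) p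
        (rec1_le_one n) (by rw [pow_one]; exact abs_psi_mul_le N n) (by norm_num)
      rw [Real.norm_eq_abs, abs_mul, abs_mul, abs_two]
      calc _ ≤ |psi N n| * (2 * ((C * rec1 n ^ 8) * (C * rec1 n ^ 8))) := by
            gcongr
            refine (Complex.abs_re_le_norm _).trans ?_
            rw [norm_mul, RCLike.norm_conj]
            exact mul_le_mul (h1 n) (h2 n) (norm_nonneg _) (by positivity)
        _ = 2 * C ^ 2 * (|psi N n| * rec1 n ^ 16) := by ring
        _ ≤ _ := by gcongr
  have d2 : HasDerivAt (fun t => correction N (coeff (u t)))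
      (∑' x : ℤ × (ℤ × ℤ), beta N x.2.1 x.2.2 (thd x) *
        (dquad (coeff (u t)) (flow κ (coeff (u t))) x.2.1 x.2.2 (thd x) x.1).re) t := by
    unfold correction
    refine hasDerivAt_tsum_of_isPreconnected (summable_quad.mul_left (4 * C ^ 4)) isOpen_Ioo
      isPreconnected_Ioo (g := fun (x : ℤ × (ℤ × ℤ)) s => beta N x.2.1 x.2.2 (thd x) *
        (quad (coeff (u s)) (coeff (u s)) (coeff (u s)) (coeff (u s)) x.2.1 x.2.2 (thd x) x.1).re)
      (g' := fun (x : ℤ × (ℤ × ℤ)) s => beta N x.2.1 x.2.2 (thd x) *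
        (dquad (coeff (u s)) (flow κ (coeff (u s))) x.2.1 x.2.2 (thd x) x.1).re)
      (fun x s _ => ?_) (fun x s hs => ?_) ht ?_ ht
    · refine HasDerivAt.const_mul _ ?_
      exact Complex.reCLM.hasFDerivAt.comp_hasDerivAt s
        (hasDerivAt_quad (fun n => hu.hasDerivAt_coeff s n) _ _ _ _)
    · obtain ⟨h1, h2⟩ := hC' s hs
      exact abs_beta_mul_re_le (by positivity) N x (norm_dquad_le h1 h2 _ _ _ _)
    · obtain ⟨h1, h2⟩ := hC' t ht
      exact Summable.of_norm_bounded (summable_quad.mul_left (C ^ 4)) fun x =>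
        abs_beta_mul_re_le (by positivity) N x (norm_quad_le h1 h1 h1 h1 _ _ _ _)
  exact d1.add (d2.const_mul _)

/-- Interchange of integration and summation under a uniform bound. -/
lemma hasSum_intervalIntegral {ι : Type*} [Countable ι] {f : ι → ℝ → ℝ} {B : ι → ℝ} (hB : Summable B)
    (hf : ∀ i, Continuous (f i)) {t : ℝ} (h : ∀ i, ∀ s ∈ Set.uIcc 0 t, |f i s| ≤ B i) :
    HasSum (fun i => ∫ s in (0 : ℝ)..t, f i s) (∫ s in (0 : ℝ)..t, ∑' i, f i s) ∧
      IntervalIntegrable (fun s => ∑' i, f i s) volume 0 t := by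
  refine ⟨?_, ?_⟩
  · refine intervalIntegral.hasSum_integral_of_dominated_convergence (fun i _ => B i)
      (fun i => (hf i).aestronglyMeasurable)
      (fun i => Filter.Eventually.of_forall fun s hs => h i s (Set.uIoc_subset_uIcc hs))
      (Filter.Eventually.of_forall fun _ _ => hB) (continuous_const.intervalIntegrable _ _)
      (Filter.Eventually.of_forall fun s hs => ?_)
    exact (Summable.of_norm_bounded hB fun i => h i s (Set.uIoc_subset_uIcc hs)).hasSum
  · exact (continuousOn_tsum (fun i => (hf i).continuousOn) hB h).intervalIntegrable

lemma IsSmoothSolution.continuous_coeff (hu : IsSmoothSolution κ u₀ u) (n : ℤ) :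
    Continuous fun s => coeff (u s) n :=
  continuous_iff_continuousAt.2 fun s => (hu.hasDerivAt_coeff s n).continuousAt

lemma IsSmoothSolution.continuous_tri (hu : IsSmoothSolution κ u₀ u) (n₁ n₂ n₃ : ℤ) :
    Continuous fun s => tri (coeff (u s)) (coeff (u s)) (coeff (u s)) n₁ n₂ n₃ :=
  ((hu.continuous_coeff n₁).mul (Complex.continuous_conj.comp (hu.continuous_coeff n₂))).mul
    (hu.continuous_coeff n₃)

lemma IsSmoothSolution.continuous_sixForm (hu : IsSmoothSolution κ u₀ u) (N : ℕ)
    (x : ℤ × (ℤ × ℤ) × (ℤ × ℤ)) : Continuous fun s => sixForm N (coeff (u s)) x :=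
  continuous_const.mul (Complex.continuous_im.comp ((hu.continuous_tri _ _ _).mul
    (Complex.continuous_conj.comp (hu.continuous_tri _ _ _))))

lemma IsSmoothSolution.continuous_resForm (hu : IsSmoothSolution κ u₀ u) (N : ℕ)
    (x : ℤ × (ℤ × ℤ)) : Continuous fun s => resForm N (coeff (u s)) x :=
  continuous_const.mul ((continuous_const.mul ((hu.continuous_coeff _).norm.pow 2)).mul
    (Complex.continuous_im.comp ((hu.continuous_tri _ _ _).mul
    (Complex.continuous_conj.comp (hu.continuous_coeff _)))))

/-- The change of the momentum of the high frequencies. -/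
theorem IsSmoothSolution.momentum_sub_eq (hu : IsSmoothSolution κ u₀ u) (hκ : κ ^ 2 = 1) (N : ℕ)
    (t : ℝ) :
    momentum (projGt N (u t)) - momentum (projGt N (u 0)) =
      κ / 12 * correction N (coeff (u 0)) - κ / 12 * correction N (coeff (u t)) +
      1 / 12 * (∑' x, ∫ s in (0 : ℝ)..t, sixForm N (coeff (u s)) x) -
      1 / 3 * ∑' x, ∫ s in (0 : ℝ)..t, resForm N (coeff (u s)) x := by
  obtain ⟨C, hC⟩ := hu.exists_dec |t|
  have hsub : ∀ s ∈ Set.uIcc 0 t, Dec 8 C (coeff (u s)) := fun s hs => by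
    refine (hC s ?_).1
    rw [Set.mem_uIcc] at hs
    have h1 := le_abs_self t
    have h2 := neg_abs_le t
    rcases hs with ⟨h3, h4⟩ | ⟨h3, h4⟩ <;> constructor <;> linarith
  obtain ⟨h1, i1⟩ := hasSum_intervalIntegral (summable_hex.mul_left (2 * C ^ 6))
    (hu.continuous_sixForm N) (t := t) fun x s hs => abs_sixForm_le N (hsub s hs) x
  obtain ⟨h2, i2⟩ := hasSum_intervalIntegral (summable_quad.mul_left (C ^ 6))
    (hu.continuous_resForm N) (t := t) fun x s hs => abs_resForm_le N (hsub s hs) x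
  have h := intervalIntegral.integral_eq_sub_of_hasDerivAt
    (fun s _ => hu.hasDerivAt_modified hκ N s) ((i1.const_mul (1 / 12)).sub (i2.const_mul (1 / 3)))
  rw [intervalIntegral.integral_sub (i1.const_mul (1 / 12)) (i2.const_mul (1 / 3)),
    intervalIntegral.integral_const_mul, intervalIntegral.integral_const_mul, ← h1.tsum_eq,
    ← h2.tsum_eq] at h
  linarith

end

section

variable {κ : ℝ} {u₀ : ℝ → ℂ} {u : ℝ → ℝ → ℂ} {t : ℝ} {v : ℤ → ℝ → ℂ} {a : ℤ → ℝ}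

/-- The interaction representation of a coefficient. -/
noncomputable def profile (v : ℤ → ℝ → ℂ) (n : ℤ) (s : ℝ) : ℂ :=
  Complex.exp (-(Complex.I * ((n : ℝ) ^ 3 * s : ℝ))) * v n s

lemma exp_mul_profile (v : ℤ → ℝ → ℂ) (n : ℤ) (s : ℝ) :
    Complex.exp (Complex.I * ((n : ℝ) ^ 3 * s : ℝ)) * profile v n s = v n s := by
  unfold profile
  rw [← mul_assoc, ← Complex.exp_add, add_neg_cancel, Complex.exp_zero, one_mul]

lemma enorm_profile (v : ℤ → ℝ → ℂ) (n : ℤ) (s : ℝ) : ‖profile v n s‖ₑ = ‖v n s‖ₑ := by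
  unfold profile
  rw [enorm_mul, show -(Complex.I * ((n : ℝ) ^ 3 * s : ℝ)) = Complex.I * ((-((n : ℝ) ^ 3 * s) : ℝ) : ℂ) by
    push_cast; ring, enorm_exp_I_mul, one_mul]

lemma tri_mul_conj_tri_eq (v : ℤ → ℝ → ℂ) (n₁ n₂ n₃ m₁ m₂ m₃ : ℤ) (s : ℝ) :
    tri (v · s) (v · s) (v · s) n₁ n₂ n₃ * starRingEnd ℂ (tri (v · s) (v · s) (v · s) m₁ m₂ m₃) =
    Complex.exp (Complex.I * (((cubes (signed n₁ n₂ n₃ m₁ m₂ m₃) : ℤ) : ℝ) * s : ℝ)) *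
      ((profile v n₁ s * starRingEnd ℂ (profile v n₂ s) * profile v n₃ s) *
      (starRingEnd ℂ (profile v m₁ s) * profile v m₂ s * starRingEnd ℂ (profile v m₃ s))) := by
  have hE : Complex.exp (Complex.I * (((cubes (signed n₁ n₂ n₃ m₁ m₂ m₃) : ℤ) : ℝ) * s : ℝ)) =
      Complex.exp (Complex.I * ((n₁ : ℝ) ^ 3 * s : ℝ)) *
      starRingEnd ℂ (Complex.exp (Complex.I * ((n₂ : ℝ) ^ 3 * s : ℝ))) *
      Complex.exp (Complex.I * ((n₃ : ℝ) ^ 3 * s : ℝ)) *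
      starRingEnd ℂ (Complex.exp (Complex.I * ((m₁ : ℝ) ^ 3 * s : ℝ))) *
      Complex.exp (Complex.I * ((m₂ : ℝ) ^ 3 * s : ℝ)) *
      starRingEnd ℂ (Complex.exp (Complex.I * ((m₃ : ℝ) ^ 3 * s : ℝ))) := by
    simp only [← Complex.exp_conj, map_mul, Complex.conj_I, Complex.conj_ofReal, ← Complex.exp_add]
    congr 1
    simp [cubes, signed, Fin.sum_univ_six]
    ring
  unfold tri
  have hp : ∀ n, v n s = Complex.exp (Complex.I * ((n : ℝ) ^ 3 * s : ℝ)) * profile v n s := fun n =>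
    (exp_mul_profile v n s).symm
  rw [hE]
  simp only [hp, map_mul, Complex.conj_conj]
  ring

/-- A single oscillatory integral. -/
lemma enorm_integral_tri_le (hw : ∀ n, HalfReg (profile v n) (ENNReal.ofReal (a n)))
    (ha : ∀ n, 0 ≤ a n) (hv : ∀ n : ℤ, ∀ᵐ s ∂(volume.restrict (Set.uIcc 0 t)), v n s = coeff (u s) n)
    (n₁ n₂ n₃ m₁ m₂ m₃ : ℤ) :
    ‖∫ s in (0 : ℝ)..t, tri (coeff (u s)) (coeff (u s)) (coeff (u s)) n₁ n₂ n₃ *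
      starRingEnd ℂ (tri (coeff (u s)) (coeff (u s)) (coeff (u s)) m₁ m₂ m₃)‖ₑ ≤
    oscConst * ENNReal.ofReal (modulation (signed n₁ n₂ n₃ m₁ m₂ m₃) ^ (-(1 / 2 : ℝ)) *
      prodSix a n₁ n₂ n₃ m₁ m₂ m₃) := by
  rw [← ofReal_norm, intervalIntegral.norm_integral_eq_norm_integral_uIoc, ofReal_norm]
  obtain ⟨W, hW⟩ : ∃ W : Fin 6 → ℝ → ℂ, W = ![profile v n₁, fun s => starRingEnd ℂ (profile v n₂ s),
    profile v n₃, fun s => starRingEnd ℂ (profile v m₁ s), profile v m₂,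
    fun s => starRingEnd ℂ (profile v m₃ s)] := ⟨_, rfl⟩
  obtain ⟨A, hA⟩ : ∃ A : Fin 6 → ℝ≥0∞, A = ![ENNReal.ofReal (a n₁), ENNReal.ofReal (a n₂),
    ENNReal.ofReal (a n₃), ENNReal.ofReal (a m₁), ENNReal.ofReal (a m₂), ENNReal.ofReal (a m₃)] :=
    ⟨_, rfl⟩
  have hWA : ∀ i, HalfReg (W i) (A i) := by
    intro i
    rw [hW, hA]
    fin_cases i
    · exact hw n₁
    · exact (hw n₂).conj
    · exact hw n₃
    · exact (hw m₁).conj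
    · exact hw m₂
    · exact (hw m₃).conj
  have hae : ∀ᵐ s ∂(volume.restrict (Set.uIoc 0 t)), ∀ n, v n s = coeff (u s) n := by
    rw [ae_all_iff]
    exact fun n => ae_mono (Measure.restrict_mono Set.uIoc_subset_uIcc le_rfl) (hv n)
  have e : ∫ s in Set.uIoc 0 t, tri (coeff (u s)) (coeff (u s)) (coeff (u s)) n₁ n₂ n₃ *
      starRingEnd ℂ (tri (coeff (u s)) (coeff (u s)) (coeff (u s)) m₁ m₂ m₃) =
      ∫ s in Set.uIoc 0 t, Complex.exp (Complex.I *
        (((cubes (signed n₁ n₂ n₃ m₁ m₂ m₃) : ℤ) : ℝ) * s : ℝ)) * ∏ i, W i s := by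
    refine integral_congr_ae ?_
    filter_upwards [hae] with s hs
    have : coeff (u s) = (v · s) := funext fun n => (hs n).symm
    rw [this, tri_mul_conj_tri_eq, hW, Fin.prod_univ_six]
    simp
    ring
  rw [e]
  refine (enorm_integral_osc_le hWA (min 0 t) (max 0 t)
    ((cubes (signed n₁ n₂ n₃ m₁ m₂ m₃) : ℤ) : ℝ)).trans (le_of_eq ?_)
  have hm : 0 ≤ modulation (signed n₁ n₂ n₃ m₁ m₂ m₃) := by unfold modulation; positivity
  rw [ENNReal.ofReal_mul (by positivity)]
  congr 2
  rw [hA, Fin.prod_univ_six]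
  unfold prodSix
  have h1 := ha n₁
  have h2 := ha n₂
  have h3 := ha n₃
  have h4 := ha m₁
  have h5 := ha m₂
  rw [ENNReal.ofReal_mul (by positivity), ENNReal.ofReal_mul (by positivity),
    ENNReal.ofReal_mul (by positivity), ENNReal.ofReal_mul (by positivity),
    ENNReal.ofReal_mul (by positivity)]
  simp
  ring

lemma IsSmoothSolution.enorm_integral_sixForm_le (hu : IsSmoothSolution κ u₀ u)
    (hw : ∀ n, HalfReg (profile v n) (ENNReal.ofReal (a n)))
    (ha : ∀ n, 0 ≤ a n) (hv : ∀ n : ℤ, ∀ᵐ s ∂(volume.restrict (Set.uIcc 0 t)), v n s = coeff (u s) n)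
    (N : ℕ) (x : ℤ × (ℤ × ℤ) × (ℤ × ℤ)) :
    ‖∫ s in (0 : ℝ)..t, sixForm N (coeff (u s)) x‖ₑ ≤ oscConst * ENNReal.ofReal
      (|sixNR N x.2.1.1 x.2.1.2 (x.1 - x.2.1.1 + x.2.1.2) x.2.2.1 x.2.2.2 (x.1 - x.2.2.1 + x.2.2.2)| *
      modulation (signed x.2.1.1 x.2.1.2 (x.1 - x.2.1.1 + x.2.1.2) x.2.2.1 x.2.2.2
        (x.1 - x.2.2.1 + x.2.2.2)) ^ (-(1 / 2 : ℝ)) *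
      prodSix a x.2.1.1 x.2.1.2 (x.1 - x.2.1.1 + x.2.1.2) x.2.2.1 x.2.2.2
        (x.1 - x.2.2.1 + x.2.2.2)) := by
  have h := enorm_integral_tri_le hw ha hv x.2.1.1 x.2.1.2 (thd (x.1, x.2.1)) x.2.2.1 x.2.2.2
    (thd (x.1, x.2.2))
  have hc : Continuous fun s => tri (coeff (u s)) (coeff (u s)) (coeff (u s)) x.2.1.1 x.2.1.2
      (thd (x.1, x.2.1)) * starRingEnd ℂ (tri (coeff (u s)) (coeff (u s)) (coeff (u s)) x.2.2.1 x.2.2.2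
        (thd (x.1, x.2.2))) :=
    (hu.continuous_tri _ _ _).mul (Complex.continuous_conj.comp (hu.continuous_tri _ _ _))
  have him := Complex.imCLM.intervalIntegral_comp_comm (hc.intervalIntegrable (μ := volume) 0 t)
  simp only [Complex.imCLM_apply] at him
  unfold sixForm
  rw [intervalIntegral.integral_const_mul, him, enorm_mul, mul_assoc |(sixNR _ _ _ _ _ _ _)|,
    ENNReal.ofReal_mul (abs_nonneg _), mul_left_comm]
  gcongr
  · rw [← ofReal_norm, Real.norm_eq_abs]
  · refine le_trans ?_ h
    rw [← ofReal_norm, ← ofReal_norm]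
    exact ENNReal.ofReal_le_ofReal (Complex.abs_im_le_norm _)

lemma enorm_integral_resForm_le (hw : ∀ n, HalfReg (profile v n) (ENNReal.ofReal (a n)))
    (ha : ∀ n, 0 ≤ a n) (hv : ∀ n : ℤ, ∀ᵐ s ∂(volume.restrict (Set.uIcc 0 t)), v n s = coeff (u s) n)
    {A : ℝ≥0∞} (hA : ∀ n : ℤ, ENNReal.ofReal (|(n : ℝ)| * a n ^ 2) ≤ A)
    (N : ℕ) (x : ℤ × (ℤ × ℤ)) :
    ‖∫ s in (0 : ℝ)..t, resForm N (coeff (u s)) x‖ₑ ≤ hexConst ^ (1 / 2 : ℝ) * A *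
      ENNReal.ofReal (|beta N x.2.1 x.2.2 (x.1 - x.2.1 + x.2.2)| *
        prodFour a x.2.1 x.2.2 (x.1 - x.2.1 + x.2.2)) := by
  obtain ⟨W, hW⟩ : ∃ W : Fin 6 → ℝ → ℂ, W = ![profile v x.1, profile v x.1, profile v x.2.1,
    profile v x.2.2, profile v (thd x), profile v x.1] := ⟨_, rfl⟩
  obtain ⟨D, hD⟩ : ∃ D : Fin 6 → ℝ≥0∞, D = ![ENNReal.ofReal (a x.1), ENNReal.ofReal (a x.1),
    ENNReal.ofReal (a x.2.1), ENNReal.ofReal (a x.2.2), ENNReal.ofReal (a (thd x)),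
    ENNReal.ofReal (a x.1)] := ⟨_, rfl⟩
  have hWD : ∀ i, HalfReg (W i) (D i) := by
    intro i
    rw [hW, hD]
    fin_cases i <;> exact hw _
  have hae : ∀ᵐ s ∂(volume.restrict (Set.uIoc 0 t)), ∀ n, v n s = coeff (u s) n := by
    rw [ae_all_iff]
    exact fun n => ae_mono (Measure.restrict_mono Set.uIoc_subset_uIcc le_rfl) (hv n)
  have hb : ∀ᵐ s ∂(volume.restrict (Set.uIoc 0 t)), ‖resForm N (coeff (u s)) x‖ₑ ≤
      ENNReal.ofReal |beta N x.2.1 x.2.2 (thd x)| * ENNReal.ofReal |(x.1 : ℝ)| * ∏ i, ‖W i s‖ₑ := by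
    filter_upwards [hae] with s hs
    have hc : ∀ n, ‖coeff (u s) n‖ₑ = ‖profile v n s‖ₑ := fun n => by rw [enorm_profile, hs]
    have hq : ‖(quad (coeff (u s)) (coeff (u s)) (coeff (u s)) (coeff (u s)) x.2.1 x.2.2 (thd x) x.1).im‖ₑ ≤
        ‖profile v x.2.1 s‖ₑ * ‖profile v x.2.2 s‖ₑ * ‖profile v (thd x) s‖ₑ * ‖profile v x.1 s‖ₑ := by
      rw [← hc, ← hc, ← hc, ← hc]
      calc _ ≤ ‖quad (coeff (u s)) (coeff (u s)) (coeff (u s)) (coeff (u s)) x.2.1 x.2.2 (thd x) x.1‖ₑ := by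
            rw [← ofReal_norm, ← ofReal_norm]
            exact ENNReal.ofReal_le_ofReal (Complex.abs_im_le_norm _)
        _ = _ := by
            unfold quad tri
            simp only [enorm_mul, RCLike.enorm_conj]
    have hn : ‖‖coeff (u s) x.1‖‖ₑ = ‖profile v x.1 s‖ₑ := by rw [enorm_norm, hc]
    unfold resForm
    rw [enorm_mul, enorm_mul, enorm_mul, enorm_pow, hn, ← ofReal_norm (beta _ _ _ _),
      ← ofReal_norm (x.1 : ℝ), Real.norm_eq_abs, Real.norm_eq_abs, hW, Fin.prod_univ_six]
    simp only [Matrix.cons_val]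
    calc _ ≤ ENNReal.ofReal |beta N x.2.1 x.2.2 (thd x)| * (ENNReal.ofReal |(x.1 : ℝ)| *
          ‖profile v x.1 s‖ₑ ^ 2 * (‖profile v x.2.1 s‖ₑ * ‖profile v x.2.2 s‖ₑ *
          ‖profile v (thd x) s‖ₑ * ‖profile v x.1 s‖ₑ)) := by gcongr
      _ = _ := by ring
  have hm : ∀ i, Measurable (W i) := fun i => (hWD i).meas
  have h1 := ha x.1
  have h2 := ha x.2.1
  have h3 := ha x.2.2
  have h4 := ha (thd x)
  rw [← ofReal_norm, intervalIntegral.norm_integral_eq_norm_integral_uIoc, ofReal_norm]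
  calc _ ≤ ∫⁻ s in Set.uIoc 0 t, ‖resForm N (coeff (u s)) x‖ₑ := enorm_integral_le_lintegral_enorm _
    _ ≤ ∫⁻ s in Set.uIoc 0 t, ENNReal.ofReal |beta N x.2.1 x.2.2 (thd x)| *
        ENNReal.ofReal |(x.1 : ℝ)| * ∏ i, ‖W i s‖ₑ := lintegral_mono_ae hb
    _ ≤ ENNReal.ofReal |beta N x.2.1 x.2.2 (thd x)| * ENNReal.ofReal |(x.1 : ℝ)| *
        (hexConst ^ (1 / 2 : ℝ) * ∏ i, D i) := by
        rw [lintegral_const_mul _ (by fun_prop)]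
        gcongr
        exact (setLIntegral_le_lintegral _ _).trans (lintegral_prod_six_le hWD)
    _ = hexConst ^ (1 / 2 : ℝ) * ENNReal.ofReal (|(x.1 : ℝ)| * a x.1 ^ 2) *
        ENNReal.ofReal (|beta N x.2.1 x.2.2 (thd x)| * prodFour a x.2.1 x.2.2 (thd x)) := by
        unfold prodFour
        rw [hD, Fin.prod_univ_six, thd_sub, ENNReal.ofReal_mul (abs_nonneg _),
          ENNReal.ofReal_mul (abs_nonneg _), ENNReal.ofReal_pow h1, ENNReal.ofReal_mul (by positivity),
          ENNReal.ofReal_mul (by positivity), ENNReal.ofReal_mul (by positivity)]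
        simp only [Matrix.cons_val]
        ring
    _ ≤ _ := by
        gcongr
        exact hA x.1

lemma enorm_tsum_le {ι : Type*} (f : ι → ℝ) : ‖∑' i, f i‖ₑ ≤ ∑' i, ‖f i‖ₑ := enorm_tsum_le_tsum_enorm

lemma enorm_correction_le {η : ℝ} (hη : 0 < η) (hη1 : η ≤ 1) {N : ℕ} (hN : 1 ≤ N) (c : ℤ → ℂ) {B : ℝ≥0∞}
    (hB : ∑' n, ENNReal.ofReal ((weight η n * ‖c n‖) ^ 2) ≤ B) :
    ‖correction N c‖ₑ ≤ ENNReal.ofReal ((N : ℝ) ^ (-(2 * η))) * (fourConst η * B ^ 2) := by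
  refine le_trans ?_ (tsum_four hη hη1 hN (fun n => norm_nonneg (c n)) hB)
  refine (enorm_tsum_le _).trans (ENNReal.tsum_le_tsum fun x => ?_)
  rw [← ofReal_norm, Real.norm_eq_abs, abs_mul]
  apply ENNReal.ofReal_le_ofReal
  gcongr
  refine (Complex.abs_re_le_norm _).trans (le_of_eq ?_)
  unfold quad tri prodFour
  rw [thd_sub]
  simp only [norm_mul, RCLike.norm_conj]

/-- The bound of the momentum change in terms of weighted sums. -/
lemma IsSmoothSolution.momentum_sub_le (hu : IsSmoothSolution κ u₀ u) (hκ : κ ^ 2 = 1)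
    {η : ℝ} (hη : 0 < η) (hη1 : η ≤ 1) {N : ℕ} (hN : 1 ≤ N)
    (hw : ∀ n, HalfReg (profile v n) (ENNReal.ofReal (a n)))
    (ha : ∀ n, 0 ≤ a n) (hv : ∀ n : ℤ, ∀ᵐ s ∂(volume.restrict (Set.uIcc 0 t)), v n s = coeff (u s) n)
    {A B B₀ : ℝ≥0∞} (hA : ∀ n : ℤ, ENNReal.ofReal (|(n : ℝ)| * a n ^ 2) ≤ A)
    (hB : ∑' n, ENNReal.ofReal ((weight η n * a n) ^ 2) ≤ B)
    (hB₀ : ∀ s ∈ Set.uIcc 0 t, ∑' n, ENNReal.ofReal ((weight η n * ‖coeff (u s) n‖) ^ 2) ≤ B₀) :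
    ENNReal.ofReal |momentum (projGt N (u t)) - momentum (projGt N (u 0))| ≤
      ENNReal.ofReal ((N : ℝ) ^ (-(2 * η))) * (2 * (fourConst η * B₀ ^ 2) +
        oscConst * (sixConst η * B ^ 3) + hexConst ^ (1 / 2 : ℝ) * A * (fourConst η * B ^ 2)) := by
  have hc : ∀ s ∈ Set.uIcc 0 t, ‖correction N (coeff (u s))‖ₑ ≤
      ENNReal.ofReal ((N : ℝ) ^ (-(2 * η))) * (fourConst η * B₀ ^ 2) := fun s hs =>
    enorm_correction_le hη hη1 hN _ (hB₀ s hs)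
  have h6 : ‖∑' x, ∫ s in (0 : ℝ)..t, sixForm N (coeff (u s)) x‖ₑ ≤
      oscConst * (ENNReal.ofReal ((N : ℝ) ^ (-(2 * η))) * (sixConst η * B ^ 3)) := by
    refine (enorm_tsum_le _).trans ?_
    refine (ENNReal.tsum_le_tsum fun x => hu.enorm_integral_sixForm_le hw ha hv N x).trans ?_
    rw [ENNReal.tsum_mul_left]
    gcongr
    exact tsum_six hη hη1 hN ha hB
  have hr : ‖∑' x, ∫ s in (0 : ℝ)..t, resForm N (coeff (u s)) x‖ₑ ≤ hexConst ^ (1 / 2 : ℝ) * A *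
      (ENNReal.ofReal ((N : ℝ) ^ (-(2 * η))) * (fourConst η * B ^ 2)) := by
    refine (enorm_tsum_le _).trans ?_
    refine (ENNReal.tsum_le_tsum fun x => enorm_integral_resForm_le hw ha hv hA N x).trans ?_
    rw [ENNReal.tsum_mul_left]
    gcongr
    exact tsum_four hη hη1 hN ha hB
  have hκ1 : |κ| = 1 := by
    rw [← sq_abs] at hκ
    exact (pow_eq_one_iff_of_nonneg (abs_nonneg _) two_ne_zero).1 hκ
  have htri : |momentum (projGt N (u t)) - momentum (projGt N (u 0))| ≤
      |correction N (coeff (u 0))| + |correction N (coeff (u t))| +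
      |∑' x, ∫ s in (0 : ℝ)..t, sixForm N (coeff (u s)) x| +
      |∑' x, ∫ s in (0 : ℝ)..t, resForm N (coeff (u s)) x| := by
    rw [hu.momentum_sub_eq hκ]
    generalize correction N (coeff (u 0)) = x
    generalize correction N (coeff (u t)) = y
    generalize (∑' x, ∫ s in (0 : ℝ)..t, sixForm N (coeff (u s)) x) = z
    generalize (∑' x, ∫ s in (0 : ℝ)..t, resForm N (coeff (u s)) x) = r
    have e1 : |κ / 12 * x| = 1 / 12 * |x| := by rw [abs_mul, abs_div, hκ1]; norm_num
    have e2 : |κ / 12 * y| = 1 / 12 * |y| := by rw [abs_mul, abs_div, hκ1]; norm_num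
    have e3 : |1 / 12 * z| = 1 / 12 * |z| := by rw [abs_mul]; norm_num
    have e4 : |1 / 3 * r| = 1 / 3 * |r| := by rw [abs_mul]; norm_num
    have t1 := abs_sub (κ / 12 * x - κ / 12 * y + 1 / 12 * z) (1 / 3 * r)
    have t2 := abs_add_le (κ / 12 * x - κ / 12 * y) (1 / 12 * z)
    have t3 := abs_sub (κ / 12 * x) (κ / 12 * y)
    have p1 := abs_nonneg x
    have p2 := abs_nonneg y
    have p3 := abs_nonneg z
    have p4 := abs_nonneg r
    linarith
  have hof : ∀ x : ℝ, ENNReal.ofReal |x| = ‖x‖ₑ := fun x => by rw [← ofReal_norm, Real.norm_eq_abs]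
  refine (ENNReal.ofReal_le_ofReal htri).trans ?_
  rw [ENNReal.ofReal_add (by positivity) (by positivity), ENNReal.ofReal_add (by positivity) (by positivity),
    ENNReal.ofReal_add (by positivity) (by positivity), hof, hof, hof, hof]
  calc _ ≤ ENNReal.ofReal ((N : ℝ) ^ (-(2 * η))) * (fourConst η * B₀ ^ 2) +
        ENNReal.ofReal ((N : ℝ) ^ (-(2 * η))) * (fourConst η * B₀ ^ 2) +
        oscConst * (ENNReal.ofReal ((N : ℝ) ^ (-(2 * η))) * (sixConst η * B ^ 3)) +
        hexConst ^ (1 / 2 : ℝ) * A * (ENNReal.ofReal ((N : ℝ) ^ (-(2 * η))) * (fourConst η * B ^ 2)) := by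
        gcongr
        · exact hc 0 Set.left_mem_uIcc
        · exact hc t Set.right_mem_uIcc
    _ = _ := by ring

end

lemma le_seqNorm {p : ℝ} (hp : 1 ≤ p) (y : ℤ → ℝ≥0∞) (n : ℤ) : y n ≤ seqNorm p y := by
  have hp0 : 0 < p := by linarith
  unfold seqNorm
  calc y n = (y n ^ p) ^ (1 / p) := by
        rw [← ENNReal.rpow_mul, mul_one_div_cancel hp0.ne', ENNReal.rpow_one]
    _ ≤ _ := ENNReal.rpow_le_rpow (ENNReal.le_tsum n) (by positivity)

lemma seqNorm_rpow {p : ℝ} (hp : 0 < p) (y : ℤ → ℝ≥0∞) : seqNorm p y ^ p = ∑' n, y n ^ p := by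
  unfold seqNorm
  rw [← ENNReal.rpow_mul, one_div_mul_cancel hp.ne', ENNReal.rpow_one]

/-- The inclusion of `ℓ^p` in `ℓ²` for `p ≤ 2`. -/
lemma tsum_sq_le_of_le_two {p : ℝ} (hp : 1 ≤ p) (hp2 : p ≤ 2) (y : ℤ → ℝ≥0∞) :
    ∑' n, y n ^ 2 ≤ seqNorm p y ^ 2 := by
  have hsq : ∀ x : ℝ≥0∞, x ^ 2 = x ^ p * x ^ (2 - p) := fun x => by
    rw [← ENNReal.rpow_add_of_nonneg _ _ (by linarith) (by linarith), ← ENNReal.rpow_natCast]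
    norm_num
  calc _ ≤ ∑' n, y n ^ p * seqNorm p y ^ (2 - p) := by
        refine ENNReal.tsum_le_tsum fun n => ?_
        rw [hsq]
        gcongr
        exact le_seqNorm hp y n
    _ = _ := by rw [ENNReal.tsum_mul_right, ← seqNorm_rpow (by linarith), ← hsq]

/-- Hölder's inequality for weighted square sums. -/
lemma tsum_mul_sq_le {p : ℝ} (hp2 : 2 < p) (g y : ℤ → ℝ≥0∞) :
    ∑' n, (g n * y n) ^ 2 ≤ (∑' n, (g n ^ 2) ^ (p / (p - 2))) ^ ((p - 2) / p) * seqNorm p y ^ 2 := by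
  have hp0 : 0 < p := by linarith
  have hp' : 0 < p - 2 := by linarith
  have hc : (p / (p - 2)).HolderConjugate (p / 2) := by
    rw [Real.holderConjugate_iff]
    refine ⟨by rw [lt_div_iff₀ hp']; linarith, ?_⟩
    field_simp
    ring
  have h := ENNReal.lintegral_mul_le_Lp_mul_Lq (Measure.count : Measure ℤ) hc
    (f := fun n => g n ^ 2) (g := fun n => y n ^ 2) (measurable_of_countable _).aemeasurable
    (measurable_of_countable _).aemeasurable
  simp only [Pi.mul_apply, lintegral_count] at h
  have e : ∀ n, (y n ^ 2) ^ (p / 2) = y n ^ p := fun n => by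
    rw [← ENNReal.rpow_natCast, ← ENNReal.rpow_mul]
    congr 1
    push_cast
    field_simp
  simp only [e, mul_pow, one_div_div] at h ⊢
  refine h.trans (le_of_eq ?_)
  congr 1
  rw [← seqNorm_rpow hp0, ← ENNReal.rpow_mul, ← ENNReal.rpow_natCast]
  congr 1
  push_cast
  field_simp

lemma half_le_bracket (n : ℤ) : (1 + |(n : ℝ)|) / 2 ≤ bracket n := by
  have h1 := one_le_bracket n
  have h2 := abs_le_bracket n
  linarith

lemma rpow_le_mul_bracket_rpow {s : ℝ} (hs : 0 ≤ s) (n : ℤ) :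
    (1 + |(n : ℝ)|) ^ s ≤ 2 ^ s * bracket n ^ s := by
  have h0 : 0 ≤ bracket n := zero_le_one.trans (one_le_bracket n)
  rw [← Real.mul_rpow (by norm_num) h0]
  refine Real.rpow_le_rpow (by positivity) ?_ hs
  have := half_le_bracket n
  linarith

lemma ofReal_half_mul_le {s p : ℝ} (hs : 1 / 2 ≤ s) (hp : 1 ≤ p) (x : ℤ → ℝ≥0∞) (n : ℤ) :
    ENNReal.ofReal ((1 + |(n : ℝ)|) ^ (1 / 2 : ℝ)) * x n ≤
      2 * seqNorm p fun n => ENNReal.ofReal (bracket n ^ s) * x n := by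
  have h := le_seqNorm hp (fun n : ℤ => ENNReal.ofReal (bracket n ^ s) * x n) n
  have hb := one_le_bracket n
  refine le_trans ?_ (mul_le_mul_right h 2)
  rw [← mul_assoc, show (2 : ℝ≥0∞) = ENNReal.ofReal 2 by norm_num, ← ENNReal.ofReal_mul (by norm_num)]
  gcongr
  refine (rpow_le_mul_bracket_rpow (by norm_num) n).trans ?_
  have h1 : (2 : ℝ) ^ (1 / 2 : ℝ) ≤ 2 := by
    calc (2 : ℝ) ^ (1 / 2 : ℝ) ≤ 2 ^ (1 : ℝ) :=
          Real.rpow_le_rpow_of_exponent_le (by norm_num) (by norm_num)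
      _ = 2 := Real.rpow_one 2
  have h2 : bracket n ^ (1 / 2 : ℝ) ≤ bracket n ^ s := Real.rpow_le_rpow_of_exponent_le hb hs
  have h3 : 0 ≤ bracket n ^ (1 / 2 : ℝ) := by positivity
  exact mul_le_mul h1 h2 h3 (by norm_num)

lemma weight_le {s η : ℝ} (hs : 0 ≤ s) (n : ℤ) :
    weight η n ≤ 2 ^ s * (1 + |(n : ℝ)|) ^ (-(s - 1 / 3 - 4 * η)) * bracket n ^ s := by
  have hJ : 0 < 1 + |(n : ℝ)| := by positivity
  have h := rpow_le_mul_bracket_rpow hs n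
  unfold weight
  calc _ = (1 + |(n : ℝ)|) ^ (-(s - 1 / 3 - 4 * η)) * (1 + |(n : ℝ)|) ^ s := by
        rw [← Real.rpow_add hJ]; congr 1; ring
    _ ≤ (1 + |(n : ℝ)|) ^ (-(s - 1 / 3 - 4 * η)) * (2 ^ s * bracket n ^ s) := by gcongr
    _ = _ := by ring

lemma weight_mul_sq_le {s η : ℝ} (hs : 0 ≤ s) (x : ℤ → ℝ≥0∞) (n : ℤ) :
    (ENNReal.ofReal (weight η n) * x n) ^ 2 ≤
      (ENNReal.ofReal (2 ^ s * (1 + |(n : ℝ)|) ^ (-(s - 1 / 3 - 4 * η))) *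
        (ENNReal.ofReal (bracket n ^ s) * x n)) ^ 2 := by
  rw [← mul_assoc, ← ENNReal.ofReal_mul (by positivity)]
  gcongr
  exact weight_le hs n

/-- The weighted square sums are controlled by the Fourier-Lebesgue norms. -/
lemma exists_weight_bound {s p : ℝ}
    (hsp : (1 / 2 ≤ s ∧ s < 5 / 6 ∧ 2 ≤ p ∧ p < 6 / (5 - 6 * s)) ∨ (5 / 6 ≤ s ∧ 1 ≤ p)) :
    ∃ η : ℝ, 0 < η ∧ η ≤ 1 ∧ ∃ D : ℝ≥0∞, D ≠ ⊤ ∧ ∀ x : ℤ → ℝ≥0∞,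
      ∑' n, (ENNReal.ofReal (weight η n) * x n) ^ 2 ≤
        D * (seqNorm p fun n => ENNReal.ofReal (bracket n ^ s) * x n) ^ 2 := by
  have hs : 1 / 2 ≤ s := by rcases hsp with h | h <;> linarith [h.1]
  have hp : 1 ≤ p := by rcases hsp with h | h; exacts [by linarith [h.2.2.1], h.2]
  have hp0 : 0 < p := by linarith
  have hδ : 0 < s - 5 / 6 + 1 / p := by
    rcases hsp with ⟨-, h2, -, h4⟩ | h
    · have h5 : 0 < 5 - 6 * s := by linarith
      rw [lt_div_iff₀ h5] at h4
      have : 5 / 6 - s < 1 / p := by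
        rw [lt_div_iff₀ hp0]
        linarith
      linarith
    · have : 0 < 1 / p := by positivity
      linarith [h.1]
  obtain ⟨η, hη0, hη1, hη2⟩ : ∃ η : ℝ, 0 < η ∧ η ≤ 1 / 24 ∧ 4 * η < s - 5 / 6 + 1 / p :=
    ⟨min (1 / 24) ((s - 5 / 6 + 1 / p) / 8), lt_min (by norm_num) (by linarith), min_le_left _ _, by
      have := min_le_right (1 / 24) ((s - 5 / 6 + 1 / p) / 8)
      linarith⟩
  refine ⟨η, hη0, by linarith, ?_⟩
  obtain ⟨θ, hθ⟩ : ∃ θ, θ = s - 1 / 3 - 4 * η := ⟨_, rfl⟩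
  rcases le_or_gt p 2 with hp2 | hp2
  · refine ⟨ENNReal.ofReal (2 ^ s) ^ 2, by finiteness, fun x => ?_⟩
    calc _ ≤ ∑' n : ℤ, ENNReal.ofReal (2 ^ s) ^ 2 * (ENNReal.ofReal (bracket n ^ s) * x n) ^ 2 := by
          refine ENNReal.tsum_le_tsum fun n =>
            (weight_mul_sq_le (s := s) (η := η) (by linarith) x n).trans ?_
          rw [mul_pow]
          refine mul_le_mul' (pow_le_pow_left' (ENNReal.ofReal_le_ofReal ?_) 2) le_rfl
          refine mul_le_of_le_one_right (by positivity) ?_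
          exact Real.rpow_le_one_of_one_le_of_nonpos (by linarith [abs_nonneg (n : ℝ)]) (by linarith)
      _ ≤ _ := by
          rw [ENNReal.tsum_mul_left]
          gcongr
          exact tsum_sq_le_of_le_two hp hp2 _
  · have hp' : 0 < p - 2 := by linarith
    obtain ⟨q, hq⟩ : ∃ q, q = p / (p - 2) := ⟨_, rfl⟩
    have hq0 : 0 < q := by rw [hq]; positivity
    have hexp : 0 < 2 * θ * q - 1 := by
      have h1 : p - 2 < 2 * θ * p := by
        have : 1 / 2 - 1 / p < θ := by rw [hθ]; linarith
        have h3 := mul_lt_mul_of_pos_right this hp0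
        have h4 : (1 / 2 - 1 / p) * p = p / 2 - 1 := by field_simp
        linarith
      rw [hq, sub_pos, ← mul_div_assoc, lt_div_iff₀ hp']
      linarith
    refine ⟨(∑' n : ℤ, (ENNReal.ofReal (2 ^ s * (1 + |(n : ℝ)|) ^ (-(s - 1 / 3 - 4 * η))) ^ 2) ^
      (p / (p - 2))) ^ ((p - 2) / p), ?_, fun x => ?_⟩
    · refine ENNReal.rpow_ne_top_of_nonneg (by positivity) ?_
      have e : ∀ n : ℤ, (ENNReal.ofReal (2 ^ s * (1 + |(n : ℝ)|) ^ (-(s - 1 / 3 - 4 * η))) ^ 2) ^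
          (p / (p - 2)) = ENNReal.ofReal ((2 ^ s) ^ (2 * q)) *
          ENNReal.ofReal (decay (2 * θ * q - 1) n) := by
        intro n
        have hJ : 0 < 1 + |(n : ℝ)| := by positivity
        rw [← hq, ← hθ, ← ENNReal.ofReal_pow (by positivity),
          ENNReal.ofReal_rpow_of_nonneg (by positivity) hq0.le, ← ENNReal.ofReal_mul (by positivity)]
        congr 1
        rw [← Real.rpow_natCast, ← Real.rpow_mul (by positivity), Real.mul_rpow (by positivity)
          (by positivity), ← Real.rpow_mul hJ.le]
        push_cast
        congr 1
        unfold decay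
        congr 1
        ring
      simp only [e]
      rw [ENNReal.tsum_mul_left]
      exact ENNReal.mul_ne_top ENNReal.ofReal_ne_top (decaySum_ne_top hexp)
    · refine le_trans (ENNReal.tsum_le_tsum fun n =>
        weight_mul_sq_le (s := s) (η := η) (by linarith) x n) ?_
      exact tsum_mul_sq_le hp2 _ _

/-- The momentum bound for a given extension of the solution. -/
lemma exists_momentum_bound {s p : ℝ}
    (hsp : (1 / 2 ≤ s ∧ s < 5 / 6 ∧ 2 ≤ p ∧ p < 6 / (5 - 6 * s)) ∨ (5 / 6 ≤ s ∧ 1 ≤ p)) :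
    ∃ η : ℝ, 0 < η ∧ ∃ Q : ℝ≥0∞, Q ≠ ⊤ ∧ ∀ κ : ℝ, κ ^ 2 = 1 → ∀ (u₀ : ℝ → ℂ) (u : ℝ → ℝ → ℂ),
      IsSmoothSolution κ u₀ u → ∀ (t : ℝ) (N : ℕ), 1 ≤ N →
      ∀ v : ℤ → Lp ℂ 2 (volume : Measure ℝ),
      (∀ n : ℤ, ∀ᵐ r ∂(volume.restrict (Set.uIcc 0 t)), v n r = coeff (u r) n) →
      ENNReal.ofReal |momentum (projGt N (u t)) - momentum (projGt N (u 0))| ≤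
        ENNReal.ofReal ((N : ℝ) ^ (-(2 * η))) * (Q * ((⨆ r ∈ Set.uIcc 0 t, flNorm s p (u r) ^ 4) +
          xNorm s (1 / 2) p v ^ 6)) := by
  have hs : 1 / 2 ≤ s := by rcases hsp with h | h <;> linarith [h.1]
  have hp : 1 ≤ p := by rcases hsp with h | h; exacts [by linarith [h.2.2.1], h.2]
  obtain ⟨η, hη, hη1, D, hD, hbound⟩ := exists_weight_bound hsp
  obtain ⟨Q₁, hQ₁⟩ : ∃ Q₁, Q₁ = 2 * (fourConst η * D ^ 2) := ⟨_, rfl⟩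
  obtain ⟨Q₂, hQ₂⟩ : ∃ Q₂, Q₂ = oscConst * (sixConst η * (16 * D) ^ 3) +
    hexConst ^ (1 / 2 : ℝ) * 64 * (fourConst η * (16 * D) ^ 2) := ⟨_, rfl⟩
  have hQ₁' : Q₁ ≠ ⊤ := by
    have := fourConst_ne_top hη
    rw [hQ₁]
    finiteness
  have hQ₂' : Q₂ ≠ ⊤ := by
    have h1 := fourConst_ne_top hη
    have h2 := sixConst_ne_top hη
    have h3 := oscConst_ne_top
    have h4 : hexConst ^ (1 / 2 : ℝ) ≠ ⊤ := ENNReal.rpow_ne_top_of_nonneg (by norm_num) hexConst_ne_top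
    rw [hQ₂]
    finiteness
  refine ⟨η, hη, Q₁ + Q₂ + 1, by finiteness, fun κ hκ u₀ u hu t N hN v hv => ?_⟩
  have hN0 : ENNReal.ofReal ((N : ℝ) ^ (-(2 * η))) ≠ 0 := by
    have : (0 : ℝ) < N := by exact_mod_cast hN
    have : 0 < (N : ℝ) ^ (-(2 * η)) := by positivity
    simpa using this
  obtain ⟨S, hS⟩ : ∃ S, S = ⨆ r ∈ Set.uIcc 0 t, flNorm s p (u r) ^ 4 := ⟨_, rfl⟩
  obtain ⟨X, hX⟩ : ∃ X, X = xNorm s (1 / 2) p v := ⟨_, rfl⟩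
  rw [← hS, ← hX]
  rcases eq_or_ne X ⊤ with hXt | hXt
  · rw [hXt, ENNReal.top_pow (by norm_num), add_top, ENNReal.mul_top (by simp), ENNReal.mul_top hN0]
    exact le_top
  have hX' : X = seqNorm p fun n => ENNReal.ofReal (bracket n ^ s) * halfNorm n (spaceTimeFT v n) := hX
  have hhalf : ∀ n : ℤ, ENNReal.ofReal ((1 + |(n : ℝ)|) ^ (1 / 2 : ℝ)) * halfNorm n (spaceTimeFT v n) ≤
      2 * X := fun n => by
    rw [hX']
    exact ofReal_half_mul_le hs hp (fun n => halfNorm n (spaceTimeFT v n)) n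
  have hfin : ∀ n : ℤ, 4 * halfNorm n (spaceTimeFT v n) ≠ ⊤ := fun n => by
    refine ENNReal.mul_ne_top (by simp) (ne_top_of_le_ne_top (b := 2 * X) (by finiteness) ?_)
    refine le_trans (le_mul_of_one_le_left bot_le ?_) (hhalf n)
    rw [ENNReal.one_le_ofReal]
    exact Real.one_le_rpow (by linarith [abs_nonneg (n : ℝ)]) (by norm_num)
  obtain ⟨a, ha⟩ : ∃ a : ℤ → ℝ, a = fun n => (4 * halfNorm n (spaceTimeFT v n)).toReal := ⟨_, rfl⟩
  have ha0 : ∀ n, 0 ≤ a n := fun n => by rw [ha]; exact ENNReal.toReal_nonneg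
  have ha' : ∀ n, ENNReal.ofReal (a n) = 4 * halfNorm n (spaceTimeFT v n) := fun n => by
    rw [ha]; exact ENNReal.ofReal_toReal (hfin n)
  have hw : ∀ n, HalfReg (profile (fun n r => v n r) n) (ENNReal.ofReal (a n)) := fun n => by
    rw [ha']
    exact halfReg_of_halfNorm v n
  have hA : ∀ n : ℤ, ENNReal.ofReal (|(n : ℝ)| * a n ^ 2) ≤ 64 * X ^ 2 := by
    intro n
    have hJ : 0 < 1 + |(n : ℝ)| := by positivity
    calc _ ≤ ENNReal.ofReal (((1 + |(n : ℝ)|) ^ (1 / 2 : ℝ) * a n) ^ 2) := by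
          apply ENNReal.ofReal_le_ofReal
          rw [mul_pow, ← Real.sqrt_eq_rpow, Real.sq_sqrt hJ.le]
          have := sq_nonneg (a n)
          nlinarith
      _ = (4 * (ENNReal.ofReal ((1 + |(n : ℝ)|) ^ (1 / 2 : ℝ)) * halfNorm n (spaceTimeFT v n))) ^ 2 := by
          have h1 := ha0 n
          rw [ENNReal.ofReal_pow (by positivity), ENNReal.ofReal_mul (by positivity), ha']
          ring
      _ ≤ (4 * (2 * X)) ^ 2 :=
        pow_le_pow_left' (mul_le_mul' le_rfl (hhalf n)) 2
      _ = _ := by ring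
  have hB : ∑' n, ENNReal.ofReal ((weight η n * a n) ^ 2) ≤ 16 * D * X ^ 2 := by
    calc _ = ∑' n : ℤ, 16 * (ENNReal.ofReal (weight η n) * halfNorm n (spaceTimeFT v n)) ^ 2 := by
          refine tsum_congr fun n => ?_
          have h1 := ha0 n
          have h2 := weight_pos η n
          rw [ENNReal.ofReal_pow (by positivity), ENNReal.ofReal_mul h2.le, ha']
          ring
      _ ≤ 16 * (D * X ^ 2) := by
          rw [ENNReal.tsum_mul_left, hX']
          gcongr
          exact hbound fun n => halfNorm n (spaceTimeFT v n)
      _ = _ := by ring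
  have hB₀ : ∀ r ∈ Set.uIcc 0 t, ∑' n, ENNReal.ofReal ((weight η n * ‖coeff (u r) n‖) ^ 2) ≤
      D * S ^ (1 / 2 : ℝ) := by
    intro r hr
    have hle : flNorm s p (u r) ^ 4 ≤ S := by
      rw [hS]
      exact le_iSup₂ (f := fun r (_ : r ∈ Set.uIcc 0 t) => flNorm s p (u r) ^ 4) r hr
    have hle2 : flNorm s p (u r) ^ 2 ≤ S ^ (1 / 2 : ℝ) := by
      refine le_of_sq_le_sq ?_
      rw [sqrt_sq, ← pow_mul]
      exact hle
    have hfl : flNorm s p (u r) = seqNorm p fun n =>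
        ENNReal.ofReal (bracket n ^ s) * ENNReal.ofReal ‖coeff (u r) n‖ := by
      unfold flNorm
      congr 1
      funext n
      have := one_le_bracket n
      rw [ENNReal.ofReal_mul (by positivity)]
    calc _ = ∑' n : ℤ, (ENNReal.ofReal (weight η n) * ENNReal.ofReal ‖coeff (u r) n‖) ^ 2 := by
          refine tsum_congr fun n => ?_
          have h2 := weight_pos η n
          rw [ENNReal.ofReal_pow (by positivity), ENNReal.ofReal_mul h2.le]
      _ ≤ D * flNorm s p (u r) ^ 2 := by
          rw [hfl]
          exact hbound _
      _ ≤ _ := by gcongr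
  refine (hu.momentum_sub_le hκ hη hη1 hN hw ha0 hv hA hB hB₀).trans ?_
  gcongr ENNReal.ofReal ((N : ℝ) ^ (-(2 * η))) * ?_
  rw [mul_pow, sqrt_sq]
  calc _ = Q₁ * S + Q₂ * X ^ 6 := by rw [hQ₁, hQ₂]; ring
    _ ≤ (Q₁ + Q₂ + 1) * S + (Q₁ + Q₂ + 1) * X ^ 6 := by
        gcongr
        · rw [add_assoc]; exact le_self_add
        · rw [add_comm Q₁, add_assoc]; exact le_self_add
    _ = _ := by ring

/-- Passage to the infimum over extensions. -/
lemma le_xNormOn_of_forall {s b p : ℝ} {I : Set ℝ} {u : ℝ → ℝ → ℂ} {L c S : ℝ≥0∞} (hc : c ≠ ⊤)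
    (hc0 : c ≠ 0)
    (h : ∀ v : ℤ → Lp ℂ 2 (volume : Measure ℝ),
      (∀ n : ℤ, ∀ᵐ r ∂(volume.restrict I), v n r = coeff (u r) n) →
      L ≤ c * (S + xNorm s b p v ^ 4 + xNorm s b p v ^ 6)) :
    L ≤ c * (S + xNormOn s b p I u ^ 4 + xNormOn s b p I u ^ 6) := by
  obtain ⟨X, hX⟩ : ∃ X, X = xNormOn s b p I u := ⟨_, rfl⟩
  rw [← hX]
  rcases eq_or_ne X ⊤ with hXt | hXt
  · have : c * (S + X ^ 4 + X ^ 6) = ⊤ := by simp [hXt, ENNReal.mul_top hc0]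
    exact le_of_le_of_eq le_top this.symm
  have hy : ∀ y, X < y → L ≤ c * (S + y ^ 4 + y ^ 6) := by
    intro y hy
    rw [hX] at hy
    unfold xNormOn at hy
    simp only [iInf_lt_iff] at hy
    obtain ⟨v, hv, hlt⟩ := hy
    refine (h v hv).trans ?_
    gcongr
  have hcont : Continuous fun y : ℝ≥0∞ => c * (S + y ^ 4 + y ^ 6) :=
    (ENNReal.continuous_const_mul hc).comp
      ((continuous_const.add (ENNReal.continuous_pow 4)).add (ENNReal.continuous_pow 6))
  have : (nhdsWithin X (Set.Ioi X)).NeBot := nhdsGT_neBot_of_exists_gt ⟨⊤, lt_top_iff_ne_top.2 hXt⟩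
  refine ge_of_tendsto (x := nhdsWithin X (Set.Ioi X))
    ((hcont.tendsto X).mono_left nhdsWithin_le_nhds) ?_
  filter_upwards [self_mem_nhdsWithin] with y hy'
  exact hy y hy'

end MKdV

theorem proposition1p8 (s p : ℝ)
    (hsp : (1 / 2 ≤ s ∧ s < 5 / 6 ∧ 2 ≤ p ∧ p < 6 / (5 - 6 * s)) ∨ (5 / 6 ≤ s ∧ 1 ≤ p)) :
    ∃ ε₀ > (0 : ℝ), ∃ C > (0 : ℝ), ∀ ε : ℝ, 0 < ε → ε ≤ ε₀ →
      ∀ κ : ℝ, (κ = 1 ∨ κ = -1) →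
      ∀ u₀ : ℝ → ℂ, MKdV.SmoothPeriodic u₀ →
      ∀ u : ℝ → ℝ → ℂ, MKdV.IsSmoothSolution κ u₀ u →
      ∀ (t : ℝ) (N : ℕ), 1 ≤ N →
        ENNReal.ofReal |MKdV.momentum (MKdV.projGt N (u t))
            - MKdV.momentum (MKdV.projGt N (u 0))| ≤
          ENNReal.ofReal (C * (1 / (N : ℝ) ^ ε)) *
            ((⨆ t' ∈ Set.uIcc 0 t, MKdV.flNorm s p (u t') ^ 4)
              + MKdV.xNormOn s (1 / 2) p (Set.uIcc 0 t) u ^ 4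
              + MKdV.xNormOn s (1 / 2) p (Set.uIcc 0 t) u ^ 6) := by
  obtain ⟨η, hη, Q, hQ, h⟩ := MKdV.exists_momentum_bound hsp
  refine ⟨2 * η, by positivity, Q.toReal + 1, by positivity, fun ε _ hε κ hκ u₀ _ u hu t N hN => ?_⟩
  have hN1 : (1 : ℝ) ≤ N := by exact_mod_cast hN
  have hN0 : (0 : ℝ) < N := by linarith
  have hC : 0 < (Q.toReal + 1) * (1 / (N : ℝ) ^ ε) := by positivity
  refine MKdV.le_xNormOn_of_forall ENNReal.ofReal_ne_top (by simpa using hC) fun v hv => ?_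
  refine (h κ (by rcases hκ with rfl | rfl <;> norm_num) u₀ u hu t N hN v hv).trans ?_
  rw [← mul_assoc]
  refine mul_le_mul' ?_ ?_
  · rw [← ENNReal.ofReal_toReal hQ, ← ENNReal.ofReal_mul (by positivity), mul_comm]
    apply ENNReal.ofReal_le_ofReal
    rw [ENNReal.toReal_ofReal ENNReal.toReal_nonneg, one_div, ← Real.rpow_neg hN0.le]
    have h1 : (N : ℝ) ^ (-(2 * η)) ≤ (N : ℝ) ^ (-ε) :=
      Real.rpow_le_rpow_of_exponent_le hN1 (by linarith)
    have h2 := ENNReal.toReal_nonneg (a := Q)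
    exact mul_le_mul (by linarith) h1 (by positivity) (by positivity)
  · gcongr
    exact le_self_add
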